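/- **Setup.** Let $X$ be a compact Hausdorff space, $n\ge 1$ an integer, $\mathcal D\subset C^0(X)$ a dense linear subspace containing the constants, $\mathcal Z$ a partially ordered real vector space whose positive cone $\mathcal Z_+$ spans $\mathcal Z$ and is closed in the finest vector space topology (the topology generated by the finite dimensional subspaces), $\mathrm{dd^c}\colon\mathcal D\to\mathcal Z$ a linear map vanishing on constants, and $(\theta_1,\dots,\theta_n)\mapsto\theta_1\wedge\dots\wedge\theta_n$ a nonzero symmetric $n$-linear map from $\mathcal Z$ to signed Radon measures on $X$, with values in positive measures when all $\theta_i\ge0$, such that $(\varphi,\psi)\mapsto\int\varphi\,\mathrm{dd^c}\psi\wedge\theta_1\wedge\dots\wedge\theta_{n-1}$ is symmetric on $\mathcal D$, and seminegative if all $\theta_i\ge0$. Let $\mathrm{Pos}(X)$ be the interior of the image of $\mathcal Z_+$ in $\mathcal Z/\mathrm{dd^c}\mathcal D$ (finest vector space topology). For $\theta\in\mathcal Z$ set $\mathcal D_\theta=\{\varphi\in\mathcal D\mid\theta+\mathrm{dd^c}\varphi\ge0\}$. Write $V_\omega=\int\omega^n$, $\mu_\omega=V_\omega^{-1}\omega^n$,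 $\mathrm{MA}_\omega(\varphi)=V_\omega^{-1}(\omega+\mathrm{dd^c}\varphi)^n$, $$\mathrm E_\omega(\varphi)=\frac1{n+1}\sum_{j=0}^nV_\omega^{-1}\int\varphi\,(\omega+\mathrm{dd^c}\varphi)^j\wedge\omega^{n-j},\qquad \mathrm J_\omega(\varphi,\psi)=\mathrm E_\omega(\varphi)-\mathrm E_\omega(\psi)+\int(\psi-\varphi)\,\mathrm{MA}_\omega(\varphi),$$ $\mathrm J_\omega(\mu)=\sup_{\varphi\in\mathcal D_\omega}\{\mathrm E_\omega(\varphi)-\int\varphi\,\mu\}$ for a Radon probability measure $\mu$, and $T_\omega=\sup_{\varphi\in\mathcal D_\omega}(\sup\varphi-\int\varphi\,\mu_\omega)$. Let $\mathcal M^1_\omega=\{\mu\mid\mathrm J_\omega(\mu)<\infty\}$, with the strong topology, i.e. the coarsest refinement of the weak topology making $\mathrm J_\omega$ continuous, and $$\underline{\mathrm d}_\omega(\mu,\nu)=\sup\Big\{\Big|\int\varphi(\mu-\nu)\Big|\;:\;\varphi\in\mathcal D_\omega,\ \mathrm J_\omega(0,\varphi)\le1\Big\}.$$ Set $\mathrm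 J^+_\omega(\mu)=\mathrm J_\omega(\mu)+T_\omega$, $\|\theta\|_\omega=\inf\{C\ge0\mid\pm\theta\le C\omega\}\in[0,\infty]$, $\mathrm d_{\mathrm T}(\omega,\omega')=\inf\{\delta\ge0\mid e^{-\delta}\omega\le\omega'\le e^\delta\omega\}$, $\alpha=2^{-n}$. The submean value property means that $T_{\omega}<\infty$ for some $\omega\in\mathcal Z_+$ with $[\omega]\in\mathrm{Pos}(X)$. The form $\omega$ has the orthogonality property if (a) whenever $\varphi,\psi\in\mathcal D_\omega$, $f\in\mathcal D$ and $\max\{\varphi,\psi\}<f$, there is $\tau\in\mathcal D_\omega$ with $\max\{\varphi,\psi\}\le\tau<f$; and (b) for all $f\in\mathcal D$, $\int(f-\varphi)\,\mathrm{MA}_\omega(\varphi)\to0$ along the directed set of all $\varphi\in\mathcal D_\omega$ with $\varphi<f$. **Theorem B.** Assume the submean value property. There is a constant $C>0$ depending only on $n$ such that the following holds for all $\omega,\omega'\in\mathcal Z_+$ that have the orthogonality property and whose classes lie in $\mathrm{Pos}(X)$. 1. $\underline{\mathrm d}_\omega$ is a metric on $\mathcal M^1_\omega$ that defines the strong topology.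 The topological spaces $\mathcal M^1_\omega$ and $\mathcal M^1_{\omega'}$ coincide $(=:\mathcal M^1)$, and $\underline{\mathrm d}_\omega$ and $\underline{\mathrm d}_{\omega'}$ are Lipschitz equivalent on it. 2. There is a unique continuous $\delta_\omega\colon\mathcal M^1\times\mathcal M^1\to\mathbb R_{\ge0}$ with $\delta_\omega(\mathrm{MA}_\omega(\varphi),\mathrm{MA}_\omega(\psi))=\mathrm J_\omega(\varphi,\psi)$ for all $\varphi,\psi\in\mathcal D_\omega$. For each $\theta\in\mathcal Z$ there is a unique strongly continuous $\mathrm J^\theta_\omega\colon\mathcal M^1\to\mathbb R$ such that $\mathrm J^\theta_\omega(\mathrm{MA}_\omega(\varphi))=\frac{d}{dt}\big|_{t=0}\mathrm E_{\omega+t\theta}(\varphi)$ for all $\varphi\in\mathcal D_\omega$; it is linear in $\theta$. If $\|\theta\|_\omega<\infty$, then for all $\mu,\nu\in\mathcal M^1$ $$|\mathrm J^\theta_\omega(\mu)-\mathrm J^\theta_\omega(\nu)|\le C\,\delta_\omega(\mu,\nu)^\alpha\max\{\mathrm J^+_\omega(\mu),\mathrm J^+_\omega(\nu)\}^{1-\alpha}\|\theta\|_\omega,\qquad|\mathrm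 J_\omega^\theta(\mu)|\le C\,\mathrm J^+_\omega(\mu)\|\theta\|_\omega.$$ For arbitrary $\theta$ there is $B>0$, depending only on $\omega$ and $\theta$ (in the given setup), such that for all $\mu,\nu\in\mathcal M^1$ $$|\mathrm J^\theta_\omega(\mu)-\mathrm J^\theta_\omega(\nu)|\le B\,\delta_\omega(\mu,\nu)^\alpha(\max\{\mathrm J_\omega(\mu),\mathrm J_\omega(\nu)\}+1)^{1-\alpha},\qquad|\mathrm J_\omega^\theta(\mu)|\le B(\mathrm J_\omega(\mu)+1).$$ 3. For all $\theta\in\mathcal Z$ and $\mu\in\mathcal M^1$, $\mathrm J_{\omega+t\theta}(\mu)$ (defined by the same supremum, even if $\omega+t\theta\not\ge0$) is finite for $|t|$ small, and $\frac{d}{dt}\big|_{t=0}\mathrm J_{\omega+t\theta}(\mu)=\mathrm J^\theta_\omega(\mu)$. 4. If $\mathrm d_{\mathrm T}(\omega,\omega')\le1$ and $\theta,\theta'\in\mathcal Z$ satisfy $\|\theta\|_\omega,\|\theta'\|_\omega<\infty$, then for all $\mu\in\mathcal M^1$ $$|\mathrm J^\theta_\omega(\mu)-\mathrm J^{\theta'}_{\omega'}(\mu)|\le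 C\left(\mathrm d_{\mathrm T}(\omega,\omega')^\alpha\|\theta\|_\omega+\|\theta-\theta'\|_\omega\right)\mathrm J^+_\omega(\mu).$$ -/

import Mathlib

open Filter Topology
open scoped ENNReal NNReal

universe u v

noncomputable section

/-- The topology of a real vector space generated by its finite dimensional subspaces:
a subset is open (closed) iff its trace on each finite dimensional subspace `W` is open (closed)
for the canonical vector space topology of `W`. -/
@[reducible] def finestVectorTopology (V : Type v) [AddCommGroup V] [Module ℝ V] : TopologicalSpace V :=
  ⨆ W : {W : Submodule ℝ V // FiniteDimensional ℝ W},
    TopologicalSpace.coinduced (W.1.subtype) (moduleTopology ℝ W.1)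

/-- Signed Radon measures on a compact Hausdorff space `X`, that is, continuous linear forms
on `C(X, ℝ)`, with the weak topology. The integral `∫ f μ` is the value `μ f`. -/
abbrev RadonMeasure (X : Type u) [TopologicalSpace X] : Type u := WeakDual ℝ C(X, ℝ)

/-- Positivity of a signed Radon measure. -/
def RadonMeasure.IsPositive {X : Type u} [TopologicalSpace X] (μ : RadonMeasure X) : Prop :=
  ∀ f : C(X, ℝ), 0 ≤ f → 0 ≤ μ f

/-- Radon probability measures. -/
def RadonMeasure.IsProbability {X : Type u} [TopologicalSpace X] (μ : RadonMeasure X) : Prop :=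
  μ.IsPositive ∧ μ 1 = 1

/-- The synthetic pluripotential theoretic setup on a compact Hausdorff space `X`, with space of
closed `(1,1)`-forms a partially ordered real vector space `Z`, in dimension `n`. -/
structure PluripotentialSetup (n : ℕ) (X : Type u) [TopologicalSpace X] (Z : Type v)
    [AddCommGroup Z] [Module ℝ Z] [PartialOrder Z] where
  /-- the dimension is at least `1` -/
  one_le_dim : 1 ≤ n
  /-- the positive cone spans `Z` -/
  span_nonneg : Submodule.span ℝ {θ : Z | 0 ≤ θ} = ⊤
  /-- the positive cone is closed -/
  isClosed_nonneg : IsClosed[finestVectorTopology Z] {θ : Z | 0 ≤ θ}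
  /-- the space of test functions -/
  D : Submodule ℝ C(X, ℝ)
  dense_D : Dense (D : Set C(X, ℝ))
  const_mem_D : ∀ c : ℝ, ContinuousMap.const X c ∈ D
  /-- the operator `ddᶜ` -/
  ddc : D →ₗ[ℝ] Z
  ddc_const : ∀ c : ℝ, ddc ⟨ContinuousMap.const X c, const_mem_D c⟩ = 0
  /-- the signed Radon measure `θ₁ ∧ … ∧ θₙ` -/
  wedge : MultilinearMap ℝ (fun _ : Fin n => Z) (RadonMeasure X)
  wedge_ne_zero : wedge ≠ 0
  wedge_symm : ∀ (σ : Equiv.Perm (Fin n)) (θ : Fin n → Z),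
    wedge (fun i => θ (σ i)) = wedge θ
  wedge_nonneg : ∀ θ : Fin n → Z, (∀ i, 0 ≤ θ i) → (wedge θ).IsPositive
  /-- integration by parts: `∫ φ ddᶜψ ∧ Θ = ∫ ψ ddᶜφ ∧ Θ`; the entry `θ i` is discarded -/
  integral_symm : ∀ (θ : Fin n → Z) (i : Fin n) (φ ψ : D),
    wedge (Function.update θ i (ddc ψ)) (φ : C(X, ℝ)) =
      wedge (Function.update θ i (ddc φ)) (ψ : C(X, ℝ))
  /-- seminegativity: `∫ φ ddᶜφ ∧ Θ ≤ 0` for `Θ` a product of nonnegative forms -/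
  integral_seminegative : ∀ (θ : Fin n → Z) (i : Fin n) (φ : D), (∀ j, j ≠ i → 0 ≤ θ j) →
    wedge (Function.update θ i (ddc φ)) (φ : C(X, ℝ)) ≤ 0

/-- The Hölder exponent `2⁻ⁿ`. -/
def holderExponent (n : ℕ) : ℝ := ((2 : ℝ) ^ n)⁻¹

namespace PluripotentialSetup

variable {n : ℕ} {X : Type u} [TopologicalSpace X] {Z : Type v}
  [AddCommGroup Z] [Module ℝ Z] [PartialOrder Z] (S : PluripotentialSetup n X Z)

/-- The Bott--Chern cohomology space `Z / ddᶜ D`. -/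
abbrev BottChern : Type v := Z ⧸ LinearMap.range S.ddc

/-- The positive cone `Pos(X)`: the interior of the image of the cone of nonnegative forms. -/
def positiveCone : Set S.BottChern :=
  @interior S.BottChern (finestVectorTopology S.BottChern)
    ((LinearMap.range S.ddc).mkQ '' {θ : Z | 0 ≤ θ})

/-- `ω ≥ 0` and `[ω] ∈ Pos(X)`. -/
def IsPolarization (ω : Z) : Prop :=
  0 ≤ ω ∧ (LinearMap.range S.ddc).mkQ ω ∈ S.positiveCone

/-- The set `D_θ` of `θ`-plurisubharmonic test functions. -/
def psh (θ : Z) : Set S.D := {φ | 0 ≤ θ + S.ddc φ}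

/-- The norm `‖θ‖_ω = inf {C ≥ 0 | ± θ ≤ C ω} ∈ [0, ∞]`. -/
def formNorm (_ : PluripotentialSetup n X Z) (ω θ : Z) : ℝ≥0∞ :=
  ⨅ (C : ℝ≥0) (_ : θ ≤ (C : ℝ) • ω ∧ -θ ≤ (C : ℝ) • ω), (C : ℝ≥0∞)

/-- The Thompson distance between two nonnegative forms. -/
def thompsonDist (_ : PluripotentialSetup n X Z) (ω ω' : Z) : ℝ≥0∞ :=
  ⨅ (δ : ℝ≥0) (_ : Real.exp (-δ) • ω ≤ ω' ∧ ω' ≤ Real.exp δ • ω), (δ : ℝ≥0∞)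

/-- The volume `V_ω = ∫ ωⁿ`. -/
def vol (ω : Z) : ℝ := S.wedge (fun _ => ω) 1

/-- The Monge--Ampère operator `MA_ω(φ) = V_ω⁻¹ (ω + ddᶜφ)ⁿ`. -/
def MA (ω : Z) (φ : S.D) : RadonMeasure X :=
  (S.vol ω)⁻¹ • S.wedge (fun _ => ω + S.ddc φ)

/-- The measure `μ_ω = V_ω⁻¹ ωⁿ`. -/
def baseMeasure (ω : Z) : RadonMeasure X := (S.vol ω)⁻¹ • S.wedge (fun _ => ω)

/-- The energy pairing `(θ₀, φ₀) ⋯ (θₙ, φₙ)`, namely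
`∑ᵢ ∫ φᵢ θ₀ ∧ … ∧ θᵢ₋₁ ∧ (θᵢ₊₁ + ddᶜφᵢ₊₁) ∧ … ∧ (θₙ + ddᶜφₙ)`. -/
def energyPairing (p : Fin (n + 1) → Z × S.D) : ℝ :=
  ∑ i : Fin (n + 1),
    S.wedge (fun j : Fin n =>
      if i.succAbove j < i then (p (i.succAbove j)).1
      else (p (i.succAbove j)).1 + S.ddc (p (i.succAbove j)).2) ((p i).2 : C(X, ℝ))

/-- The Monge--Ampère energy `E_ω(φ) = (ω, φ)ⁿ⁺¹ / ((n + 1) V_ω)`. -/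
def MAEnergy (ω : Z) (φ : S.D) : ℝ :=
  S.energyPairing (fun _ => (ω, φ)) / ((n + 1) * S.vol ω)

/-- The Dirichlet functional `J_ω(φ, ψ) = E_ω(φ) - E_ω(ψ) + ∫ (ψ - φ) MA_ω(φ)`. -/
def dirichlet (ω : Z) (φ ψ : S.D) : ℝ :=
  S.MAEnergy ω φ - S.MAEnergy ω ψ + S.MA ω φ ((ψ : C(X, ℝ)) - (φ : C(X, ℝ)))

/-- The energy `J_ω(μ) = sup {E_ω(φ) - ∫ φ μ | φ ∈ D_ω}` of a measure. It makes sense also when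
`ω` is not assumed nonnegative. -/
def energy (ω : Z) (μ : RadonMeasure X) : EReal :=
  ⨆ φ ∈ S.psh ω, ((S.MAEnergy ω φ - μ (φ : C(X, ℝ)) : ℝ) : EReal)

/-- The space `M¹_ω` of (probability) measures of finite energy. -/
def FiniteEnergy (ω : Z) : Type u :=
  {μ : RadonMeasure X // μ.IsProbability ∧ S.energy ω μ < ⊤}

/-- The underlying measure. -/
def FiniteEnergy.toMeasure {S : PluripotentialSetup n X Z} {ω : Z} (μ : S.FiniteEnergy ω) :
    RadonMeasure X := μ.1

/-- The energy `J_ω(μ)`, as a real number. -/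
def FiniteEnergy.J {S : PluripotentialSetup n X Z} {ω : Z} (μ : S.FiniteEnergy ω) : ℝ :=
  (S.energy ω μ.toMeasure).toReal

/-- The strong topology: the coarsest refinement of the weak topology in which the energy is
continuous. -/
instance FiniteEnergy.strongTopology (ω : Z) : TopologicalSpace (S.FiniteEnergy ω) :=
  TopologicalSpace.induced FiniteEnergy.toMeasure inferInstance ⊓
    TopologicalSpace.induced FiniteEnergy.J inferInstance

/-- The distance `sup |∫ φ (μ - ν)|` over `φ ∈ D_ω` with `J_ω(0, φ) ≤ 1`. -/
def strongDist (ω : Z) (μ ν : RadonMeasure X) : ℝ≥0∞ :=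
  ⨆ φ ∈ {φ : S.D | φ ∈ S.psh ω ∧ S.dirichlet ω 0 φ ≤ 1},
    ENNReal.ofReal |μ (φ : C(X, ℝ)) - ν (φ : C(X, ℝ))|

/-- The quantity `T_ω = sup {sup φ - ∫ φ μ_ω | φ ∈ D_ω} ∈ [0, ∞]`. -/
def submeanConst (ω : Z) : ℝ≥0∞ :=
  ⨆ φ ∈ S.psh ω,
    ENNReal.ofReal ((⨆ x : X, (φ : C(X, ℝ)) x) - S.baseMeasure ω (φ : C(X, ℝ)))

/-- The submean value property. -/
def SubmeanValueProperty : Prop := ∃ ω : Z, S.IsPolarization ω ∧ S.submeanConst ω < ⊤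

/-- The quantity `J⁺_ω(μ) = J_ω(μ) + T_ω`. -/
def FiniteEnergy.Jplus {S : PluripotentialSetup n X Z} {ω : Z} (μ : S.FiniteEnergy ω) : ℝ :=
  μ.J + (S.submeanConst ω).toReal

/-- `D_ω` admits maxima. -/
def AdmitsMaxima (ω : Z) : Prop :=
  ∀ φ ∈ S.psh ω, ∀ ψ ∈ S.psh ω, ∀ f : S.D,
    (∀ x : X, max ((φ : C(X, ℝ)) x) ((ψ : C(X, ℝ)) x) < (f : C(X, ℝ)) x) →
    ∃ τ ∈ S.psh ω, ∀ x : X,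
      max ((φ : C(X, ℝ)) x) ((ψ : C(X, ℝ)) x) ≤ (τ : C(X, ℝ)) x ∧
      (τ : C(X, ℝ)) x < (f : C(X, ℝ)) x

/-- The orthogonality property: `D_ω` admits maxima and, for each `f ∈ D`,
`∫ (f - φ) MA_ω(φ)` tends to `0` along the directed set of all `φ ∈ D_ω` with `φ < f`. -/
def OrthogonalityProperty (ω : Z) : Prop :=
  S.AdmitsMaxima ω ∧
  ∀ f : S.D, ∀ ε : ℝ, 0 < ε →
    ∃ φ₀ ∈ S.psh ω, (∀ x : X, (φ₀ : C(X, ℝ)) x < (f : C(X, ℝ)) x) ∧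
      ∀ φ ∈ S.psh ω, (∀ x : X, (φ₀ : C(X, ℝ)) x ≤ (φ : C(X, ℝ)) x) →
        (∀ x : X, (φ : C(X, ℝ)) x < (f : C(X, ℝ)) x) →
        |S.MA ω φ ((f : C(X, ℝ)) - (φ : C(X, ℝ)))| ≤ ε

/-- `d` is the Dirichlet quasi-metric of `M¹_ω`: the continuous function with values in `[0, ∞)`
such that `d (MA_ω(φ), MA_ω(ψ)) = J_ω(φ, ψ)` for all `φ, ψ ∈ D_ω`. -/
def IsDirichletQuasiMetric (ω : Z) (d : S.FiniteEnergy ω → S.FiniteEnergy ω → ℝ) : Prop :=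
  (∀ μ ν, 0 ≤ d μ ν) ∧ Continuous (Function.uncurry d) ∧
  ∀ φ ∈ S.psh ω, ∀ ψ ∈ S.psh ω, ∃ μ ν : S.FiniteEnergy ω,
    μ.toMeasure = S.MA ω φ ∧ ν.toMeasure = S.MA ω ψ ∧ d μ ν = S.dirichlet ω φ ψ

/-- `F` is the `θ`-twisted energy on `M¹_ω`: it is strongly continuous and, for all `φ ∈ D_ω`,
`F (MA_ω(φ))` is the derivative at `t = 0` of `E_{ω + t θ}(φ)`. -/
def IsTwistedEnergy (ω θ : Z) (F : S.FiniteEnergy ω → ℝ) : Prop :=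
  Continuous F ∧
  ∀ φ ∈ S.psh ω, ∃ μ : S.FiniteEnergy ω, μ.toMeasure = S.MA ω φ ∧
    HasDerivAt (fun t : ℝ => S.MAEnergy (ω + t • θ) φ) (F μ) 0

end PluripotentialSetup

end

/-!
# Twisted energies of measures of finite energy

Everything follows from Hölder estimates for the pairing of a difference `φ - ψ` of
`ω`-plurisubharmonic test functions with a difference of measures of finite energy.

*Estimates on functions.* The Dirichlet functional `J_ω(φ, ψ)` is comparable to the symmetric
quantity `quasiDist`, the normalized integral of `d(φ - ψ) ∧ dᶜ(φ - ψ)` against the `(n - 1)`-st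
power of `ω + ddᶜγ` at the midpoint `γ` (`dirichlet_bounds`); concavity of the energy makes it a
quasi-metric (`quasiDist_triangle`, and `quasiDist_le_of_gap` for almost maximizers of one concave
functional). Cauchy--Schwarz permits the replacement of one factor `ω + ddᶜγ` by another at the
price of a square root (`dirForm_exchange`). After `n - 1` replacements, and one more square root
from the comparison of the two Monge--Ampère measures, one obtains `MA_holder` with exponent
`2⁻ⁿ`.

*Passage to measures.* Orthogonality shows that Monge--Ampère measures of almost maximizers of
`E_ω - μ` approximate `μ` (`FiniteEnergy.exists_approx`): the projection onto the psh functions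
below `φ + t f` is almost as good a competitor as `φ`, with mass of `f` almost at most `∫ f μ`. So
the Hölder estimates extend to `μ` (`FiniteEnergy.sub_MA_sq_le`, `FiniteEnergy.abs_sub_pow_le`),
with `J_ω(μ, φ)` replaced by the gap `J_ω(μ) - E_ω(φ) + ∫ φ μ`. They give the metric on `M¹`
(`FiniteEnergy.exists_metricSpace`) and the density of the Monge--Ampère measures.

*Dependence on `ω`.* A form in `Pos(X)` dominates a multiple of every other form after adding
some `ddᶜg` (`IsPolarization.exists_bound`), and `g` is absorbed by a translation. For comparable
forms, psh functions normalized by `sup φ = 0` have mass controlled by their energy and the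
submean value constant, whence comparable energies (`FiniteEnergy.exists_of_comparable`) and
independence of `M¹` (`exists_homeomorph`).

*Twisted energy.* The derivative of `E_{ω + tθ}(φ)` is `twist`. Its variation with `φ` is an
integral of `φ - ψ` against the difference of a mixed measure `θ ∧ (ω + ddᶜχ)ⁿ⁻¹` and a
Monge--Ampère measure; the mixed measure is dominated by `MA(χ / 2)`, hence has finite energy
(`exists_mixed_point`), and the Hölder estimate for measures applies (`abs_twist_sub_le`). The
function `twist` thus extends to `M¹` by density.

*Perturbation.* If `ω₁` and `s` are `ε`-close to `ω` and `1`, the energies and twisted energies of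
`(ω, φ)` and `(ω₁, s φ)` differ by at most `ε` times a mass which is bounded by the gap of `φ`
plus `J⁺` (`IsClose`, `FiniteEnergy.negMass_le_gap`). Transporting almost maximizers from one
form to the other in this way yields the derivative of the energy (`hasDerivAt_energy`) and the
Hölder dependence of the twisted energy on the form (`abs_twistedEnergy_sub_le_thompsonDist`).
-/

noncomputable section

/-! ### Products of forms -/

/-- Two finite families with the same multiset of values differ by a permutation of the indices. -/
theorem exists_perm_of_map_univ_eq {n : ℕ} {α : Type*} {f g : Fin n → α}
    (h : Multiset.map f Finset.univ.val = Multiset.map g Finset.univ.val) :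
    ∃ σ : Equiv.Perm (Fin n), ∀ i, g (σ i) = f i := by
  classical
  have key : ∀ c : α, Nonempty ({i // f i = c} ≃ {i // g i = c}) := by
    intro c
    refine Fintype.card_eq.mp ?_
    have h1 := congrArg (Multiset.count c) h
    rw [Multiset.count_map, Multiset.count_map] at h1
    rw [Fintype.card_subtype, Fintype.card_subtype]
    simpa [Finset.card_def, eq_comm] using h1
  exact ⟨Equiv.ofFiberEquiv (fun c => (key c).some), fun i => Equiv.ofFiberEquiv_map _ i⟩

namespace RadonMeasure

variable {X : Type u} [TopologicalSpace X]

@[simp] theorem add_apply (μ ν : RadonMeasure X) (f : C(X, ℝ)) : (μ + ν) f = μ f + ν f := rfl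
@[simp] theorem sub_apply (μ ν : RadonMeasure X) (f : C(X, ℝ)) : (μ - ν) f = μ f - ν f := rfl
@[simp] theorem zero_apply (f : C(X, ℝ)) : (0 : RadonMeasure X) f = 0 := rfl
@[simp] theorem smul_apply (c : ℝ) (μ : RadonMeasure X) (f : C(X, ℝ)) : (c • μ) f = c * μ f := rfl

theorem IsPositive.mono {μ : RadonMeasure X} (h : μ.IsPositive) {f g : C(X, ℝ)} (hfg : f ≤ g) :
    μ f ≤ μ g := by
  have := h (g - f) (sub_nonneg.mpr hfg)
  rw [map_sub] at this
  linarith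

end RadonMeasure

namespace PluripotentialSetup

variable {n : ℕ} {X : Type u} [TopologicalSpace X] {Z : Type v}
  [AddCommGroup Z] [Module ℝ Z] [PartialOrder Z] (S : PluripotentialSetup n X Z)

/-- The wedge product of a multiset of forms, a signed Radon measure. By convention it vanishes
unless the multiset has exactly `n` elements, so that multilinearity holds without any condition
on the cardinality. -/
def prod (s : Multiset Z) : RadonMeasure X :=
  if h : s.card = n then S.wedge (fun i => s.toList.get (Fin.cast (by simp [h]) i)) else 0

theorem prod_map_univ (θ : Fin n → Z) :
    S.prod (Multiset.map θ Finset.univ.val) = S.wedge θ := by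
  have hc : (Multiset.map θ Finset.univ.val).card = n := by simp
  rw [prod, dif_pos hc]
  set s := Multiset.map θ Finset.univ.val with hs
  obtain ⟨σ, hσ⟩ := exists_perm_of_map_univ_eq
    (f := fun i => s.toList.get (Fin.cast (by simp [hc]) i)) (g := θ) (by
      rw [← hs]
      conv_rhs => rw [← Multiset.coe_toList s]
      have hl : s.toList.length = n := by simp [hc]
      rw [Fin.univ_def]
      simp only [Multiset.map_coe, Multiset.coe_eq_coe]
      refine List.Perm.of_eq ?_
      apply List.ext_get
      · simp [hc]
      · intro i h1 h2
        simp)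
  rw [← S.wedge_symm σ θ]
  congr 1
  funext i
  exact (hσ i).symm

theorem prod_eq_zero {s : Multiset Z} (h : s.card ≠ n) : S.prod s = 0 := by
  rw [prod, dif_neg h]

theorem prod_replicate (θ : Z) : S.prod (Multiset.replicate n θ) = S.wedge (fun _ => θ) := by
  rw [← prod_map_univ]
  simp

/-- The wedge product with one factor singled out, as a value of the multilinear map. -/
theorem exists_prod_cons {s : Multiset Z} (h : s.card + 1 = n) :
    ∃ (θ : Fin n → Z) (i : Fin n), (∀ x, S.prod (x ::ₘ s) = S.wedge (Function.update θ i x)) ∧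
      ∀ j, j ≠ i → θ j ∈ s := by
  subst h
  have hl : s.toList.length = s.card := by simp
  refine ⟨Fin.cons 0 (fun i => s.toList.get (Fin.cast hl.symm i)), 0, ?_, ?_⟩
  · intro x
    rw [← prod_map_univ]
    congr 1
    rw [Fin.update_cons_zero, Fin.univ_def]
    conv_lhs => rw [← Multiset.coe_toList s]
    simp only [Multiset.map_coe, Multiset.cons_coe, Multiset.coe_eq_coe, List.finRange_succ,
      List.map_cons, Fin.cons_zero, List.map_map]
    refine List.Perm.cons _ (List.Perm.of_eq ?_)
    apply List.ext_get
    · simp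
    · intro i h1 h2
      simp
  · intro j hj
    obtain ⟨k, rfl⟩ := Fin.exists_succ_eq.mpr hj
    rw [Fin.cons_succ]
    rw [← Multiset.mem_toList]
    exact List.get_mem _ _

theorem prod_add_cons (x y : Z) (s : Multiset Z) :
    S.prod ((x + y) ::ₘ s) = S.prod (x ::ₘ s) + S.prod (y ::ₘ s) := by
  by_cases h : s.card + 1 = n
  · obtain ⟨θ, i, h1, -⟩ := S.exists_prod_cons h
    simp only [h1, MultilinearMap.map_update_add]
  · rw [prod_eq_zero, prod_eq_zero, prod_eq_zero, add_zero] <;> simpa using h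

theorem prod_smul_cons (c : ℝ) (x : Z) (s : Multiset Z) :
    S.prod ((c • x) ::ₘ s) = c • S.prod (x ::ₘ s) := by
  by_cases h : s.card + 1 = n
  · obtain ⟨θ, i, h1, -⟩ := S.exists_prod_cons h
    simp only [h1, MultilinearMap.map_update_smul]
  · rw [prod_eq_zero, prod_eq_zero, smul_zero] <;> simpa using h

theorem prod_neg_cons (x : Z) (s : Multiset Z) :
    S.prod ((-x) ::ₘ s) = - S.prod (x ::ₘ s) := by
  have := S.prod_smul_cons (-1) x s
  simpa using this

theorem prod_sub_cons (x y : Z) (s : Multiset Z) :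
    S.prod ((x - y) ::ₘ s) = S.prod (x ::ₘ s) - S.prod (y ::ₘ s) := by
  rw [sub_eq_add_neg, prod_add_cons, prod_neg_cons, ← sub_eq_add_neg]

theorem prod_zero_cons (s : Multiset Z) : S.prod ((0 : Z) ::ₘ s) = 0 := by
  have := S.prod_smul_cons 0 0 s
  simpa using this

theorem prod_nonneg {s : Multiset Z} (hs : ∀ x ∈ s, 0 ≤ x) : (S.prod s).IsPositive := by
  by_cases h : s.card = n
  · rw [prod, dif_pos h]
    refine S.wedge_nonneg _ fun i => hs _ ?_
    rw [← Multiset.mem_toList]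
    exact List.get_mem _ _
  · rw [prod_eq_zero _ h]
    intro f _
    simp

theorem prod_ddc_symm (s : Multiset Z) (φ ψ : S.D) :
    S.prod (S.ddc ψ ::ₘ s) (φ : C(X, ℝ)) = S.prod (S.ddc φ ::ₘ s) (ψ : C(X, ℝ)) := by
  by_cases h : s.card + 1 = n
  · obtain ⟨θ, i, h1, -⟩ := S.exists_prod_cons h
    simp only [h1, S.integral_symm θ i φ ψ]
  · rw [prod_eq_zero, prod_eq_zero] <;> simp [h]

theorem prod_ddc_self_nonpos {s : Multiset Z} (hs : ∀ x ∈ s, 0 ≤ x) (φ : S.D) :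
    S.prod (S.ddc φ ::ₘ s) (φ : C(X, ℝ)) ≤ 0 := by
  by_cases h : s.card + 1 = n
  · obtain ⟨θ, i, h1, h2⟩ := S.exists_prod_cons h
    rw [h1]
    exact S.integral_seminegative θ i φ fun j hj => hs _ (h2 j hj)
  · rw [prod_eq_zero] <;> simp [h]

/-- The constant function `c`, as a test function. -/
def constD (c : ℝ) : S.D := ⟨ContinuousMap.const X c, S.const_mem_D c⟩

@[simp] theorem coe_constD (c : ℝ) : (S.constD c : C(X, ℝ)) = c • (1 : C(X, ℝ)) := by
  ext x; simp [constD]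

@[simp] theorem ddc_constD (c : ℝ) : S.ddc (S.constD c) = 0 := S.ddc_const c

/-- Exact forms have total mass zero against any product. -/
theorem prod_ddc_one (s : Multiset Z) (φ : S.D) : S.prod (S.ddc φ ::ₘ s) 1 = 0 := by
  have h := S.prod_ddc_symm s (S.constD 1) φ
  rw [ddc_constD, prod_zero_cons] at h
  simpa using h

/-- The total mass of a product depends only on the classes modulo exact forms. -/
theorem prod_add_ddc_one (x : Z) (s : Multiset Z) (φ : S.D) :
    S.prod ((x + S.ddc φ) ::ₘ s) 1 = S.prod (x ::ₘ s) 1 := by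
  rw [prod_add_cons]
  simp [prod_ddc_one]

end PluripotentialSetup

/-! ### The energy and its derivative -/

namespace PluripotentialSetup

variable {n : ℕ} {X : Type u} [TopologicalSpace X] {Z : Type v}
  [AddCommGroup Z] [Module ℝ Z] [PartialOrder Z] (S : PluripotentialSetup n X Z)

theorem hasDerivAt_prod_replicate (b β : Z) (f : C(X, ℝ)) (t : ℝ) (j : ℕ) : ∀ s : Multiset Z,
    HasDerivAt (fun t : ℝ => S.prod (Multiset.replicate j (b + t • β) + s) f)
      (j * S.prod (β ::ₘ (Multiset.replicate (j - 1) (b + t • β) + s)) f) t := by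
  induction j with
  | zero =>
    intro s
    simpa using hasDerivAt_const t (S.prod s f)
  | succ j ih =>
    intro s
    have h1 := ih (b ::ₘ s)
    have h2 := ih (β ::ₘ s)
    have h3 := h1.add ((hasDerivAt_id t).mul h2)
    refine (h3.congr_deriv ?_).congr_of_eventuallyEq (Eventually.of_forall fun t => ?_)
    · simp only [id, Nat.add_sub_cancel, one_mul, Multiset.add_cons]
      rcases j with _ | j
      · simp
      · simp only [Nat.add_sub_cancel, Multiset.replicate_succ, Multiset.cons_add,
          Multiset.cons_swap β (b + t • β), prod_add_cons, prod_smul_cons,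
          RadonMeasure.add_apply, RadonMeasure.smul_apply]
        simp only [Multiset.cons_swap β b]
        push_cast
        ring
    · simp only [Multiset.add_cons, Multiset.replicate_succ, Multiset.cons_add, prod_add_cons,
        prod_smul_cons, RadonMeasure.add_apply, RadonMeasure.smul_apply, id, Pi.add_apply,
        Pi.mul_apply]

/-- Leibniz rule for a product of powers of two affine families of forms. -/
theorem hasDerivAt_prod_replicate_add (a α b β : Z) (f : C(X, ℝ)) (t : ℝ) (i j : ℕ) :
    ∀ s : Multiset Z,
    HasDerivAt (fun t : ℝ => S.prod (Multiset.replicate i (a + t • α) +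
        Multiset.replicate j (b + t • β) + s) f)
      (i * S.prod (α ::ₘ (Multiset.replicate (i - 1) (a + t • α) +
          Multiset.replicate j (b + t • β) + s)) f +
        j * S.prod (β ::ₘ (Multiset.replicate i (a + t • α) +
          Multiset.replicate (j - 1) (b + t • β) + s)) f) t := by
  induction i with
  | zero =>
    intro s
    simpa using S.hasDerivAt_prod_replicate b β f t j s
  | succ i ih =>
    intro s
    have h1 := ih (a ::ₘ s)
    have h2 := ih (α ::ₘ s)
    have h3 := h1.add ((hasDerivAt_id t).mul h2)
    refine (h3.congr_deriv ?_).congr_of_eventuallyEq (Eventually.of_forall fun t => ?_)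
    · simp only [id, Nat.add_sub_cancel, one_mul, Multiset.add_cons]
      have e : ∀ u : Multiset Z, S.prod (β ::ₘ (a + t • α) ::ₘ u) f =
          S.prod (β ::ₘ a ::ₘ u) f + t * S.prod (β ::ₘ α ::ₘ u) f := by
        intro u
        rw [Multiset.cons_swap, prod_add_cons, prod_smul_cons, Multiset.cons_swap a,
          Multiset.cons_swap α]
        rfl
      have e' : ∀ u : Multiset Z, S.prod (α ::ₘ (a + t • α) ::ₘ u) f =
          S.prod (α ::ₘ a ::ₘ u) f + t * S.prod (α ::ₘ α ::ₘ u) f := by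
        intro u
        rw [Multiset.cons_swap, prod_add_cons, prod_smul_cons, Multiset.cons_swap a]
        rfl
      rcases i with _ | i
      · simp only [Multiset.replicate_succ, Multiset.cons_add, e]
        simp
        ring
      · simp only [Nat.add_sub_cancel, Multiset.replicate_succ, Multiset.cons_add, e, e']
        push_cast
        ring
    · simp only [Multiset.add_cons, Multiset.replicate_succ, Multiset.cons_add, prod_add_cons,
        prod_smul_cons, RadonMeasure.add_apply, RadonMeasure.smul_apply, id, Pi.add_apply,
        Pi.mul_apply]

/-- The unnormalized Monge--Ampère energy `∑_{i ≤ m} ∫ φ ω^i ∧ (ω + ddᶜφ)^(m - i) ∧ s`. -/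
def preEnergy (m : ℕ) (s : Multiset Z) (ω : Z) (φ : S.D) : ℝ :=
  ∑ i ∈ Finset.range (m + 1), S.prod (Multiset.replicate i ω +
    Multiset.replicate (m - i) (ω + S.ddc φ) + s) (φ : C(X, ℝ))

/-- The sum occurring in the derivative of `preEnergy` in the direction of `ω`:
for `m + 1` factors, it is `∑_{i ≤ m} ∫ φ θ ∧ ω^i ∧ (ω + ddᶜφ)^(m - i) ∧ s`. -/
theorem hasDerivAt_preEnergy (m : ℕ) (s : Multiset Z) (ω θ : Z) (φ u : S.D) (t : ℝ) :
    HasDerivAt (fun t : ℝ => S.preEnergy m s (ω + t • θ) (φ + t • u))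
      ((m + 1) * ((if m = 0 then 0 else
          S.preEnergy (m - 1) (θ ::ₘ s) (ω + t • θ) (φ + t • u)) +
        S.prod (Multiset.replicate m (ω + t • θ + S.ddc (φ + t • u)) + s) (u : C(X, ℝ)))) t := by
  set W : Z := ω + t • θ with hW
  set ψ : S.D := φ + t • u with hψ
  -- the terms of the sums telescope after an integration by parts
  set c : ℕ → ℝ := fun i => S.prod (Multiset.replicate i W +
    Multiset.replicate (m - i) (W + S.ddc ψ) + s) (u : C(X, ℝ)) with hc
  set A : ℕ → ℝ := fun i => S.prod (θ ::ₘ (Multiset.replicate i W +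
    Multiset.replicate (m - 1 - i) (W + S.ddc ψ) + s)) (ψ : C(X, ℝ)) with hA
  have hterm : ∀ i ∈ Finset.range (m + 1),
      HasDerivAt (fun t : ℝ => S.prod (Multiset.replicate i (ω + t • θ) +
        Multiset.replicate (m - i) (ω + t • θ + S.ddc (φ + t • u)) + s)
          ((φ + t • u : S.D) : C(X, ℝ)))
        (c i + (i * A (i - 1) + (m - i : ℕ) * (A i + (c i - c (i + 1))))) t := by
    intro i hi
    have hi' : i ≤ m := Nat.lt_succ_iff.mp (Finset.mem_range.mp hi)
    have e1 : ∀ t : ℝ, ω + t • θ + S.ddc (φ + t • u) = (ω + S.ddc φ) + t • (θ + S.ddc u) := by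
      intro t
      rw [map_add, map_smul, smul_add]
      abel
    have h1 := S.hasDerivAt_prod_replicate_add ω θ (ω + S.ddc φ) (θ + S.ddc u)
      (φ : C(X, ℝ)) t i (m - i) s
    have h2 := S.hasDerivAt_prod_replicate_add ω θ (ω + S.ddc φ) (θ + S.ddc u)
      (u : C(X, ℝ)) t i (m - i) s
    have h3 := h1.add ((hasDerivAt_id t).mul h2)
    refine (h3.congr_deriv ?_).congr_of_eventuallyEq (Eventually.of_forall fun t => ?_)
    · simp only [id, one_mul, ← e1, ← hW, ← hψ]
      have key : ∀ x : Multiset Z, S.prod x (ψ : C(X, ℝ)) =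
          S.prod x (φ : C(X, ℝ)) + t * S.prod x (u : C(X, ℝ)) := by
        intro x
        rw [hψ, Submodule.coe_add, Submodule.coe_smul, map_add, map_smul, smul_eq_mul]
      have hdiff : S.prod (S.ddc u ::ₘ (Multiset.replicate i W +
          Multiset.replicate (m - i - 1) (W + S.ddc ψ) + s)) (ψ : C(X, ℝ)) * (m - i : ℕ)
          = (c i - c (i + 1)) * (m - i : ℕ) := by
        rcases Nat.eq_or_lt_of_le hi' with rfl | hlt
        · simp
        · congr 1
          rw [S.prod_ddc_symm, ← add_sub_cancel_left W (S.ddc ψ), prod_sub_cons,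
            RadonMeasure.sub_apply, add_sub_cancel_left W (S.ddc ψ)]
          obtain ⟨k, hk⟩ : ∃ k, m - i = k + 1 := ⟨m - i - 1, by omega⟩
          have hk' : m - (i + 1) = k := by omega
          simp only [hc, hk, hk', Nat.add_sub_cancel, Multiset.replicate_succ, Multiset.cons_add,
            Multiset.add_cons]
      have hA1 : A i = S.prod (θ ::ₘ (Multiset.replicate i W +
          Multiset.replicate (m - i - 1) (W + S.ddc ψ) + s)) (ψ : C(X, ℝ)) := by
        simp only [hA]
        rw [Nat.sub_right_comm]
      have hA2 : (i : ℝ) * A (i - 1) = i * S.prod (θ ::ₘ (Multiset.replicate (i - 1) W +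
          Multiset.replicate (m - i) (W + S.ddc ψ) + s)) (ψ : C(X, ℝ)) := by
        rcases i with _ | i
        · simp
        · simp only [hA, Nat.add_sub_cancel]
          rw [show m - 1 - i = m - (i + 1) by omega]
      have hsplit : S.prod ((θ + S.ddc u) ::ₘ (Multiset.replicate i W +
          Multiset.replicate (m - i - 1) (W + S.ddc ψ) + s)) (ψ : C(X, ℝ)) * (m - i : ℕ)
          = (m - i : ℕ) * (A i + (c i - c (i + 1))) := by
        rw [prod_add_cons, RadonMeasure.add_apply, add_mul, hdiff, hA1]
        ring
      rw [hA2, ← hsplit, key, key]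
      simp only [hc]
      ring
    · simp only [Pi.add_apply, Pi.mul_apply, id, ← e1, Submodule.coe_add, Submodule.coe_smul,
        map_add, map_smul, smul_eq_mul]
  have hsum := HasDerivAt.fun_sum hterm
  refine hsum.congr_deriv ?_
  rw [Finset.sum_add_distrib, Finset.sum_add_distrib]
  have hS1 : ∀ k, k ≤ m → ∑ i ∈ Finset.range k, (c i + (m - i : ℕ) * (c i - c (i + 1)))
      = (m + 1) * c 0 - (m + 1 - k : ℕ) * c k := by
    intro k
    induction k with
    | zero => intro _; simp
    | succ k ih =>
      intro hk
      rw [Finset.sum_range_succ, ih (by omega)]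
      rw [Nat.cast_sub (by omega), Nat.cast_sub (by omega), Nat.cast_sub (by omega)]
      push_cast
      ring
  have hS2 : ∑ i ∈ Finset.range (m + 1), ((i : ℝ) * A (i - 1) + (m - i : ℕ) * A i)
      = (m + 1) * ∑ i ∈ Finset.range m, A i := by
    rw [Finset.sum_add_distrib, Finset.sum_range_succ', Finset.sum_range_succ, Finset.mul_sum]
    simp only [Nat.add_sub_cancel, Nat.cast_zero, zero_mul, add_zero, Nat.sub_self]
    rw [← Finset.sum_add_distrib]
    refine Finset.sum_congr rfl fun i hi => ?_
    have : i < m := Finset.mem_range.mp hi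
    rw [Nat.cast_sub this.le]
    push_cast
    ring
  have hS3 : (if m = 0 then 0 else S.preEnergy (m - 1) (θ ::ₘ s) W ψ)
      = ∑ i ∈ Finset.range m, A i := by
    rcases m with _ | m
    · simp
    · simp only [Nat.add_eq_zero_iff, one_ne_zero, and_false, if_false, preEnergy,
        Nat.add_sub_cancel, hA, Multiset.add_cons]
  have hS4 := hS1 m le_rfl
  have hc0 : c 0 = S.prod (Multiset.replicate m (W + S.ddc ψ) + s) (u : C(X, ℝ)) := by
    simp [hc]
  rw [hS3, ← hc0, mul_add, ← hS2]
  have hS5 : ∑ i ∈ Finset.range (m + 1), (c i + (m - i : ℕ) * (c i - c (i + 1)))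
      = (m + 1) * c 0 := by
    rw [Finset.sum_range_succ, hS4]
    simp
  rw [← hS5, ← Finset.sum_add_distrib, ← Finset.sum_add_distrib, ← Finset.sum_add_distrib]
  refine Finset.sum_congr rfl fun i _ => ?_
  ring

/-- The energy pairing of the definition is the symmetric sum over all mixed products. -/
theorem energyPairing_eq (ω : Z) (φ : S.D) :
    S.energyPairing (fun _ => (ω, φ)) = S.preEnergy n 0 ω φ := by
  rw [energyPairing, preEnergy, ← Fin.sum_univ_eq_sum_range
    (fun i => S.prod (Multiset.replicate i ω +
      Multiset.replicate (n - i) (ω + S.ddc φ) + 0) (φ : C(X, ℝ)))]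
  refine Finset.sum_congr rfl fun i _ => ?_
  rw [← prod_map_univ]
  congr 2
  have hcond : ∀ j : Fin n, (i.succAbove j < i) ↔ j.val < i.val := by
    intro j
    rw [Fin.succAbove_lt_iff_castSucc_lt, Fin.lt_def, Fin.val_castSucc]
  simp only [hcond, add_zero]
  have hi : i.val ≤ n := Nat.lt_succ_iff.mp i.isLt
  obtain ⟨k, hk⟩ := Nat.exists_eq_add_of_le hi
  have hrange : Multiset.map Fin.val (Finset.univ : Finset (Fin n)).val = Multiset.range n := by
    rw [Fin.univ_def]
    simp [Multiset.range]
  have hmap := congrArg (Multiset.map (fun x : ℕ => if x < i.val then ω else ω + S.ddc φ)) hrange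
  rw [Multiset.map_map] at hmap
  simp only [Function.comp_def] at hmap
  rw [hmap, show n - i.val = k by omega]
  rw [(congrArg Multiset.range hk).trans (Multiset.range_add _ _), Multiset.map_add,
    Multiset.map_map]
  congr 1
  · rw [Multiset.map_congr rfl (g := fun _ => ω) fun x hx => by
      rw [if_pos (Multiset.mem_range.mp hx)]]
    simp
  · rw [Multiset.map_congr rfl (g := fun _ => ω + S.ddc φ) fun x _ => by simp]
    simp

end PluripotentialSetup

/-! ### Positive multilinear functions and the Dirichlet form -/

/-- A real function of multisets of vectors which is linear in each entry, and nonnegative on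
multisets of nonnegative vectors. -/
structure IsPosMultilinear {Z : Type v} [AddCommGroup Z] [Module ℝ Z] [PartialOrder Z]
    (F : Multiset Z → ℝ) : Prop where
  add_cons : ∀ x y s, F ((x + y) ::ₘ s) = F (x ::ₘ s) + F (y ::ₘ s)
  smul_cons : ∀ (c : ℝ) x s, F ((c • x) ::ₘ s) = c * F (x ::ₘ s)
  nonneg : ∀ s : Multiset Z, (∀ x ∈ s, 0 ≤ x) → 0 ≤ F s

namespace IsPosMultilinear

theorem nonneg_cons {Z : Type v} [AddCommGroup Z] [PartialOrder Z] {x : Z} {s : Multiset Z}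
    (hx : 0 ≤ x) (hs : ∀ z ∈ s, 0 ≤ z) :
    ∀ z ∈ x ::ₘ s, 0 ≤ z := by
  intro z hz
  rcases Multiset.mem_cons.mp hz with rfl | hz
  · exact hx
  · exact hs z hz

theorem nonneg_replicate {Z : Type v} [AddCommGroup Z] [PartialOrder Z] {x : Z} (k : ℕ)
    (hx : 0 ≤ x) : ∀ z ∈ Multiset.replicate k x, 0 ≤ z := by
  intro z hz
  rw [Multiset.eq_of_mem_replicate hz]
  exact hx

theorem nonneg_add {Z : Type v} [AddCommGroup Z] [PartialOrder Z] {r s : Multiset Z}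
    (hr : ∀ z ∈ r, 0 ≤ z) (hs : ∀ z ∈ s, 0 ≤ z) :
    ∀ z ∈ r + s, 0 ≤ z := by
  intro z hz
  rcases Multiset.mem_add.mp hz with hz | hz
  · exact hr z hz
  · exact hs z hz

variable {Z : Type v} [AddCommGroup Z] [Module ℝ Z] [PartialOrder Z] {F : Multiset Z → ℝ}

theorem sub_cons (hF : IsPosMultilinear F) (x y : Z) (s : Multiset Z) :
    F ((x - y) ::ₘ s) = F (x ::ₘ s) - F (y ::ₘ s) := by
  have h := hF.smul_cons (-1) y s
  rw [sub_eq_add_neg, hF.add_cons, ← neg_one_smul ℝ y, h]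
  ring

variable [IsOrderedAddMonoid Z]

theorem cons_mono (hF : IsPosMultilinear F) {x y : Z} (hxy : x ≤ y) {s : Multiset Z}
    (hs : ∀ z ∈ s, 0 ≤ z) : F (x ::ₘ s) ≤ F (y ::ₘ s) := by
  have h := hF.nonneg _ (nonneg_cons (sub_nonneg.mpr hxy) hs)
  rw [hF.sub_cons] at h
  linarith

theorem replicate_add_le (hF : IsPosMultilinear F) {a b : Z} (ha : 0 ≤ a) (hb : 0 ≤ b) {c : ℝ}
    (hc : 0 ≤ c) (hab : a ≤ c • b) (k : ℕ) : ∀ {s : Multiset Z}, (∀ z ∈ s, 0 ≤ z) →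
    F (Multiset.replicate k a + s) ≤ c ^ k * F (Multiset.replicate k b + s) := by
  induction k with
  | zero => intro s _; simp
  | succ k ih =>
    intro s hs
    rw [Multiset.replicate_succ, Multiset.replicate_succ, Multiset.cons_add, Multiset.cons_add]
    refine (hF.cons_mono hab (nonneg_add (nonneg_replicate k ha) hs)).trans ?_
    rw [hF.smul_cons, pow_succ', mul_assoc]
    refine mul_le_mul_of_nonneg_left ?_ hc
    have h := ih (s := b ::ₘ s) (nonneg_cons hb hs)
    rwa [Multiset.add_cons, Multiset.add_cons] at h

theorem replicate_le (hF : IsPosMultilinear F) {a b : Z} (ha : 0 ≤ a) (hb : 0 ≤ b) {c : ℝ}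
    (hc : 0 ≤ c) (hab : a ≤ c • b) (k : ℕ) :
    F (Multiset.replicate k a) ≤ c ^ k * F (Multiset.replicate k b) := by
  simpa using hF.replicate_add_le ha hb hc hab k (s := 0) (by simp)

theorem replicate_add_replicate_le (hF : IsPosMultilinear F) {a a' b : Z} (ha : 0 ≤ a)
    (ha' : 0 ≤ a') (hb : 0 ≤ b) {c : ℝ} (hc : 0 ≤ c) (hab : a ≤ c • b) (hab' : a' ≤ c • b)
    (i j : ℕ) : F (Multiset.replicate i a + Multiset.replicate j a') ≤
      c ^ (i + j) * F (Multiset.replicate (i + j) b) := by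
  refine (hF.replicate_add_le ha hb hc hab i (nonneg_replicate j ha')).trans ?_
  rw [pow_add, mul_assoc]
  refine mul_le_mul_of_nonneg_left ?_ (by positivity)
  have h := hF.replicate_add_le ha' hb hc hab' j (s := Multiset.replicate i b)
    (nonneg_replicate i hb)
  rwa [add_comm, Multiset.replicate_add, add_comm (Multiset.replicate i b)]

/-- If all entries of `s` lie between `-A η` and `A η`, then `F (s + r)` is bounded by a multiple
of the value obtained by replacing the entries of `s` by `η`. -/
theorem abs_add_le (hF : IsPosMultilinear F) {η : Z} (hη : 0 ≤ η) {A : ℝ} (hA : 0 ≤ A)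
    (s : Multiset Z) : (∀ x ∈ s, x ≤ A • η ∧ -x ≤ A • η) → ∀ r : Multiset Z, (∀ x ∈ r, 0 ≤ x) →
      |F (s + r)| ≤ (3 * A) ^ s.card * F (Multiset.replicate s.card η + r) := by
  induction s using Multiset.induction with
  | empty =>
    intro _ r hr
    simp [abs_of_nonneg (hF.nonneg r hr)]
  | cons x s ih =>
    intro hs r hr
    have hx := hs x (Multiset.mem_cons_self x s)
    have hs' : ∀ y ∈ s, y ≤ A • η ∧ -y ≤ A • η := fun y hy => hs y (Multiset.mem_cons_of_mem hy)
    have hpos : 0 ≤ x + A • η := by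
      have := hx.2
      rw [neg_le_iff_add_nonneg] at this
      rwa [add_comm]
    have h1 := ih hs' ((x + A • η) ::ₘ r) (nonneg_cons hpos hr)
    have h2 := ih hs' (η ::ₘ r) (nonneg_cons hη hr)
    rw [Multiset.card_cons]
    set k := s.card
    have hrep := nonneg_add (nonneg_replicate k hη) hr
    have e1 : F (x ::ₘ s + r) = F (s + (x + A • η) ::ₘ r) - A * F (s + η ::ₘ r) := by
      rw [Multiset.add_cons, Multiset.add_cons, Multiset.cons_add, hF.add_cons, hF.smul_cons]
      ring
    have e2 : F (Multiset.replicate k η + (x + A • η) ::ₘ r)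
        ≤ (2 * A) * F (Multiset.replicate (k + 1) η + r) := by
      rw [Multiset.add_cons, Multiset.replicate_succ, Multiset.cons_add]
      have := hF.cons_mono (x := x + A • η) (y := (2 * A) • η) (by
        rw [two_mul, add_smul]; exact add_le_add_left hx.1 _) hrep
      rwa [hF.smul_cons] at this
    have e3 : F (Multiset.replicate k η + η ::ₘ r) = F (Multiset.replicate (k + 1) η + r) := by
      rw [Multiset.add_cons, Multiset.replicate_succ, Multiset.cons_add]
    rw [e3] at h2
    rw [e1]
    have hA3 : 0 ≤ (3 * A) ^ k := by positivity
    calc |F (s + (x + A • η) ::ₘ r) - A * F (s + η ::ₘ r)|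
        ≤ |F (s + (x + A • η) ::ₘ r)| + A * |F (s + η ::ₘ r)| := by
          refine (abs_sub _ _).trans ?_
          rw [abs_mul, abs_of_nonneg hA]
      _ ≤ (3 * A) ^ k * ((2 * A) * F (Multiset.replicate (k + 1) η + r))
          + A * ((3 * A) ^ k * F (Multiset.replicate (k + 1) η + r)) := by
          refine add_le_add (h1.trans (mul_le_mul_of_nonneg_left e2 hA3))
            (mul_le_mul_of_nonneg_left h2 hA)
      _ = (3 * A) ^ (k + 1) * F (Multiset.replicate (k + 1) η + r) := by ring

theorem abs_le (hF : IsPosMultilinear F) {η : Z} (hη : 0 ≤ η) {A : ℝ} (hA : 0 ≤ A)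
    (s : Multiset Z) (hs : ∀ x ∈ s, x ≤ A • η ∧ -x ≤ A • η) :
      |F s| ≤ (3 * A) ^ s.card * F (Multiset.replicate s.card η) := by
  simpa using hF.abs_add_le hη hA s hs 0 (by simp)

variable [PosSMulMono ℝ Z]

/-- Two multisets of vectors bounded by `A η` whose entries differ by at most `ε η` have values
differing by `O(ε)`. The multiset `T` lists the pairs of corresponding entries. -/
theorem abs_sub_le (hF : IsPosMultilinear F) {η : Z} (hη : 0 ≤ η) {A ε : ℝ} (hA : 1 ≤ A)
    (hε : 0 < ε) (T : Multiset (Z × Z)) :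
    (∀ p ∈ T, (p.1 ≤ A • η ∧ -p.1 ≤ A • η) ∧ (p.2 ≤ A • η ∧ -p.2 ≤ A • η) ∧
      (p.1 - p.2 ≤ ε • η ∧ -(p.1 - p.2) ≤ ε • η)) →
    ∀ r : Multiset Z, (∀ x ∈ r, x ≤ A • η ∧ -x ≤ A • η) →
      |F (T.map Prod.fst + r) - F (T.map Prod.snd + r)| ≤
        T.card * ε * (3 * A) ^ (T.card + r.card) *
          F (Multiset.replicate (T.card + r.card) η) := by
  induction T using Multiset.induction with
  | empty => intro _ r _; simp
  | cons p T ih =>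
    intro hT r hr
    obtain ⟨h1, h2, h3⟩ := hT p (Multiset.mem_cons_self p T)
    have hT' := fun q hq => hT q (Multiset.mem_cons_of_mem hq)
    have hA0 : 0 < A := by linarith
    -- the difference of the first entries, rescaled so that it is again bounded by `A η`
    set y := (A / ε) • (p.1 - p.2) with hy
    have hyb : y ≤ A • η ∧ -y ≤ A • η := by
      have e : A • η = (A / ε) • (ε • η) := by rw [smul_smul, div_mul_cancel₀ _ hε.ne']
      rw [e, hy, ← smul_neg]
      exact ⟨smul_le_smul_of_nonneg_left h3.1 (by positivity),
        smul_le_smul_of_nonneg_left h3.2 (by positivity)⟩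
    have hpy : p.1 - p.2 = (ε / A) • y := by
      rw [hy, smul_smul]
      have : ε / A * (A / ε) = 1 := by field_simp
      rw [this, one_smul]
    have hcons : ∀ x, (x ≤ A • η ∧ -x ≤ A • η) → ∀ z ∈ x ::ₘ r, z ≤ A • η ∧ -z ≤ A • η := by
      intro x hx z hz
      rcases Multiset.mem_cons.mp hz with rfl | hz
      · exact hx
      · exact hr z hz
    have k1 := ih hT' (p.1 ::ₘ r) (hcons _ h1)
    have k2 := hF.abs_le hη hA0.le (y ::ₘ (T.map Prod.snd + r)) (by
      intro z hz
      rcases Multiset.mem_cons.mp hz with rfl | hz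
      · exact hyb
      rcases Multiset.mem_add.mp hz with hz | hz
      · obtain ⟨q, hq, rfl⟩ := Multiset.mem_map.mp hz
        exact (hT' q hq).2.1
      · exact hr z hz)
    simp only [Multiset.card_cons, Multiset.card_add, Multiset.card_map] at k1 k2 ⊢
    rw [show T.card + (r.card + 1) = T.card + r.card + 1 by ring] at k1
    rw [show T.card + 1 + r.card = T.card + r.card + 1 by ring]
    set B := (3 * A) ^ (T.card + r.card + 1) *
      F (Multiset.replicate (T.card + r.card + 1) η) with hB
    have e : F (Multiset.map Prod.fst (p ::ₘ T) + r) - F (Multiset.map Prod.snd (p ::ₘ T) + r)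
        = (F (T.map Prod.fst + p.1 ::ₘ r) - F (T.map Prod.snd + p.1 ::ₘ r))
          + (ε / A) * F (y ::ₘ (T.map Prod.snd + r)) := by
      rw [← hF.smul_cons, ← hpy, hF.sub_cons]
      simp only [Multiset.map_cons, Multiset.cons_add, Multiset.add_cons]
      ring
    have hB0 : 0 ≤ B := (abs_nonneg _).trans k2
    rw [e]
    calc _ ≤ |F (T.map Prod.fst + p.1 ::ₘ r) - F (T.map Prod.snd + p.1 ::ₘ r)|
          + |(ε / A) * F (y ::ₘ (T.map Prod.snd + r))| := _root_.abs_add_le _ _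
      _ ≤ T.card * ε * B + ε * B := by
          refine add_le_add (k1.trans (by rw [hB]; ring_nf; rfl)) ?_
          rw [abs_mul, abs_of_pos (by positivity)]
          refine mul_le_mul (div_le_self hε.le hA) k2 (abs_nonneg _) hε.le
      _ = _ := by rw [hB]; push_cast; ring

end IsPosMultilinear

namespace PluripotentialSetup

variable {n : ℕ} {X : Type u} [TopologicalSpace X] {Z : Type v}
  [AddCommGroup Z] [Module ℝ Z] [PartialOrder Z] (S : PluripotentialSetup n X Z)

theorem isPosMultilinear_prod {f : C(X, ℝ)} (hf : 0 ≤ f) :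
    IsPosMultilinear (fun s => S.prod s f) where
  add_cons x y s := by rw [prod_add_cons]; rfl
  smul_cons c x s := by rw [prod_smul_cons]; rfl
  nonneg s hs := S.prod_nonneg hs f hf

/-- The Dirichlet form `∫ dφ ∧ dᶜψ ∧ s = - ∫ φ ddᶜψ ∧ s`. -/
def dirForm (s : Multiset Z) (φ ψ : S.D) : ℝ := - S.prod (S.ddc φ ::ₘ s) (ψ : C(X, ℝ))

theorem dirForm_comm (s : Multiset Z) (φ ψ : S.D) : S.dirForm s φ ψ = S.dirForm s ψ φ := by
  rw [dirForm, dirForm, prod_ddc_symm]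

theorem isPosMultilinear_dirForm (φ : S.D) : IsPosMultilinear (fun s => S.dirForm s φ φ) where
  add_cons x y s := by
    simp only [dirForm, Multiset.cons_swap _ x, Multiset.cons_swap _ y,
      Multiset.cons_swap _ (x + y), prod_add_cons, RadonMeasure.add_apply]
    ring
  smul_cons c x s := by
    simp only [dirForm, Multiset.cons_swap _ x, Multiset.cons_swap _ (c • x), prod_smul_cons,
      RadonMeasure.smul_apply]
    ring
  nonneg s hs := neg_nonneg.mpr (S.prod_ddc_self_nonpos hs φ)

theorem dirForm_nonneg {s : Multiset Z} (hs : ∀ x ∈ s, 0 ≤ x) (φ : S.D) : 0 ≤ S.dirForm s φ φ :=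
  (S.isPosMultilinear_dirForm φ).nonneg s hs

theorem dirForm_add_right (s : Multiset Z) (φ ψ χ : S.D) :
    S.dirForm s φ (ψ + χ) = S.dirForm s φ ψ + S.dirForm s φ χ := by
  simp only [dirForm, Submodule.coe_add, map_add]
  ring

theorem dirForm_smul_right (s : Multiset Z) (c : ℝ) (φ ψ : S.D) :
    S.dirForm s φ (c • ψ) = c * S.dirForm s φ ψ := by
  simp only [dirForm, Submodule.coe_smul, map_smul, smul_eq_mul]
  ring

theorem dirForm_add_left (s : Multiset Z) (φ ψ χ : S.D) :
    S.dirForm s (φ + ψ) χ = S.dirForm s φ χ + S.dirForm s ψ χ := by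
  rw [S.dirForm_comm s _ χ, dirForm_add_right, S.dirForm_comm s χ, S.dirForm_comm s χ]

theorem dirForm_smul_left (s : Multiset Z) (c : ℝ) (φ ψ : S.D) :
    S.dirForm s (c • φ) ψ = c * S.dirForm s φ ψ := by
  rw [S.dirForm_comm s _ ψ, dirForm_smul_right, S.dirForm_comm s ψ]

theorem dirForm_smul_smul (s : Multiset Z) (c : ℝ) (φ : S.D) :
    S.dirForm s (c • φ) (c • φ) = c ^ 2 * S.dirForm s φ φ := by
  rw [dirForm_smul_left, dirForm_smul_right]
  ring

/-- The Cauchy--Schwarz inequality for the Dirichlet form. -/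
theorem dirForm_sq_le {s : Multiset Z} (hs : ∀ x ∈ s, 0 ≤ x) (φ ψ : S.D) :
    S.dirForm s φ ψ ^ 2 ≤ S.dirForm s φ φ * S.dirForm s ψ ψ := by
  have h : ∀ t : ℝ, 0 ≤ S.dirForm s ψ ψ * (t * t) + 2 * S.dirForm s φ ψ * t + S.dirForm s φ φ := by
    intro t
    have := S.dirForm_nonneg hs (φ + t • ψ)
    rw [dirForm_add_left, dirForm_add_right, dirForm_add_right, dirForm_smul_left,
      dirForm_smul_left, dirForm_smul_right, dirForm_smul_right, S.dirForm_comm s ψ φ] at this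
    linarith
  have := discrim_le_zero h
  rw [discrim] at this
  nlinarith

theorem preEnergy_zero_cons (m : ℕ) (s : Multiset Z) (ω : Z) (φ : S.D) :
    S.preEnergy m (0 ::ₘ s) ω φ = 0 := by
  simp only [preEnergy, Multiset.add_cons, prod_zero_cons, RadonMeasure.zero_apply,
    Finset.sum_const_zero]

/-- The value of the `θ`-twisted energy at `φ`, that is, the derivative of the Monge--Ampère energy
`E_ω(φ)` with respect to `ω` in the direction `θ`. -/
def twist (ω θ : Z) (φ : S.D) : ℝ :=
  S.preEnergy (n - 1) {θ} ω φ / S.vol ω -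
    n * S.prod (θ ::ₘ Multiset.replicate (n - 1) ω) 1 / S.vol ω * S.MAEnergy ω φ

theorem vol_eq (ω : Z) : S.vol ω = S.prod (Multiset.replicate n ω) 1 := by
  rw [prod_replicate]; rfl

theorem MA_apply (ω : Z) (φ : S.D) (f : C(X, ℝ)) :
    S.MA ω φ f = (S.vol ω)⁻¹ * S.prod (Multiset.replicate n (ω + S.ddc φ)) f := by
  rw [MA, prod_replicate]; rfl

theorem MAEnergy_eq (ω : Z) (φ : S.D) :
    S.MAEnergy ω φ = S.preEnergy n 0 ω φ / ((n + 1) * S.vol ω) := by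
  rw [MAEnergy, energyPairing_eq]

theorem hasDerivAt_vol (ω θ : Z) (t : ℝ) :
    HasDerivAt (fun t : ℝ => S.vol (ω + t • θ))
      (n * S.prod (θ ::ₘ Multiset.replicate (n - 1) (ω + t • θ)) 1) t := by
  have := S.hasDerivAt_prod_replicate ω θ 1 t n 0
  simpa only [add_zero, ← vol_eq] using this

theorem hasDerivAt_MAEnergy (ω θ : Z) (φ u : S.D) (t : ℝ) (hV : S.vol (ω + t • θ) ≠ 0) :
    HasDerivAt (fun t : ℝ => S.MAEnergy (ω + t • θ) (φ + t • u))
      (S.twist (ω + t • θ) θ (φ + t • u) + S.MA (ω + t • θ) (φ + t • u) (u : C(X, ℝ))) t := by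
  have h1 := S.hasDerivAt_preEnergy n 0 ω θ φ u t
  have h2 := (S.hasDerivAt_vol ω θ t).const_mul ((n : ℝ) + 1)
  have hn : n ≠ 0 := Nat.one_le_iff_ne_zero.mp S.one_le_dim
  have hn1 : (n : ℝ) + 1 ≠ 0 := by positivity
  have h3 := h1.div h2 (mul_ne_zero hn1 hV)
  refine (h3.congr_deriv ?_).congr_of_eventuallyEq (Eventually.of_forall fun t => ?_)
  · rw [twist, MA_apply, MAEnergy_eq, if_neg hn]
    simp only [add_zero, Multiset.cons_zero]
    field_simp
    ring
  · simp only [Pi.div_apply, MAEnergy_eq]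

/-- The energy is concave along affine segments: its derivative is the integral against the
Monge--Ampère measure. -/
theorem hasDerivAt_MAEnergy_line (ω : Z) (φ u : S.D) (t : ℝ) (hV : S.vol ω ≠ 0) :
    HasDerivAt (fun t : ℝ => S.MAEnergy ω (φ + t • u)) (S.MA ω (φ + t • u) (u : C(X, ℝ))) t := by
  have h := S.hasDerivAt_preEnergy n 0 ω 0 φ u t
  have h1 := h.div_const (((n : ℝ) + 1) * S.vol ω)
  have hn1 : (n : ℝ) + 1 ≠ 0 := by positivity
  have h0 := S.preEnergy_zero_cons (n - 1) 0 (ω + t • (0 : Z)) (φ + t • u)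
  refine (h1.congr_deriv ?_).congr_of_eventuallyEq (Eventually.of_forall fun t => ?_)
  · rw [h0, MA_apply]
    simp only [ite_self, smul_zero, add_zero, zero_add]
    field_simp
  · simp only [MAEnergy_eq, smul_zero, add_zero]

/-- The derivative of the Monge--Ampère operator. -/
theorem hasDerivAt_MA_line (ω : Z) (φ u : S.D) (w : S.D) (t : ℝ) :
    HasDerivAt (fun t : ℝ => S.MA ω (φ + t • u) (w : C(X, ℝ)))
      (-((S.vol ω)⁻¹ * n *
        S.dirForm (Multiset.replicate (n - 1) (ω + S.ddc (φ + t • u))) u w)) t := by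
  have h := (S.hasDerivAt_prod_replicate (ω + S.ddc φ) (S.ddc u) (w : C(X, ℝ)) t n 0).const_mul
    (S.vol ω)⁻¹
  refine (h.congr_deriv ?_).congr_of_eventuallyEq (Eventually.of_forall fun t => ?_)
  · simp only [dirForm, add_zero, map_add, map_smul, ← add_assoc]
    ring
  · simp only [MA_apply, add_zero, map_add, map_smul, ← add_assoc]

/-- The derivative of the twisted energy along an affine segment of test functions. -/
theorem hasDerivAt_twist_line (ω θ : Z) (φ u : S.D) (t : ℝ) (hV : S.vol ω ≠ 0) :
    HasDerivAt (fun t : ℝ => S.twist ω θ (φ + t • u))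
      (n * ((S.vol ω)⁻¹ * S.prod (θ ::ₘ Multiset.replicate (n - 1) (ω + S.ddc (φ + t • u)))
          (u : C(X, ℝ)) -
        S.prod (θ ::ₘ Multiset.replicate (n - 1) ω) 1 / S.vol ω *
          S.MA ω (φ + t • u) (u : C(X, ℝ)))) t := by
  have h1 := (S.hasDerivAt_preEnergy (n - 1) {θ} ω 0 φ u t).div_const (S.vol ω)
  have h2 := (S.hasDerivAt_MAEnergy_line ω φ u t hV).const_mul
    (n * S.prod (θ ::ₘ Multiset.replicate (n - 1) ω) 1 / S.vol ω)
  have h0 := S.preEnergy_zero_cons (n - 1 - 1) {θ} (ω + t • (0 : Z)) (φ + t • u)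
  refine ((h1.sub h2).congr_deriv ?_).congr_of_eventuallyEq (Eventually.of_forall fun t => ?_)
  · rw [h0, Nat.cast_sub S.one_le_dim]
    simp only [ite_self, smul_zero, add_zero, zero_add, ← Multiset.singleton_add,
      Nat.cast_one, sub_add_cancel]
    rw [add_comm (Multiset.replicate _ _)]
    ring
  · simp only [twist, smul_zero, add_zero, Pi.sub_apply]

end PluripotentialSetup

/-! ### The quasi-distance -/

/-- A quantitative form of concavity: the Taylor remainder at `1` of a function on `[0, 1]` is
controlled by its second derivative. -/
theorem taylor_remainder_bounds {f f' h : ℝ → ℝ} (hf : ∀ t, HasDerivAt f (f' t) t)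
    (hf' : ∀ t, HasDerivAt f' (-h t) t) (h0 : ∀ t ∈ Set.Icc (0 : ℝ) 1, 0 ≤ h t) :
    (∀ M, (∀ t ∈ Set.Icc (0 : ℝ) 1, h t ≤ M) → f 1 - f 0 - f' 1 ≤ M) ∧
    (∀ m, (∀ t ∈ Set.Icc (1 / 4 : ℝ) (3 / 4), m ≤ h t) → m / 8 ≤ f 1 - f 0 - f' 1) ∧
    0 ≤ f 1 - f 0 - f' 1 := by
  have mvt : ∀ a b : ℝ, a < b → ∃ c ∈ Set.Ioo a b, f b - f a = (b - a) * f' c := by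
    intro a b hab
    obtain ⟨c, hc, e⟩ := exists_hasDerivAt_eq_slope f f' hab
      (fun x _ => (hf x).continuousAt.continuousWithinAt) (fun x _ => hf x)
    refine ⟨c, hc, ?_⟩
    rw [e, mul_div_cancel₀ _ (by linarith : b - a ≠ 0)]
  have mvt' : ∀ a b : ℝ, a < b → ∃ c ∈ Set.Ioo a b, f' a - f' b = (b - a) * h c := by
    intro a b hab
    obtain ⟨c, hc, e⟩ := exists_hasDerivAt_eq_slope f' (fun t => -h t) hab
      (fun x _ => (hf' x).continuousAt.continuousWithinAt) (fun x _ => hf' x)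
    refine ⟨c, hc, ?_⟩
    have : (b - a) * (-h c) = f' b - f' a := by
      rw [e, mul_div_cancel₀ _ (by linarith : b - a ≠ 0)]
    linarith
  have anti : ∀ a b : ℝ, 0 ≤ a → a ≤ b → b ≤ 1 → f' b ≤ f' a := by
    intro a b ha hab hb
    rcases hab.eq_or_lt with rfl | hab
    · exact le_rfl
    obtain ⟨c, hc, e⟩ := mvt' a b hab
    have := mul_nonneg (sub_pos.mpr hab).le (h0 c ⟨by linarith [hc.1], by linarith [hc.2]⟩)
    linarith
  obtain ⟨c, hc, e⟩ := mvt 0 1 one_pos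
  refine ⟨fun M hM => ?_, fun m hm => ?_, ?_⟩
  · obtain ⟨d, hd, e'⟩ := mvt' c 1 hc.2
    have hd1 : d ∈ Set.Icc (0 : ℝ) 1 := ⟨by linarith [hc.1, hd.1], hd.2.le⟩
    have h1 := h0 d hd1
    have h2 := hM d hd1
    have h3 : (1 - c) * h d ≤ h d := by nlinarith [hc.1]
    linarith
  · obtain ⟨c₀, hc₀, e₀⟩ := mvt 0 (1 / 4) (by norm_num)
    obtain ⟨c₁, hc₁, e₁⟩ := mvt (1 / 4) 1 (by norm_num)
    obtain ⟨d, hd, e'⟩ := mvt' (1 / 4) (3 / 4) (by norm_num)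
    have h1 := anti c₁ 1 (by linarith [hc₁.1]) hc₁.2.le le_rfl
    have h2 := anti c₀ (1 / 4) hc₀.1.le hc₀.2.le (by norm_num)
    have h3 := anti (3 / 4) 1 (by norm_num) (by norm_num) le_rfl
    have h4 := hm d ⟨hd.1.le, hd.2.le⟩
    linarith
  · have := anti c 1 hc.1.le hc.2.le le_rfl
    linarith

namespace PluripotentialSetup

/-- A constant depending only on the dimension, in powers of which the constants in the basic
estimates are expressed. -/
def dimConst (n : ℕ) : ℝ := 4 ^ (n + 1)

theorem one_le_dimConst (n : ℕ) : 1 ≤ dimConst n := one_le_pow₀ (by norm_num)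

theorem dimConst_pos (n : ℕ) : 0 < dimConst n := one_pos.trans_le (one_le_dimConst n)

variable {n : ℕ} {X : Type u} [TopologicalSpace X] {Z : Type v}
  [AddCommGroup Z] [Module ℝ Z] [PartialOrder Z] (S : PluripotentialSetup n X Z)

/-- A symmetric version of the Dirichlet functional:
`V_ω⁻¹ ∫ d(φ - ψ) ∧ dᶜ(φ - ψ) ∧ (ω + ddᶜχ)ⁿ⁻¹`, where `χ` is the midpoint of `φ` and `ψ`. -/
def quasiDist (ω : Z) (φ ψ : S.D) : ℝ :=
  (S.vol ω)⁻¹ * S.dirForm (Multiset.replicate (n - 1) (ω + S.ddc ((1 / 2 : ℝ) • (φ + ψ))))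
    (φ - ψ) (φ - ψ)

theorem quasiDist_comm (ω : Z) (φ ψ : S.D) : S.quasiDist ω φ ψ = S.quasiDist ω ψ φ := by
  have h := S.dirForm_smul_smul (Multiset.replicate (n - 1) (ω + S.ddc ((1 / 2 : ℝ) • (φ + ψ))))
    (-1) (φ - ψ)
  rw [show (-1 : ℝ) • (φ - ψ) = ψ - φ by module] at h
  rw [quasiDist, quasiDist, add_comm ψ φ, h]
  ring

theorem prod_replicate_add_ddc_one (ω : Z) (φ : S.D) (k : ℕ) : ∀ s : Multiset Z,
    S.prod (Multiset.replicate k (ω + S.ddc φ) + s) 1 =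
      S.prod (Multiset.replicate k ω + s) 1 := by
  induction k with
  | zero => intro s; simp
  | succ k ih =>
    intro s
    rw [Multiset.replicate_succ, Multiset.cons_add, prod_add_ddc_one, ← Multiset.add_cons, ih,
      Multiset.add_cons, Multiset.replicate_succ, Multiset.cons_add]

theorem MA_one {ω : Z} (hV : 0 < S.vol ω) (φ : S.D) : S.MA ω φ 1 = 1 := by
  have := S.prod_replicate_add_ddc_one ω φ n 0
  simp only [add_zero] at this
  rw [MA_apply, this, ← vol_eq, inv_mul_cancel₀ hV.ne']

theorem MA_isProbability {ω : Z} (hV : 0 < S.vol ω) {φ : S.D} (hφ : φ ∈ S.psh ω) :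
    (S.MA ω φ).IsProbability := by
  refine ⟨fun f hf => ?_, S.MA_one hV φ⟩
  rw [MA_apply]
  exact mul_nonneg (inv_nonneg.mpr hV.le)
    (S.prod_nonneg (IsPosMultilinear.nonneg_replicate n hφ) f hf)

theorem MA_zero (ω : Z) : S.MA ω 0 = S.baseMeasure ω := by
  simp [MA, baseMeasure]

theorem MAEnergy_zero (ω : Z) : S.MAEnergy ω 0 = 0 := by
  simp [MAEnergy_eq, preEnergy]

theorem twist_zero (ω θ : Z) : S.twist ω θ 0 = 0 := by
  simp [twist, preEnergy, MAEnergy_zero]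

theorem zero_mem_psh {ω : Z} (hω : 0 ≤ ω) : (0 : S.D) ∈ S.psh ω := by
  simpa [psh] using hω

/-- The Taylor remainder of the energy on a segment is the Dirichlet functional. -/
theorem dirichlet_eq (ω : Z) (φ ψ : S.D) :
    S.dirichlet ω φ ψ = S.MAEnergy ω (ψ + (1 : ℝ) • (φ - ψ)) -
      S.MAEnergy ω (ψ + (0 : ℝ) • (φ - ψ)) -
        S.MA ω (ψ + (1 : ℝ) • (φ - ψ)) ((φ - ψ : S.D) : C(X, ℝ)) := by
  rw [one_smul, zero_smul, add_zero, add_sub_cancel, dirichlet, Submodule.coe_sub, map_sub,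
    map_sub]
  ring

theorem dirichlet_self (ω : Z) (φ : S.D) : S.dirichlet ω φ φ = 0 := by
  simp [dirichlet]

theorem dirichlet_zero_left (ω : Z) (φ : S.D) :
    S.dirichlet ω 0 φ = S.MA ω 0 (φ : C(X, ℝ)) - S.MAEnergy ω φ := by
  simp [dirichlet, MAEnergy_zero]
  ring

theorem form_line (ω : Z) (φ ψ : S.D) (t : ℝ) :
    ω + S.ddc (ψ + t • (φ - ψ)) = (1 - t) • (ω + S.ddc ψ) + t • (ω + S.ddc φ) := by
  simp only [map_add, map_smul, map_sub]
  module

theorem form_mid (ω : Z) (φ ψ : S.D) :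
    ω + S.ddc ((1 / 2 : ℝ) • (φ + ψ)) = (1 / 2 : ℝ) • (ω + S.ddc ψ) +
      (1 / 2 : ℝ) • (ω + S.ddc φ) := by
  simp only [map_add, map_smul]
  module

variable [IsOrderedAddMonoid Z] [PosSMulMono ℝ Z]

variable {S} in
theorem line_mem_psh {ω : Z} {φ ψ : S.D} (hφ : φ ∈ S.psh ω) (hψ : ψ ∈ S.psh ω) {t : ℝ}
    (h0 : 0 ≤ t) (h1 : t ≤ 1) : ψ + t • (φ - ψ) ∈ S.psh ω := by
  rw [psh, Set.mem_ofPred_eq, form_line]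
  exact add_nonneg (smul_nonneg (by linarith) hψ) (smul_nonneg h0 hφ)

variable {S} in
theorem mid_mem_psh {ω : Z} {φ ψ : S.D} (hφ : φ ∈ S.psh ω) (hψ : ψ ∈ S.psh ω) :
    (1 / 2 : ℝ) • (φ + ψ) ∈ S.psh ω := by
  rw [psh, Set.mem_ofPred_eq, form_mid]
  exact add_nonneg (smul_nonneg (by norm_num) hψ) (smul_nonneg (by norm_num) hφ)

variable {S} in
theorem smul_mem_psh {ω : Z} (hω : 0 ≤ ω) {φ : S.D} (hφ : φ ∈ S.psh ω) {t : ℝ}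
    (h0 : 0 ≤ t) (h1 : t ≤ 1) : t • φ ∈ S.psh ω := by
  have := line_mem_psh hφ (S.zero_mem_psh hω) h0 h1
  simpa using this

/-- The form at any point of a segment is at most twice the form at the midpoint. -/
theorem form_line_le {ω : Z} {φ ψ : S.D} (hφ : φ ∈ S.psh ω) (hψ : ψ ∈ S.psh ω) {t : ℝ}
    (h0 : 0 ≤ t) (h1 : t ≤ 1) :
    ω + S.ddc (ψ + t • (φ - ψ)) ≤ (2 : ℝ) • (ω + S.ddc ((1 / 2 : ℝ) • (φ + ψ))) := by
  rw [form_line, form_mid, ← sub_nonneg]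
  have e : (2 : ℝ) • ((1 / 2 : ℝ) • (ω + S.ddc ψ) + (1 / 2 : ℝ) • (ω + S.ddc φ)) -
      ((1 - t) • (ω + S.ddc ψ) + t • (ω + S.ddc φ)) =
      t • (ω + S.ddc ψ) + (1 - t) • (ω + S.ddc φ) := by module
  rw [e]
  exact add_nonneg (smul_nonneg h0 hψ) (smul_nonneg (by linarith) hφ)

/-- In the middle half of a segment, the forms are bounded below by half the form at the
midpoint. -/
theorem form_mid_le {ω : Z} {φ ψ : S.D} (hφ : φ ∈ S.psh ω) (hψ : ψ ∈ S.psh ω) {t : ℝ}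
    (h0 : 1 / 4 ≤ t) (h1 : t ≤ 3 / 4) :
    ω + S.ddc ((1 / 2 : ℝ) • (φ + ψ)) ≤ (2 : ℝ) • (ω + S.ddc (ψ + t • (φ - ψ))) := by
  rw [form_line, form_mid, ← sub_nonneg]
  have e : (2 : ℝ) • ((1 - t) • (ω + S.ddc ψ) + t • (ω + S.ddc φ)) -
      ((1 / 2 : ℝ) • (ω + S.ddc ψ) + (1 / 2 : ℝ) • (ω + S.ddc φ)) =
      (3 / 2 - 2 * t) • (ω + S.ddc ψ) + (2 * t - 1 / 2) • (ω + S.ddc φ) := by module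
  rw [e]
  exact add_nonneg (smul_nonneg (by linarith) hψ) (smul_nonneg (by linarith) hφ)

variable {S} in
theorem left_le_mid {ω : Z} {φ ψ : S.D} (hφ : φ ∈ S.psh ω) (hψ : ψ ∈ S.psh ω) :
    ω + S.ddc φ ≤ (2 : ℝ) • (ω + S.ddc ((1 / 2 : ℝ) • (φ + ψ))) := by
  have := S.form_line_le hφ hψ zero_le_one le_rfl
  rwa [one_smul, add_sub_cancel] at this

variable {S} in
theorem right_le_mid {ω : Z} {φ ψ : S.D} (hφ : φ ∈ S.psh ω) (hψ : ψ ∈ S.psh ω) :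
    ω + S.ddc ψ ≤ (2 : ℝ) • (ω + S.ddc ((1 / 2 : ℝ) • (φ + ψ))) := by
  have := S.form_line_le hφ hψ le_rfl zero_le_one
  rwa [zero_smul, add_zero] at this

theorem dirForm_line_le {ω : Z} {φ ψ : S.D} (hφ : φ ∈ S.psh ω) (hψ : ψ ∈ S.psh ω) {t : ℝ}
    (h0 : 0 ≤ t) (h1 : t ≤ 1) (w : S.D) (k : ℕ) :
    S.dirForm (Multiset.replicate k (ω + S.ddc (ψ + t • (φ - ψ)))) w w ≤
      2 ^ k * S.dirForm (Multiset.replicate k (ω + S.ddc ((1 / 2 : ℝ) • (φ + ψ)))) w w :=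
  (S.isPosMultilinear_dirForm w).replicate_le (line_mem_psh hφ hψ h0 h1) (mid_mem_psh hφ hψ)
    zero_le_two (S.form_line_le hφ hψ h0 h1) k

theorem quasiDist_nonneg {ω : Z} (hV : 0 < S.vol ω) {φ ψ : S.D} (hφ : φ ∈ S.psh ω)
    (hψ : ψ ∈ S.psh ω) : 0 ≤ S.quasiDist ω φ ψ :=
  mul_nonneg (inv_nonneg.mpr hV.le)
    (S.dirForm_nonneg (IsPosMultilinear.nonneg_replicate _ (mid_mem_psh hφ hψ)) _)

/-- The Dirichlet functional is comparable to its symmetric version. -/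
theorem dirichlet_bounds {ω : Z} (hV : 0 < S.vol ω) {φ ψ : S.D} (hφ : φ ∈ S.psh ω)
    (hψ : ψ ∈ S.psh ω) :
    0 ≤ S.dirichlet ω φ ψ ∧ S.dirichlet ω φ ψ ≤ dimConst n * S.quasiDist ω φ ψ ∧
      S.quasiDist ω φ ψ ≤ dimConst n * S.dirichlet ω φ ψ := by
  have hn := S.one_le_dim
  obtain ⟨m, rfl⟩ : ∃ m, n = m + 1 := ⟨n - 1, by omega⟩
  obtain ⟨hub, hlb, hpos⟩ := taylor_remainder_bounds
    (f := fun t : ℝ => S.MAEnergy ω (ψ + t • (φ - ψ)))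
    (f' := fun t : ℝ => S.MA ω (ψ + t • (φ - ψ)) ((φ - ψ : S.D) : C(X, ℝ)))
    (h := fun t : ℝ => (S.vol ω)⁻¹ * (m + 1 : ℕ) * S.dirForm
      (Multiset.replicate (m + 1 - 1) (ω + S.ddc (ψ + t • (φ - ψ)))) (φ - ψ) (φ - ψ))
    (fun t => S.hasDerivAt_MAEnergy_line ω ψ (φ - ψ) t hV.ne')
    (fun t => S.hasDerivAt_MA_line ω ψ (φ - ψ) (φ - ψ) t)
    (fun t ht => mul_nonneg (by positivity) (S.dirForm_nonneg
      (IsPosMultilinear.nonneg_replicate _ (line_mem_psh hφ hψ ht.1 ht.2)) _))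
  simp only [← dirichlet_eq] at hub hlb hpos
  have hN := S.quasiDist_nonneg hV hφ hψ
  have hV' := inv_pos.mpr hV
  have hpow : ((m + 1 : ℕ) : ℝ) ≤ 2 ^ (m + 1) := by
    exact_mod_cast Nat.lt_two_pow_self.le
  have h4 : dimConst (m + 1) = 2 ^ (m + 2) * 2 ^ (m + 2) := by
    rw [dimConst, ← mul_pow]; norm_num
  have h2 : (2 : ℝ) ^ m ≤ 2 ^ (m + 2) := pow_le_pow_right₀ (by norm_num) (by omega)
  have h2' : (2 : ℝ) ^ (m + 1) ≤ 2 ^ (m + 2) := pow_le_pow_right₀ (by norm_num) (by omega)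
  refine ⟨hpos, ?_, ?_⟩
  · refine (hub ((m + 1 : ℕ) * 2 ^ m * S.quasiDist ω φ ψ) fun t ht => ?_).trans ?_
    · have := S.dirForm_line_le hφ hψ ht.1 ht.2 (φ - ψ) m
      calc _ ≤ (S.vol ω)⁻¹ * (m + 1 : ℕ) * (2 ^ m * S.dirForm
            (Multiset.replicate m (ω + S.ddc ((1 / 2 : ℝ) • (φ + ψ)))) (φ - ψ) (φ - ψ)) :=
            mul_le_mul_of_nonneg_left this (by positivity)
        _ = _ := by rw [quasiDist, Nat.add_sub_cancel]; ring
    · rw [h4]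
      refine mul_le_mul_of_nonneg_right ?_ hN
      exact mul_le_mul (hpow.trans h2') h2 (by positivity) (by positivity)
  · have key := hlb ((m + 1 : ℕ) * (2 ^ m)⁻¹ * S.quasiDist ω φ ψ) fun t ht => ?_
    · have h1 : (1 : ℝ) ≤ ((m + 1 : ℕ) : ℝ) := by exact_mod_cast Nat.le_add_left 1 m
      have hc : (2 ^ m : ℝ) * (2 ^ m)⁻¹ = 1 := mul_inv_cancel₀ (by positivity)
      have e8 : (2 : ℝ) ^ (m + 3) = 8 * 2 ^ m := by ring
      have h3 : S.quasiDist ω φ ψ ≤ 2 ^ (m + 3) * S.dirichlet ω φ ψ := by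
        have hk : (2 ^ m)⁻¹ * S.quasiDist ω φ ψ ≤ (m + 1 : ℕ) * (2 ^ m)⁻¹ * S.quasiDist ω φ ψ := by
          rw [mul_assoc]
          exact le_mul_of_one_le_left (by positivity) h1
        calc S.quasiDist ω φ ψ = 2 ^ m * ((2 ^ m)⁻¹ * S.quasiDist ω φ ψ) := by
              rw [← mul_assoc, hc, one_mul]
          _ ≤ 2 ^ m * (8 * S.dirichlet ω φ ψ) := by
              refine mul_le_mul_of_nonneg_left ?_ (by positivity)
              linarith
          _ = _ := by rw [e8]; ring
      refine h3.trans (mul_le_mul_of_nonneg_right ?_ hpos)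
      rw [dimConst, show (4 : ℝ) = 2 ^ 2 by norm_num, ← pow_mul]
      exact pow_le_pow_right₀ (by norm_num) (by omega)
    · have := (S.isPosMultilinear_dirForm (φ - ψ)).replicate_le (mid_mem_psh hφ hψ)
        (line_mem_psh hφ hψ (t := t) (by linarith [ht.1]) (by linarith [ht.2])) zero_le_two
        (S.form_mid_le hφ hψ ht.1 ht.2) m
      rw [quasiDist, Nat.add_sub_cancel]
      calc _ = (S.vol ω)⁻¹ * (m + 1 : ℕ) * ((2 ^ m)⁻¹ * S.dirForm
            (Multiset.replicate m (ω + S.ddc ((1 / 2 : ℝ) • (φ + ψ)))) (φ - ψ) (φ - ψ)) := by ring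
        _ ≤ _ := by
            refine mul_le_mul_of_nonneg_left ?_ (by positivity)
            rw [inv_mul_le_iff₀ (by positivity)]
            exact this

theorem dirichlet_nonneg {ω : Z} (hV : 0 < S.vol ω) {φ ψ : S.D} (hφ : φ ∈ S.psh ω)
    (hψ : ψ ∈ S.psh ω) : 0 ≤ S.dirichlet ω φ ψ := (S.dirichlet_bounds hV hφ hψ).1

theorem dirichlet_le {ω : Z} (hV : 0 < S.vol ω) {φ ψ : S.D} (hφ : φ ∈ S.psh ω)
    (hψ : ψ ∈ S.psh ω) : S.dirichlet ω φ ψ ≤ dimConst n * S.quasiDist ω φ ψ :=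
  (S.dirichlet_bounds hV hφ hψ).2.1

theorem quasiDist_le {ω : Z} (hV : 0 < S.vol ω) {φ ψ : S.D} (hφ : φ ∈ S.psh ω)
    (hψ : ψ ∈ S.psh ω) : S.quasiDist ω φ ψ ≤ dimConst n * S.dirichlet ω φ ψ :=
  (S.dirichlet_bounds hV hφ hψ).2.2

/-- The tangent inequality expressing concavity of the energy. -/
theorem MAEnergy_le_tangent {ω : Z} (hV : 0 < S.vol ω) {φ ψ : S.D} (hφ : φ ∈ S.psh ω)
    (hψ : ψ ∈ S.psh ω) :
    S.MAEnergy ω ψ ≤ S.MAEnergy ω φ + S.MA ω φ (ψ : C(X, ℝ)) - S.MA ω φ (φ : C(X, ℝ)) := by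
  have := S.dirichlet_nonneg hV hφ hψ
  rw [dirichlet, map_sub] at this
  linarith

/-- Restricted to a segment ending at the origin, the symmetric Dirichlet functional of the
midpoint bounds that of the segment. -/
theorem quasiDist_le_mid {ω : Z} (hV : 0 < S.vol ω) {φ ψ : S.D} (hφ : φ ∈ S.psh ω)
    (hψ : ψ ∈ S.psh ω) :
    S.quasiDist ω φ ψ ≤ 2 ^ (n + 1) * S.quasiDist ω ((1 / 2 : ℝ) • (φ + ψ)) φ := by
  have hn := S.one_le_dim
  obtain ⟨m, rfl⟩ : ∃ m, n = m + 1 := ⟨n - 1, by omega⟩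
  have e1 : (1 / 2 : ℝ) • ((1 / 2 : ℝ) • (φ + ψ) + φ) = ψ + (3 / 4 : ℝ) • (φ - ψ) := by module
  have e2 : (1 / 2 : ℝ) • (φ + ψ) - φ = (-(1 / 2 : ℝ)) • (φ - ψ) := by module
  have h1 := (S.isPosMultilinear_dirForm (φ - ψ)).replicate_le (mid_mem_psh hφ hψ)
        (line_mem_psh hφ hψ (t := 3 / 4) (by norm_num) (by norm_num)) zero_le_two
        (S.form_mid_le hφ hψ (by norm_num) le_rfl) m
  rw [quasiDist, quasiDist, e1, e2, dirForm_smul_smul, Nat.add_sub_cancel]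
  have hV' := inv_pos.mpr hV
  calc _ ≤ _ := mul_le_mul_of_nonneg_left h1 hV'.le
    _ = _ := by ring

/-- Two near-maximizers of a functional `E_ω - μ` which is bounded above are close to each
other. -/
theorem quasiDist_le_of_gap {ω : Z} (hV : 0 < S.vol ω) {φ ψ : S.D} (hφ : φ ∈ S.psh ω)
    (hψ : ψ ∈ S.psh ω) {μ : RadonMeasure X} {a ε : ℝ}
    (ha : ∀ χ ∈ S.psh ω, S.MAEnergy ω χ - μ (χ : C(X, ℝ)) ≤ a)
    (h1 : a - S.MAEnergy ω φ + μ (φ : C(X, ℝ)) ≤ ε)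
    (h2 : a - S.MAEnergy ω ψ + μ (ψ : C(X, ℝ)) ≤ ε) :
    S.quasiDist ω φ ψ ≤ dimConst n ^ 2 * ε := by
  have hm := mid_mem_psh hφ hψ
  have h3 := ha _ hm
  set γ : S.D := (1 / 2 : ℝ) • (φ + ψ) with hγ
  have hc : ((γ : S.D) : C(X, ℝ)) = (1 / 2 : ℝ) • ((φ : C(X, ℝ)) + (ψ : C(X, ℝ))) := rfl
  have h4 := S.quasiDist_le hV hm hφ
  have h5 := S.dirichlet_nonneg hV hm hψ
  have h6 := S.quasiDist_le_mid hV hφ hψ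
  -- the linear terms cancel, since `γ` is the midpoint
  have h7 : S.dirichlet ω γ φ + S.dirichlet ω γ ψ ≤ 2 * ε := by
    rw [dirichlet, dirichlet]
    have e1 : μ (γ : C(X, ℝ)) = (1 / 2) * (μ (φ : C(X, ℝ)) + μ (ψ : C(X, ℝ))) := by
      rw [hc, map_smul, map_add, smul_eq_mul]
    have e2 : S.MA ω γ (γ : C(X, ℝ)) =
        (1 / 2) * (S.MA ω γ (φ : C(X, ℝ)) + S.MA ω γ (ψ : C(X, ℝ))) := by
      conv_lhs => rw [hc]
      rw [map_smul, map_add, smul_eq_mul]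
    rw [map_sub, map_sub]
    linarith
  have h8 : S.dirichlet ω γ φ ≤ 2 * ε := by linarith
  have hκ := dimConst_pos n
  have hε : 0 ≤ ε := by
    have := S.dirichlet_nonneg hV hm hφ
    linarith
  calc S.quasiDist ω φ ψ ≤ 2 ^ (n + 1) * (dimConst n * (2 * ε)) :=
        h6.trans (mul_le_mul_of_nonneg_left
          (h4.trans (mul_le_mul_of_nonneg_left h8 hκ.le)) (by positivity))
    _ = (2 ^ (n + 1) * 2) * (dimConst n * ε) := by ring
    _ ≤ dimConst n * (dimConst n * ε) := by
        refine mul_le_mul_of_nonneg_right ?_ (by positivity)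
        rw [dimConst, show (4 : ℝ) = 2 ^ 2 by norm_num, ← pow_mul, ← pow_succ]
        exact pow_le_pow_right₀ (by norm_num) (by omega)
    _ = _ := by ring

/-- The quasi-triangle inequality. -/
theorem quasiDist_triangle {ω : Z} (hV : 0 < S.vol ω) {φ ψ χ : S.D} (hφ : φ ∈ S.psh ω)
    (hψ : ψ ∈ S.psh ω) (hχ : χ ∈ S.psh ω) {M : ℝ} (h1 : S.quasiDist ω φ χ ≤ M)
    (h2 : S.quasiDist ω ψ χ ≤ M) : S.quasiDist ω φ ψ ≤ dimConst n ^ 3 * M := by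
  have hκ := dimConst_pos n
  rw [quasiDist_comm] at h1 h2
  have k1 := (S.dirichlet_le hV hχ hφ).trans (mul_le_mul_of_nonneg_left h1 hκ.le)
  have k2 := (S.dirichlet_le hV hχ hψ).trans (mul_le_mul_of_nonneg_left h2 hκ.le)
  rw [dirichlet, map_sub] at k1 k2
  have := S.quasiDist_le_of_gap hV hφ hψ (μ := S.MA ω χ)
    (a := S.MAEnergy ω χ - S.MA ω χ (χ : C(X, ℝ))) (ε := dimConst n * M)
    (fun η hη => by
      have := S.MAEnergy_le_tangent hV hχ hη
      linarith) (by linarith) (by linarith)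
  calc _ ≤ _ := this
    _ = _ := by ring

theorem quasiDist_le_zero_right {ω : Z} (hω : 0 ≤ ω) (hV : 0 < S.vol ω) {φ ψ : S.D}
    (hφ : φ ∈ S.psh ω) (hψ : ψ ∈ S.psh ω) {M : ℝ} (h1 : S.quasiDist ω φ 0 ≤ M)
    (h2 : S.quasiDist ω ψ 0 ≤ M) : S.quasiDist ω φ ψ ≤ dimConst n ^ 3 * M :=
  S.quasiDist_triangle hV hφ hψ (S.zero_mem_psh hω) h1 h2

/-- Convexity of the Dirichlet functional `J_ω(0, ·)` on segments. -/
theorem dirichlet_zero_line_le {ω : Z} (hV : 0 < S.vol ω) {φ ψ : S.D}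
    (hφ : φ ∈ S.psh ω) (hψ : ψ ∈ S.psh ω) {t : ℝ} (h0 : 0 ≤ t) (h1 : t ≤ 1) :
    S.dirichlet ω 0 (ψ + t • (φ - ψ)) ≤ (1 - t) * S.dirichlet ω 0 ψ + t * S.dirichlet ω 0 φ := by
  have hl := line_mem_psh hφ hψ h0 h1
  have k1 := S.MAEnergy_le_tangent hV hl hφ
  have k2 := S.MAEnergy_le_tangent hV hl hψ
  have e : ∀ μ : RadonMeasure X, μ ((ψ + t • (φ - ψ) : S.D) : C(X, ℝ)) =
      (1 - t) * μ (ψ : C(X, ℝ)) + t * μ (φ : C(X, ℝ)) := by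
    intro μ
    rw [Submodule.coe_add, Submodule.coe_smul, Submodule.coe_sub, map_add, map_smul, map_sub,
      smul_eq_mul]
    ring
  rw [dirichlet_zero_left, dirichlet_zero_left, dirichlet_zero_left, e (S.MA ω 0)]
  rw [e] at k1 k2
  nlinarith

theorem quasiDist_line_le {ω : Z} (hω : 0 ≤ ω) (hV : 0 < S.vol ω) {φ ψ : S.D}
    (hφ : φ ∈ S.psh ω) (hψ : ψ ∈ S.psh ω) {t : ℝ} (h0 : 0 ≤ t) (h1 : t ≤ 1) {M : ℝ}
    (hM1 : S.quasiDist ω φ 0 ≤ M) (hM2 : S.quasiDist ω ψ 0 ≤ M) :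
    S.quasiDist ω (ψ + t • (φ - ψ)) 0 ≤ dimConst n ^ 2 * M := by
  have hz := S.zero_mem_psh hω
  have hκ := dimConst_pos n
  have k := S.dirichlet_zero_line_le hV hφ hψ h0 h1
  rw [quasiDist_comm] at hM1 hM2 ⊢
  have k1 := (S.dirichlet_le hV hz hφ).trans (mul_le_mul_of_nonneg_left hM1 hκ.le)
  have k2 := (S.dirichlet_le hV hz hψ).trans (mul_le_mul_of_nonneg_left hM2 hκ.le)
  have k3 := S.quasiDist_le hV hz (line_mem_psh hφ hψ h0 h1)
  have k4 : S.dirichlet ω 0 (ψ + t • (φ - ψ)) ≤ dimConst n * M := by nlinarith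
  calc _ ≤ _ := k3.trans (mul_le_mul_of_nonneg_left k4 hκ.le)
    _ = _ := by ring

theorem quasiDist_mid_le {ω : Z} (hω : 0 ≤ ω) (hV : 0 < S.vol ω) {φ ψ : S.D}
    (hφ : φ ∈ S.psh ω) (hψ : ψ ∈ S.psh ω) {M : ℝ}
    (hM1 : S.quasiDist ω φ 0 ≤ M) (hM2 : S.quasiDist ω ψ 0 ≤ M) :
    S.quasiDist ω ((1 / 2 : ℝ) • (φ + ψ)) 0 ≤ dimConst n ^ 2 * M := by
  have := S.quasiDist_line_le hω hV hφ hψ (t := 1 / 2) (by norm_num) (by norm_num) hM1 hM2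
  rwa [show ψ + (1 / 2 : ℝ) • (φ - ψ) = (1 / 2 : ℝ) • (φ + ψ) by module] at this

end PluripotentialSetup

/-! ### Hölder estimates for the Monge–Ampère operator -/

namespace PluripotentialSetup

variable {n : ℕ} {X : Type u} [TopologicalSpace X] {Z : Type v}
  [AddCommGroup Z] [Module ℝ Z] [PartialOrder Z] (S : PluripotentialSetup n X Z)
  [IsOrderedAddMonoid Z] [PosSMulMono ℝ Z]

/-- One step of the exchange of forms: replacing one factor `ω + ddᶜγ`, where `γ` is the midpoint
of `φ` and `ψ`, by another factor `ω + ddᶜτ` in the Dirichlet form of `φ - ψ`. -/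
theorem dirForm_exchange {ω : Z} {φ ψ τ : S.D} (hφ : φ ∈ S.psh ω)
    (hψ : ψ ∈ S.psh ω) {s : Multiset Z} (hs : ∀ x ∈ s, 0 ≤ x) :
    S.dirForm ((ω + S.ddc τ) ::ₘ s) (φ - ψ) (φ - ψ) ≤
      S.dirForm ((ω + S.ddc ((1 / 2 : ℝ) • (φ + ψ))) ::ₘ s) (φ - ψ) (φ - ψ) +
      4 * √(S.dirForm ((ω + S.ddc ((1 / 2 : ℝ) • (φ + ψ))) ::ₘ s) (φ - ψ) (φ - ψ) *
        S.dirForm ((ω + S.ddc ((1 / 2 : ℝ) • (φ + ψ))) ::ₘ s)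
          (τ - (1 / 2 : ℝ) • (φ + ψ)) (τ - (1 / 2 : ℝ) • (φ + ψ))) := by
  set γ : S.D := (1 / 2 : ℝ) • (φ + ψ) with hγ
  set u : S.D := φ - ψ with hu
  set w : S.D := τ - γ with hw
  have hγp : 0 ≤ ω + S.ddc γ := mid_mem_psh hφ hψ
  set a := S.dirForm ((ω + S.ddc γ) ::ₘ s) u u with ha
  set b := S.dirForm ((ω + S.ddc γ) ::ₘ s) w w with hb
  have ha0 : 0 ≤ a := S.dirForm_nonneg (IsPosMultilinear.nonneg_cons hγp hs) u
  have hb0 : 0 ≤ b := S.dirForm_nonneg (IsPosMultilinear.nonneg_cons hγp hs) w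
  have bound : ∀ η : S.D, η ∈ S.psh ω → ω + S.ddc η ≤ (2 : ℝ) • (ω + S.ddc γ) →
      |S.dirForm ((ω + S.ddc η) ::ₘ s) u w| ≤ 2 * √(a * b) := by
    intro η hη hle
    have h1 := S.dirForm_sq_le (IsPosMultilinear.nonneg_cons hη hs) u w
    have h2 : ∀ v : S.D, S.dirForm ((ω + S.ddc η) ::ₘ s) v v ≤
        2 * S.dirForm ((ω + S.ddc γ) ::ₘ s) v v := by
      intro v
      have := (S.isPosMultilinear_dirForm v).cons_mono hle hs
      rwa [(S.isPosMultilinear_dirForm v).smul_cons] at this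
    have h3 : S.dirForm ((ω + S.ddc η) ::ₘ s) u w ^ 2 ≤ (2 * √(a * b)) ^ 2 := by
      rw [mul_pow, Real.sq_sqrt (mul_nonneg ha0 hb0)]
      refine h1.trans ((mul_le_mul (h2 u) (h2 w)
        (S.dirForm_nonneg (IsPosMultilinear.nonneg_cons hη hs) w) (by positivity)).trans
        (le_of_eq ?_))
      ring
    exact abs_le_of_sq_le_sq h3 (by positivity)
  have b1 := bound φ hφ (left_le_mid hφ hψ)
  have b2 := bound ψ hψ (right_le_mid hφ hψ)
  -- integrate by parts to move one `u` onto `ddᶜw`, and split `ddᶜu` into positive parts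
  have key : S.dirForm ((ω + S.ddc τ) ::ₘ s) u u = a +
      (S.dirForm ((ω + S.ddc φ) ::ₘ s) u w - S.dirForm ((ω + S.ddc ψ) ::ₘ s) u w) := by
    have e1 : ω + S.ddc τ = (ω + S.ddc γ) + S.ddc w := by rw [hw, map_sub]; abel
    have e2 : S.ddc u = (ω + S.ddc φ) - (ω + S.ddc ψ) := by rw [hu, map_sub]; abel
    rw [e1, (S.isPosMultilinear_dirForm u).add_cons]
    rw [ha]
    congr 1
    rw [S.dirForm_comm _ u w, S.dirForm_comm _ u w]
    simp only [dirForm]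
    rw [Multiset.cons_swap]
    conv_lhs => rw [e2]
    rw [Multiset.cons_swap (S.ddc w), Multiset.cons_swap (S.ddc w), Multiset.cons_swap (S.ddc w),
      prod_sub_cons, RadonMeasure.sub_apply]
    ring
  rw [key]
  have := abs_le.mp b1
  have := abs_le.mp b2
  linarith

theorem quasiDist_le_dirForm {ω : Z} (hV : 0 < S.vol ω) {τ γ : S.D} (hτ : τ ∈ S.psh ω)
    (hγ : γ ∈ S.psh ω) (i j : ℕ) (hij : i + j = n - 1) :
    (S.vol ω)⁻¹ * S.dirForm (Multiset.replicate i (ω + S.ddc τ) +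
      Multiset.replicate j (ω + S.ddc γ)) (τ - γ) (τ - γ) ≤
      2 ^ (n - 1) * S.quasiDist ω τ γ := by
  have := (S.isPosMultilinear_dirForm (τ - γ)).replicate_add_replicate_le hτ hγ
    (mid_mem_psh hτ hγ) zero_le_two (left_le_mid hτ hγ) (right_le_mid hτ hγ) i j
  rw [hij] at this
  rw [quasiDist]
  have hV' := inv_pos.mpr hV
  calc _ ≤ _ := mul_le_mul_of_nonneg_left this hV'.le
    _ = _ := by ring

/-- The Dirichlet form of `φ - ψ` with respect to an arbitrary `(ω + ddᶜτ)ⁿ⁻¹` is controlled by a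
power of the symmetric Dirichlet functional. The `n - 1` exchanges of a factor cost one square
root each, whence the exponent. -/
theorem dirForm_exchange_all {ω : Z} (hV : 0 < S.vol ω) {φ ψ τ : S.D} (hφ : φ ∈ S.psh ω)
    (hψ : ψ ∈ S.psh ω) (hτ : τ ∈ S.psh ω) {L : ℝ} (hL : S.quasiDist ω φ ψ ≤ L)
    (hL' : S.quasiDist ω τ ((1 / 2 : ℝ) • (φ + ψ)) ≤ L) :
    (S.vol ω)⁻¹ * S.dirForm (Multiset.replicate (n - 1) (ω + S.ddc τ)) (φ - ψ) (φ - ψ) ≤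
      8 ^ n * L ∧
    ((S.vol ω)⁻¹ * S.dirForm (Multiset.replicate (n - 1) (ω + S.ddc τ)) (φ - ψ) (φ - ψ)) ^
        2 ^ (n - 1) ≤ S.quasiDist ω φ ψ * (8 ^ (n + 2) * L) ^ (2 ^ (n - 1) - 1) := by
  set γ : S.D := (1 / 2 : ℝ) • (φ + ψ) with hγ
  have hγp : γ ∈ S.psh ω := mid_mem_psh hφ hψ
  set u : S.D := φ - ψ with hu
  set b : ℕ → ℝ := fun p => (S.vol ω)⁻¹ * S.dirForm (Multiset.replicate p (ω + S.ddc τ) +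
    Multiset.replicate (n - 1 - p) (ω + S.ddc γ)) u u with hb
  have hV' := inv_pos.mpr hV
  have hN := S.quasiDist_nonneg hV hφ hψ
  have hL0 : 0 ≤ L := hN.trans hL
  have hb0 : b 0 = S.quasiDist ω φ ψ := by simp [hb, quasiDist, hu, hγ]
  have hbn : ∀ p, 0 ≤ b p := fun p => mul_nonneg hV'.le (S.dirForm_nonneg
    (IsPosMultilinear.nonneg_add (IsPosMultilinear.nonneg_replicate _ hτ)
      (IsPosMultilinear.nonneg_replicate _ hγp)) u)
  -- `b p` has `p` factors `ω + ddᶜτ`, the remaining ones being `ω + ddᶜγ`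
  have step : ∀ p, p < n - 1 → b (p + 1) ≤ b p + 4 * √(b p * (2 ^ (n - 1) * L)) := by
    intro p hp
    obtain ⟨k, hk⟩ : ∃ k, n - 1 - p = k + 1 := ⟨n - 1 - p - 1, by omega⟩
    have hk' : n - 1 - (p + 1) = k := by omega
    set s := Multiset.replicate p (ω + S.ddc τ) + Multiset.replicate k (ω + S.ddc γ) with hs
    have hsn : ∀ x ∈ s, 0 ≤ x := IsPosMultilinear.nonneg_add
      (IsPosMultilinear.nonneg_replicate _ hτ) (IsPosMultilinear.nonneg_replicate _ hγp)
    have e1 : b (p + 1) = (S.vol ω)⁻¹ * S.dirForm ((ω + S.ddc τ) ::ₘ s) u u := by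
      simp only [hb, hk', hs, Multiset.replicate_succ, Multiset.cons_add]
    have e2 : b p = (S.vol ω)⁻¹ * S.dirForm ((ω + S.ddc γ) ::ₘ s) u u := by
      simp only [hb, hk, hs, Multiset.replicate_succ, Multiset.add_cons]
    have h1 := S.dirForm_exchange (τ := τ) hφ hψ hsn
    rw [← hγ, ← hu] at h1
    have h2 := S.quasiDist_le_dirForm hV hτ hγp p (k + 1) (by omega)
    rw [Multiset.replicate_succ, Multiset.add_cons, ← hs] at h2
    set A := S.dirForm ((ω + S.ddc γ) ::ₘ s) u u with hA
    set B := S.dirForm ((ω + S.ddc γ) ::ₘ s) (τ - γ) (τ - γ) with hB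
    have hA0 : 0 ≤ A := S.dirForm_nonneg (IsPosMultilinear.nonneg_cons hγp hsn) u
    rw [e1, e2]
    calc (S.vol ω)⁻¹ * S.dirForm ((ω + S.ddc τ) ::ₘ s) u u
        ≤ (S.vol ω)⁻¹ * (A + 4 * √(A * B)) := mul_le_mul_of_nonneg_left h1 hV'.le
      _ = (S.vol ω)⁻¹ * A + 4 * √(((S.vol ω)⁻¹ * A) * ((S.vol ω)⁻¹ * B)) := by
          rw [show ((S.vol ω)⁻¹ * A) * ((S.vol ω)⁻¹ * B) = (S.vol ω)⁻¹ ^ 2 * (A * B) by ring,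
            Real.sqrt_mul (show (0 : ℝ) ≤ (S.vol ω)⁻¹ ^ 2 by positivity), Real.sqrt_sq hV'.le]
          ring
      _ ≤ _ := by
          have h3 : (S.vol ω)⁻¹ * B ≤ 2 ^ (n - 1) * L :=
            h2.trans (mul_le_mul_of_nonneg_left hL' (by positivity))
          have h4 := Real.sqrt_le_sqrt (mul_le_mul_of_nonneg_left h3 (mul_nonneg hV'.le hA0))
          linarith
  have h2n : (2 : ℝ) ^ (n - 1) ≤ 2 ^ n := pow_le_pow_right₀ (by norm_num) (by omega)
  have crude : ∀ p, p ≤ n - 1 → b p ≤ 4 ^ p * (2 ^ n * L) := by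
    intro p
    induction p with
    | zero =>
      intro _
      rw [hb0, pow_zero, one_mul]
      exact hL.trans (le_mul_of_one_le_left hL0 (one_le_pow₀ (by norm_num)))
    | succ p ih =>
      intro hp
      have h1 := step p (by omega)
      have h2 := ih (by omega)
      have h3 : √(b p * (2 ^ (n - 1) * L)) ≤ (b p + 2 ^ (n - 1) * L) / 2 := by
        rw [Real.sqrt_le_left (by have := hbn p; positivity)]
        nlinarith [sq_nonneg (b p - 2 ^ (n - 1) * L)]
      have h4 : (2 : ℝ) * (2 ^ (n - 1) * L) = 2 ^ n * L := by
        have : (2 : ℝ) ^ n = 2 * 2 ^ (n - 1) := by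
          rw [← pow_succ']; congr 1; have := S.one_le_dim; omega
        rw [this]; ring
      have h5 : (2 : ℝ) ^ n * L ≤ 4 ^ p * (2 ^ n * L) :=
        le_mul_of_one_le_left (by positivity) (one_le_pow₀ (by norm_num))
      rw [pow_succ]
      linarith
  have crude' : ∀ p, p ≤ n - 1 → b p ≤ 8 ^ n * L := by
    intro p hp
    refine (crude p hp).trans ?_
    have h1 : (4 : ℝ) ^ p ≤ 4 ^ n := pow_le_pow_right₀ (by norm_num) (by omega)
    have h2 : (8 : ℝ) ^ n = 4 ^ n * 2 ^ n := by rw [← mul_pow]; norm_num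
    rw [h2, mul_assoc]
    exact mul_le_mul_of_nonneg_right h1 (by positivity)
  -- inserting the linear bound in the steps yields a bound by a square root
  have sq : ∀ p, p < n - 1 → b (p + 1) ^ 2 ≤ (8 ^ (n + 2) * L) * b p := by
    intro p hp
    have h1 := step p hp
    have h2 := crude' p hp.le
    have h0 := hbn p
    have hs := Real.sq_sqrt (mul_nonneg h0 (by positivity : (0 : ℝ) ≤ 2 ^ (n - 1) * L))
    set r := √(b p * (2 ^ (n - 1) * L))
    have h3 : b (p + 1) ^ 2 ≤ (b p + 4 * r) ^ 2 := pow_le_pow_left₀ (hbn _) h1 2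
    have h4 : (b p + 4 * r) ^ 2 ≤ 2 * (b p * b p) + 32 * (b p * (2 ^ (n - 1) * L)) := by
      rw [← hs]; nlinarith [sq_nonneg (b p - 4 * r)]
    have h5 : b p * b p ≤ b p * (8 ^ n * L) := mul_le_mul_of_nonneg_left h2 h0
    have h6 : (2 : ℝ) ^ (n - 1) ≤ 8 ^ n :=
      h2n.trans (pow_le_pow_left₀ (by norm_num) (by norm_num) n)
    have h7 : b p * (2 ^ (n - 1) * L) ≤ b p * (8 ^ n * L) :=
      mul_le_mul_of_nonneg_left (mul_le_mul_of_nonneg_right h6 hL0) h0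
    have h8 : (8 ^ (n + 2) * L) * b p = 64 * (b p * (8 ^ n * L)) := by ring
    have h9 : 0 ≤ b p * (8 ^ n * L) := by positivity
    linarith
  have pow : ∀ p, p ≤ n - 1 → b p ^ 2 ^ p ≤ b 0 * (8 ^ (n + 2) * L) ^ (2 ^ p - 1) := by
    intro p
    induction p with
    | zero => intro _; simp
    | succ p ih =>
      intro hp
      have h1 := ih (by omega)
      have h2 : b (p + 1) ^ 2 ^ (p + 1) ≤ ((8 ^ (n + 2) * L) * b p) ^ 2 ^ p := by
        rw [pow_succ' 2 p, pow_mul]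
        exact pow_le_pow_left₀ (sq_nonneg _) (sq p (by omega)) (2 ^ p)
      have e : 2 ^ (p + 1) - 1 = 2 ^ p + (2 ^ p - 1) := by
        have : 1 ≤ 2 ^ p := Nat.one_le_two_pow
        rw [pow_succ]; omega
      rw [mul_pow _ (b p)] at h2
      rw [e, pow_add]
      calc _ ≤ _ := h2
        _ ≤ (8 ^ (n + 2) * L) ^ 2 ^ p * (b 0 * (8 ^ (n + 2) * L) ^ (2 ^ p - 1)) :=
            mul_le_mul_of_nonneg_left h1 (by positivity)
        _ = _ := by ring
  have e3 : b (n - 1) = (S.vol ω)⁻¹ *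
      S.dirForm (Multiset.replicate (n - 1) (ω + S.ddc τ)) u u := by
    simp [hb]
  rw [← e3, ← hb0]
  exact ⟨crude' _ le_rfl, pow _ le_rfl⟩

/-- The difference of two Monge--Ampère measures, integrated against a difference of test
functions. -/
theorem abs_MA_sub_sq_le {ω : Z} (hV : 0 < S.vol ω) {χ χ' : S.D} (hχ : χ ∈ S.psh ω)
    (hχ' : χ' ∈ S.psh ω) (u : S.D) :
    (S.MA ω χ (u : C(X, ℝ)) - S.MA ω χ' (u : C(X, ℝ))) ^ 2 ≤
      16 ^ n * ((S.vol ω)⁻¹ * S.dirForm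
        (Multiset.replicate (n - 1) (ω + S.ddc ((1 / 2 : ℝ) • (χ + χ')))) u u) *
        S.quasiDist ω χ χ' := by
  obtain ⟨t, ht, e⟩ := exists_hasDerivAt_eq_slope
    (fun t : ℝ => S.MA ω (χ' + t • (χ - χ')) (u : C(X, ℝ))) _ one_pos
    (fun t _ => (S.hasDerivAt_MA_line ω χ' (χ - χ') u t).continuousAt.continuousWithinAt)
    (fun t _ => S.hasDerivAt_MA_line ω χ' (χ - χ') u t)
  simp only [one_smul, zero_smul, add_zero, add_sub_cancel, sub_zero, div_one] at e
  rw [← e]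
  have hV' := inv_pos.mpr hV
  have hl := line_mem_psh hχ hχ' ht.1.le ht.2.le
  have h1 := S.dirForm_sq_le (IsPosMultilinear.nonneg_replicate (n - 1) hl) (χ - χ') u
  have h2 := S.dirForm_line_le hχ hχ' ht.1.le ht.2.le (χ - χ') (n - 1)
  have h3 := S.dirForm_line_le hχ hχ' ht.1.le ht.2.le u (n - 1)
  have h4 := S.dirForm_nonneg (IsPosMultilinear.nonneg_replicate (n - 1) hl) u
  have hm := IsPosMultilinear.nonneg_replicate (n - 1) (mid_mem_psh hχ hχ')
  have h5 := S.dirForm_nonneg hm (χ - χ')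
  have h6 := S.dirForm_nonneg hm u
  rw [quasiDist]
  set Q1 := S.dirForm (Multiset.replicate (n - 1) (ω + S.ddc ((1 / 2 : ℝ) • (χ + χ'))))
    (χ - χ') (χ - χ')
  set Q2 := S.dirForm (Multiset.replicate (n - 1) (ω + S.ddc ((1 / 2 : ℝ) • (χ + χ')))) u u
  have h7 := h1.trans (mul_le_mul h2 h3 h4 (by positivity))
  have hn : (n : ℝ) ≤ 2 ^ n := by exact_mod_cast Nat.lt_two_pow_self.le
  have h2n : (2 : ℝ) ^ (n - 1) ≤ 2 ^ n := pow_le_pow_right₀ (by norm_num) (by omega)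
  have h16 : (16 : ℝ) ^ n = (2 ^ n) ^ 2 * (2 ^ n * 2 ^ n) := by
    rw [← pow_mul, ← pow_add, ← pow_add, show (16 : ℝ) = 2 ^ 4 by norm_num, ← pow_mul]
    congr 1; ring
  have hnn : (n : ℝ) ^ 2 ≤ (2 ^ n) ^ 2 := pow_le_pow_left₀ (by positivity) hn 2
  rw [h16, neg_sq, mul_pow, mul_pow]
  have hQ : 0 ≤ Q1 * Q2 := mul_nonneg h5 h6
  calc _ ≤ (S.vol ω)⁻¹ ^ 2 * (2 ^ n) ^ 2 * (2 ^ (n - 1) * Q1 * (2 ^ (n - 1) * Q2)) :=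
        mul_le_mul (mul_le_mul_of_nonneg_left hnn (by positivity)) h7 (sq_nonneg _) (by positivity)
    _ = (S.vol ω)⁻¹ ^ 2 * (2 ^ n) ^ 2 * (Q1 * Q2) * (2 ^ (n - 1) * 2 ^ (n - 1)) := by ring
    _ ≤ (S.vol ω)⁻¹ ^ 2 * (2 ^ n) ^ 2 * (Q1 * Q2) * (2 ^ n * 2 ^ n) :=
        mul_le_mul_of_nonneg_left (mul_le_mul h2n h2n (by positivity) (by positivity))
          (by positivity)
    _ = _ := by ring

/-- The basic Hölder estimates for the Monge--Ampère operator: exponent `1/2` in the measures, and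
exponent `2⁻ⁿ` in the functions. -/
theorem MA_holder {ω : Z} (hω : 0 ≤ ω) (hV : 0 < S.vol ω) {φ ψ χ χ' : S.D} (hφ : φ ∈ S.psh ω)
    (hψ : ψ ∈ S.psh ω) (hχ : χ ∈ S.psh ω) (hχ' : χ' ∈ S.psh ω) {M : ℝ}
    (h1 : S.quasiDist ω φ 0 ≤ M) (h2 : S.quasiDist ω ψ 0 ≤ M)
    (h3 : S.quasiDist ω χ 0 ≤ M) (h4 : S.quasiDist ω χ' 0 ≤ M) :
    (S.MA ω χ ((φ - ψ : S.D) : C(X, ℝ)) - S.MA ω χ' ((φ - ψ : S.D) : C(X, ℝ))) ^ 2 ≤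
      dimConst n ^ 9 * M * S.quasiDist ω χ χ' ∧
    |S.MA ω χ ((φ - ψ : S.D) : C(X, ℝ)) - S.MA ω χ' ((φ - ψ : S.D) : C(X, ℝ))| ^ 2 ^ n ≤
      S.quasiDist ω φ ψ * (dimConst n ^ 8 * M) ^ (2 ^ n - 1) := by
  have hκ := one_le_dimConst n
  have hκ0 := dimConst_pos n
  have hz := S.zero_mem_psh hω
  have hM : 0 ≤ M := (S.quasiDist_nonneg hV hφ hz).trans h1
  have hm1 := mid_mem_psh hφ hψ
  have hm2 := mid_mem_psh hχ hχ'
  have k1 := S.quasiDist_mid_le hω hV hφ hψ h1 h2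
  have k2 := S.quasiDist_mid_le hω hV hχ hχ' h3 h4
  have k3 := S.quasiDist_le_zero_right hω hV hm2 hm1 k2 k1
  have k4 := S.quasiDist_le_zero_right hω hV hφ hψ h1 h2
  have k5 := S.quasiDist_le_zero_right hω hV hχ hχ' h3 h4
  have k4' : S.quasiDist ω φ ψ ≤ dimConst n ^ 3 * (dimConst n ^ 2 * M) := by
    refine k4.trans (mul_le_mul_of_nonneg_left ?_ (by positivity))
    exact le_mul_of_one_le_left hM (one_le_pow₀ hκ)
  obtain ⟨c1, c2⟩ := S.dirForm_exchange_all hV hφ hψ hm2 k4' k3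
  have c3 := S.abs_MA_sub_sq_le hV hχ hχ' (φ - ψ)
  have hb0 : 0 ≤ (S.vol ω)⁻¹ * S.dirForm (Multiset.replicate (n - 1)
      (ω + S.ddc ((1 / 2 : ℝ) • (χ + χ')))) (φ - ψ) (φ - ψ) :=
    mul_nonneg (inv_nonneg.mpr hV.le)
      (S.dirForm_nonneg (IsPosMultilinear.nonneg_replicate (n - 1) hm2) _)
  set b := (S.vol ω)⁻¹ * S.dirForm (Multiset.replicate (n - 1)
      (ω + S.ddc ((1 / 2 : ℝ) • (χ + χ')))) (φ - ψ) (φ - ψ)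
  set d := S.MA ω χ ((φ - ψ : S.D) : C(X, ℝ)) - S.MA ω χ' ((φ - ψ : S.D) : C(X, ℝ))
  have hN := S.quasiDist_nonneg hV hχ hχ'
  have hN' := S.quasiDist_nonneg hV hφ hψ
  set κ := dimConst n with hκdef
  have p1 : (16 : ℝ) ^ n ≤ κ ^ 2 := by
    rw [hκdef, dimConst, ← pow_mul, show (16 : ℝ) = 4 ^ 2 by norm_num, ← pow_mul]
    exact pow_le_pow_right₀ (by norm_num) (by omega)
  have p2 : (8 : ℝ) ^ (n + 2) ≤ κ ^ 3 := by
    rw [hκdef, dimConst, ← pow_mul, show (8 : ℝ) = 2 ^ 3 by norm_num, show (4 : ℝ) = 2 ^ 2 by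
      norm_num, ← pow_mul, ← pow_mul]
    exact pow_le_pow_right₀ (by norm_num) (by omega)
  have p3 : (8 : ℝ) ^ n ≤ κ ^ 2 := by
    rw [hκdef, dimConst, ← pow_mul, show (8 : ℝ) = 2 ^ 3 by norm_num, show (4 : ℝ) = 2 ^ 2 by
      norm_num, ← pow_mul, ← pow_mul]
    exact pow_le_pow_right₀ (by norm_num) (by omega)
  constructor
  · calc d ^ 2 ≤ 16 ^ n * b * S.quasiDist ω χ χ' := c3
      _ ≤ κ ^ 2 * (κ ^ 2 * (κ ^ 3 * (κ ^ 2 * M))) * S.quasiDist ω χ χ' := by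
          refine mul_le_mul_of_nonneg_right ?_ hN
          refine mul_le_mul p1 (c1.trans ?_) hb0 (by positivity)
          exact mul_le_mul_of_nonneg_right p3 (by positivity)
      _ = _ := by ring
  · have hn := S.one_le_dim
    have e : 2 ^ n = 2 * 2 ^ (n - 1) := by rw [← pow_succ']; congr 1; omega
    have e' : 2 ^ n - 1 = 2 ^ (n - 1) + (2 ^ (n - 1) - 1) := by
      have : 1 ≤ 2 ^ (n - 1) := Nat.one_le_two_pow
      omega
    have c4 : d ^ 2 ≤ (κ ^ 8 * M) * b := by
      calc d ^ 2 ≤ 16 ^ n * b * S.quasiDist ω χ χ' := c3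
        _ ≤ κ ^ 2 * b * (κ ^ 3 * M) :=
            mul_le_mul (mul_le_mul_of_nonneg_right p1 hb0) k5 hN (by positivity)
        _ = (κ ^ 5 * M) * b := by ring
        _ ≤ _ := by
            refine mul_le_mul_of_nonneg_right (mul_le_mul_of_nonneg_right ?_ hM) hb0
            exact pow_le_pow_right₀ hκ (by norm_num)
    have c5 : (8 : ℝ) ^ (n + 2) * (κ ^ 3 * (κ ^ 2 * M)) ≤ κ ^ 8 * M := by
      calc (8 : ℝ) ^ (n + 2) * (κ ^ 3 * (κ ^ 2 * M)) ≤ κ ^ 3 * (κ ^ 3 * (κ ^ 2 * M)) :=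
            mul_le_mul_of_nonneg_right p2 (by positivity)
        _ = _ := by ring
    calc |d| ^ 2 ^ n = (d ^ 2) ^ 2 ^ (n - 1) := by rw [e, pow_mul, sq_abs]
      _ ≤ ((κ ^ 8 * M) * b) ^ 2 ^ (n - 1) := pow_le_pow_left₀ (sq_nonneg _) c4 _
      _ = (κ ^ 8 * M) ^ 2 ^ (n - 1) * b ^ 2 ^ (n - 1) := mul_pow _ _ _
      _ ≤ (κ ^ 8 * M) ^ 2 ^ (n - 1) * (S.quasiDist ω φ ψ * (κ ^ 8 * M) ^ (2 ^ (n - 1) - 1)) := by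
          refine mul_le_mul_of_nonneg_left (c2.trans ?_) (by positivity)
          exact mul_le_mul_of_nonneg_left (pow_le_pow_left₀ (by positivity) c5 _) hN'
      _ = _ := by rw [e', pow_add]; ring

end PluripotentialSetup

/-! ### Measures of finite energy -/

namespace RadonMeasure

variable {X : Type u} [TopologicalSpace X]

theorem IsProbability.le_of_forall_le {μ : RadonMeasure X} (h : μ.IsProbability) {f : C(X, ℝ)}
    {c : ℝ} (hf : ∀ x, f x ≤ c) : μ f ≤ c := by
  have h1 : f ≤ c • (1 : C(X, ℝ)) := fun x => by simpa using hf x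
  have := h.1.mono h1
  rwa [map_smul, h.2, smul_eq_mul, mul_one] at this

variable [CompactSpace X]

theorem IsProbability.le_norm {μ : RadonMeasure X} (h : μ.IsProbability) (f : C(X, ℝ)) :
    μ f ≤ ‖f‖ :=
  h.le_of_forall_le fun x => (le_abs_self _).trans (f.norm_coe_le_norm x)

theorem IsProbability.abs_le_norm {μ : RadonMeasure X} (h : μ.IsProbability) (f : C(X, ℝ)) :
    |μ f| ≤ ‖f‖ := by
  refine abs_le.mpr ⟨?_, h.le_norm f⟩
  have := h.le_norm (-f)
  rw [map_neg, norm_neg] at this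
  linarith

end RadonMeasure

namespace PluripotentialSetup

variable {n : ℕ} {X : Type u} [TopologicalSpace X] {Z : Type v}
  [AddCommGroup Z] [Module ℝ Z] [PartialOrder Z] {S : PluripotentialSetup n X Z}

namespace FiniteEnergy

variable {ω : Z}

theorem isProbability (μ : S.FiniteEnergy ω) : μ.toMeasure.IsProbability := μ.2.1

theorem toMeasure_injective : Function.Injective (toMeasure : S.FiniteEnergy ω → _) :=
  Subtype.val_injective

theorem energy_ne_bot (hω : 0 ≤ ω) (μ : S.FiniteEnergy ω) : S.energy ω μ.toMeasure ≠ ⊥ := by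
  have h := le_iSup₂ (f := fun (φ : S.D) (_ : φ ∈ S.psh ω) =>
    ((S.MAEnergy ω φ - μ.toMeasure (φ : C(X, ℝ)) : ℝ) : EReal)) 0 (S.zero_mem_psh hω)
  intro hb
  rw [energy] at hb
  rw [hb] at h
  exact EReal.coe_ne_bot _ (le_bot_iff.mp h)

theorem coe_J (hω : 0 ≤ ω) (μ : S.FiniteEnergy ω) : (μ.J : EReal) = S.energy ω μ.toMeasure :=
  EReal.coe_toReal μ.2.2.ne (μ.energy_ne_bot hω)

theorem le_J (hω : 0 ≤ ω) (μ : S.FiniteEnergy ω) {φ : S.D} (hφ : φ ∈ S.psh ω) :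
    S.MAEnergy ω φ - μ.toMeasure (φ : C(X, ℝ)) ≤ μ.J := by
  have h := le_iSup₂ (f := fun (φ : S.D) (_ : φ ∈ S.psh ω) =>
    ((S.MAEnergy ω φ - μ.toMeasure (φ : C(X, ℝ)) : ℝ) : EReal)) φ hφ
  rw [← energy, ← μ.coe_J hω] at h
  exact_mod_cast h

theorem J_nonneg (hω : 0 ≤ ω) (μ : S.FiniteEnergy ω) : 0 ≤ μ.J := by
  have := μ.le_J hω (S.zero_mem_psh hω)
  simpa [MAEnergy_zero] using this

theorem J_le (hω : 0 ≤ ω) (μ : S.FiniteEnergy ω) {B : ℝ}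
    (h : ∀ φ ∈ S.psh ω, S.MAEnergy ω φ - μ.toMeasure (φ : C(X, ℝ)) ≤ B) : μ.J ≤ B := by
  have : S.energy ω μ.toMeasure ≤ (B : EReal) := iSup₂_le fun φ hφ => by exact_mod_cast h φ hφ
  rw [← μ.coe_J hω] at this
  exact_mod_cast this

/-- A probability measure at which `E_ω - μ` is bounded above has finite energy. -/
theorem exists_of_bound {μ : RadonMeasure X} (hμ : μ.IsProbability) {B : ℝ}
    (h : ∀ φ ∈ S.psh ω, S.MAEnergy ω φ - μ (φ : C(X, ℝ)) ≤ B) :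
    ∃ m : S.FiniteEnergy ω, m.toMeasure = μ :=
  ⟨⟨μ, hμ, (iSup₂_le fun φ hφ => by exact_mod_cast h φ hφ : S.energy ω μ ≤ (B : EReal)).trans_lt
    (EReal.coe_lt_top B)⟩, rfl⟩

/-- The gap in the supremum defining the energy of `μ`, at the candidate `φ`. It plays the role of
the Dirichlet functional `J_ω(μ, φ)`. -/
def gap (μ : S.FiniteEnergy ω) (φ : S.D) : ℝ :=
  μ.J - S.MAEnergy ω φ + μ.toMeasure (φ : C(X, ℝ))

theorem gap_nonneg (hω : 0 ≤ ω) (μ : S.FiniteEnergy ω) {φ : S.D} (hφ : φ ∈ S.psh ω) :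
    0 ≤ μ.gap φ := by
  have := μ.le_J hω hφ
  rw [gap]
  linarith

@[simp] theorem gap_zero (μ : S.FiniteEnergy ω) : μ.gap 0 = μ.J := by
  simp [gap, MAEnergy_zero]

theorem exists_gap_lt (hω : 0 ≤ ω) (μ : S.FiniteEnergy ω) {ε : ℝ} (hε : 0 < ε) :
    ∃ φ ∈ S.psh ω, μ.gap φ < ε := by
  by_contra! h
  have := μ.J_le hω (B := μ.J - ε) fun φ hφ => by
    have := h φ hφ
    rw [gap] at this
    linarith
  linarith

end FiniteEnergy

variable [IsOrderedAddMonoid Z] [PosSMulMono ℝ Z] {ω : Z}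

/-- The Monge--Ampère measure of a psh test function, as a measure of finite energy. -/
def maPoint (hV : 0 < S.vol ω) {φ : S.D} (hφ : φ ∈ S.psh ω) : S.FiniteEnergy ω :=
  ⟨S.MA ω φ, S.MA_isProbability hV hφ, by
    have h : S.energy ω (S.MA ω φ) ≤ ((S.MAEnergy ω φ - S.MA ω φ (φ : C(X, ℝ)) : ℝ) : EReal) :=
      iSup₂_le fun ψ hψ => by
        have := S.MAEnergy_le_tangent hV hφ hψ
        exact_mod_cast (by linarith :
          S.MAEnergy ω ψ - S.MA ω φ (ψ : C(X, ℝ)) ≤ S.MAEnergy ω φ - S.MA ω φ (φ : C(X, ℝ)))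
    exact h.trans_lt (EReal.coe_lt_top _)⟩

@[simp] theorem toMeasure_maPoint (hV : 0 < S.vol ω) {φ : S.D} (hφ : φ ∈ S.psh ω) :
    (maPoint hV hφ).toMeasure = S.MA ω φ := rfl

theorem J_maPoint (hω : 0 ≤ ω) (hV : 0 < S.vol ω) {φ : S.D} (hφ : φ ∈ S.psh ω) :
    (maPoint hV hφ).J = S.MAEnergy ω φ - S.MA ω φ (φ : C(X, ℝ)) := by
  refine le_antisymm ((maPoint hV hφ).J_le hω fun ψ hψ => ?_) ((maPoint hV hφ).le_J hω hφ)
  have := S.MAEnergy_le_tangent hV hφ hψ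
  rw [toMeasure_maPoint]
  linarith

theorem gap_maPoint (hω : 0 ≤ ω) (hV : 0 < S.vol ω) {φ : S.D} (hφ : φ ∈ S.psh ω) (ψ : S.D) :
    (maPoint hV hφ).gap ψ = S.dirichlet ω φ ψ := by
  rw [FiniteEnergy.gap, J_maPoint hω, dirichlet, map_sub, toMeasure_maPoint]
  ring

namespace FiniteEnergy

/-- Almost maximizers for the same measure are close to each other. -/
theorem quasiDist_le_gap (hω : 0 ≤ ω) (hV : 0 < S.vol ω) (μ : S.FiniteEnergy ω) {φ ψ : S.D}
    (hφ : φ ∈ S.psh ω) (hψ : ψ ∈ S.psh ω) :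
    S.quasiDist ω φ ψ ≤ dimConst n ^ 2 * (μ.gap φ + μ.gap ψ) := by
  have h1 := μ.gap_nonneg hω hφ
  have h2 := μ.gap_nonneg hω hψ
  refine S.quasiDist_le_of_gap hV hφ hψ (fun χ hχ => μ.le_J hω hχ) ?_ ?_ <;>
  · simp only [gap] at *
    linarith

theorem quasiDist_zero_le (hω : 0 ≤ ω) (hV : 0 < S.vol ω) (μ : S.FiniteEnergy ω) {φ : S.D}
    (hφ : φ ∈ S.psh ω) : S.quasiDist ω φ 0 ≤ dimConst n ^ 2 * (μ.gap φ + μ.J) := by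
  have := μ.quasiDist_le_gap hω hV hφ (S.zero_mem_psh hω)
  rwa [gap_zero] at this

variable [CompactSpace X]

/-- The orthogonality property produces near-maximizers `ψ` for `μ` with one-sided control of
`∫ f MA_ω(ψ)`: one takes a near-maximizer `φ`, and then `ψ` close to the envelope of `φ + t f`. -/
theorem exists_gap_le_MA_le (hω : 0 ≤ ω) (hV : 0 < S.vol ω) (ho : S.OrthogonalityProperty ω)
    (μ : S.FiniteEnergy ω) (f : S.D) {t : ℝ} (ht : 0 < t) (ht1 : t ≤ 1) :
    ∃ ψ ∈ S.psh ω, μ.gap ψ ≤ t * (2 * ‖(f : C(X, ℝ))‖ + 2) ∧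
      S.MA ω ψ (f : C(X, ℝ)) ≤ μ.toMeasure (f : C(X, ℝ)) + 2 * t := by
  obtain ⟨φ, hφ, hg⟩ := μ.exists_gap_lt hω (pow_pos ht 2)
  obtain ⟨φ₀, hφ₀, hlt, H⟩ := ho.2 (φ + t • f) (t ^ 2) (pow_pos ht 2)
  set r : ℝ := t * ‖(f : C(X, ℝ))‖ + t with hr
  have hfb : ∀ x, -‖(f : C(X, ℝ))‖ ≤ (f : C(X, ℝ)) x ∧ (f : C(X, ℝ)) x ≤ ‖(f : C(X, ℝ))‖ :=
    fun x => abs_le.mp ((f : C(X, ℝ)).norm_coe_le_norm x)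
  have hφ₁ : φ - S.constD r ∈ S.psh ω := by
    rw [psh, Set.mem_ofPred_eq, map_sub, ddc_constD, sub_zero]
    exact hφ
  obtain ⟨ψ, hψ, hψb⟩ := ho.1 φ₀ hφ₀ (φ - S.constD r) hφ₁ (φ + t • f) (fun x => by
    refine max_lt (hlt x) ?_
    simp only [Submodule.coe_sub, Submodule.coe_add, Submodule.coe_smul, coe_constD,
      ContinuousMap.sub_apply, ContinuousMap.add_apply, ContinuousMap.smul_apply,
      ContinuousMap.one_apply, smul_eq_mul]
    have := mul_le_mul_of_nonneg_left (hfb x).1 ht.le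
    linarith)
  have hMA := S.MA_isProbability hV hψ
  have h1 := H ψ hψ (fun x => (le_max_left _ _).trans (hψb x).1) fun x => (hψb x).2
  have h2 := S.MAEnergy_le_tangent hV hψ hφ
  have h3 := μ.le_J hω hψ
  -- `φ ≤ ψ + r` and `ψ ≤ φ + t f`
  have h4 : S.MA ω ψ ((φ : C(X, ℝ)) - (ψ : C(X, ℝ))) ≤ r := hMA.le_of_forall_le fun x => by
    have := (le_max_right _ _).trans (hψb x).1
    simp only [Submodule.coe_sub, coe_constD, ContinuousMap.sub_apply, ContinuousMap.smul_apply,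
      ContinuousMap.one_apply, smul_eq_mul] at this ⊢
    linarith
  have h5 : μ.toMeasure (ψ : C(X, ℝ)) ≤ μ.toMeasure ((φ + t • f : S.D) : C(X, ℝ)) :=
    μ.isProbability.1.mono fun x => (hψb x).2.le
  have h6 := μ.isProbability.le_norm (f : C(X, ℝ))
  rw [Submodule.coe_add, Submodule.coe_smul] at h1 h5
  simp only [map_sub, map_add, map_smul, smul_eq_mul] at h1 h4 h5
  have h7 := (abs_le.mp h1).2
  have h8 := mul_le_mul_of_nonneg_left h6 ht.le
  have ht2 : t ^ 2 ≤ t := by nlinarith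
  rw [gap] at hg
  refine ⟨ψ, hψ, ?_, ?_⟩
  · rw [gap]
    linarith
  · have : t * S.MA ω ψ (f : C(X, ℝ)) ≤ t * (μ.toMeasure (f : C(X, ℝ)) + 2 * t) := by
      linarith
    exact le_of_mul_le_mul_left this ht

/-- Density of Monge--Ampère measures: each measure of finite energy admits a maximizing sequence
whose Monge--Ampère measures converge to it, when tested against `φ - ψ`. -/
theorem exists_approx (hω : 0 ≤ ω) (hV : 0 < S.vol ω) (ho : S.OrthogonalityProperty ω)
    (μ : S.FiniteEnergy ω) {φ ψ : S.D} (hφ : φ ∈ S.psh ω) (hψ : ψ ∈ S.psh ω) :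
    ∃ χ : ℕ → S.D, (∀ k, χ k ∈ S.psh ω) ∧ Tendsto (fun k => μ.gap (χ k)) atTop (𝓝 0) ∧
      Tendsto (fun k => S.MA ω (χ k) ((φ - ψ : S.D) : C(X, ℝ))) atTop
        (𝓝 (μ.toMeasure ((φ - ψ : S.D) : C(X, ℝ)))) := by
  set κ := dimConst n with hκ
  have hκ1 := one_le_dimConst n
  have hκ0 := dimConst_pos n
  have hz := S.zero_mem_psh hω
  set c := 2 * ‖((φ - ψ : S.D) : C(X, ℝ))‖ + 2 with hc
  have hc0 : 0 ≤ c := by positivity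
  have hJ := μ.J_nonneg hω
  set M : ℝ → ℝ := fun t => S.quasiDist ω φ 0 + S.quasiDist ω ψ 0 + κ ^ 2 * (t * c + μ.J) with hM
  set e : ℝ → ℝ := fun t => 2 * t + √(κ ^ 9 * M t * (κ ^ 2 * (t * c + t * c))) with he
  have key : ∀ t, 0 < t → t ≤ 1 → ∃ χ ∈ S.psh ω, μ.gap χ ≤ t * c ∧
      |S.MA ω χ ((φ - ψ : S.D) : C(X, ℝ)) - μ.toMeasure ((φ - ψ : S.D) : C(X, ℝ))| ≤ e t := by
    intro t ht ht1
    obtain ⟨χ, hχ, g1, k1⟩ := μ.exists_gap_le_MA_le hω hV ho (φ - ψ) ht ht1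
    obtain ⟨χ', hχ', g2, k2⟩ := μ.exists_gap_le_MA_le hω hV ho (-(φ - ψ)) ht ht1
    rw [Submodule.coe_neg, map_neg, map_neg] at k2
    rw [Submodule.coe_neg, norm_neg] at g2
    refine ⟨χ, hχ, g1, ?_⟩
    have hN1 := S.quasiDist_nonneg hV hφ hz
    have hN2 := S.quasiDist_nonneg hV hψ hz
    have l3 : S.quasiDist ω χ 0 ≤ κ ^ 2 * (t * c + μ.J) :=
      (μ.quasiDist_zero_le hω hV hχ).trans (by gcongr)
    have l4 : S.quasiDist ω χ' 0 ≤ κ ^ 2 * (t * c + μ.J) :=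
      (μ.quasiDist_zero_le hω hV hχ').trans (by gcongr)
    have l5 : S.quasiDist ω χ χ' ≤ κ ^ 2 * (t * c + t * c) :=
      (μ.quasiDist_le_gap hω hV hχ hχ').trans (by gcongr)
    have l0 : 0 ≤ κ ^ 2 * (t * c + μ.J) := by positivity
    have hM0 : 0 ≤ M t := by simp only [hM]; linarith
    have h := (S.MA_holder hω hV hφ hψ hχ hχ' (M := M t) (by simp only [hM]; linarith)
      (by simp only [hM]; linarith) (by simp only [hM]; linarith)
      (by simp only [hM]; linarith)).1
    have h' := Real.abs_le_sqrt (h.trans (mul_le_mul_of_nonneg_left l5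
      (mul_nonneg (by positivity) hM0)))
    have h2 := (abs_le.mp h').2
    have h1 := (abs_le.mp h').1
    have h0 := Real.sqrt_nonneg (κ ^ 9 * M t * (κ ^ 2 * (t * c + t * c)))
    rw [abs_le]
    simp only [he]
    constructor <;> linarith
  choose! χ hχ h1 h2 using key
  have hlim : Tendsto (fun k : ℕ => (1 / ((k : ℝ) + 1))) atTop (𝓝 0) :=
    tendsto_one_div_add_atTop_nhds_zero_nat
  have hpos : ∀ k : ℕ, 0 < 1 / ((k : ℝ) + 1) := fun k => Nat.one_div_pos_of_nat
  have hle : ∀ k : ℕ, 1 / ((k : ℝ) + 1) ≤ 1 := fun k => by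
    rw [div_le_one (by positivity)]
    have : (0 : ℝ) ≤ k := Nat.cast_nonneg k
    linarith
  have hec : Continuous e := by simp only [he, hM]; fun_prop
  have he0 : e 0 = 0 := by simp [he]
  refine ⟨fun k => χ (1 / ((k : ℝ) + 1)), fun k => hχ _ (hpos k) (hle k), ?_, ?_⟩
  · refine squeeze_zero (fun k => μ.gap_nonneg hω (hχ _ (hpos k) (hle k)))
      (fun k => h1 _ (hpos k) (hle k)) ?_
    simpa using hlim.mul_const c
  · rw [tendsto_iff_norm_sub_tendsto_zero]
    refine squeeze_zero (fun k => norm_nonneg _) (fun k => h2 _ (hpos k) (hle k)) ?_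
    have := (hec.tendsto 0).comp hlim
    rwa [he0] at this

/-- The distance from a measure of finite energy to a Monge--Ampère measure is controlled by the
gap. -/
theorem sub_MA_sq_le (hω : 0 ≤ ω) (hV : 0 < S.vol ω) (ho : S.OrthogonalityProperty ω)
    (μ : S.FiniteEnergy ω) {φ ψ χ : S.D} (hφ : φ ∈ S.psh ω) (hψ : ψ ∈ S.psh ω) (hχ : χ ∈ S.psh ω)
    {M : ℝ} (h1 : S.quasiDist ω φ 0 ≤ M) (h2 : S.quasiDist ω ψ 0 ≤ M)
    (h3 : S.quasiDist ω χ 0 ≤ M) (h4 : μ.J ≤ M) :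
    (μ.toMeasure ((φ - ψ : S.D) : C(X, ℝ)) - S.MA ω χ ((φ - ψ : S.D) : C(X, ℝ))) ^ 2 ≤
      dimConst n ^ 13 * M * μ.gap χ := by
  obtain ⟨η, hη, l1, l2⟩ := μ.exists_approx hω hV ho hφ hψ
  set κ := dimConst n with hκ
  have hκ1 := one_le_dimConst n
  have hκ0 := dimConst_pos n
  have hM := (μ.J_nonneg hω).trans h4
  have r1 : Tendsto (fun k => (S.MA ω (η k) ((φ - ψ : S.D) : C(X, ℝ)) -
      S.MA ω χ ((φ - ψ : S.D) : C(X, ℝ))) ^ 2) atTop (𝓝 ((μ.toMeasure ((φ - ψ : S.D) : C(X, ℝ)) -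
      S.MA ω χ ((φ - ψ : S.D) : C(X, ℝ))) ^ 2)) := (l2.sub_const _).pow 2
  have r2 : Tendsto (fun k => κ ^ 9 * (κ ^ 2 * (μ.gap (η k) + M)) *
      (κ ^ 2 * (μ.gap (η k) + μ.gap χ))) atTop
      (𝓝 (κ ^ 9 * (κ ^ 2 * (0 + M)) * (κ ^ 2 * (0 + μ.gap χ)))) :=
    (((l1.add_const M).const_mul _).const_mul _).mul ((l1.add_const _).const_mul _)
  have h := le_of_tendsto_of_tendsto' r1 r2 fun k => by
    have g0 := μ.gap_nonneg hω (hη k)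
    have hle : M ≤ κ ^ 2 * (μ.gap (η k) + M) := by
      have : 1 ≤ κ ^ 2 := one_le_pow₀ hκ1
      nlinarith
    refine (S.MA_holder hω hV hφ hψ (hη k) hχ (h1.trans hle) (h2.trans hle)
      ((μ.quasiDist_zero_le hω hV (hη k)).trans (by gcongr)) (h3.trans hle)).1.trans ?_
    exact mul_le_mul_of_nonneg_left (μ.quasiDist_le_gap hω hV (hη k) hχ) (by positivity)
  refine h.trans (le_of_eq ?_)
  ring

/-- The Hölder estimate for a pair of measures of finite energy. -/
theorem abs_sub_pow_le (hω : 0 ≤ ω) (hV : 0 < S.vol ω) (ho : S.OrthogonalityProperty ω)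
    (μ ν : S.FiniteEnergy ω) {φ ψ : S.D} (hφ : φ ∈ S.psh ω) (hψ : ψ ∈ S.psh ω)
    {M : ℝ} (h1 : S.quasiDist ω φ 0 ≤ M) (h2 : S.quasiDist ω ψ 0 ≤ M)
    (h3 : μ.J ≤ M) (h4 : ν.J ≤ M) :
    |μ.toMeasure ((φ - ψ : S.D) : C(X, ℝ)) - ν.toMeasure ((φ - ψ : S.D) : C(X, ℝ))| ^ 2 ^ n ≤
      S.quasiDist ω φ ψ * (dimConst n ^ 10 * M) ^ (2 ^ n - 1) := by
  obtain ⟨η, hη, l1, l2⟩ := μ.exists_approx hω hV ho hφ hψ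
  obtain ⟨ξ, hξ, l3, l4⟩ := ν.exists_approx hω hV ho hφ hψ
  set κ := dimConst n with hκ
  have hκ1 := one_le_dimConst n
  have hκ0 := dimConst_pos n
  have hM := (μ.J_nonneg hω).trans h3
  have r1 := (l2.sub l4).abs.pow (2 ^ n)
  have r2 : Tendsto (fun k => S.quasiDist ω φ ψ *
      (κ ^ 8 * (κ ^ 2 * (μ.gap (η k) + ν.gap (ξ k) + M))) ^ (2 ^ n - 1)) atTop
      (𝓝 (S.quasiDist ω φ ψ * (κ ^ 8 * (κ ^ 2 * (0 + 0 + M))) ^ (2 ^ n - 1))) :=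
    (((((l1.add l3).add_const M).const_mul _).const_mul _).pow _).const_mul _
  have h := le_of_tendsto_of_tendsto' r1 r2 fun k => by
    have g0 := μ.gap_nonneg hω (hη k)
    have g1 := ν.gap_nonneg hω (hξ k)
    have hle : M ≤ κ ^ 2 * (μ.gap (η k) + ν.gap (ξ k) + M) := by
      have : 1 ≤ κ ^ 2 := one_le_pow₀ hκ1
      nlinarith
    refine (S.MA_holder hω hV hφ hψ (hη k) (hξ k) (h1.trans hle) (h2.trans hle)
      ((μ.quasiDist_zero_le hω hV (hη k)).trans ?_)
      ((ν.quasiDist_zero_le hω hV (hξ k)).trans ?_)).2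
    · refine mul_le_mul_of_nonneg_left ?_ (by positivity)
      linarith
    · refine mul_le_mul_of_nonneg_left ?_ (by positivity)
      linarith
  refine h.trans (le_of_eq ?_)
  congr 2
  ring

end FiniteEnergy

end PluripotentialSetup

/-! ### Polarizations -/

/-- An open set for the finest vector topology meets each affine line in an open set. -/
theorem exists_add_smul_mem_of_isOpen {V : Type v} [AddCommGroup V] [Module ℝ V] {U : Set V}
    (hU : IsOpen[finestVectorTopology V] U) {a : V} (ha : a ∈ U) (b : V) :
    ∃ ε > 0, a - (ε : ℝ) • b ∈ U := by
  let W : Submodule ℝ V := Submodule.span ℝ {a, b}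
  have hW : FiniteDimensional ℝ W := FiniteDimensional.span_of_finite ℝ (by simp)
  rw [finestVectorTopology, isOpen_iSup_iff] at hU
  have hU' := hU ⟨W, hW⟩
  rw [isOpen_coinduced] at hU'
  let : TopologicalSpace W := moduleTopology ℝ W
  have : IsModuleTopology ℝ W := ⟨rfl⟩
  have : ContinuousAdd W := IsModuleTopology.toContinuousAdd ℝ W
  have : ContinuousSMul ℝ W := IsModuleTopology.toContinuousSMul ℝ W
  let a' : W := ⟨a, Submodule.subset_span (by simp)⟩
  let b' : W := ⟨b, Submodule.subset_span (by simp)⟩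
  have hc : Continuous (fun t : ℝ => a' + (-t) • b') := by fun_prop
  have h0 : (fun t : ℝ => a' + (-t) • b') ⁻¹' (W.subtype ⁻¹' U) ∈ 𝓝 (0 : ℝ) := by
    refine (hU'.preimage hc).mem_nhds ?_
    simpa [a'] using ha
  obtain ⟨ε, hε, h⟩ := Metric.mem_nhds_iff.mp h0
  refine ⟨ε / 2, by positivity, ?_⟩
  have := @h (ε / 2) (by
    rw [Metric.mem_ball, dist_zero_right, Real.norm_eq_abs, abs_of_pos (by positivity)]
    linarith)
  simpa [a', b', sub_eq_add_neg] using this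

namespace PluripotentialSetup

variable {n : ℕ} {X : Type u} [TopologicalSpace X] {Z : Type v}
  [AddCommGroup Z] [Module ℝ Z] [PartialOrder Z] {S : PluripotentialSetup n X Z}

/-- The interior of the positive cone absorbs every direction, up to `ddᶜ`-exact forms. -/
theorem IsPolarization.exists_sub_nonneg {ω : Z} (h : S.IsPolarization ω) (θ : Z) :
    ∃ ε > 0, ∃ g : S.D, 0 ≤ ω + S.ddc g - (ε : ℝ) • θ := by
  let π := (LinearMap.range S.ddc).mkQ
  obtain ⟨ε, hε, hmem⟩ := exists_add_smul_mem_of_isOpen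
    (@isOpen_interior _ (finestVectorTopology S.BottChern) (π '' {θ : Z | 0 ≤ θ})) h.2 (π θ)
  obtain ⟨η, hη, e⟩ := @interior_subset _ (finestVectorTopology S.BottChern) _ _ hmem
  have e' : π (η - (ω - ε • θ)) = 0 := by
    rw [map_sub, map_sub, map_smul, e, sub_self]
  obtain ⟨g, hg⟩ := (Submodule.Quotient.mk_eq_zero _).mp e'
  refine ⟨ε, hε, g, ?_⟩
  have : ω + S.ddc g - ε • θ = η := by rw [hg]; abel
  rw [this]
  exact hη

theorem IsPolarization.add_ddc {ω : Z} (h : S.IsPolarization ω) {g : S.D} (hg : g ∈ S.psh ω) :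
    S.IsPolarization (ω + S.ddc g) := by
  refine ⟨hg, ?_⟩
  have : (LinearMap.range S.ddc).mkQ (ω + S.ddc g) = (LinearMap.range S.ddc).mkQ ω := by
    rw [map_add]
    simp
  rw [this]
  exact h.2

theorem vol_add_ddc (ω : Z) (φ : S.D) : S.vol (ω + S.ddc φ) = S.vol ω := by
  have := S.prod_replicate_add_ddc_one ω φ n 0
  rwa [add_zero, add_zero, ← vol_eq, ← vol_eq] at this

theorem isPosMultilinear_mass : IsPosMultilinear (fun s => S.prod s 1) :=
  S.isPosMultilinear_prod (fun _ => zero_le_one)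

variable [IsOrderedAddMonoid Z] [PosSMulMono ℝ Z]

theorem exists_eq_sub_nonneg (S : PluripotentialSetup n X Z) (θ : Z) :
    ∃ a b : Z, 0 ≤ a ∧ 0 ≤ b ∧ θ = a - b := by
  have h : θ ∈ Submodule.span ℝ {θ : Z | 0 ≤ θ} := by rw [S.span_nonneg]; trivial
  induction h using Submodule.span_induction with
  | mem x hx => exact ⟨x, 0, hx, le_rfl, by simp⟩
  | zero => exact ⟨0, 0, le_rfl, le_rfl, by simp⟩
  | add x y _ _ hx hy =>
    obtain ⟨a, b, ha, hb, rfl⟩ := hx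
    obtain ⟨a', b', ha', hb', rfl⟩ := hy
    exact ⟨a + a', b + b', add_nonneg ha ha', add_nonneg hb hb', by abel⟩
  | smul c x _ hx =>
    obtain ⟨a, b, ha, hb, rfl⟩ := hx
    rcases le_total 0 c with hc | hc
    · exact ⟨c • a, c • b, smul_nonneg hc ha, smul_nonneg hc hb, smul_sub _ _ _⟩
    · refine ⟨(-c) • b, (-c) • a, smul_nonneg (by linarith) hb, smul_nonneg (by linarith) ha, ?_⟩
      module

/-- Every form is bounded by some form in the class of a given polarization. -/
theorem IsPolarization.exists_bound {ω : Z} (h : S.IsPolarization ω) (θ : Z) :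
    ∃ K : ℝ, 0 < K ∧ ∃ g ∈ S.psh ω, θ ≤ K • (ω + S.ddc g) ∧ -θ ≤ K • (ω + S.ddc g) := by
  obtain ⟨a, b, ha, hb, rfl⟩ := S.exists_eq_sub_nonneg θ
  obtain ⟨ε, hε, g, hg⟩ := h.exists_sub_nonneg (a + b)
  have h1 : a + b ≤ ε⁻¹ • (ω + S.ddc g) := by
    have := smul_le_smul_of_nonneg_left (sub_nonneg.mp hg) (inv_nonneg.mpr hε.le)
    rwa [smul_smul, inv_mul_cancel₀ hε.ne', one_smul] at this
  refine ⟨ε⁻¹, inv_pos.mpr hε, g, ?_, le_trans ?_ h1, le_trans ?_ h1⟩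
  · exact (smul_nonneg hε.le (add_nonneg ha hb)).trans (sub_nonneg.mp hg)
  · exact (sub_le_self a hb).trans (le_add_of_nonneg_right hb)
  · rw [neg_sub]
    exact (sub_le_self b ha).trans (le_add_of_nonneg_left ha)

/-- If `-K (ω + ddᶜg) ≤ ddᶜf` then `f` is a multiple of a difference of psh test functions. -/
theorem IsPolarization.exists_eq_smul_sub {ω : Z} (h : S.IsPolarization ω) (f : S.D) :
    ∃ K : ℝ, ∃ φ ∈ S.psh ω, ∃ g ∈ S.psh ω, f = K • (φ - g) := by
  obtain ⟨K, hK, g, hg, -, h2⟩ := h.exists_bound (S.ddc f)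
  refine ⟨K, K⁻¹ • f + g, ?_, g, hg, ?_⟩
  · rw [psh, Set.mem_ofPred_eq, map_add, map_smul]
    have := smul_le_smul_of_nonneg_left h2 (inv_nonneg.mpr hK.le)
    rw [smul_smul, inv_mul_cancel₀ hK.ne', one_smul, smul_neg] at this
    rw [neg_le_iff_add_nonneg'] at this
    convert this using 1
    abel
  · rw [add_sub_cancel_right, smul_smul, mul_inv_cancel₀ hK.ne', one_smul]

/-- The volume of a polarization is positive: otherwise every product of forms would vanish. -/
theorem IsPolarization.vol_pos [CompactSpace X] {ω : Z} (h : S.IsPolarization ω) :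
    0 < S.vol ω := by
  have h0 : 0 ≤ S.vol ω := by
    rw [vol_eq]
    exact isPosMultilinear_mass.nonneg _ (IsPosMultilinear.nonneg_replicate n h.1)
  refine lt_of_le_of_ne h0 fun hv => S.wedge_ne_zero ?_
  ext1 θ
  choose a b ha hb hab using fun i => S.exists_eq_sub_nonneg (θ i)
  obtain ⟨ε, hε, g, hg⟩ := h.exists_sub_nonneg (∑ i, (a i + b i))
  set η := ω + S.ddc g with hη
  have hsum : ∀ i, a i + b i ≤ ∑ i, (a i + b i) := fun i =>
    Finset.single_le_sum (f := fun i => a i + b i) (fun j _ => add_nonneg (ha j) (hb j))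
      (Finset.mem_univ i)
  have hle : ∑ i, (a i + b i) ≤ ε⁻¹ • η := by
    have := smul_le_smul_of_nonneg_left (sub_nonneg.mp hg) (inv_nonneg.mpr hε.le)
    rwa [smul_smul, inv_mul_cancel₀ hε.ne', one_smul] at this
  have hη0 : 0 ≤ η := (smul_nonneg hε.le (Finset.sum_nonneg fun i _ =>
    add_nonneg (ha i) (hb i))).trans (sub_nonneg.mp hg)
  have hbd : ∀ x ∈ Multiset.map θ Finset.univ.val, x ≤ ε⁻¹ • η ∧ -x ≤ ε⁻¹ • η := by
    intro x hx
    obtain ⟨i, -, rfl⟩ := Multiset.mem_map.mp hx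
    rw [hab i, neg_sub]
    have := (hsum i).trans hle
    exact ⟨((sub_le_self _ (hb i)).trans (le_add_of_nonneg_right (hb i))).trans this,
      ((sub_le_self _ (ha i)).trans (le_add_of_nonneg_left (ha i))).trans this⟩
  have hzero : ∀ f : C(X, ℝ), 0 ≤ f → S.wedge θ f = 0 := by
    intro f hf
    have h1 := (S.isPosMultilinear_prod hf).abs_le hη0 (inv_nonneg.mpr hε.le) _ hbd
    have h2 : S.prod (Multiset.replicate n η) f ≤ 0 := by
      have h3 := (S.prod_nonneg (IsPosMultilinear.nonneg_replicate n hη0)).mono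
        (f := f) (g := ‖f‖ • 1) fun x => by
          simpa using (le_abs_self _).trans (f.norm_coe_le_norm x)
      have h4 : S.prod (Multiset.replicate n η) 1 = 0 := by
        rw [← vol_eq, hη, vol_add_ddc, ← hv]
      rwa [map_smul, h4, smul_zero] at h3
    have hc : (Multiset.map θ Finset.univ.val).card = n := by simp
    simp only [prod_map_univ, hc] at h1
    have h5 : (3 * ε⁻¹) ^ n * S.prod (Multiset.replicate n η) f ≤ 0 :=
      mul_nonpos_of_nonneg_of_nonpos (by positivity) h2
    exact abs_eq_zero.mp (le_antisymm (h1.trans h5) (abs_nonneg _))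
  refine ContinuousLinearMap.ext fun f => ?_
  have h1 := hzero (f + ‖f‖ • 1) fun x => by
    have := (abs_le.mp (f.norm_coe_le_norm x)).1
    simp
    linarith
  have h2 := hzero (‖f‖ • 1) fun x => by simp
  rw [map_add, h2, add_zero] at h1
  exact h1

end PluripotentialSetup

/-! ### The metric on the space of measures of finite energy -/

namespace PluripotentialSetup

variable {n : ℕ} {X : Type u} [TopologicalSpace X] {Z : Type v}
  [AddCommGroup Z] [Module ℝ Z] [PartialOrder Z] {S : PluripotentialSetup n X Z} {ω : Z}

theorem strongDist_le {μ ν : RadonMeasure X} {c : ℝ}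
    (h : ∀ φ ∈ S.psh ω, S.dirichlet ω 0 φ ≤ 1 → |μ (φ : C(X, ℝ)) - ν (φ : C(X, ℝ))| ≤ c) :
    S.strongDist ω μ ν ≤ ENNReal.ofReal c :=
  iSup₂_le fun φ hφ => ENNReal.ofReal_le_ofReal (h φ hφ.1 hφ.2)

theorem strongDist_comm (μ ν : RadonMeasure X) : S.strongDist ω μ ν = S.strongDist ω ν μ := by
  simp only [strongDist, abs_sub_comm]

theorem strongDist_self (μ : RadonMeasure X) : S.strongDist ω μ μ = 0 := by
  simp [strongDist]

theorem strongDist_triangle (μ ν ξ : RadonMeasure X) :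
    S.strongDist ω μ ξ ≤ S.strongDist ω μ ν + S.strongDist ω ν ξ := by
  refine iSup₂_le fun φ hφ => ?_
  have h1 := le_iSup₂ (f := fun (φ : S.D) (_ : φ ∈ {φ : S.D | φ ∈ S.psh ω ∧ S.dirichlet ω 0 φ ≤ 1})
    => ENNReal.ofReal |μ (φ : C(X, ℝ)) - ν (φ : C(X, ℝ))|) φ hφ
  have h2 := le_iSup₂ (f := fun (φ : S.D) (_ : φ ∈ {φ : S.D | φ ∈ S.psh ω ∧ S.dirichlet ω 0 φ ≤ 1})
    => ENNReal.ofReal |ν (φ : C(X, ℝ)) - ξ (φ : C(X, ℝ))|) φ hφ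
  refine le_trans ?_ (add_le_add h1 h2)
  rw [← ENNReal.ofReal_add (abs_nonneg _) (abs_nonneg _)]
  exact ENNReal.ofReal_le_ofReal (abs_sub_le _ _ _)

theorem le_strongDist {μ ν : RadonMeasure X} (hfin : S.strongDist ω μ ν ≠ ⊤) {φ : S.D}
    (hφ : φ ∈ S.psh ω) (h1 : S.dirichlet ω 0 φ ≤ 1) :
    |μ (φ : C(X, ℝ)) - ν (φ : C(X, ℝ))| ≤ (S.strongDist ω μ ν).toReal := by
  have h := le_iSup₂ (f := fun (φ : S.D) (_ : φ ∈ {φ : S.D | φ ∈ S.psh ω ∧ S.dirichlet ω 0 φ ≤ 1})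
    => ENNReal.ofReal |μ (φ : C(X, ℝ)) - ν (φ : C(X, ℝ))|) φ ⟨hφ, h1⟩
  exact (ENNReal.ofReal_le_iff_le_toReal hfin).mp h

namespace FiniteEnergy

theorem strongTopology_eq : strongTopology S ω = TopologicalSpace.induced toMeasure inferInstance ⊓
    TopologicalSpace.induced J inferInstance := rfl

theorem nhds_eq (μ : S.FiniteEnergy ω) :
    𝓝 μ = comap toMeasure (𝓝 μ.toMeasure) ⊓ comap J (𝓝 μ.J) := by
  refine (nhds_inf (t₁ := TopologicalSpace.induced toMeasure inferInstance)
    (t₂ := TopologicalSpace.induced J inferInstance)).trans ?_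
  rw [nhds_induced, nhds_induced]

theorem continuous_toMeasure : Continuous (toMeasure : S.FiniteEnergy ω → RadonMeasure X) :=
  continuous_iff_le_induced.mpr (strongTopology_eq.trans_le inf_le_left)

theorem continuous_J : Continuous (J : S.FiniteEnergy ω → ℝ) :=
  continuous_iff_le_induced.mpr (strongTopology_eq.trans_le inf_le_right)

theorem continuous_eval (f : C(X, ℝ)) :
    Continuous (fun μ : S.FiniteEnergy ω => μ.toMeasure f) :=
  (WeakDual.eval_continuous f).comp continuous_toMeasure

theorem continuous_gap (φ : S.D) : Continuous (fun μ : S.FiniteEnergy ω => μ.gap φ) :=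
  (continuous_J.sub continuous_const).add (continuous_eval _)

/-- The distance `sup |∫ φ (μ - ν)|`, as a real number. -/
def rdist (μ ν : S.FiniteEnergy ω) : ℝ := (S.strongDist ω μ.toMeasure ν.toMeasure).toReal

theorem rdist_nonneg (μ ν : S.FiniteEnergy ω) : 0 ≤ μ.rdist ν := ENNReal.toReal_nonneg

theorem rdist_comm (μ ν : S.FiniteEnergy ω) : μ.rdist ν = ν.rdist μ := by
  rw [rdist, rdist, strongDist_comm]

end FiniteEnergy

variable [IsOrderedAddMonoid Z] [PosSMulMono ℝ Z]

/-- Test functions of arbitrary energy can be used after rescaling. -/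
theorem abs_sub_le_strongDist (hω : 0 ≤ ω) (hV : 0 < S.vol ω) {μ ν : RadonMeasure X}
    (hfin : S.strongDist ω μ ν ≠ ⊤) {φ : S.D} (hφ : φ ∈ S.psh ω) {r : ℝ} (hr : 1 ≤ r)
    (h1 : S.dirichlet ω 0 φ ≤ r) :
    |μ (φ : C(X, ℝ)) - ν (φ : C(X, ℝ))| ≤ r * (S.strongDist ω μ ν).toReal := by
  have hr0 : 0 < r := by linarith
  have hi0 : 0 ≤ r⁻¹ := inv_nonneg.mpr hr0.le
  have hi1 : r⁻¹ ≤ 1 := inv_le_one_of_one_le₀ hr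
  have hz := S.zero_mem_psh hω
  have h2 := S.dirichlet_zero_line_le hV hφ hz hi0 hi1
  rw [sub_zero, zero_add, dirichlet_self, mul_zero, zero_add] at h2
  have h3 := le_strongDist hfin (smul_mem_psh hω hφ hi0 hi1) (h2.trans (by
    rw [inv_mul_le_iff₀ hr0, mul_one]; exact h1))
  rw [Submodule.coe_smul, map_smul, map_smul, ← smul_sub, smul_eq_mul, abs_mul,
    abs_of_nonneg hi0, inv_mul_le_iff₀ hr0] at h3
  exact h3

theorem quasiDist_le_of_dirichlet (hω : 0 ≤ ω) (hV : 0 < S.vol ω) {φ : S.D}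
    (hφ : φ ∈ S.psh ω) (h : S.dirichlet ω 0 φ ≤ 1) : S.quasiDist ω φ 0 ≤ dimConst n := by
  rw [quasiDist_comm]
  have := S.quasiDist_le hV (S.zero_mem_psh hω) hφ
  have h2 := mul_le_mul_of_nonneg_left h (dimConst_pos n).le
  linarith

namespace FiniteEnergy

variable [CompactSpace X]

/-- Measures with a common near-maximizer are close, uniformly on test functions of bounded
energy. -/
theorem abs_sub_le_of_gap (hω : 0 ≤ ω) (hV : 0 < S.vol ω) (ho : S.OrthogonalityProperty ω)
    (μ ν : S.FiniteEnergy ω) {φ χ : S.D} (hφ : φ ∈ S.psh ω) (hχ : χ ∈ S.psh ω) {M η : ℝ}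
    (h1 : S.quasiDist ω φ 0 ≤ M) (h2 : S.quasiDist ω χ 0 ≤ M) (h3 : μ.J ≤ M) (h4 : ν.J ≤ M)
    (h5 : μ.gap χ ≤ η) (h6 : ν.gap χ ≤ η) :
    |μ.toMeasure (φ : C(X, ℝ)) - ν.toMeasure (φ : C(X, ℝ))| ≤ 2 * √(dimConst n ^ 13 * M * η) := by
  have hz := S.zero_mem_psh hω
  have hκ0 := dimConst_pos n
  have hM : 0 ≤ M := (μ.J_nonneg hω).trans h3
  have h0 : S.quasiDist ω 0 0 ≤ M := by simpa [quasiDist, dirForm] using hM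
  have k1 := μ.sub_MA_sq_le hω hV ho hφ hz hχ h1 h0 h2 h3
  have k2 := ν.sub_MA_sq_le hω hV ho hφ hz hχ h1 h0 h2 h4
  rw [sub_zero] at k1 k2
  have l1 := Real.abs_le_sqrt (k1.trans (mul_le_mul_of_nonneg_left h5 (by positivity)))
  have l2 := Real.abs_le_sqrt (k2.trans (mul_le_mul_of_nonneg_left h6 (by positivity)))
  rw [abs_le] at *
  constructor <;> linarith [l1.1, l1.2, l2.1, l2.2]

/-- The distance between two measures with a common near-maximizer. -/
theorem strongDist_le_of_gap (hω : 0 ≤ ω) (hV : 0 < S.vol ω) (ho : S.OrthogonalityProperty ω)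
    (μ ν : S.FiniteEnergy ω) {χ : S.D} (hχ : χ ∈ S.psh ω) {M η : ℝ}
    (h1 : dimConst n ≤ M) (h2 : S.quasiDist ω χ 0 ≤ M) (h3 : μ.J ≤ M) (h4 : ν.J ≤ M)
    (h5 : μ.gap χ ≤ η) (h6 : ν.gap χ ≤ η) :
    S.strongDist ω μ.toMeasure ν.toMeasure ≤
      ENNReal.ofReal (2 * √(dimConst n ^ 13 * M * η)) :=
  strongDist_le fun _ hφ hφ1 => abs_sub_le_of_gap hω hV ho μ ν hφ hχ
    ((quasiDist_le_of_dirichlet hω hV hφ hφ1).trans h1) h2 h3 h4 h5 h6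

theorem strongDist_ne_top (hω : 0 ≤ ω) (hV : 0 < S.vol ω) (ho : S.OrthogonalityProperty ω)
    (μ ν : S.FiniteEnergy ω) : S.strongDist ω μ.toMeasure ν.toMeasure ≠ ⊤ := by
  have hκ0 := dimConst_pos n
  have h1 := μ.J_nonneg hω
  have h2 := ν.J_nonneg hω
  refine ne_top_of_le_ne_top ENNReal.ofReal_ne_top
    (strongDist_le_of_gap hω hV ho μ ν (S.zero_mem_psh hω) (M := dimConst n + μ.J + ν.J)
      (η := μ.J + ν.J) (by linarith) ?_ (by linarith) (by linarith) ?_ ?_)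
  · have : S.quasiDist ω 0 0 = 0 := by simp [quasiDist, dirForm]
    linarith
  · rw [gap_zero]; linarith
  · rw [gap_zero]; linarith

/-- Semicontinuity of the energy for the distance: an almost maximizer for `ν` is a competitor in
the supremum that defines the energy of `μ`. -/
theorem J_le_J_add (hω : 0 ≤ ω) (hV : 0 < S.vol ω) (ho : S.OrthogonalityProperty ω)
    (μ ν : S.FiniteEnergy ω) :
    ν.J ≤ μ.J + μ.rdist ν * (1 + dimConst n ^ 3 * ν.J) := by
  have hκ0 := dimConst_pos n
  have hz := S.zero_mem_psh hω
  have hJ := ν.J_nonneg hω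
  have hd := μ.rdist_nonneg ν
  have key : ∀ η : ℝ, 0 < η → ν.J ≤ μ.J + η + μ.rdist ν * (1 + dimConst n ^ 3 * (η + ν.J)) := by
    intro η hη
    obtain ⟨ψ, hψ, hg⟩ := ν.exists_gap_lt hω hη
    have h1 := μ.le_J hω hψ
    have h2 : S.dirichlet ω 0 ψ ≤ 1 + dimConst n ^ 3 * (η + ν.J) := by
      have h3 := S.dirichlet_le hV hz hψ
      rw [quasiDist_comm] at h3
      have h4 := ν.quasiDist_zero_le hω hV hψ
      calc _ ≤ _ := h3.trans (mul_le_mul_of_nonneg_left h4 hκ0.le)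
        _ = dimConst n ^ 3 * (ν.gap ψ + ν.J) := by ring
        _ ≤ dimConst n ^ 3 * (η + ν.J) := by gcongr
        _ ≤ _ := by linarith
    have h5 := abs_sub_le_strongDist hω hV (strongDist_ne_top hω hV ho μ ν) hψ (by
      have : 0 ≤ dimConst n ^ 3 * (η + ν.J) := by positivity
      linarith) h2
    rw [← rdist] at h5
    have h6 := (abs_le.mp h5).2
    rw [gap] at hg
    linarith
  have hlim : Tendsto (fun η : ℝ => μ.J + η + μ.rdist ν * (1 + dimConst n ^ 3 * (η + ν.J)))
      (𝓝[>] 0) (𝓝 (μ.J + 0 + μ.rdist ν * (1 + dimConst n ^ 3 * (0 + ν.J)))) :=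
    tendsto_nhdsWithin_of_tendsto_nhds (Continuous.tendsto (by fun_prop) 0)
  have := ge_of_tendsto hlim (eventually_mem_nhdsWithin.mono fun η hη => key η hη)
  simpa using this

/-- Convergence for the distance implies strong convergence. -/
theorem tendsto_of_rdist (hp : S.IsPolarization ω) (ho : S.OrthogonalityProperty ω)
    {ι : Type*} {F : Filter ι} {ν : ι → S.FiniteEnergy ω} {μ : S.FiniteEnergy ω}
    (h : Tendsto (fun i => μ.rdist (ν i)) F (𝓝 0)) : Tendsto ν F (𝓝 μ) := by
  have hω := hp.1
  have hV := hp.vol_pos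
  have hκ0 := dimConst_pos n
  rw [nhds_eq, tendsto_inf, tendsto_comap_iff, tendsto_comap_iff]
  constructor
  · have hpsh : ∀ φ ∈ S.psh ω, Tendsto (fun i => (ν i).toMeasure (φ : C(X, ℝ))) F
        (𝓝 (μ.toMeasure (φ : C(X, ℝ)))) := by
      intro φ hφ
      rw [tendsto_iff_norm_sub_tendsto_zero]
      have hlim := h.const_mul (max 1 (S.dirichlet ω 0 φ))
      rw [mul_zero] at hlim
      refine squeeze_zero (fun i => norm_nonneg _) (fun i => ?_) hlim
      rw [Real.norm_eq_abs, abs_sub_comm]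
      exact abs_sub_le_strongDist hω hV (strongDist_ne_top hω hV ho μ (ν i)) hφ
        (le_max_left _ _) (le_max_right _ _)
    have hD : ∀ f : S.D, Tendsto (fun i => (ν i).toMeasure (f : C(X, ℝ))) F
        (𝓝 (μ.toMeasure (f : C(X, ℝ)))) := by
      intro f
      obtain ⟨K, φ, hφ, g, hg, rfl⟩ := hp.exists_eq_smul_sub f
      simp only [Submodule.coe_smul, Submodule.coe_sub, map_smul, map_sub]
      exact ((hpsh φ hφ).sub (hpsh g hg)).const_smul K
    rw [tendsto_iff_forall_eval_tendsto_topDualPairing]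
    intro f
    change Tendsto (fun i => (ν i).toMeasure f) F (𝓝 (μ.toMeasure f))
    rw [Metric.tendsto_nhds]
    intro ε hε
    obtain ⟨g, hgD, hg⟩ := Metric.mem_closure_iff.mp (S.dense_D f) (ε / 3) (by positivity)
    have h1 := Metric.tendsto_nhds.mp (hD ⟨g, hgD⟩) (ε / 3) (by positivity)
    refine h1.mono fun i hi => ?_
    rw [Real.dist_eq] at *
    rw [dist_eq_norm] at hg
    have h2 := (ν i).isProbability.abs_le_norm (f - g)
    have h3 := μ.isProbability.abs_le_norm (f - g)
    rw [map_sub] at h2 h3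
    rw [abs_le] at h2 h3
    rw [abs_lt] at *
    simp only at hi
    constructor <;> linarith [h2.1, h2.2, h3.1, h3.2, hi.1, hi.2]
  · set c := dimConst n ^ 3 with hc
    have hc0 : 0 < c := by positivity
    have hu : Tendsto (fun i => (μ.J + μ.rdist (ν i)) / (1 - μ.rdist (ν i) * c)) F
        (𝓝 ((μ.J + 0) / (1 - 0 * c))) :=
      (h.const_add _).div ((h.mul_const _).const_sub _) (by norm_num)
    have hl : Tendsto (fun i => μ.J - μ.rdist (ν i) * (1 + c * μ.J)) F
        (𝓝 (μ.J - 0 * (1 + c * μ.J))) := (h.mul_const _).const_sub _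
    rw [add_zero, zero_mul, sub_zero, div_one] at hu
    rw [zero_mul, sub_zero] at hl
    have hs : ∀ᶠ i in F, μ.rdist (ν i) * c < 1 := by
      have := h.mul_const c
      rw [zero_mul] at this
      exact this.eventually_lt_const one_pos
    refine tendsto_of_tendsto_of_tendsto_of_le_of_le' hl hu ?_ ?_
    · refine Eventually.of_forall fun i => ?_
      have := (ν i).J_le_J_add hω hV ho μ
      rw [rdist_comm] at this
      simp only [Function.comp]
      linarith
    · filter_upwards [hs] with i hi
      have := μ.J_le_J_add hω hV ho (ν i)
      rw [Function.comp, le_div_iff₀ (by linarith)]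
      linarith

/-- Strong neighborhoods contain balls of the distance. -/
theorem rdist_lt_mem_nhds (hp : S.IsPolarization ω) (ho : S.OrthogonalityProperty ω)
    (μ : S.FiniteEnergy ω) {ε : ℝ} (hε : 0 < ε) : {ν | μ.rdist ν < ε} ∈ 𝓝 μ := by
  have hω := hp.1
  have hV := hp.vol_pos
  have hκ1 := one_le_dimConst n
  have hκ0 := dimConst_pos n
  have hJ := μ.J_nonneg hω
  set M := dimConst n + dimConst n ^ 2 * (1 + μ.J) + (1 + μ.J) with hM
  have hM0 : 0 < M := by positivity
  have hcont : Tendsto (fun η : ℝ => 2 * √(dimConst n ^ 13 * M * η)) (𝓝[>] 0)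
      (𝓝 (2 * √(dimConst n ^ 13 * M * 0))) :=
    tendsto_nhdsWithin_of_tendsto_nhds (Continuous.tendsto (by fun_prop) 0)
  rw [mul_zero, Real.sqrt_zero, mul_zero] at hcont
  obtain ⟨η, hη1, hη, hη0⟩ := ((hcont.eventually_lt_const hε).and
    ((eventually_nhdsWithin_of_eventually_nhds (eventually_lt_nhds one_pos)).and
      eventually_mem_nhdsWithin)).exists
  obtain ⟨χ, hχ, hg⟩ := μ.exists_gap_lt hω hη0
  have e1 : {ν : S.FiniteEnergy ω | ν.gap χ < η} ∈ 𝓝 μ :=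
    (continuous_gap χ).continuousAt.eventually_lt_const hg
  have e2 : {ν : S.FiniteEnergy ω | ν.J < 1 + μ.J} ∈ 𝓝 μ :=
    continuous_J.continuousAt.eventually_lt_const (by linarith)
  filter_upwards [e1, e2] with ν h1 h2
  have hq : S.quasiDist ω χ 0 ≤ dimConst n ^ 2 * (1 + μ.J) :=
    (μ.quasiDist_zero_le hω hV hχ).trans (by gcongr; linarith)
  have p1 : 0 ≤ dimConst n ^ 2 * (1 + μ.J) := by positivity
  have := strongDist_le_of_gap hω hV ho μ ν hχ (M := M) (η := η)
    (by linarith) (by linarith) (by linarith) (by linarith [Set.mem_ofPred.mp h2]) hg.le h1.le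
  exact (ENNReal.toReal_le_of_le_ofReal (by positivity) this).trans_lt hη1

theorem eq_of_rdist_eq_zero (hp : S.IsPolarization ω) (ho : S.OrthogonalityProperty ω)
    {μ ν : S.FiniteEnergy ω} (h : μ.rdist ν = 0) : μ = ν := by
  have := tendsto_of_rdist hp ho (F := (⊤ : Filter Unit)) (ν := fun _ => ν) (μ := μ)
    (by simp [h])
  have h1 := ((tendsto_iff_forall_eval_tendsto_topDualPairing).mp
    ((continuous_toMeasure.tendsto μ).comp this))
  refine toMeasure_injective (ContinuousLinearMap.ext fun f => ?_)
  have h2 : Tendsto (fun _ : Unit => ν.toMeasure f) ⊤ (𝓝 (μ.toMeasure f)) := h1 f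
  exact tendsto_nhds_unique h2 tendsto_const_nhds

/-- The metric space structure on the space of measures of finite energy. -/
theorem exists_metricSpace (hp : S.IsPolarization ω) (ho : S.OrthogonalityProperty ω) :
    ∃ m : MetricSpace (S.FiniteEnergy ω),
      m.toUniformSpace.toTopologicalSpace = strongTopology S ω ∧
      ∀ μ ν : S.FiniteEnergy ω,
        ENNReal.ofReal (m.dist μ ν) = S.strongDist ω μ.toMeasure ν.toMeasure := by
  have hω := hp.1
  have hV := hp.vol_pos
  refine ⟨MetricSpace.ofDistTopology rdist (fun μ => by simp [rdist, strongDist_self])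
    rdist_comm (fun μ ν ξ => ?_) (fun s => ?_) (fun μ ν h => eq_of_rdist_eq_zero hp ho h),
    rfl, fun μ ν => ENNReal.ofReal_toReal (strongDist_ne_top hω hV ho μ ν)⟩
  · rw [rdist, rdist, rdist, ← ENNReal.toReal_add (strongDist_ne_top hω hV ho _ _)
      (strongDist_ne_top hω hV ho _ _)]
    exact ENNReal.toReal_mono (ENNReal.add_ne_top.mpr ⟨strongDist_ne_top hω hV ho _ _,
      strongDist_ne_top hω hV ho _ _⟩) (strongDist_triangle _ _ _)
  · rw [isOpen_iff_mem_nhds]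
    constructor
    · intro h μ hμ
      have hcomap : Tendsto id (comap μ.rdist (𝓝 0)) (𝓝 μ) :=
        tendsto_of_rdist hp ho tendsto_comap
      obtain ⟨t, ht, hts⟩ := mem_comap.mp (hcomap (h μ hμ))
      obtain ⟨ε, hε, hb⟩ := Metric.mem_nhds_iff.mp ht
      refine ⟨ε, hε, fun ν hν => hts (hb ?_)⟩
      rw [Metric.mem_ball, Real.dist_eq, sub_zero, abs_of_nonneg (rdist_nonneg _ _)]
      exact hν
    · intro h μ hμ
      obtain ⟨ε, hε, hb⟩ := h μ hμ
      exact mem_of_superset (rdist_lt_mem_nhds hp ho μ hε) fun ν hν => hb ν hν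

/-- The Monge--Ampère measures of near-maximizers of `μ` converge strongly to `μ`. -/
theorem tendsto_maPoint (hp : S.IsPolarization ω) (ho : S.OrthogonalityProperty ω)
    {ι : Type*} {F : Filter ι} {μ : S.FiniteEnergy ω} {χ : ι → S.D} (hχ : ∀ i, χ i ∈ S.psh ω)
    (h : Tendsto (fun i => μ.gap (χ i)) F (𝓝 0)) :
    Tendsto (fun i => maPoint hp.vol_pos (hχ i)) F (𝓝 μ) := by
  have hω := hp.1
  have hV := hp.vol_pos
  have hκ0 := dimConst_pos n
  have hκ1 := one_le_dimConst n
  have hJ := μ.J_nonneg hω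
  refine tendsto_of_rdist hp ho ?_
  set M : ι → ℝ := fun i => dimConst n + dimConst n ^ 3 * (μ.gap (χ i) + μ.J) with hM
  have hlim : Tendsto (fun i => 2 * √(dimConst n ^ 13 * M i * μ.gap (χ i))) F (𝓝 0) := by
    have h1 : Tendsto (fun i => 2 * √(dimConst n ^ 13 * M i * μ.gap (χ i))) F
        (𝓝 (2 * √(dimConst n ^ 13 * (dimConst n + dimConst n ^ 3 * (0 + μ.J)) * 0))) :=
      ((((((h.add_const _).const_mul _).const_add _).const_mul _).mul h).sqrt).const_mul _
    simpa using h1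
  refine squeeze_zero (fun i => rdist_nonneg _ _) (fun i => ?_) hlim
  have hg := μ.gap_nonneg hω (hχ i)
  have hq := μ.quasiDist_zero_le hω hV (hχ i)
  have hpos : 0 ≤ μ.gap (χ i) + μ.J := by linarith
  have p1 : dimConst n ^ 2 * (μ.gap (χ i) + μ.J) ≤ dimConst n ^ 3 * (μ.gap (χ i) + μ.J) :=
    mul_le_mul_of_nonneg_right (pow_le_pow_right₀ hκ1 (by norm_num)) hpos
  have p2 : μ.gap (χ i) + μ.J ≤ dimConst n ^ 3 * (μ.gap (χ i) + μ.J) :=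
    le_mul_of_one_le_left hpos (one_le_pow₀ hκ1)
  have hJm : (maPoint hV (hχ i)).J ≤ dimConst n ^ 3 * (μ.gap (χ i) + μ.J) := by
    rw [← gap_zero, gap_maPoint hω]
    refine (S.dirichlet_le hV (hχ i) (S.zero_mem_psh hω)).trans ?_
    refine (mul_le_mul_of_nonneg_left hq hκ0.le).trans (le_of_eq ?_)
    ring
  have := strongDist_le_of_gap hω hV ho μ (maPoint hV (hχ i)) (hχ i) (M := M i)
    (η := μ.gap (χ i)) (by simp only [hM]; linarith) (by simp only [hM]; linarith)
    (by simp only [hM]; linarith) (by simp only [hM]; linarith) le_rfl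
    (by rw [gap_maPoint hω, dirichlet_self]; exact hg)
  exact ENNReal.toReal_le_of_le_ofReal (by positivity) this

end FiniteEnergy

end PluripotentialSetup

namespace PluripotentialSetup

variable {n : ℕ} {X : Type u} [TopologicalSpace X] {Z : Type v}
  [AddCommGroup Z] [Module ℝ Z] [PartialOrder Z] {S : PluripotentialSetup n X Z} {ω : Z}

/-! ### Change of reference form in a cohomology class -/

theorem form_shift (ω : Z) (g φ : S.D) : ω + S.ddc g + S.ddc (φ - g) = ω + S.ddc φ := by
  rw [map_sub]; abel

theorem sub_mem_psh_shift {g φ : S.D} : φ - g ∈ S.psh (ω + S.ddc g) ↔ φ ∈ S.psh ω := by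
  rw [psh, psh, Set.mem_ofPred_eq, Set.mem_ofPred_eq, form_shift]

theorem add_mem_psh {g φ : S.D} (h : φ ∈ S.psh (ω + S.ddc g)) : φ + g ∈ S.psh ω := by
  rw [← sub_mem_psh_shift (g := g), add_sub_cancel_right]
  exact h

theorem MA_shift (ω : Z) (g φ : S.D) : S.MA (ω + S.ddc g) (φ - g) = S.MA ω φ := by
  rw [MA, MA, vol_add_ddc, form_shift]

theorem preEnergy_shift (ω : Z) (g φ : S.D) (m : ℕ) :
    S.preEnergy m 0 (ω + S.ddc g) (φ - g) = S.preEnergy m 0 ω φ - S.preEnergy m 0 ω g := by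
  have h1 := fun t : ℝ => S.hasDerivAt_preEnergy m 0 (ω + S.ddc g) 0 0 (φ - g) t
  have h2 := fun t : ℝ => S.hasDerivAt_preEnergy m 0 ω 0 g (φ - g) t
  have h3 := fun t : ℝ => (h1 t).sub (h2 t)
  have hconst := is_const_of_deriv_eq_zero (fun t => (h3 t).differentiableAt) (fun t => by
    rw [(h3 t).deriv, preEnergy_zero_cons, preEnergy_zero_cons]
    simp only [smul_zero, add_zero, zero_add, map_add, ← add_assoc]
    ring) 1 0
  simp only [Pi.sub_apply, smul_zero, add_zero, zero_add, one_smul, zero_smul,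
    add_sub_cancel] at hconst
  have h0 : S.preEnergy m 0 (ω + S.ddc g) 0 = 0 := by simp [preEnergy]
  rw [h0] at hconst
  linarith

theorem MAEnergy_shift (ω : Z) (g φ : S.D) :
    S.MAEnergy (ω + S.ddc g) (φ - g) = S.MAEnergy ω φ - S.MAEnergy ω g := by
  rw [MAEnergy_eq, MAEnergy_eq, MAEnergy_eq, vol_add_ddc, preEnergy_shift, sub_div]

theorem quasiDist_shift (ω : Z) (g φ ψ : S.D) :
    S.quasiDist (ω + S.ddc g) (φ - g) (ψ - g) = S.quasiDist ω φ ψ := by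
  have e : (1 / 2 : ℝ) • (φ - g + (ψ - g)) = (1 / 2 : ℝ) • (φ + ψ) - g := by module
  rw [quasiDist, quasiDist, vol_add_ddc, e, form_shift, sub_sub_sub_cancel_right]

/-- The twisted energy of functions under a translation by `g`; the two sides differ by a constant
which depends on `g` and `θ` only. -/
theorem twist_shift (hV : S.vol ω ≠ 0) (θ : Z) (g φ : S.D) :
    S.twist (ω + S.ddc g) θ (φ - g) = S.twist ω θ φ - S.twist ω θ g := by
  have hV' : S.vol (ω + S.ddc g) ≠ 0 := by rwa [vol_add_ddc]
  have h1 := S.hasDerivAt_MAEnergy (ω + S.ddc g) θ (φ - g) 0 0 (by simpa using hV')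
  have h2 := S.hasDerivAt_MAEnergy ω θ φ 0 0 (by simpa using hV)
  have h3 := S.hasDerivAt_MAEnergy ω θ g 0 0 (by simpa using hV)
  simp only [smul_zero, zero_smul, add_zero, Submodule.coe_zero, map_zero] at h1 h2 h3
  refine h1.unique ((h2.sub h3).congr_of_eventuallyEq (Eventually.of_forall fun t => ?_))
  rw [Pi.sub_apply, ← MAEnergy_shift, add_right_comm]

theorem OrthogonalityProperty.shift (ho : S.OrthogonalityProperty ω) (g : S.D) :
    S.OrthogonalityProperty (ω + S.ddc g) := by
  refine ⟨fun φ hφ ψ hψ f hf => ?_, fun f ε hε => ?_⟩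
  · obtain ⟨τ, hτ, h⟩ := ho.1 (φ + g) (add_mem_psh hφ) (ψ + g) (add_mem_psh hψ) (f + g)
      (fun x => by
        have := hf x
        simp only [Submodule.coe_add, ContinuousMap.add_apply, max_add_add_right]
        linarith)
    refine ⟨τ - g, sub_mem_psh_shift.mpr hτ, fun x => ?_⟩
    have := h x
    simp only [Submodule.coe_add, Submodule.coe_sub, ContinuousMap.add_apply,
      ContinuousMap.sub_apply, max_add_add_right] at this ⊢
    constructor <;> linarith [this.1, this.2]
  · obtain ⟨φ₀, hφ₀, h1, h2⟩ := ho.2 (f + g) ε hε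
    refine ⟨φ₀ - g, sub_mem_psh_shift.mpr hφ₀, fun x => ?_, fun φ hφ hle hlt => ?_⟩
    · have := h1 x
      simp only [Submodule.coe_add, Submodule.coe_sub, ContinuousMap.add_apply,
        ContinuousMap.sub_apply] at this ⊢
      linarith
    · have := h2 (φ + g) (add_mem_psh hφ)
        (fun x => by
          have := hle x
          simp only [Submodule.coe_add, Submodule.coe_sub, ContinuousMap.add_apply,
            ContinuousMap.sub_apply] at this ⊢
          linarith)
        (fun x => by
          have := hlt x
          simp only [Submodule.coe_add, ContinuousMap.add_apply] at this ⊢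
          linarith)
      rw [← MA_shift ω g, add_sub_cancel_right] at this
      simpa using this

/-- A measure of finite energy with respect to `ω` has finite energy with respect to any form in
the same class, and its energy is given by the gap. -/
theorem FiniteEnergy.exists_shift (hω : 0 ≤ ω) (μ : S.FiniteEnergy ω) {g : S.D}
    (hg : g ∈ S.psh ω) :
    ∃ ν : S.FiniteEnergy (ω + S.ddc g), ν.toMeasure = μ.toMeasure ∧ ν.J = μ.gap g ∧
      ∀ φ, ν.gap (φ - g) = μ.gap φ := by
  have hb : ∀ φ ∈ S.psh (ω + S.ddc g),
      S.MAEnergy (ω + S.ddc g) φ - μ.toMeasure (φ : C(X, ℝ)) ≤ μ.gap g := by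
    intro φ hφ
    have h1 := μ.le_J hω (add_mem_psh hφ)
    have h2 := MAEnergy_shift ω g (φ + g)
    rw [add_sub_cancel_right] at h2
    rw [Submodule.coe_add, map_add] at h1
    rw [h2, FiniteEnergy.gap]
    linarith
  obtain ⟨ν, hν⟩ := FiniteEnergy.exists_of_bound μ.isProbability hb
  have hJ : ν.J = μ.gap g := by
    refine le_antisymm (ν.J_le hg (by rwa [hν])) ?_
    have : μ.J ≤ ν.J + S.MAEnergy ω g - μ.toMeasure (g : C(X, ℝ)) := μ.J_le hω fun φ hφ => by
      have h1 := ν.le_J hg (sub_mem_psh_shift.mpr hφ)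
      rw [MAEnergy_shift, hν, Submodule.coe_sub, map_sub] at h1
      linarith
    rw [FiniteEnergy.gap]
    linarith
  refine ⟨ν, hν, hJ, fun φ => ?_⟩
  rw [FiniteEnergy.gap, hJ, MAEnergy_shift, hν, Submodule.coe_sub, map_sub, FiniteEnergy.gap,
    FiniteEnergy.gap]
  ring

theorem submeanConst_le {c : ℝ}
    (h : ∀ φ ∈ S.psh ω, (⨆ x : X, (φ : C(X, ℝ)) x) - S.baseMeasure ω (φ : C(X, ℝ)) ≤ c) :
    S.submeanConst ω ≤ ENNReal.ofReal c :=
  iSup₂_le fun φ hφ => ENNReal.ofReal_le_ofReal (h φ hφ)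

theorem le_submeanConst (hT : S.submeanConst ω ≠ ⊤) {φ : S.D} (hφ : φ ∈ S.psh ω) :
    (⨆ x : X, (φ : C(X, ℝ)) x) - S.baseMeasure ω (φ : C(X, ℝ)) ≤ (S.submeanConst ω).toReal := by
  have h := le_iSup₂ (f := fun (φ : S.D) (_ : φ ∈ S.psh ω) =>
    ENNReal.ofReal ((⨆ x : X, (φ : C(X, ℝ)) x) - S.baseMeasure ω (φ : C(X, ℝ)))) φ hφ
  exact (ENNReal.ofReal_le_iff_le_toReal hT).mp h

theorem sub_constD_mem_psh {φ : S.D} (hφ : φ ∈ S.psh ω) (c : ℝ) : φ - S.constD c ∈ S.psh ω := by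
  rw [psh, Set.mem_ofPred_eq, map_sub, ddc_constD, sub_zero]
  exact hφ

theorem MA_constD (hV : 0 < S.vol ω) (φ : S.D) (c : ℝ) :
    S.MA ω φ (S.constD c : C(X, ℝ)) = c := by
  rw [coe_constD, map_smul, S.MA_one hV, smul_eq_mul, mul_one]

theorem MAEnergy_sub_constD (hV : 0 < S.vol ω) (φ : S.D) (c : ℝ) :
    S.MAEnergy ω (φ - S.constD c) = S.MAEnergy ω φ - c := by
  have h1 := MAEnergy_shift ω (S.constD c) φ
  have h2 : S.MAEnergy ω (S.constD c) = c := by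
    have hd := fun t : ℝ => (S.hasDerivAt_MAEnergy_line ω 0 (S.constD c) t hV.ne').sub
      ((hasDerivAt_id t).mul_const c)
    have := is_const_of_deriv_eq_zero (fun t => (hd t).differentiableAt)
      (fun t => by rw [(hd t).deriv, MA_constD hV]; ring) 1 0
    simp only [Pi.sub_apply, id, zero_add, one_smul, zero_smul, S.MAEnergy_zero] at this
    linarith
  rw [ddc_constD, add_zero, h2] at h1
  exact h1

theorem nonempty_of_vol_pos (hV : 0 < S.vol ω) : Nonempty X := by
  by_contra h
  rw [not_nonempty_iff] at h
  have : (1 : C(X, ℝ)) = 0 := ContinuousMap.ext fun x => h.elim x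
  rw [vol, this, map_zero] at hV
  exact hV.false

section Normalization

variable [CompactSpace X]

theorem exists_eq_iSup [Nonempty X] (f : C(X, ℝ)) :
    ∃ x₀, (⨆ x : X, f x) = f x₀ ∧ ∀ x, f x ≤ f x₀ := by
  obtain ⟨x₀, -, hx₀⟩ := isCompact_univ.exists_isMaxOn Set.univ_nonempty f.continuous.continuousOn
  exact ⟨x₀, le_antisymm (ciSup_le fun x => hx₀ (Set.mem_univ x))
    (le_ciSup (isCompact_range f.continuous).bddAbove x₀), fun x => hx₀ (Set.mem_univ x)⟩

/-- Every `ω`-plurisubharmonic test function can be normalized by `sup φ = 0`. -/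
theorem exists_normalized [Nonempty X] {φ : S.D} (hφ : φ ∈ S.psh ω) :
    ∃ c : ℝ, φ - S.constD c ∈ S.psh ω ∧ (∀ x, ((φ - S.constD c : S.D) : C(X, ℝ)) x ≤ 0) ∧
      ∃ x, ((φ - S.constD c : S.D) : C(X, ℝ)) x = 0 := by
  obtain ⟨x₀, -, hx₀⟩ := exists_eq_iSup (φ : C(X, ℝ))
  refine ⟨(φ : C(X, ℝ)) x₀, sub_constD_mem_psh hφ _, fun x => ?_, x₀, by simp⟩
  simpa using hx₀ x

/-- For a normalized function, the supremum in the definition of `T` is attained at `0`. -/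
theorem normalized_mass_le (hT : S.submeanConst ω ≠ ⊤) {φ : S.D} (hφ : φ ∈ S.psh ω)
    (hx : ∃ x, (φ : C(X, ℝ)) x = 0) :
    -S.MA ω 0 (φ : C(X, ℝ)) ≤ (S.submeanConst ω).toReal := by
  obtain ⟨x, hx⟩ := hx
  have h1 := le_submeanConst hT hφ
  have h2 := le_ciSup (isCompact_range (φ : C(X, ℝ)).continuous).bddAbove x
  rw [S.MA_zero]
  linarith

theorem submeanConst_le_of_normalized (hV : 0 < S.vol ω) {c : ℝ}
    (h : ∀ φ ∈ S.psh ω, (∀ x, (φ : C(X, ℝ)) x ≤ 0) → (∃ x, (φ : C(X, ℝ)) x = 0) →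
      -S.MA ω 0 (φ : C(X, ℝ)) ≤ c) :
    S.submeanConst ω ≤ ENNReal.ofReal c := by
  have := nonempty_of_vol_pos hV
  refine submeanConst_le fun φ hφ => ?_
  obtain ⟨x₀, hs, hx₀⟩ := exists_eq_iSup (φ : C(X, ℝ))
  have := h (φ - S.constD ((φ : C(X, ℝ)) x₀)) (sub_constD_mem_psh hφ _)
    (fun x => by simpa using hx₀ x) ⟨x₀, by simp⟩
  rw [Submodule.coe_sub, map_sub, MA_constD hV, S.MA_zero] at this
  rw [hs]
  linarith

end Normalization

end PluripotentialSetup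

namespace PluripotentialSetup

variable {n : ℕ} {X : Type u} [TopologicalSpace X] {Z : Type v}
  [AddCommGroup Z] [Module ℝ Z] [PartialOrder Z] {S : PluripotentialSetup n X Z} {ω ω' : Z}

/-! ### Comparable forms -/

theorem cons_replicate_self (S : PluripotentialSetup n X Z) (ω : Z) :
    ω ::ₘ Multiset.replicate (n - 1) ω = Multiset.replicate n ω := by
  rw [← Multiset.replicate_succ, Nat.sub_add_cancel S.one_le_dim]

theorem prod_cons_replicate_one (η ω : Z) (φ : S.D) :
    S.prod (η ::ₘ Multiset.replicate (n - 1) (ω + S.ddc φ)) 1 =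
      S.prod (η ::ₘ Multiset.replicate (n - 1) ω) 1 := by
  have := S.prod_replicate_add_ddc_one ω φ (n - 1) {η}
  rwa [add_comm _ ({η} : Multiset Z), Multiset.singleton_add, add_comm _ ({η} : Multiset Z),
    Multiset.singleton_add] at this

variable [IsOrderedAddMonoid Z]

theorem vol_le_of_le (hω : 0 ≤ ω) (hω' : 0 ≤ ω') {A : ℝ} (hA : 0 ≤ A) (h : ω' ≤ A • ω) :
    S.vol ω' ≤ A ^ n * S.vol ω := by
  rw [vol_eq, vol_eq]
  exact (isPosMultilinear_mass (S := S)).replicate_le hω' hω hA h n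

theorem neg_MA_le_of_le (hω : 0 ≤ ω) (hω' : 0 ≤ ω') (hV : 0 < S.vol ω) (hV' : 0 < S.vol ω')
    {A : ℝ} (hA : 0 ≤ A) (h : ω' ≤ A • ω) {f : C(X, ℝ)} (hf : ∀ x, f x ≤ 0) :
    -S.MA ω' 0 f ≤ A ^ n * (S.vol ω / S.vol ω') * -S.MA ω 0 f := by
  have h1 := (isPosMultilinear_prod (S := S) (f := -f)
    (fun x => by simpa using hf x)).replicate_le hω' hω hA h n
  rw [MA_apply, MA_apply, map_zero, add_zero, add_zero]
  rw [map_neg, map_neg] at h1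
  calc -((S.vol ω')⁻¹ * S.prod (Multiset.replicate n ω') f)
      = (S.vol ω')⁻¹ * -S.prod (Multiset.replicate n ω') f := by ring
    _ ≤ (S.vol ω')⁻¹ * (A ^ n * -S.prod (Multiset.replicate n ω) f) :=
        mul_le_mul_of_nonneg_left h1 (inv_nonneg.mpr hV'.le)
    _ = _ := by field_simp

variable [PosSMulMono ℝ Z]

theorem smul_inv_mem_psh {A : ℝ} (hA : 0 < A) (h : ω' ≤ A • ω) {φ : S.D} (hφ : φ ∈ S.psh ω') :
    A⁻¹ • φ ∈ S.psh ω := by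
  have h1 : ω + S.ddc (A⁻¹ • φ) = A⁻¹ • ((A • ω - ω') + (ω' + S.ddc φ)) := by
    rw [← add_assoc, sub_add_cancel, smul_add, smul_smul, inv_mul_cancel₀ hA.ne', one_smul,
      map_smul]
  rw [psh, Set.mem_ofPred_eq, h1]
  exact smul_nonneg (inv_nonneg.mpr hA.le) (add_nonneg (sub_nonneg.mpr h) hφ)

/-- The submean value constant of a form dominated by a multiple of `ω` is finite when that of `ω`
is. -/
theorem submeanConst_le_of_le [CompactSpace X] (hω : 0 ≤ ω) (hω' : 0 ≤ ω') (hV : 0 < S.vol ω)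
    (hV' : 0 < S.vol ω') {A : ℝ} (hA : 0 < A) (h : ω' ≤ A • ω) (hT : S.submeanConst ω ≠ ⊤) :
    S.submeanConst ω' ≤ ENNReal.ofReal
      (A ^ n * (S.vol ω / S.vol ω') * (A * (S.submeanConst ω).toReal)) := by
  refine submeanConst_le_of_normalized hV' fun φ hφ h0 ⟨x, hx⟩ => ?_
  refine (neg_MA_le_of_le hω hω' hV hV' hA.le h h0).trans
    (mul_le_mul_of_nonneg_left ?_ (by positivity))
  have := normalized_mass_le hT (smul_inv_mem_psh hA h hφ) ⟨x, by simp [hx]⟩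
  rw [Submodule.coe_smul, map_smul, smul_eq_mul] at this
  have h2 := mul_le_mul_of_nonneg_left this hA.le
  have h3 : A * -(A⁻¹ * S.MA ω 0 (φ : C(X, ℝ))) = -S.MA ω 0 (φ : C(X, ℝ)) := by field_simp
  linarith

/-- A Chern--Levine--Nirenberg type bound. -/
theorem abs_MA_sub_le_norm [CompactSpace X] (hω : 0 ≤ ω) (hV : 0 < S.vol ω) {φ g : S.D}
    (hφ : φ ∈ S.psh ω) (hg : g ∈ S.psh ω) :
    |S.MA ω g (φ : C(X, ℝ)) - S.MA ω 0 (φ : C(X, ℝ))| ≤ 2 * n * ‖(g : C(X, ℝ))‖ := by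
  have hd := fun t : ℝ => S.hasDerivAt_MA_line ω 0 g φ t
  have hb : ∀ t ∈ Set.Ico (0 : ℝ) 1, ‖-((S.vol ω)⁻¹ * n *
        S.dirForm (Multiset.replicate (n - 1) (ω + S.ddc (0 + t • g))) g φ)‖ ≤
          2 * n * ‖(g : C(X, ℝ))‖ := by
    intro t ht
    have hmem : t • g ∈ S.psh ω := smul_mem_psh hω hg ht.1 ht.2.le
    rw [zero_add, S.dirForm_comm, dirForm]
    set r := Multiset.replicate (n - 1) (ω + S.ddc (t • g)) with hr
    have hnn : ∀ z ∈ r, 0 ≤ z := fun z hz => by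
      rw [Multiset.eq_of_mem_replicate hz]; exact hmem
    have hmass : S.prod (ω ::ₘ r) 1 = S.vol ω := by
      rw [hr, prod_cons_replicate_one, cons_replicate_self S, vol_eq]
    have hmass' : S.prod ((ω + S.ddc φ) ::ₘ r) 1 = S.vol ω := by
      rw [S.prod_add_ddc_one, hmass]
    have hpos : ∀ η : Z, 0 ≤ η → S.prod (η ::ₘ r) 1 = S.vol ω →
        |S.prod (η ::ₘ r) (g : C(X, ℝ))| ≤ S.vol ω * ‖(g : C(X, ℝ))‖ := by
      intro η hη hm
      have hp : ((S.vol ω)⁻¹ • S.prod (η ::ₘ r)).IsProbability := by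
        refine ⟨fun f hf => ?_, ?_⟩
        · rw [RadonMeasure.smul_apply]
          exact mul_nonneg (inv_nonneg.mpr hV.le) (S.prod_nonneg
            (IsPosMultilinear.nonneg_cons hη hnn) f hf)
        · rw [RadonMeasure.smul_apply, hm, inv_mul_cancel₀ hV.ne']
      have := hp.abs_le_norm (g : C(X, ℝ))
      rw [RadonMeasure.smul_apply, abs_mul, abs_of_pos (inv_pos.mpr hV),
        inv_mul_le_iff₀ hV] at this
      exact this
    have e : S.prod (S.ddc φ ::ₘ r) (g : C(X, ℝ)) =
        S.prod ((ω + S.ddc φ) ::ₘ r) (g : C(X, ℝ)) - S.prod (ω ::ₘ r) (g : C(X, ℝ)) := by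
      rw [S.prod_add_cons, RadonMeasure.add_apply]; ring
    have h1 := hpos _ hφ hmass'
    have h2 := hpos _ hω hmass
    have h3 : |S.prod (S.ddc φ ::ₘ r) (g : C(X, ℝ))| ≤ S.vol ω * (2 * ‖(g : C(X, ℝ))‖) := by
      rw [e]
      exact (abs_sub _ _).trans (by linarith)
    rw [Real.norm_eq_abs, abs_neg, abs_mul, abs_neg, abs_of_nonneg (by positivity)]
    calc (S.vol ω)⁻¹ * (n : ℝ) * |S.prod (S.ddc φ ::ₘ r) (g : C(X, ℝ))|
        ≤ (S.vol ω)⁻¹ * (n : ℝ) * (S.vol ω * (2 * ‖(g : C(X, ℝ))‖)) := by gcongr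
      _ = _ := by field_simp
  have := norm_image_sub_le_of_norm_deriv_le_segment_01'
    (fun t _ => (hd t).hasDerivWithinAt) hb
  simpa using this

theorem submeanConst_add_ddc_ne_top [CompactSpace X] (hω : 0 ≤ ω) (hV : 0 < S.vol ω) {g : S.D}
    (hg : g ∈ S.psh ω) (hT : S.submeanConst ω ≠ ⊤) : S.submeanConst (ω + S.ddc g) ≠ ⊤ := by
  have hV' : 0 < S.vol (ω + S.ddc g) := by rwa [vol_add_ddc]
  refine ne_top_of_le_ne_top ENNReal.ofReal_ne_top (submeanConst_le_of_normalized hV'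
    (c := (S.submeanConst ω).toReal + (2 * n + 2) * ‖(g : C(X, ℝ))‖) fun φ hφ h0 ⟨x, hx⟩ => ?_)
  have hφ' := add_mem_psh hφ
  have h1 := le_submeanConst hT hφ'
  have h2 := le_ciSup (isCompact_range ((φ + g : S.D) : C(X, ℝ)).continuous).bddAbove x
  have h3 : (g : C(X, ℝ)) x ≤ ⨆ x : X, ((φ + g : S.D) : C(X, ℝ)) x := by
    have e : ((φ + g : S.D) : C(X, ℝ)) x = (g : C(X, ℝ)) x := by simp [hx]
    rwa [e] at h2
  have h4 := abs_le.mp (ContinuousMap.norm_coe_le_norm (g : C(X, ℝ)) x)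
  have h5 := abs_le.mp (abs_MA_sub_le_norm hω hV hφ' hg)
  have h6 : S.MA (ω + S.ddc g) 0 = S.MA ω g := by
    have := MA_shift ω g g
    rwa [sub_self] at this
  have h7 := abs_le.mp ((S.MA_isProbability hV hg).abs_le_norm (g : C(X, ℝ)))
  rw [h6]
  rw [← S.MA_zero] at h1
  have h8 : S.MA ω g ((φ + g : S.D) : C(X, ℝ)) = S.MA ω g (φ : C(X, ℝ)) +
    S.MA ω g (g : C(X, ℝ)) := by rw [Submodule.coe_add, map_add]
  simp only [Submodule.coe_add, ContinuousMap.add_apply] at h1 h3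
  rw [Submodule.coe_add] at h8 h5
  linarith [h4.1, h5.1, h7.2]

/-- The submean value property gives finiteness of `T` for every polarization. -/
theorem IsPolarization.submeanConst_ne_top [CompactSpace X] (hS : S.SubmeanValueProperty)
    (h : S.IsPolarization ω) : S.submeanConst ω ≠ ⊤ := by
  obtain ⟨ω₀, h₀, hT⟩ := hS
  obtain ⟨K, hK, g, hg, hle, -⟩ := h₀.exists_bound ω
  have h1 := submeanConst_add_ddc_ne_top h₀.1 h₀.vol_pos hg hT.ne
  exact ne_top_of_le_ne_top ENNReal.ofReal_ne_top (submeanConst_le_of_le hg h.1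
    (h₀.add_ddc hg).vol_pos h.vol_pos hK hle h1)

end PluripotentialSetup

namespace PluripotentialSetup

variable {n : ℕ} {X : Type u} [TopologicalSpace X] {Z : Type v}
  [AddCommGroup Z] [Module ℝ Z] [PartialOrder Z] {S : PluripotentialSetup n X Z} {ω ω' : Z}

@[simp] theorem quasiDist_self (ω : Z) (φ : S.D) : S.quasiDist ω φ φ = 0 := by
  rw [quasiDist, sub_self, dirForm, Submodule.coe_zero, map_zero, neg_zero, mul_zero]

variable [IsOrderedAddMonoid Z] [PosSMulMono ℝ Z]

theorem le_smul_of_le_smul {η ζ : Z} {A B : ℝ} (hζ : 0 ≤ ζ) (h : η ≤ A • ζ) (hAB : A ≤ B) :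
    η ≤ B • ζ := by
  refine h.trans ?_
  rw [← sub_nonneg, ← sub_smul]
  exact smul_nonneg (sub_nonneg.mpr hAB) hζ

/-- Comparison of the quasi-distances to `0` for comparable forms. -/
theorem quasiDist_inv_smul_le (hω : 0 ≤ ω) (hω' : 0 ≤ ω') (hV : 0 < S.vol ω) (hV' : 0 < S.vol ω')
    {A : ℝ} (hA : 1 ≤ A) (h1 : ω' ≤ A • ω) (h2 : ω ≤ A • ω') {φ : S.D} (hφ : φ ∈ S.psh ω') :
    S.quasiDist ω (A⁻¹ • φ) 0 ≤ (2 * A) ^ (2 * n) * S.quasiDist ω' φ 0 := by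
  have hA0 : 0 < A := by linarith
  have hle : ω + S.ddc ((1 / 2 : ℝ) • (A⁻¹ • φ + 0)) ≤
      (2 * A) • (ω' + S.ddc ((1 / 2 : ℝ) • (φ + 0))) := by
    have e : (2 * A) • (ω' + S.ddc ((1 / 2 : ℝ) • (φ + 0))) -
        (ω + S.ddc ((1 / 2 : ℝ) • (A⁻¹ • φ + 0))) =
        (A • ω' - ω) + (A - (2 * A)⁻¹) • (ω' + S.ddc φ) + (2 * A)⁻¹ • ω' := by
      simp only [add_zero, map_smul]
      match_scalars <;> (field_simp; try ring)
    rw [← sub_nonneg, e]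
    have h3 : (2 * A)⁻¹ ≤ A := by
      rw [inv_le_comm₀ (by positivity) hA0]
      exact (inv_le_one_of_one_le₀ hA).trans (by linarith)
    exact add_nonneg (add_nonneg (sub_nonneg.mpr h2)
      (smul_nonneg (sub_nonneg.mpr h3) hφ)) (smul_nonneg (by positivity) hω')
  have hm : 0 ≤ ω + S.ddc ((1 / 2 : ℝ) • (A⁻¹ • φ + 0)) :=
    mid_mem_psh (smul_inv_mem_psh hA0 h1 hφ) (S.zero_mem_psh hω)
  have hm' : 0 ≤ ω' + S.ddc ((1 / 2 : ℝ) • (φ + 0)) := mid_mem_psh hφ (S.zero_mem_psh hω')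
  have hb := (S.isPosMultilinear_dirForm φ).replicate_le hm hm' (by positivity) hle (n - 1)
  have hv := vol_le_of_le (S := S) hω hω' hA0.le h1
  have hq : 0 ≤ S.quasiDist ω' φ 0 := S.quasiDist_nonneg hV' hφ (S.zero_mem_psh hω')
  have hd : 0 ≤ S.dirForm (Multiset.replicate (n - 1) (ω' + S.ddc ((1 / 2 : ℝ) • (φ + 0)))) φ φ :=
    S.dirForm_nonneg (IsPosMultilinear.nonneg_replicate _ hm') φ
  have hv' : (S.vol ω)⁻¹ ≤ A ^ n * (S.vol ω')⁻¹ := by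
    rw [← div_eq_mul_inv, inv_eq_one_div, div_le_div_iff₀ hV hV', one_mul]
    exact hv
  simp only [quasiDist, sub_zero, S.dirForm_smul_smul]
  calc (S.vol ω)⁻¹ * (A⁻¹ ^ 2 * S.dirForm (Multiset.replicate (n - 1)
          (ω + S.ddc ((1 / 2 : ℝ) • (A⁻¹ • φ + 0)))) φ φ)
      ≤ (A ^ n * (S.vol ω')⁻¹) * (1 * ((2 * A) ^ (n - 1) * S.dirForm (Multiset.replicate (n - 1)
          (ω' + S.ddc ((1 / 2 : ℝ) • (φ + 0)))) φ φ)) := by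
        refine mul_le_mul hv' (mul_le_mul ?_ hb ?_ zero_le_one) ?_ (by positivity)
        · exact pow_le_one₀ (by positivity) (inv_le_one_of_one_le₀ hA)
        · exact S.dirForm_nonneg (IsPosMultilinear.nonneg_replicate _ hm) φ
        · exact mul_nonneg (by positivity)
            (S.dirForm_nonneg (IsPosMultilinear.nonneg_replicate _ hm) φ)
    _ ≤ ((2 * A) ^ n * (S.vol ω')⁻¹) * (1 * ((2 * A) ^ n * S.dirForm (Multiset.replicate (n - 1)
          (ω' + S.ddc ((1 / 2 : ℝ) • (φ + 0)))) φ φ)) := by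
        have h4 : (2 * A) ^ (n - 1) ≤ (2 * A) ^ n :=
          pow_le_pow_right₀ (by linarith) (Nat.sub_le n 1)
        have h5 : A ^ n ≤ (2 * A) ^ n := pow_le_pow_left₀ hA0.le (by linarith) n
        gcongr
    _ = _ := by rw [two_mul n, pow_add]; ring

/-- Any two polarizations are comparable, up to moving them in their cohomology classes. -/
theorem IsPolarization.exists_comparable (h : S.IsPolarization ω) (h' : S.IsPolarization ω') :
    ∃ A : ℝ, 1 ≤ A ∧ ∃ g ∈ S.psh ω, ∃ g' ∈ S.psh ω',
      ω' + S.ddc g' ≤ A • (ω + S.ddc g) ∧ ω + S.ddc g ≤ A • (ω' + S.ddc g') := by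
  obtain ⟨ε₁, hε₁, k, hk⟩ := h.exists_sub_nonneg ω'
  obtain ⟨ε₂, hε₂, l, hl⟩ := h'.exists_sub_nonneg ω
  set ε := min (1 / 2) (min ε₁ ε₂) with hε
  have hε0 : 0 < ε := by rw [hε]; positivity
  have hε12 : ε ≤ 1 / 2 := min_le_left _ _
  have mono : ∀ {δ : ℝ} {a b : Z}, 0 ≤ b → ε ≤ δ → 0 ≤ a - δ • b → 0 ≤ a - ε • b := by
    intro δ a b hb hδ hab
    have e : a - ε • b = (a - δ • b) + (δ - ε) • b := by module
    rw [e]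
    exact add_nonneg hab (smul_nonneg (sub_nonneg.mpr hδ) hb)
  replace hk := mono h'.1 ((min_le_right _ _).trans (min_le_left _ _)) hk
  replace hl := mono h.1 ((min_le_right _ _).trans (min_le_right _ _)) hl
  have hd : 0 < 1 - ε ^ 2 := by nlinarith
  set a := (1 - ε ^ 2)⁻¹ with ha
  have ha0 : 0 < a := inv_pos.mpr hd
  have haε : a * ε ^ 2 = a - 1 := by rw [ha]; field_simp; ring
  have e1 : ω + S.ddc (a • (k + ε • l)) = a • (ω + S.ddc k - ε • ω') +
      (a * ε) • (ω' + S.ddc l - ε • ω) := by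
    simp only [map_smul, map_add]
    match_scalars <;> linarith
  have e2 : ω' + S.ddc (a • (ε • k + l)) = (a * ε) • (ω + S.ddc k - ε • ω') +
      a • (ω' + S.ddc l - ε • ω) := by
    simp only [map_smul, map_add]
    match_scalars <;> linarith
  have hε1 : 1 ≤ ε⁻¹ := (one_le_inv₀ hε0).mpr (by linarith)
  refine ⟨ε⁻¹, hε1, a • (k + ε • l), ?_, a • (ε • k + l), ?_, ?_, ?_⟩
  · rw [psh, Set.mem_ofPred_eq, e1]
    exact add_nonneg (smul_nonneg ha0.le hk) (smul_nonneg (by positivity) hl)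
  · rw [psh, Set.mem_ofPred_eq, e2]
    exact add_nonneg (smul_nonneg (by positivity) hk) (smul_nonneg ha0.le hl)
  · rw [e1, e2]
    generalize ω + S.ddc k - ε • ω' = P at *
    generalize ω' + S.ddc l - ε • ω = R at *
    have e : ε⁻¹ • (a • P + (a * ε) • R) - ((a * ε) • P + a • R) = (a * (ε⁻¹ - ε)) • P := by
      match_scalars <;> (field_simp; try ring)
    rw [← sub_nonneg, e]
    exact smul_nonneg (mul_nonneg ha0.le (by linarith)) hk
  · rw [e1, e2]
    generalize ω + S.ddc k - ε • ω' = P at *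
    generalize ω' + S.ddc l - ε • ω = R at *
    have e : ε⁻¹ • ((a * ε) • P + a • R) - (a • P + (a * ε) • R) = (a * (ε⁻¹ - ε)) • R := by
      match_scalars <;> (field_simp; try ring)
    rw [← sub_nonneg, e]
    exact smul_nonneg (mul_nonneg ha0.le (by linarith)) hl

/-- The comparison constant for the energies with respect to comparable forms. -/
def compareConst (n : ℕ) (A : ℝ) : ℝ := 1 + A + A ^ 2 * dimConst n ^ 14 * (2 * A) ^ (2 * n)

theorem one_le_compareConst (n : ℕ) {A : ℝ} (hA : 0 ≤ A) : 1 ≤ compareConst n A := by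
  have := dimConst_pos n
  have : 0 ≤ A ^ 2 * dimConst n ^ 14 * (2 * A) ^ (2 * n) := by positivity
  rw [compareConst]; linarith

/-- Along functions normalized by `sup φ = 0`, the energy is nonpositive, and controls the
quasi-distance. -/
theorem MAEnergy_le_of_nonpos (hω : 0 ≤ ω) (hV : 0 < S.vol ω) {φ : S.D} (hφ : φ ∈ S.psh ω)
    (h0 : ∀ x, (φ : C(X, ℝ)) x ≤ 0) :
    S.MAEnergy ω φ ≤ -((dimConst n)⁻¹ * S.quasiDist ω φ 0) := by
  have hz := S.zero_mem_psh hω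
  have h1 := S.quasiDist_le hV hz hφ
  rw [S.quasiDist_comm, ← inv_mul_le_iff₀ (dimConst_pos n), S.dirichlet_zero_left] at h1
  have := (S.MA_isProbability hV hz).le_of_forall_le h0
  linarith

variable [CompactSpace X]

/-- The linear part of the energy along functions normalized by `sup φ = 0`. -/
theorem FiniteEnergy.neg_le_of_normalized (hω : 0 ≤ ω) (hV : 0 < S.vol ω)
    (ho : S.OrthogonalityProperty ω) (hT : S.submeanConst ω ≠ ⊤) (μ : S.FiniteEnergy ω) {ψ : S.D}
    (hψ : ψ ∈ S.psh ω) (hx : ∃ x, (ψ : C(X, ℝ)) x = 0) {lam : ℝ} (hlam : 0 < lam) :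
    -μ.toMeasure (ψ : C(X, ℝ)) ≤ (S.submeanConst ω).toReal +
      lam * (S.quasiDist ω ψ 0 + μ.J) + dimConst n ^ 13 / lam * μ.J := by
  have h0 := S.zero_mem_psh hω
  have hq := S.quasiDist_nonneg hV hψ h0
  have hJ := μ.J_nonneg hω
  have h1 := μ.sub_MA_sq_le hω hV ho hψ h0 h0 (M := S.quasiDist ω ψ 0 + μ.J) (by linarith)
    (by rw [quasiDist_self]; linarith) (by rw [quasiDist_self]; linarith)
    (by linarith)
  rw [μ.gap_zero, sub_zero] at h1
  have h2 := normalized_mass_le hT hψ hx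
  -- the geometric mean is at most the weighted sum, with weights `lam` and `1 / lam`
  have h3 : -(μ.toMeasure (ψ : C(X, ℝ)) - S.MA ω 0 (ψ : C(X, ℝ))) ≤
      lam * (S.quasiDist ω ψ 0 + μ.J) + dimConst n ^ 13 / lam * μ.J := by
    have hP : 0 ≤ lam * (S.quasiDist ω ψ 0 + μ.J) := by positivity
    have hκ := dimConst_pos n
    have hQ : 0 ≤ dimConst n ^ 13 / lam * μ.J := by positivity
    have hPQ : lam * (S.quasiDist ω ψ 0 + μ.J) * (dimConst n ^ 13 / lam * μ.J) =
        dimConst n ^ 13 * (S.quasiDist ω ψ 0 + μ.J) * μ.J := by field_simp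
    exact (neg_le_abs _).trans (abs_le_of_sq_le_sq (by nlinarith) (by positivity))
  linarith

/-- Energies with respect to comparable forms are comparable. -/
theorem FiniteEnergy.exists_of_comparable (hω : 0 ≤ ω) (hω' : 0 ≤ ω') (hV : 0 < S.vol ω)
    (hV' : 0 < S.vol ω') (ho : S.OrthogonalityProperty ω) (hT : S.submeanConst ω ≠ ⊤)
    {A : ℝ} (hA : 1 ≤ A) (h1 : ω' ≤ A • ω) (h2 : ω ≤ A • ω') (μ : S.FiniteEnergy ω) :
    ∃ ν : S.FiniteEnergy ω', ν.toMeasure = μ.toMeasure ∧ ν.J ≤ compareConst n A * μ.Jplus := by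
  have := nonempty_of_vol_pos hV
  have hA0 : 0 < A := by linarith
  have hκ := dimConst_pos n
  have hJ := μ.J_nonneg hω
  have hb : ∀ φ ∈ S.psh ω', S.MAEnergy ω' φ - μ.toMeasure (φ : C(X, ℝ)) ≤
      compareConst n A * μ.Jplus := by
    intro φ₀ hφ₀
    obtain ⟨c, hφ, h0, x, hx⟩ := exists_normalized hφ₀
    have e : S.MAEnergy ω' φ₀ - μ.toMeasure (φ₀ : C(X, ℝ)) =
        S.MAEnergy ω' (φ₀ - S.constD c) - μ.toMeasure ((φ₀ - S.constD c : S.D) : C(X, ℝ)) := by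
      rw [MAEnergy_sub_constD hV', Submodule.coe_sub, map_sub, coe_constD, map_smul,
        μ.isProbability.2, smul_eq_mul]
      ring
    rw [e]
    generalize φ₀ - S.constD c = φ at *
    have h3 := MAEnergy_le_of_nonpos hω' hV' hφ h0
    have h4 := quasiDist_inv_smul_le hω hω' hV hV' hA h1 h2 hφ
    -- the weight for which the quasi-distance is absorbed by the energy
    have h5 := μ.neg_le_of_normalized hω hV ho hT (smul_inv_mem_psh hA0 h1 hφ) ⟨x, by simp [hx]⟩
      (lam := (A * dimConst n * (2 * A) ^ (2 * n))⁻¹) (by positivity)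
    have h6 := mul_le_mul_of_nonneg_left h5 hA0.le
    have e2 : A * -μ.toMeasure ((A⁻¹ • φ : S.D) : C(X, ℝ)) = -μ.toMeasure (φ : C(X, ℝ)) := by
      rw [Submodule.coe_smul, map_smul, smul_eq_mul]; field_simp
    rw [e2] at h6
    have hc : A * (A * dimConst n * (2 * A) ^ (2 * n))⁻¹ =
        (dimConst n)⁻¹ * ((2 * A) ^ (2 * n))⁻¹ := by field_simp
    have h7 : A * ((A * dimConst n * (2 * A) ^ (2 * n))⁻¹ * S.quasiDist ω (A⁻¹ • φ) 0) ≤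
        (dimConst n)⁻¹ * S.quasiDist ω' φ 0 := by
      rw [← mul_assoc, hc, mul_assoc]
      refine mul_le_mul_of_nonneg_left ?_ (by positivity)
      rwa [inv_mul_le_iff₀ (by positivity)]
    have h8 : A * ((A * dimConst n * (2 * A) ^ (2 * n))⁻¹ * μ.J) ≤ μ.J := by
      rw [← mul_assoc, hc]
      refine mul_le_of_le_one_left hJ (mul_le_one₀ (inv_le_one_of_one_le₀ (one_le_dimConst n))
        (by positivity) (inv_le_one_of_one_le₀ (one_le_pow₀ (by linarith))))
    have h9 : A * (dimConst n ^ 13 / (A * dimConst n * (2 * A) ^ (2 * n))⁻¹ * μ.J) =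
        A ^ 2 * dimConst n ^ 14 * (2 * A) ^ (2 * n) * μ.J := by
      rw [div_inv_eq_mul]; ring
    have hTn : 0 ≤ (S.submeanConst ω).toReal := ENNReal.toReal_nonneg
    rw [FiniteEnergy.Jplus, compareConst]
    have h10 : 0 ≤ (1 + A ^ 2 * dimConst n ^ 14 * (2 * A) ^ (2 * n)) *
      (S.submeanConst ω).toReal := by positivity
    have h11 : 0 ≤ A * μ.J := by positivity
    linarith
  obtain ⟨ν, hν⟩ := FiniteEnergy.exists_of_bound μ.isProbability hb
  exact ⟨ν, hν, ν.J_le hω' fun φ hφ => by rw [hν]; exact hb φ hφ⟩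

theorem submeanConst_toReal_le (hω : 0 ≤ ω) (hω' : 0 ≤ ω') (hV : 0 < S.vol ω)
    (hV' : 0 < S.vol ω') (hT : S.submeanConst ω ≠ ⊤) {A : ℝ} (hA : 1 ≤ A) (h1 : ω' ≤ A • ω)
    (h2 : ω ≤ A • ω') :
    (S.submeanConst ω').toReal ≤ A ^ (2 * n + 1) * (S.submeanConst ω).toReal := by
  have hA0 : 0 < A := by linarith
  have h3 := ENNReal.toReal_le_of_le_ofReal (by positivity)
    (submeanConst_le_of_le hω hω' hV hV' hA0 h1 hT)
  have h4 := vol_le_of_le (S := S) hω' hω hA0.le h2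
  rw [← div_le_iff₀ hV'] at h4
  refine h3.trans ?_
  calc A ^ n * (S.vol ω / S.vol ω') * (A * (S.submeanConst ω).toReal)
      ≤ A ^ n * A ^ n * (A * (S.submeanConst ω).toReal) := by
        have : 0 ≤ (S.submeanConst ω).toReal := ENNReal.toReal_nonneg
        gcongr
    _ = _ := by rw [pow_succ, two_mul, pow_add]; ring

end PluripotentialSetup

namespace PluripotentialSetup

variable {n : ℕ} {X : Type u} [TopologicalSpace X] {Z : Type v}
  [AddCommGroup Z] [Module ℝ Z] [PartialOrder Z] {S : PluripotentialSetup n X Z} {ω ω' : Z}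

/-! ### Independence of the reference form -/

/-- Finite energy with respect to a form in the class of `ω` implies finite energy with respect
to `ω`. -/
theorem FiniteEnergy.exists_unshift {g : S.D} (h : 0 ≤ ω + S.ddc g)
    (μ : S.FiniteEnergy (ω + S.ddc g)) : ∃ ν : S.FiniteEnergy ω, ν.toMeasure = μ.toMeasure := by
  refine FiniteEnergy.exists_of_bound μ.isProbability
    (B := μ.J + (S.MAEnergy ω g - μ.toMeasure (g : C(X, ℝ)))) fun φ hφ => ?_
  have h1 := μ.le_J h (sub_mem_psh_shift.mpr hφ)
  rw [MAEnergy_shift, Submodule.coe_sub, map_sub] at h1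
  linarith

variable [IsOrderedAddMonoid Z] [PosSMulMono ℝ Z] [CompactSpace X]

/-- The space of measures of finite energy does not depend on the polarization. -/
theorem FiniteEnergy.exists_transport (hS : S.SubmeanValueProperty) (hp : S.IsPolarization ω)
    (ho : S.OrthogonalityProperty ω) (hp' : S.IsPolarization ω')
    (μ : S.FiniteEnergy ω) : ∃ ν : S.FiniteEnergy ω', ν.toMeasure = μ.toMeasure := by
  obtain ⟨A, hA, g, hg, g', hg', h1, h2⟩ := hp.exists_comparable hp'
  have hpg := hp.add_ddc hg
  have hpg' := hp'.add_ddc hg'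
  obtain ⟨μ₁, e1, -, -⟩ := μ.exists_shift hp.1 hg
  obtain ⟨μ₂, e2, -⟩ := μ₁.exists_of_comparable hpg.1 hpg'.1 hpg.vol_pos hpg'.vol_pos (ho.shift g)
    (hpg.submeanConst_ne_top hS) hA h1 h2
  obtain ⟨μ₃, e3⟩ := μ₂.exists_unshift hpg'.1
  exact ⟨μ₃, by rw [e3, e2, e1]⟩

/-- The distance defined by `ω'` is bounded by a multiple of the distance defined by `ω`. -/
theorem exists_strongDist_le (hp : S.IsPolarization ω) (ho : S.OrthogonalityProperty ω)
    (hp' : S.IsPolarization ω') :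
    ∃ A : ℝ≥0, ∀ μ ν : S.FiniteEnergy ω, S.strongDist ω' μ.toMeasure ν.toMeasure ≤
      A * S.strongDist ω μ.toMeasure ν.toMeasure := by
  obtain ⟨A, hA, g, hg, g', hg', h1, h2⟩ := hp.exists_comparable hp'
  have hA0 : 0 < A := by linarith
  have hpg := hp.add_ddc hg
  have hpg' := hp'.add_ddc hg'
  have hV := hp.vol_pos
  have hV' := hp'.vol_pos
  have hκ := dimConst_pos n
  set M₁ := max (dimConst n) (S.quasiDist ω' g' 0) with hM₁
  set M₂ := max ((2 * A) ^ (2 * n) * (dimConst n ^ 3 * M₁)) (S.quasiDist ω g 0) with hM₂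
  set R := max 1 (max (dimConst n * (dimConst n ^ 3 * M₂)) (S.dirichlet ω 0 g)) with hR
  have hR1 : 1 ≤ R := le_max_left _ _
  have hsub : ∀ φ ∈ S.psh ω', S.dirichlet ω' 0 φ ≤ 1 →
      A⁻¹ • (φ - g') + g ∈ S.psh ω ∧ S.dirichlet ω 0 (A⁻¹ • (φ - g') + g) ≤ R := by
    intro φ hφ hd
    have hφ' : φ - g' ∈ S.psh (ω' + S.ddc g') := sub_mem_psh_shift.mpr hφ
    have hψ : A⁻¹ • (φ - g') ∈ S.psh (ω + S.ddc g) := smul_inv_mem_psh hA0 h1 hφ'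
    have hψ' := add_mem_psh hψ
    refine ⟨hψ', ?_⟩
    have q0 := quasiDist_le_of_dirichlet hp'.1 hV' hφ hd
    have q1 : S.quasiDist ω' φ g' ≤ dimConst n ^ 3 * M₁ :=
      S.quasiDist_le_zero_right hp'.1 hV' hφ hg' (q0.trans (le_max_left _ _)) (le_max_right _ _)
    rw [← quasiDist_shift ω' g', sub_self] at q1
    have q2 := quasiDist_inv_smul_le hpg.1 hpg'.1 hpg.vol_pos hpg'.vol_pos hA h1 h2 hφ'
    have q3 : S.quasiDist ω (A⁻¹ • (φ - g') + g) g ≤ M₂ := by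
      rw [← quasiDist_shift ω g, sub_self, add_sub_cancel_right]
      exact (q2.trans (mul_le_mul_of_nonneg_left q1 (by positivity))).trans (le_max_left _ _)
    have q4 : S.quasiDist ω (A⁻¹ • (φ - g') + g) 0 ≤ dimConst n ^ 3 * M₂ :=
      S.quasiDist_triangle hV hψ' (S.zero_mem_psh hp.1) hg q3
        ((S.quasiDist_comm ω 0 g).trans_le (le_max_right _ _))
    have q5 := S.dirichlet_le hV (S.zero_mem_psh hp.1) hψ'
    rw [S.quasiDist_comm] at q5
    exact ((q5.trans (mul_le_mul_of_nonneg_left q4 hκ.le)).trans (le_max_left _ _)).trans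
      (le_max_right _ _)
  obtain ⟨K, p, hp₁, q, hq₁, hK⟩ := hp.exists_eq_smul_sub g'
  set R' := max 1 (max (S.dirichlet ω 0 p) (S.dirichlet ω 0 q)) with hR'
  have hR'1 : 1 ≤ R' := le_max_left _ _
  refine ⟨⟨A * (2 * R) + |K| * (2 * R'), by positivity⟩, fun μ ν => ?_⟩
  have hfin := FiniteEnergy.strongDist_ne_top hp.1 hV ho μ ν
  have hmain := strongDist_le (ω := ω') (μ := μ.toMeasure) (ν := ν.toMeasure)
    (c := (A * (2 * R) + |K| * (2 * R')) * (S.strongDist ω μ.toMeasure ν.toMeasure).toReal)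
    fun φ hφ hd => by
      obtain ⟨hψ, hdψ⟩ := hsub φ hφ hd
      have b1 := abs_sub_le_strongDist hp.1 hV hfin hψ hR1 hdψ
      have b2 := abs_sub_le_strongDist hp.1 hV hfin hg hR1
        ((le_max_right _ _).trans (le_max_right _ _))
      have b3 := abs_sub_le_strongDist hp.1 hV hfin hp₁ hR'1
        ((le_max_left _ _).trans (le_max_right _ _))
      have b4 := abs_sub_le_strongDist hp.1 hV hfin hq₁ hR'1
        ((le_max_right _ _).trans (le_max_right _ _))
      have e : φ = A • ((A⁻¹ • (φ - g') + g) - g) + K • (p - q) := by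
        rw [add_sub_cancel_right, smul_smul, mul_inv_cancel₀ hA0.ne', one_smul, ← hK,
          sub_add_cancel]
      generalize A⁻¹ • (φ - g') + g = ψ at *
      generalize (S.strongDist ω μ.toMeasure ν.toMeasure).toReal = d at *
      have e' : μ.toMeasure (φ : C(X, ℝ)) - ν.toMeasure (φ : C(X, ℝ)) =
          A * ((μ.toMeasure (ψ : C(X, ℝ)) - ν.toMeasure (ψ : C(X, ℝ))) -
            (μ.toMeasure (g : C(X, ℝ)) - ν.toMeasure (g : C(X, ℝ)))) +
          K * ((μ.toMeasure (p : C(X, ℝ)) - ν.toMeasure (p : C(X, ℝ))) -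
            (μ.toMeasure (q : C(X, ℝ)) - ν.toMeasure (q : C(X, ℝ)))) := by
        rw [e]
        simp only [Submodule.coe_add, Submodule.coe_sub, Submodule.coe_smul, map_add, map_sub,
          map_smul, smul_eq_mul]
        ring
      rw [e']
      refine (abs_add_le _ _).trans ?_
      rw [abs_mul, abs_mul, abs_of_pos hA0]
      have c1 := mul_le_mul_of_nonneg_left ((abs_sub _ _).trans (add_le_add b1 b2)) hA0.le
      have c2 := mul_le_mul_of_nonneg_left ((abs_sub _ _).trans (add_le_add b3 b4)) (abs_nonneg K)
      linarith
  refine hmain.trans_eq ?_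
  rw [ENNReal.ofReal_mul (by positivity), ENNReal.ofReal_toReal hfin]
  congr 1
  exact ENNReal.ofReal_eq_coe_nnreal _

/-- The strong topologies and the Lipschitz classes of the distances of two polarizations
coincide. -/
theorem exists_homeomorph (hS : S.SubmeanValueProperty) (hp : S.IsPolarization ω)
    (ho : S.OrthogonalityProperty ω) (hp' : S.IsPolarization ω')
    (ho' : S.OrthogonalityProperty ω') :
    (∃ e : S.FiniteEnergy ω ≃ₜ S.FiniteEnergy ω', ∀ μ, (e μ).toMeasure = μ.toMeasure) ∧
      ∃ A : ℝ≥0, ∀ μ ν : S.FiniteEnergy ω,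
        S.strongDist ω' μ.toMeasure ν.toMeasure ≤ A * S.strongDist ω μ.toMeasure ν.toMeasure ∧
        S.strongDist ω μ.toMeasure ν.toMeasure ≤ A * S.strongDist ω' μ.toMeasure ν.toMeasure := by
  -- continuity of a measure preserving map between the two spaces
  have key : ∀ {η η' : Z}, S.IsPolarization η → S.OrthogonalityProperty η →
      S.IsPolarization η' → S.OrthogonalityProperty η' →
      ∀ e : S.FiniteEnergy η → S.FiniteEnergy η', (∀ μ, (e μ).toMeasure = μ.toMeasure) →
        Continuous e := by
    intro η η' hp ho hp' ho' e he
    obtain ⟨A, hA⟩ := exists_strongDist_le hp ho hp'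
    rw [continuous_iff_continuousAt]
    intro μ
    have h1 : Tendsto (fun ν : S.FiniteEnergy η => μ.rdist ν) (𝓝 μ) (𝓝 0) := by
      rw [Metric.tendsto_nhds]
      intro ε hε
      filter_upwards [FiniteEnergy.rdist_lt_mem_nhds hp ho μ hε] with ν hν
      rwa [Real.dist_0_eq_abs, abs_of_nonneg (μ.rdist_nonneg ν)]
    refine FiniteEnergy.tendsto_of_rdist hp' ho' ?_
    refine squeeze_zero (fun ν => FiniteEnergy.rdist_nonneg _ _) (fun ν => ?_)
      (g := fun ν => (A : ℝ) * μ.rdist ν) (by simpa using h1.const_mul (A : ℝ))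
    have h2 := hA μ ν
    have h3 := FiniteEnergy.strongDist_ne_top hp.1 hp.vol_pos ho μ ν
    have h4 := ENNReal.toReal_mono (ENNReal.mul_ne_top ENNReal.coe_ne_top h3) h2
    rw [ENNReal.toReal_mul, ENNReal.coe_toReal] at h4
    rwa [FiniteEnergy.rdist, he, he]
  choose e he using fun μ : S.FiniteEnergy ω => μ.exists_transport hS hp ho hp'
  choose e' he' using fun μ : S.FiniteEnergy ω' => μ.exists_transport hS hp' ho' hp
  refine ⟨⟨⟨⟨e, e', fun μ => FiniteEnergy.toMeasure_injective (by rw [he', he]),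
    fun μ => FiniteEnergy.toMeasure_injective (by rw [he, he'])⟩, key hp ho hp' ho' e he,
    key hp' ho' hp ho e' he'⟩, he⟩, ?_⟩
  obtain ⟨A, hA⟩ := exists_strongDist_le hp ho hp'
  obtain ⟨A', hA'⟩ := exists_strongDist_le hp' ho' hp
  refine ⟨max A A', fun μ ν => ⟨(hA μ ν).trans ?_, ?_⟩⟩
  · gcongr
    exact le_max_left _ _
  · have := hA' (e μ) (e ν)
    rw [he, he] at this
    refine this.trans ?_
    gcongr
    exact le_max_right _ _

end PluripotentialSetup

/-! ### Hölder continuity of the twisted energy of functions -/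

theorem holderExponent_pos (n : ℕ) : 0 < holderExponent n := by rw [holderExponent]; positivity

theorem holderExponent_le_one (n : ℕ) : holderExponent n ≤ 1 :=
  inv_le_one_of_one_le₀ (one_le_pow₀ (by norm_num))

theorem le_rpow_of_pow_le {n : ℕ} {x a b : ℝ} (hx : 0 ≤ x) (ha : 0 ≤ a) (hb : 0 ≤ b)
    (h : x ^ 2 ^ n ≤ a * b ^ (2 ^ n - 1)) :
    x ≤ a ^ holderExponent n * b ^ (1 - holderExponent n) := by
  have h2 : (2 : ℝ) ^ n ≠ 0 := by positivity
  have h1 := Real.rpow_le_rpow (by positivity) h (holderExponent_pos n).le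
  rw [Real.mul_rpow ha (by positivity), ← Real.rpow_natCast, ← Real.rpow_natCast,
    ← Real.rpow_mul hx, ← Real.rpow_mul hb, Nat.cast_sub Nat.one_le_two_pow] at h1
  push_cast at h1
  rw [holderExponent, mul_inv_cancel₀ h2, Real.rpow_one, sub_mul, mul_inv_cancel₀ h2,
    one_mul] at h1
  exact h1

namespace PluripotentialSetup

variable {n : ℕ} {X : Type u} [TopologicalSpace X] {Z : Type v}
  [AddCommGroup Z] [Module ℝ Z] [PartialOrder Z] {S : PluripotentialSetup n X Z} {ω ω' θ : Z}

theorem preEnergy_add_singleton (m : ℕ) (θ₁ θ₂ : Z) (φ : S.D) :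
    S.preEnergy m {θ₁ + θ₂} ω φ = S.preEnergy m {θ₁} ω φ + S.preEnergy m {θ₂} ω φ := by
  rw [preEnergy, preEnergy, preEnergy, ← Finset.sum_add_distrib]
  refine Finset.sum_congr rfl fun i _ => ?_
  simp only [add_comm _ ({_} : Multiset Z), Multiset.singleton_add]
  rw [S.prod_add_cons, RadonMeasure.add_apply]

theorem preEnergy_smul_singleton (m : ℕ) (c : ℝ) (θ : Z) (φ : S.D) :
    S.preEnergy m {c • θ} ω φ = c * S.preEnergy m {θ} ω φ := by
  rw [preEnergy, preEnergy, Finset.mul_sum]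
  refine Finset.sum_congr rfl fun i _ => ?_
  simp only [add_comm _ ({_} : Multiset Z), Multiset.singleton_add]
  rw [S.prod_smul_cons, RadonMeasure.smul_apply]

theorem twist_add (θ₁ θ₂ : Z) (φ : S.D) :
    S.twist ω (θ₁ + θ₂) φ = S.twist ω θ₁ φ + S.twist ω θ₂ φ := by
  rw [twist, twist, twist, preEnergy_add_singleton, S.prod_add_cons, RadonMeasure.add_apply]
  ring

theorem twist_smul (c : ℝ) (θ : Z) (φ : S.D) :
    S.twist ω (c • θ) φ = c * S.twist ω θ φ := by
  rw [twist, twist, preEnergy_smul_singleton, S.prod_smul_cons, RadonMeasure.smul_apply]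
  ring

variable [IsOrderedAddMonoid Z] [PosSMulMono ℝ Z]

theorem FiniteEnergy.J_maPoint_le (hω : 0 ≤ ω) (hV : 0 < S.vol ω) {φ : S.D} (hφ : φ ∈ S.psh ω) :
    (maPoint hV hφ).J ≤ dimConst n * S.quasiDist ω φ 0 := by
  rw [← FiniteEnergy.gap_zero, gap_maPoint hω hV hφ]
  exact S.dirichlet_le hV hφ (S.zero_mem_psh hω)

variable [CompactSpace X]

/-- The mixed measure `θ ∧ (ω + ddᶜχ)ⁿ⁻¹`, for `θ` comparable to `ω`, is dominated by a
multiple of `MA(χ / 2)` after normalization, and so has finite energy. -/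
theorem exists_mixed_point (hω : 0 ≤ ω) (hV : 0 < S.vol ω) (ho : S.OrthogonalityProperty ω)
    (hT : S.submeanConst ω ≠ ⊤) (h1 : ω ≤ θ) (h3 : θ ≤ (3 : ℝ) • ω) {χ : S.D}
    (hχ : χ ∈ S.psh ω) :
    ∃ ν : S.FiniteEnergy ω, ν.toMeasure =
      (S.prod (θ ::ₘ Multiset.replicate (n - 1) ω) 1)⁻¹ •
        S.prod (θ ::ₘ Multiset.replicate (n - 1) (ω + S.ddc χ)) ∧
      ν.J ≤ dimConst n ^ 20 * (S.quasiDist ω χ 0 + (S.submeanConst ω).toReal) := by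
  have := nonempty_of_vol_pos hV
  have hθ : 0 ≤ θ := hω.trans h1
  have hκ := dimConst_pos n
  have hκ1 := one_le_dimConst n
  have hz := S.zero_mem_psh hω
  have hTn : 0 ≤ (S.submeanConst ω).toReal := ENNReal.toReal_nonneg
  have hq := S.quasiDist_nonneg hV hχ hz
  set r := Multiset.replicate (n - 1) (ω + S.ddc χ) with hr
  set c := S.prod (θ ::ₘ Multiset.replicate (n - 1) ω) 1 with hc
  have hcV : S.vol ω ≤ c := by
    rw [vol_eq, ← cons_replicate_self S]
    exact (isPosMultilinear_mass (S := S)).cons_mono h1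
      (IsPosMultilinear.nonneg_replicate _ hω)
  have hc0 : 0 < c := hV.trans_le hcV
  have hnn : ∀ z ∈ r, 0 ≤ z := IsPosMultilinear.nonneg_replicate _ hχ
  have hprob : (c⁻¹ • S.prod (θ ::ₘ r)).IsProbability := by
    refine ⟨fun f hf => ?_, ?_⟩
    · rw [RadonMeasure.smul_apply]
      exact mul_nonneg (inv_nonneg.mpr hc0.le) (S.prod_nonneg
        (IsPosMultilinear.nonneg_cons hθ hnn) f hf)
    · rw [RadonMeasure.smul_apply, hr, prod_cons_replicate_one, ← hc, inv_mul_cancel₀ hc0.ne']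
  set ξ : S.D := (1 / 2 : ℝ) • (χ + 0) with hξ
  have hξm : ξ ∈ S.psh ω := mid_mem_psh hχ hz
  have hξ1 : ω + S.ddc χ ≤ (2 : ℝ) • (ω + S.ddc ξ) := left_le_mid hχ hz
  have hξ2 : ω ≤ (2 : ℝ) • (ω + S.ddc ξ) := by
    calc ω = ω + S.ddc (0 : S.D) := by rw [map_zero, add_zero]
      _ ≤ _ := right_le_mid hχ hz
  have hξ3 : θ ≤ (6 : ℝ) • (ω + S.ddc ξ) := by
    refine h3.trans ((smul_le_smul_of_nonneg_left hξ2 (by norm_num)).trans_eq ?_)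
    rw [smul_smul]; norm_num
  have hξJ : (maPoint hV hξm).J ≤ dimConst n ^ 3 * S.quasiDist ω χ 0 := by
    refine (FiniteEnergy.J_maPoint_le hω hV hξm).trans ?_
    have := S.quasiDist_mid_le hω hV hχ hz le_rfl (by rwa [quasiDist_self])
    calc dimConst n * S.quasiDist ω ξ 0 ≤ dimConst n * (dimConst n ^ 2 * S.quasiDist ω χ 0) :=
          mul_le_mul_of_nonneg_left this hκ.le
      _ = _ := by ring
  have hξJ0 := (maPoint hV hξm).J_nonneg hω
  -- domination by the Monge--Ampère measure of `ξ`
  have hdom : ∀ f : C(X, ℝ), 0 ≤ f → (c⁻¹ • S.prod (θ ::ₘ r)) f ≤ dimConst n * S.MA ω ξ f := by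
    intro f hf
    have hF := isPosMultilinear_prod (S := S) hf
    have e1 : S.prod (θ ::ₘ r) f ≤ 6 * (2 ^ (n - 1) * (S.vol ω * S.MA ω ξ f)) := by
      have e2 : S.vol ω * S.MA ω ξ f = S.prod (Multiset.replicate n (ω + S.ddc ξ)) f := by
        rw [MA_apply]; field_simp
      rw [e2, ← cons_replicate_self S]
      have e3 := hF.cons_mono hξ3 hnn
      simp only [hF.smul_cons] at e3
      refine e3.trans (mul_le_mul_of_nonneg_left ?_ (by norm_num))
      have e4 := hF.replicate_add_le (a := ω + S.ddc χ) (b := ω + S.ddc ξ) hχ hξm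
        (by norm_num) hξ1 (n - 1) (s := {ω + S.ddc ξ})
        (fun x hx => by rw [Multiset.mem_singleton.mp hx]; exact hξm)
      simpa only [add_comm _ ({_} : Multiset Z), Multiset.singleton_add] using e4
    have hMA0 : 0 ≤ S.MA ω ξ f := (S.MA_isProbability hV hξm).1 f hf
    have e5 : (6 : ℝ) * 2 ^ (n - 1) ≤ dimConst n := by
      have : (2 : ℝ) ^ (n - 1) ≤ 2 ^ n := pow_le_pow_right₀ (by norm_num) (Nat.sub_le n 1)
      have h2 : (6 : ℝ) * 2 ^ (n - 1) ≤ 4 * 4 ^ n := by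
        obtain ⟨m, hm⟩ : ∃ m, n = m + 1 := ⟨n - 1, by have := S.one_le_dim; omega⟩
        rw [hm, Nat.add_sub_cancel]
        have : (2 : ℝ) ^ m ≤ 4 ^ m := pow_le_pow_left₀ (by norm_num) (by norm_num) m
        rw [pow_succ]
        nlinarith [pow_pos (show (0 : ℝ) < 4 by norm_num) m]
      rw [dimConst, pow_succ]; linarith
    rw [RadonMeasure.smul_apply, inv_mul_le_iff₀ hc0]
    calc S.prod (θ ::ₘ r) f ≤ 6 * (2 ^ (n - 1) * (S.vol ω * S.MA ω ξ f)) := e1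
      _ = (6 * 2 ^ (n - 1)) * (S.vol ω * S.MA ω ξ f) := by ring
      _ ≤ dimConst n * (c * S.MA ω ξ f) := by gcongr
      _ = _ := by ring
  have hb : ∀ φ ∈ S.psh ω, S.MAEnergy ω φ - (c⁻¹ • S.prod (θ ::ₘ r)) (φ : C(X, ℝ)) ≤
      dimConst n ^ 20 * (S.quasiDist ω χ 0 + (S.submeanConst ω).toReal) := by
    intro φ₀ hφ₀
    obtain ⟨a, hφ, h0, hx⟩ := exists_normalized hφ₀
    have e : S.MAEnergy ω φ₀ - (c⁻¹ • S.prod (θ ::ₘ r)) (φ₀ : C(X, ℝ)) =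
        S.MAEnergy ω (φ₀ - S.constD a) -
          (c⁻¹ • S.prod (θ ::ₘ r)) ((φ₀ - S.constD a : S.D) : C(X, ℝ)) := by
      rw [MAEnergy_sub_constD hV, Submodule.coe_sub, map_sub, coe_constD, map_smul,
        hprob.2, smul_eq_mul]
      ring
    rw [e]
    generalize φ₀ - S.constD a = φ at *
    have e1 := MAEnergy_le_of_nonpos hω hV hφ h0
    have e2 := hdom (-(φ : C(X, ℝ))) (fun x => by simpa using h0 x)
    rw [map_neg, map_neg] at e2
    have e3 := (maPoint hV hξm).neg_le_of_normalized hω hV ho hT hφ hx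
      (lam := (dimConst n ^ 2)⁻¹) (by positivity)
    rw [toMeasure_maPoint] at e3
    have e4 := mul_le_mul_of_nonneg_left e3 hκ.le
    generalize (maPoint hV hξm).J = j at *
    generalize (S.submeanConst ω).toReal = T at *
    generalize S.quasiDist ω φ 0 = q at *
    have e5 : dimConst n * (T + (dimConst n ^ 2)⁻¹ * (q + j) + dimConst n ^ 13 /
        (dimConst n ^ 2)⁻¹ * j) = dimConst n * T + (dimConst n)⁻¹ * q +
          ((dimConst n)⁻¹ + dimConst n ^ 16) * j := by field_simp; ring
    rw [e5] at e4
    have e6 : (dimConst n)⁻¹ + dimConst n ^ 16 ≤ dimConst n ^ 17 := by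
      have k1 : (dimConst n)⁻¹ ≤ 1 := inv_le_one_of_one_le₀ hκ1
      have k2 : 1 ≤ dimConst n ^ 16 := one_le_pow₀ hκ1
      have k3 : 4 ≤ dimConst n := by
        rw [dimConst, pow_succ]
        have : (1 : ℝ) ≤ 4 ^ n := one_le_pow₀ (by norm_num)
        linarith
      rw [pow_succ _ 16]; nlinarith
    have e7 : ((dimConst n)⁻¹ + dimConst n ^ 16) * j ≤
        dimConst n ^ 20 * S.quasiDist ω χ 0 := by
      calc ((dimConst n)⁻¹ + dimConst n ^ 16) * j ≤ dimConst n ^ 17 *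
            (dimConst n ^ 3 * S.quasiDist ω χ 0) := by gcongr
        _ = _ := by ring
    have e8 : dimConst n * T ≤ dimConst n ^ 20 * T :=
      mul_le_mul_of_nonneg_right (le_self_pow₀ hκ1 (by norm_num)) hTn
    linarith
  obtain ⟨ν, hν⟩ := FiniteEnergy.exists_of_bound hprob hb
  exact ⟨ν, hν, ν.J_le hω fun φ hφ => by rw [hν]; exact hb φ hφ⟩

/-- Hölder estimate for the twisted energy, for `θ` comparable to `ω`. -/
theorem abs_twist_sub_le_of_le (hω : 0 ≤ ω) (hV : 0 < S.vol ω) (ho : S.OrthogonalityProperty ω)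
    (hT : S.submeanConst ω ≠ ⊤) (h1 : ω ≤ θ) (h3 : θ ≤ (3 : ℝ) • ω) {φ ψ : S.D}
    (hφ : φ ∈ S.psh ω) (hψ : ψ ∈ S.psh ω) {M : ℝ} (hM1 : S.quasiDist ω φ 0 ≤ M)
    (hM2 : S.quasiDist ω ψ 0 ≤ M) :
    |S.twist ω θ φ - S.twist ω θ ψ| ≤ dimConst n ^ 33 *
      (S.quasiDist ω φ ψ ^ holderExponent n *
        (M + (S.submeanConst ω).toReal) ^ (1 - holderExponent n)) := by
  have hκ := dimConst_pos n
  have hκ1 := one_le_dimConst n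
  have hTn : 0 ≤ (S.submeanConst ω).toReal := ENNReal.toReal_nonneg
  have hM0 : 0 ≤ M := (S.quasiDist_nonneg hV hφ (S.zero_mem_psh hω)).trans hM1
  have hq := S.quasiDist_nonneg hV hφ hψ
  set T := (S.submeanConst ω).toReal
  set c := S.prod (θ ::ₘ Multiset.replicate (n - 1) ω) 1 with hc
  have hcV : S.vol ω ≤ c := by
    rw [vol_eq, ← cons_replicate_self S]
    exact (isPosMultilinear_mass (S := S)).cons_mono h1
      (IsPosMultilinear.nonneg_replicate _ hω)
  have hcV3 : c ≤ 3 * S.vol ω := by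
    have := (isPosMultilinear_mass (S := S)).cons_mono h3
      (IsPosMultilinear.nonneg_replicate (n - 1) hω)
    rwa [(isPosMultilinear_mass (S := S)).smul_cons, cons_replicate_self S, ← vol_eq] at this
  have hc0 : 0 < c := hV.trans_le hcV
  have hn : (3 : ℝ) * n ≤ dimConst n := by
    have : (n : ℝ) ≤ 4 ^ n := by exact_mod_cast (Nat.lt_pow_self (by norm_num : 1 < 4)).le
    rw [dimConst, pow_succ]
    linarith [pow_pos (show (0 : ℝ) < 4 by norm_num) n]
  have hd := fun t : ℝ => S.hasDerivAt_twist_line ω θ ψ (φ - ψ) t hV.ne'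
  have hb : ∀ t ∈ Set.Ico (0 : ℝ) 1, ‖n * ((S.vol ω)⁻¹ *
      S.prod (θ ::ₘ Multiset.replicate (n - 1) (ω + S.ddc (ψ + t • (φ - ψ))))
          ((φ - ψ : S.D) : C(X, ℝ)) - c / S.vol ω *
          S.MA ω (ψ + t • (φ - ψ)) ((φ - ψ : S.D) : C(X, ℝ)))‖ ≤ dimConst n ^ 33 *
      (S.quasiDist ω φ ψ ^ holderExponent n * (M + T) ^ (1 - holderExponent n)) := by
    intro t ht
    have hχ := line_mem_psh hφ hψ ht.1 ht.2.le
    have hχq := S.quasiDist_line_le hω hV hφ hψ ht.1 ht.2.le hM1 hM2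
    generalize ψ + t • (φ - ψ) = χ at *
    -- the derivative compares the normalized mixed measure `ν` with `MA(χ)`
    obtain ⟨ν, hν, hνJ⟩ := exists_mixed_point hω hV ho hT h1 h3 hχ
    have hJχ := FiniteEnergy.J_maPoint_le hω hV hχ
    have b0 : dimConst n ^ 20 * (S.quasiDist ω χ 0 + T) ≤ dimConst n ^ 22 * (M + T) := by
      have : dimConst n ^ 20 * T ≤ dimConst n ^ 22 * T :=
        mul_le_mul_of_nonneg_right (pow_le_pow_right₀ hκ1 (by norm_num)) hTn
      have h2 : dimConst n ^ 20 * S.quasiDist ω χ 0 ≤ dimConst n ^ 22 * M := by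
        calc dimConst n ^ 20 * S.quasiDist ω χ 0 ≤ dimConst n ^ 20 * (dimConst n ^ 2 * M) := by
              gcongr
          _ = _ := by ring
      linarith
    have b1 : ∀ x : ℝ, x ≤ M → x ≤ dimConst n ^ 22 * (M + T) := fun x hx =>
      hx.trans ((le_mul_of_one_le_left hM0 (one_le_pow₀ hκ1)).trans
        (mul_le_mul_of_nonneg_left (by linarith) (by positivity)))
    have b2 : (maPoint hV hχ).J ≤ dimConst n ^ 22 * (M + T) := by
      calc (maPoint hV hχ).J ≤ dimConst n * (dimConst n ^ 2 * M) :=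
            hJχ.trans (mul_le_mul_of_nonneg_left hχq hκ.le)
        _ = dimConst n ^ 3 * M := by ring
        _ ≤ dimConst n ^ 22 * M :=
            mul_le_mul_of_nonneg_right (pow_le_pow_right₀ hκ1 (by norm_num)) hM0
        _ ≤ _ := mul_le_mul_of_nonneg_left (by linarith) (by positivity)
    have key := FiniteEnergy.abs_sub_pow_le hω hV ho ν (maPoint hV hχ) hφ hψ
      (M := dimConst n ^ 22 * (M + T)) (b1 _ hM1) (b1 _ hM2) (hνJ.trans b0) b2
    have key2 := le_rpow_of_pow_le (abs_nonneg _) hq (by positivity) key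
    rw [toMeasure_maPoint] at key2
    have e : n * ((S.vol ω)⁻¹ * S.prod (θ ::ₘ Multiset.replicate (n - 1) (ω + S.ddc χ))
          ((φ - ψ : S.D) : C(X, ℝ)) - c / S.vol ω * S.MA ω χ ((φ - ψ : S.D) : C(X, ℝ))) =
        (n * (c / S.vol ω)) * (ν.toMeasure ((φ - ψ : S.D) : C(X, ℝ)) -
          S.MA ω χ ((φ - ψ : S.D) : C(X, ℝ))) := by
      rw [hν, ← hc, RadonMeasure.smul_apply]
      field_simp
    have hcn : (n * (c / S.vol ω)) ≤ dimConst n := by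
      have : c / S.vol ω ≤ 3 := (div_le_iff₀ hV).mpr hcV3
      calc (n * (c / S.vol ω)) ≤ n * 3 := by gcongr
        _ ≤ _ := by linarith
    have hpow : (dimConst n ^ 10 * (dimConst n ^ 22 * (M + T))) ^ (1 - holderExponent n) ≤
        dimConst n ^ 32 * (M + T) ^ (1 - holderExponent n) := by
      rw [← mul_assoc, ← pow_add, Real.mul_rpow (by positivity) (by positivity)]
      refine mul_le_mul_of_nonneg_right ?_ (by positivity)
      calc (dimConst n ^ 32) ^ (1 - holderExponent n) ≤ (dimConst n ^ 32) ^ (1 : ℝ) :=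
            Real.rpow_le_rpow_of_exponent_le (one_le_pow₀ hκ1)
              (by linarith [holderExponent_pos n])
        _ = _ := Real.rpow_one _
    rw [Real.norm_eq_abs, e, abs_mul, abs_of_nonneg (by positivity)]
    calc _ ≤ dimConst n * (S.quasiDist ω φ ψ ^ holderExponent n *
          (dimConst n ^ 32 * (M + T) ^ (1 - holderExponent n))) := by
          refine mul_le_mul hcn (key2.trans ?_) (abs_nonneg _) hκ.le
          exact mul_le_mul_of_nonneg_left hpow (by positivity)
      _ = _ := by ring
  have := norm_image_sub_le_of_norm_deriv_le_segment_01'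
    (fun t _ => (hd t).hasDerivWithinAt) hb
  simpa using this

/-- Hölder estimate for the twisted energy of an `ω`-bounded form. -/
theorem abs_twist_sub_le (hω : 0 ≤ ω) (hV : 0 < S.vol ω) (ho : S.OrthogonalityProperty ω)
    (hT : S.submeanConst ω ≠ ⊤) {K : ℝ} (hK : 0 < K) (h1 : θ ≤ K • ω) (h2 : -θ ≤ K • ω)
    {φ ψ : S.D} (hφ : φ ∈ S.psh ω) (hψ : ψ ∈ S.psh ω) {M : ℝ} (hM1 : S.quasiDist ω φ 0 ≤ M)
    (hM2 : S.quasiDist ω ψ 0 ≤ M) :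
    |S.twist ω θ φ - S.twist ω θ ψ| ≤ dimConst n ^ 34 * K *
      (S.quasiDist ω φ ψ ^ holderExponent n *
        (M + (S.submeanConst ω).toReal) ^ (1 - holderExponent n)) := by
  -- by linearity it suffices to treat forms between `ω` and `3ω`
  set θ' : Z := K⁻¹ • θ + (2 : ℝ) • ω with hθ'
  have e : θ = K • (θ' + (-2 : ℝ) • ω) := by
    rw [hθ']
    match_scalars <;> field_simp
    ring
  have h1' : K⁻¹ • θ ≤ ω := by
    have := smul_le_smul_of_nonneg_left h1 (inv_nonneg.mpr hK.le)
    rwa [smul_smul, inv_mul_cancel₀ hK.ne', one_smul] at this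
  have h2' : -(K⁻¹ • θ) ≤ ω := by
    have := smul_le_smul_of_nonneg_left h2 (inv_nonneg.mpr hK.le)
    rwa [smul_smul, inv_mul_cancel₀ hK.ne', one_smul, smul_neg] at this
  have h3 : ω ≤ θ' := by
    rw [← sub_nonneg] at h2' ⊢
    have : θ' - ω = ω - -(K⁻¹ • θ) := by rw [hθ']; module
    rwa [this]
  have h4 : θ' ≤ (3 : ℝ) • ω := by
    rw [← sub_nonneg] at h1' ⊢
    have : (3 : ℝ) • ω - θ' = ω - K⁻¹ • θ := by rw [hθ']; module
    rwa [this]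
  have h5 : ω ≤ (3 : ℝ) • ω := by
    rw [← sub_nonneg]
    have : (3 : ℝ) • ω - ω = (2 : ℝ) • ω := by module
    rw [this]
    exact smul_nonneg (by norm_num) hω
  have a1 := abs_twist_sub_le_of_le hω hV ho hT h3 h4 hφ hψ hM1 hM2
  have a2 := abs_twist_sub_le_of_le hω hV ho hT le_rfl h5 hφ hψ hM1 hM2
  have e2 : S.twist ω θ φ - S.twist ω θ ψ = K * ((S.twist ω θ' φ - S.twist ω θ' ψ) -
      2 * (S.twist ω ω φ - S.twist ω ω ψ)) := by
    have et : ∀ χ : S.D, S.twist ω θ χ = K * (S.twist ω θ' χ - 2 * S.twist ω ω χ) := fun χ => by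
      conv_lhs => rw [e, twist_smul, twist_add, twist_smul]
      ring
    rw [et, et]; ring
  have hM0 : 0 ≤ M := (S.quasiDist_nonneg hV hφ (S.zero_mem_psh hω)).trans hM1
  have hTn : 0 ≤ (S.submeanConst ω).toReal := ENNReal.toReal_nonneg
  have hq := S.quasiDist_nonneg hV hφ hψ
  have hr : 0 ≤ S.quasiDist ω φ ψ ^ holderExponent n *
        (M + (S.submeanConst ω).toReal) ^ (1 - holderExponent n) := by positivity
  generalize S.quasiDist ω φ ψ ^ holderExponent n *
        (M + (S.submeanConst ω).toReal) ^ (1 - holderExponent n) = R at *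
  have h4' : 4 ≤ dimConst n := by
    rw [dimConst, pow_succ]
    have : (1 : ℝ) ≤ 4 ^ n := one_le_pow₀ (by norm_num)
    linarith
  have hκ := dimConst_pos n
  have hP : 0 ≤ dimConst n ^ 33 * R := by positivity
  rw [e2, abs_mul, abs_of_pos hK]
  have a3 : |(S.twist ω θ' φ - S.twist ω θ' ψ) - 2 * (S.twist ω ω φ - S.twist ω ω ψ)| ≤
      dimConst n * (dimConst n ^ 33 * R) := by
    refine (abs_sub _ _).trans ?_
    rw [abs_mul, abs_of_pos (show (0 : ℝ) < 2 by norm_num)]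
    nlinarith
  calc _ ≤ K * (dimConst n * (dimConst n ^ 33 * R)) := mul_le_mul_of_nonneg_left a3 hK.le
    _ = _ := by ring

end PluripotentialSetup

/-! ### Extension by density -/

/-- A function that is Cauchy at every point of the target of a map with dense range extends
continuously. -/
theorem DenseRange.exists_continuous_extension {A B : Type*} [TopologicalSpace B] {i : A → B}
    (hi : DenseRange i) {f : A → ℝ}
    (h : ∀ b, ∀ ε > 0, ∃ U ∈ 𝓝 b, ∀ a a', i a ∈ U → i a' ∈ U → |f a - f a'| ≤ ε) :
    ∃ F : B → ℝ, Continuous F ∧ ∀ a, F (i a) = f a := by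
  let : TopologicalSpace A := TopologicalSpace.induced i inferInstance
  have hd : IsDenseInducing i := ⟨⟨rfl⟩, hi⟩
  have hc : ∀ b, ∃ c, Tendsto f (comap i (𝓝 b)) (𝓝 c) := by
    intro b
    have := hd.comap_nhds_neBot b
    have hcauchy : Cauchy (map f (comap i (𝓝 b))) := by
      refine Metric.cauchy_iff.mpr ⟨inferInstance, fun ε hε => ?_⟩
      obtain ⟨U, hU, h1⟩ := h b (ε / 2) (half_pos hε)
      refine ⟨f '' (i ⁻¹' U), image_mem_map (preimage_mem_comap hU), ?_⟩
      rintro _ ⟨a, ha, rfl⟩ _ ⟨a', ha', rfl⟩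
      exact (h1 a a' ha ha').trans_lt (half_lt_self hε)
    exact cauchy_map_iff_exists_tendsto.mp hcauchy
  refine ⟨hd.extend f, hd.continuous_extend hc, fun a => ?_⟩
  obtain ⟨c, hc⟩ := hc (i a)
  have h1 : c = f a := by
    by_contra hne
    have hpos : 0 < |c - f a| := abs_pos.mpr (sub_ne_zero.mpr hne)
    have h2 := Metric.tendsto_nhds.mp hc _ hpos
    have h3 := (mem_comap.mp h2)
    obtain ⟨U, hU, hsub⟩ := h3
    have h4 := hsub (show i a ∈ U from mem_of_mem_nhds hU)
    rw [Set.mem_ofPred_eq, Real.dist_eq, abs_sub_comm] at h4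
    exact h4.false
  rw [← h1]
  exact hd.extend_eq_of_tendsto hc

namespace PluripotentialSetup

variable {n : ℕ} {X : Type u} [TopologicalSpace X] {Z : Type v}
  [AddCommGroup Z] [Module ℝ Z] [PartialOrder Z] {S : PluripotentialSetup n X Z} {ω ω' θ : Z}
  [IsOrderedAddMonoid Z] [PosSMulMono ℝ Z]

/-- The Monge--Ampère operator, from `ω`-plurisubharmonic test functions to `M¹`. -/
def maMap (hp : S.IsPolarization ω) [CompactSpace X] (φ : S.psh ω) : S.FiniteEnergy ω :=
  maPoint hp.vol_pos φ.2

variable [CompactSpace X]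

theorem denseRange_maMap (hp : S.IsPolarization ω) (ho : S.OrthogonalityProperty ω) :
    DenseRange (maMap hp) := by
  intro μ
  choose φ hφ h using fun k : ℕ => μ.exists_gap_lt hp.1 (ε := 1 / ((k : ℝ) + 1)) (by positivity)
  refine mem_closure_of_tendsto (FiniteEnergy.tendsto_maPoint (F := atTop) hp ho hφ ?_)
    (Eventually.of_forall fun k => ⟨⟨φ k, hφ k⟩, rfl⟩)
  exact squeeze_zero (fun k => μ.gap_nonneg hp.1 (hφ k)) (fun k => (h k).le)
    tendsto_one_div_add_atTop_nhds_zero_nat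

theorem J_maMap (hp : S.IsPolarization ω) (φ : S.psh ω) :
    (maMap hp φ).J = S.dirichlet ω φ.1 0 := by
  rw [← FiniteEnergy.gap_zero, maMap, gap_maPoint hp.1]

theorem quasiDist_le_J_maMap (hp : S.IsPolarization ω) (φ : S.psh ω) :
    S.quasiDist ω φ.1 0 ≤ dimConst n * (maMap hp φ).J := by
  rw [J_maMap]
  exact S.quasiDist_le hp.vol_pos φ.2 (S.zero_mem_psh hp.1)

/-- Functions whose Monge--Ampère measures are strongly close are close, with bounds. -/
theorem exists_nhds_quasiDist_le (hp : S.IsPolarization ω) (μ : S.FiniteEnergy ω) {ε : ℝ}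
    (hε : 0 < ε) : ∃ U ∈ 𝓝 μ, (∀ φ, maMap hp φ ∈ U → |(maMap hp φ).J - μ.J| ≤ ε) ∧
      (∀ φ, maMap hp φ ∈ U → S.quasiDist ω φ.1 0 ≤ dimConst n * (μ.J + ε)) ∧
      ∀ φ ψ, maMap hp φ ∈ U → maMap hp ψ ∈ U → S.quasiDist ω φ.1 ψ.1 ≤ ε := by
  have hκ := dimConst_pos n
  obtain ⟨χ, hχ, hg⟩ := μ.exists_gap_lt hp.1 (ε := ε / dimConst n ^ 4) (by positivity)
  have h1 : ∀ᶠ ν in 𝓝 μ, ν.gap χ < ε / dimConst n ^ 4 :=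
    (FiniteEnergy.continuous_gap χ).continuousAt.eventually_lt_const hg
  have h2 : ∀ᶠ ν in 𝓝 μ, |ν.J - μ.J| < ε :=
    Metric.tendsto_nhds.mp (FiniteEnergy.continuous_J.tendsto μ) ε hε
  refine ⟨_, h1.and h2, fun φ h => h.2.le, fun φ h => ?_, fun φ ψ h h' => ?_⟩
  · refine (quasiDist_le_J_maMap hp φ).trans (mul_le_mul_of_nonneg_left ?_ hκ.le)
    linarith [(abs_lt.mp h.2).2]
  · have key : ∀ φ : S.psh ω, (maMap hp φ).gap χ < ε / dimConst n ^ 4 →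
        S.quasiDist ω φ.1 χ ≤ ε / dimConst n ^ 3 := by
      intro φ h
      rw [maMap, gap_maPoint hp.1] at h
      refine (S.quasiDist_le hp.vol_pos φ.2 hχ).trans
        ((mul_le_mul_of_nonneg_left h.le hκ.le).trans_eq ?_)
      field_simp
    refine (S.quasiDist_triangle hp.vol_pos φ.2 ψ.2 hχ (key φ h.1) (key ψ h'.1)).trans_eq ?_
    field_simp

/-! ### The Dirichlet quasi-metric -/

theorem dirichlet_eq_J (hp : S.IsPolarization ω) (φ ψ : S.psh ω) :
    S.dirichlet ω φ.1 ψ.1 = (maMap hp φ).J - (maMap hp ψ).J +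
      S.MA ω φ.1 (ψ.1 : C(X, ℝ)) - S.MA ω ψ.1 (ψ.1 : C(X, ℝ)) := by
  rw [J_maMap, J_maMap, dirichlet, dirichlet, dirichlet]
  simp only [map_sub, Submodule.coe_zero, map_zero]
  ring

/-- Continuity estimate for the Dirichlet functional. -/
theorem abs_dirichlet_sub_le (hp : S.IsPolarization ω) (φ ψ φ' ψ' : S.psh ω) {M ε : ℝ}
    (h1 : S.quasiDist ω φ.1 0 ≤ M) (h2 : S.quasiDist ω ψ.1 0 ≤ M)
    (h3 : S.quasiDist ω φ'.1 0 ≤ M) (h4 : S.quasiDist ω ψ'.1 0 ≤ M)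
    (h5 : S.quasiDist ω φ.1 φ'.1 ≤ ε) (h6 : S.quasiDist ω ψ.1 ψ'.1 ≤ ε) :
    |S.dirichlet ω φ.1 ψ.1 - S.dirichlet ω φ'.1 ψ'.1| ≤
      |(maMap hp φ).J - (maMap hp φ').J| + |(maMap hp ψ).J - (maMap hp ψ').J| +
      2 * √(dimConst n ^ 9 * M * ε) +
      ε ^ holderExponent n * (dimConst n ^ 8 * M) ^ (1 - holderExponent n) := by
  have hω := hp.1
  have hV := hp.vol_pos
  have hκ := dimConst_pos n
  have hz := S.zero_mem_psh hω
  have hM0 : 0 ≤ M := (S.quasiDist_nonneg hV φ.2 hz).trans h1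
  have hz0 : S.quasiDist ω 0 0 ≤ M := by rwa [quasiDist_self]
  have a1 := (S.MA_holder hω hV ψ.2 hz φ.2 φ'.2 h2 hz0 h1 h3).1
  have a2 := (S.MA_holder hω hV ψ'.2 hz ψ.2 ψ'.2 h4 hz0 h2 h4).1
  have a3 := (S.MA_holder hω hV ψ.2 ψ'.2 φ'.2 ψ.2 h2 h4 h3 h2).2
  have hq := S.quasiDist_nonneg hV ψ.2 ψ'.2
  have hε0 : 0 ≤ ε := hq.trans h6
  rw [sub_zero] at a1 a2
  have b1 := Real.abs_le_sqrt (a1.trans (mul_le_mul_of_nonneg_left h5 (by positivity)))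
  have b2 := Real.abs_le_sqrt (a2.trans (mul_le_mul_of_nonneg_left h6 (by positivity)))
  have b3 := (le_rpow_of_pow_le (abs_nonneg _) hq (by positivity) a3).trans
    (mul_le_mul_of_nonneg_right (Real.rpow_le_rpow hq h6 (holderExponent_pos n).le)
      (by positivity))
  rw [dirichlet_eq_J hp, dirichlet_eq_J hp]
  rw [Submodule.coe_sub, map_sub, map_sub] at b3
  rw [abs_le] at b1 b2 b3 ⊢
  have c1 := neg_abs_le ((maMap hp φ).J - (maMap hp φ').J)
  have c2 := le_abs_self ((maMap hp φ).J - (maMap hp φ').J)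
  have c3 := neg_abs_le ((maMap hp ψ).J - (maMap hp ψ').J)
  have c4 := le_abs_self ((maMap hp ψ).J - (maMap hp ψ').J)
  constructor <;> linarith [b1.1, b1.2, b2.1, b2.2, b3.1, b3.2]

/-- The modulus of continuity of the Dirichlet functional tends to `0`. -/
theorem exists_small_modulus (n : ℕ) (M : ℝ) {η : ℝ} (hη : 0 < η) :
    ∃ ε > 0, ε ≤ 1 ∧ ∀ c, 0 ≤ c → c ≤ 4 * ε + 2 * √(dimConst n ^ 9 * M * ε) +
      ε ^ holderExponent n * (dimConst n ^ 8 * M) ^ (1 - holderExponent n) → c ≤ η := by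
  have hc : ContinuousAt (fun ε : ℝ => 4 * ε + 2 * √(dimConst n ^ 9 * M * ε) +
      ε ^ holderExponent n * (dimConst n ^ 8 * M) ^ (1 - holderExponent n)) 0 := by
    refine ContinuousAt.add (by fun_prop) (ContinuousAt.mul ?_ continuousAt_const)
    exact Real.continuousAt_rpow_const _ _ (Or.inr (holderExponent_pos n).le)
  have h0 := hc.eventually_lt_const (u := η) (by
    simpa [Real.zero_rpow (holderExponent_pos n).ne'] using hη)
  obtain ⟨δ, hδ, h⟩ := Metric.eventually_nhds_iff.mp h0
  refine ⟨min 1 (δ / 2), by positivity, min_le_left _ _, fun c _ hc => hc.trans (h ?_).le⟩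
  rw [Real.dist_0_eq_abs, abs_of_pos (by positivity)]
  exact (min_le_right _ _).trans_lt (half_lt_self hδ)

/-- The Dirichlet functional extends continuously from pairs of Monge--Ampère measures to pairs of
measures of finite energy. -/
theorem exists_dirichletQuasiMetric (hp : S.IsPolarization ω) (ho : S.OrthogonalityProperty ω) :
    ∃ d : S.FiniteEnergy ω × S.FiniteEnergy ω → ℝ, Continuous d ∧
      ∀ φ ψ : S.psh ω, d (maMap hp φ, maMap hp ψ) = S.dirichlet ω φ.1 ψ.1 := by
  have hdense := (denseRange_maMap hp ho).prodMap (denseRange_maMap hp ho)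
  obtain ⟨d, hd, h⟩ := hdense.exists_continuous_extension
    (f := fun p : S.psh ω × S.psh ω => S.dirichlet ω p.1.1 p.2.1) (by
      rintro ⟨μ, ν⟩ η hη
      set M := dimConst n * (μ.J + ν.J + 1) with hM
      obtain ⟨ε, hε, hε1, hmod⟩ := exists_small_modulus n M hη
      obtain ⟨U, hU, u1, u2, u3⟩ := exists_nhds_quasiDist_le hp μ hε
      obtain ⟨W, hW, w1, w2, w3⟩ := exists_nhds_quasiDist_le hp ν hε
      refine ⟨U ×ˢ W, prod_mem_nhds hU hW, ?_⟩
      rintro ⟨φ, ψ⟩ ⟨φ', ψ'⟩ ⟨k1, k2⟩ ⟨k3, k4⟩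
      simp only [Prod.map] at k1 k2 k3 k4
      have hκ := dimConst_pos n
      have hμ := μ.J_nonneg hp.1
      have hν := ν.J_nonneg hp.1
      have hMu : ∀ x, x ≤ dimConst n * (μ.J + ε) → x ≤ M := fun x hx =>
        hx.trans (mul_le_mul_of_nonneg_left (by linarith) hκ.le)
      have hMw : ∀ x, x ≤ dimConst n * (ν.J + ε) → x ≤ M := fun x hx =>
        hx.trans (mul_le_mul_of_nonneg_left (by linarith) hκ.le)
      refine hmod _ (abs_nonneg _) ((abs_dirichlet_sub_le hp φ ψ φ' ψ' (hMu _ (u2 _ k1))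
        (hMw _ (w2 _ k2)) (hMu _ (u2 _ k3)) (hMw _ (w2 _ k4)) (u3 _ _ k1 k3)
        (w3 _ _ k2 k4)).trans ?_)
      have a1 := abs_le.mp (u1 _ k1)
      have a2 := abs_le.mp (u1 _ k3)
      have a3 := abs_le.mp (w1 _ k2)
      have a4 := abs_le.mp (w1 _ k4)
      have b1 : |(maMap hp φ).J - (maMap hp φ').J| ≤ 2 * ε :=
        abs_le.mpr ⟨by linarith [a1.1, a2.2], by linarith [a1.2, a2.1]⟩
      have b2 : |(maMap hp ψ).J - (maMap hp ψ').J| ≤ 2 * ε :=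
        abs_le.mpr ⟨by linarith [a3.1, a4.2], by linarith [a3.2, a4.1]⟩
      linarith)
  exact ⟨d, hd, fun φ ψ => h (φ, ψ)⟩

/-- The Dirichlet quasi-metric of `M¹`: the continuous extension of the Dirichlet functional along
`(φ, ψ) ↦ (MA_ω(φ), MA_ω(ψ))`. -/
def dirichletMetric (hp : S.IsPolarization ω) (ho : S.OrthogonalityProperty ω)
    (μ ν : S.FiniteEnergy ω) : ℝ := (exists_dirichletQuasiMetric hp ho).choose (μ, ν)

theorem continuous_dirichletMetric (hp : S.IsPolarization ω) (ho : S.OrthogonalityProperty ω) :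
    Continuous (Function.uncurry (dirichletMetric hp ho)) :=
  (exists_dirichletQuasiMetric hp ho).choose_spec.1

theorem dirichletMetric_maMap (hp : S.IsPolarization ω) (ho : S.OrthogonalityProperty ω)
    (φ ψ : S.psh ω) :
    dirichletMetric hp ho (maMap hp φ) (maMap hp ψ) = S.dirichlet ω φ.1 ψ.1 :=
  (exists_dirichletQuasiMetric hp ho).choose_spec.2 φ ψ

theorem dirichletMetric_nonneg (hp : S.IsPolarization ω) (ho : S.OrthogonalityProperty ω)
    (μ ν : S.FiniteEnergy ω) : 0 ≤ dirichletMetric hp ho μ ν := by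
  refine (denseRange_maMap hp ho).induction_on₂
    (p := fun μ ν => 0 ≤ dirichletMetric hp ho μ ν) ?_ (fun φ ψ => ?_) μ ν
  · exact isClosed_le continuous_const (continuous_dirichletMetric hp ho)
  · rw [dirichletMetric_maMap]
    exact S.dirichlet_nonneg hp.vol_pos φ.2 ψ.2

/-- The quasi-distance from `μ` to a Monge--Ampère measure is the gap in the variational problem
defining the energy of `μ`. -/
theorem dirichletMetric_right (hp : S.IsPolarization ω) (ho : S.OrthogonalityProperty ω)
    (μ : S.FiniteEnergy ω) (ψ : S.psh ω) :
    dirichletMetric hp ho μ (maMap hp ψ) = μ.gap ψ.1 := by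
  refine (denseRange_maMap hp ho).induction_on
    (p := fun μ => dirichletMetric hp ho μ (maMap hp ψ) = μ.gap ψ.1) μ ?_ (fun φ => ?_)
  · refine isClosed_eq ?_ (FiniteEnergy.continuous_gap _)
    exact (continuous_dirichletMetric hp ho).comp (Continuous.prodMk continuous_id continuous_const)
  · rw [dirichletMetric_maMap, maMap, gap_maPoint hp.1]

theorem isDirichletQuasiMetric (hp : S.IsPolarization ω) (ho : S.OrthogonalityProperty ω) :
    S.IsDirichletQuasiMetric ω (dirichletMetric hp ho) :=
  ⟨dirichletMetric_nonneg hp ho, continuous_dirichletMetric hp ho, fun φ hφ ψ hψ =>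
    ⟨maMap hp ⟨φ, hφ⟩, maMap hp ⟨ψ, hψ⟩, rfl, rfl, dirichletMetric_maMap hp ho _ _⟩⟩

theorem IsDirichletQuasiMetric.eq (hp : S.IsPolarization ω) (ho : S.OrthogonalityProperty ω)
    {d : S.FiniteEnergy ω → S.FiniteEnergy ω → ℝ} (h : S.IsDirichletQuasiMetric ω d) :
    d = dirichletMetric hp ho := by
  funext μ ν
  refine (denseRange_maMap hp ho).induction_on₂
    (p := fun μ ν => d μ ν = dirichletMetric hp ho μ ν) ?_ (fun φ ψ => ?_) μ ν
  · exact isClosed_eq h.2.1 (continuous_dirichletMetric hp ho)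
  · obtain ⟨μ', ν', h1, h2, h3⟩ := h.2.2 φ.1 φ.2 ψ.1 ψ.2
    have e1 : μ' = maMap hp φ := FiniteEnergy.toMeasure_injective h1
    have e2 : ν' = maMap hp ψ := FiniteEnergy.toMeasure_injective h2
    rw [← e1, ← e2, h3, e1, e2, dirichletMetric_maMap]

end PluripotentialSetup

namespace PluripotentialSetup

variable {n : ℕ} {X : Type u} [TopologicalSpace X] {Z : Type v}
  [AddCommGroup Z] [Module ℝ Z] [PartialOrder Z] {S : PluripotentialSetup n X Z} {ω ω' θ : Z}

theorem hasDerivAt_MAEnergy_zero (hV : S.vol ω ≠ 0) (θ : Z) (φ : S.D) :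
    HasDerivAt (fun t : ℝ => S.MAEnergy (ω + t • θ) φ) (S.twist ω θ φ) 0 := by
  simpa using S.hasDerivAt_MAEnergy ω θ φ 0 0 (by simpa using hV)

theorem FiniteEnergy.Jplus_nonneg (hω : 0 ≤ ω) (μ : S.FiniteEnergy ω) : 0 ≤ μ.Jplus :=
  add_nonneg (μ.J_nonneg hω) ENNReal.toReal_nonneg

theorem FiniteEnergy.continuous_Jplus :
    Continuous (FiniteEnergy.Jplus : S.FiniteEnergy ω → ℝ) :=
  FiniteEnergy.continuous_J.add continuous_const

variable [IsOrderedAddMonoid Z] [PosSMulMono ℝ Z] [CompactSpace X]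

/-! ### The twisted energy of measures -/

/-- Hölder estimate for the twisted energy of an arbitrary form. -/
theorem exists_abs_twist_sub_le (hS : S.SubmeanValueProperty) (hp : S.IsPolarization ω)
    (ho : S.OrthogonalityProperty ω) (θ : Z) :
    ∃ B : ℝ, 0 < B ∧ ∀ φ ∈ S.psh ω, ∀ ψ ∈ S.psh ω, ∀ M, S.quasiDist ω φ 0 ≤ M →
      S.quasiDist ω ψ 0 ≤ M → |S.twist ω θ φ - S.twist ω θ ψ| ≤
        B * (S.quasiDist ω φ ψ ^ holderExponent n * (M + 1) ^ (1 - holderExponent n)) := by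
  obtain ⟨K, hK, g, hg, h1, h2⟩ := hp.exists_bound θ
  have hpg := hp.add_ddc hg
  have hT := hpg.submeanConst_ne_top hS
  have hV := hp.vol_pos
  have hκ := dimConst_pos n
  have hκ1 := one_le_dimConst n
  have hz := S.zero_mem_psh hp.1
  have hq := S.quasiDist_nonneg hV hg hz
  have hTn : 0 ≤ (S.submeanConst (ω + S.ddc g)).toReal := ENNReal.toReal_nonneg
  set B₁ := dimConst n ^ 3 + dimConst n ^ 3 * S.quasiDist ω g 0 +
    (S.submeanConst (ω + S.ddc g)).toReal with hB₁
  have hB₁0 : 0 < B₁ := by positivity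
  refine ⟨dimConst n ^ 34 * K * B₁ ^ (1 - holderExponent n), by positivity,
    fun φ hφ ψ hψ M hM1 hM2 => ?_⟩
  have hM0 : 0 ≤ M := (S.quasiDist_nonneg hV hφ hz).trans hM1
  have hqg : ∀ χ ∈ S.psh ω, S.quasiDist ω χ 0 ≤ M →
      S.quasiDist (ω + S.ddc g) (χ - g) 0 ≤ dimConst n ^ 3 * (M + S.quasiDist ω g 0) := by
    intro χ hχ hM
    have e := quasiDist_shift ω g χ g
    rw [sub_self] at e
    rw [e]
    exact S.quasiDist_le_zero_right hp.1 hV hχ hg (by linarith) (by linarith)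
  have key := abs_twist_sub_le hpg.1 hpg.vol_pos (ho.shift g) hT hK h1 h2
    (sub_mem_psh_shift.mpr hφ) (sub_mem_psh_shift.mpr hψ) (hqg φ hφ hM1) (hqg ψ hψ hM2)
  rw [quasiDist_shift, twist_shift hV.ne', twist_shift hV.ne', sub_sub_sub_cancel_right] at key
  refine key.trans ?_
  have e : (dimConst n ^ 3 * (M + S.quasiDist ω g 0) +
      (S.submeanConst (ω + S.ddc g)).toReal) ^ (1 - holderExponent n) ≤
      B₁ ^ (1 - holderExponent n) * (M + 1) ^ (1 - holderExponent n) := by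
    rw [← Real.mul_rpow hB₁0.le (by linarith)]
    refine Real.rpow_le_rpow (by positivity) ?_ (by linarith [holderExponent_le_one n])
    have : 0 ≤ M * (dimConst n ^ 3 * S.quasiDist ω g 0 +
        (S.submeanConst (ω + S.ddc g)).toReal) + dimConst n ^ 3 := by positivity
    rw [hB₁]
    linarith
  have hqq := S.quasiDist_nonneg hV hφ hψ
  calc _ ≤ dimConst n ^ 34 * K * (S.quasiDist ω φ ψ ^ holderExponent n *
        (B₁ ^ (1 - holderExponent n) * (M + 1) ^ (1 - holderExponent n))) := by gcongr
    _ = _ := by ring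

/-- The twisted energy extends continuously from Monge--Ampère measures to measures of finite
energy. -/
theorem exists_twistedEnergy (hS : S.SubmeanValueProperty) (hp : S.IsPolarization ω)
    (ho : S.OrthogonalityProperty ω) (θ : Z) :
    ∃ F : S.FiniteEnergy ω → ℝ, Continuous F ∧
      ∀ φ : S.psh ω, F (maMap hp φ) = S.twist ω θ φ.1 := by
  obtain ⟨B, hB, hb⟩ := exists_abs_twist_sub_le hS hp ho θ
  refine (denseRange_maMap hp ho).exists_continuous_extension
    (f := fun φ : S.psh ω => S.twist ω θ φ.1) fun μ η hη => ?_
  have hκ := dimConst_pos n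
  have hμ := μ.J_nonneg hp.1
  set M := dimConst n * (μ.J + 1) with hM
  have hc : ContinuousAt (fun ε : ℝ => B * (ε ^ holderExponent n *
      (M + 1) ^ (1 - holderExponent n))) 0 := by
    refine continuousAt_const.mul (ContinuousAt.mul ?_ continuousAt_const)
    exact Real.continuousAt_rpow_const _ _ (Or.inr (holderExponent_pos n).le)
  have h0 := hc.eventually_lt_const (u := η) (by
    simpa [Real.zero_rpow (holderExponent_pos n).ne'] using hη)
  obtain ⟨δ, hδ, h⟩ := Metric.eventually_nhds_iff.mp h0
  have hε : 0 < min 1 (δ / 2) := by positivity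
  have hε' : min 1 (δ / 2) < δ := (min_le_right _ _).trans_lt (half_lt_self hδ)
  obtain ⟨U, hU, -, u2, u3⟩ := exists_nhds_quasiDist_le hp μ hε
  refine ⟨U, hU, fun φ ψ hφ hψ => ?_⟩
  have hMu : ∀ x, x ≤ dimConst n * (μ.J + min 1 (δ / 2)) → x ≤ M := fun x hx =>
    hx.trans (mul_le_mul_of_nonneg_left (by linarith [min_le_left 1 (δ / 2)]) hκ.le)
  refine (hb φ.1 φ.2 ψ.1 ψ.2 M (hMu _ (u2 _ hφ)) (hMu _ (u2 _ hψ))).trans ?_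
  have hq := S.quasiDist_nonneg hp.vol_pos φ.2 ψ.2
  refine (h (y := S.quasiDist ω φ.1 ψ.1) ?_).le
  rw [Real.dist_0_eq_abs, abs_of_nonneg hq]
  exact (u3 _ _ hφ hψ).trans_lt hε'

/-- The `θ`-twisted energy of a measure: the continuous extension of `twist` along
`φ ↦ MA_ω(φ)`. -/
def twistedEnergy (hS : S.SubmeanValueProperty) (hp : S.IsPolarization ω)
    (ho : S.OrthogonalityProperty ω) (θ : Z) : S.FiniteEnergy ω → ℝ :=
  (exists_twistedEnergy hS hp ho θ).choose

theorem continuous_twistedEnergy (hS : S.SubmeanValueProperty) (hp : S.IsPolarization ω)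
    (ho : S.OrthogonalityProperty ω) (θ : Z) : Continuous (twistedEnergy hS hp ho θ) :=
  (exists_twistedEnergy hS hp ho θ).choose_spec.1

theorem twistedEnergy_maMap (hS : S.SubmeanValueProperty) (hp : S.IsPolarization ω)
    (ho : S.OrthogonalityProperty ω) (θ : Z) (φ : S.psh ω) :
    twistedEnergy hS hp ho θ (maMap hp φ) = S.twist ω θ φ.1 :=
  (exists_twistedEnergy hS hp ho θ).choose_spec.2 φ

theorem isTwistedEnergy_twistedEnergy (hS : S.SubmeanValueProperty) (hp : S.IsPolarization ω)
    (ho : S.OrthogonalityProperty ω) (θ : Z) :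
    S.IsTwistedEnergy ω θ (twistedEnergy hS hp ho θ) := by
  refine ⟨continuous_twistedEnergy hS hp ho θ, fun φ hφ => ⟨maMap hp ⟨φ, hφ⟩, rfl, ?_⟩⟩
  rw [twistedEnergy_maMap]
  exact hasDerivAt_MAEnergy_zero hp.vol_pos.ne' θ φ

theorem IsTwistedEnergy.eq (hS : S.SubmeanValueProperty) (hp : S.IsPolarization ω)
    (ho : S.OrthogonalityProperty ω) {F : S.FiniteEnergy ω → ℝ} (h : S.IsTwistedEnergy ω θ F) :
    F = twistedEnergy hS hp ho θ := by
  refine Continuous.ext_on (denseRange_maMap hp ho) h.1 (continuous_twistedEnergy hS hp ho θ) ?_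
  rintro _ ⟨φ, rfl⟩
  obtain ⟨μ, h1, h2⟩ := h.2 φ.1 φ.2
  have e : μ = maMap hp φ := FiniteEnergy.toMeasure_injective h1
  rw [← e, h2.unique (hasDerivAt_MAEnergy_zero hp.vol_pos.ne' θ φ.1), e, twistedEnergy_maMap]

/-- The twisted energy, as a linear function of the twisting form. -/
def twistedEnergyLinear (hS : S.SubmeanValueProperty) (hp : S.IsPolarization ω)
    (ho : S.OrthogonalityProperty ω) : Z →ₗ[ℝ] (S.FiniteEnergy ω → ℝ) where
  toFun := twistedEnergy hS hp ho
  map_add' θ₁ θ₂ := by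
    refine Continuous.ext_on (denseRange_maMap hp ho) (continuous_twistedEnergy hS hp ho _)
      ((continuous_twistedEnergy hS hp ho _).add (continuous_twistedEnergy hS hp ho _)) ?_
    rintro _ ⟨φ, rfl⟩
    simp only [Pi.add_apply, twistedEnergy_maMap, twist_add]
  map_smul' c θ := by
    refine Continuous.ext_on (denseRange_maMap hp ho) (continuous_twistedEnergy hS hp ho _)
      (continuous_const.mul (continuous_twistedEnergy hS hp ho θ)) ?_
    rintro _ ⟨φ, rfl⟩
    rw [RingHom.id_apply, Pi.smul_apply, smul_eq_mul, twistedEnergy_maMap, twistedEnergy_maMap,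
      twist_smul]

theorem rpow_mul_rpow_le (n : ℕ) {a b : ℝ} (ha : 0 ≤ a) (hab : a ≤ b) :
    a ^ holderExponent n * b ^ (1 - holderExponent n) ≤ b := by
  have hb : 0 ≤ b := ha.trans hab
  calc a ^ holderExponent n * b ^ (1 - holderExponent n) ≤
      b ^ holderExponent n * b ^ (1 - holderExponent n) :=
        mul_le_mul_of_nonneg_right (Real.rpow_le_rpow ha hab (holderExponent_pos n).le)
          (by positivity)
    _ = b := by
        rw [← Real.rpow_add_of_nonneg hb (holderExponent_pos n).le
          (by linarith [holderExponent_le_one n]), add_sub_cancel, Real.rpow_one]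

theorem rpow_mul_rpow_mono (n : ℕ) {a a' b b' c : ℝ} (hc : 1 ≤ c) (ha : 0 ≤ a) (ha' : 0 ≤ a')
    (hb : 0 ≤ b) (hb' : 0 ≤ b') (h1 : a' ≤ c * a) (h2 : b' ≤ c * b) :
    a' ^ holderExponent n * b' ^ (1 - holderExponent n) ≤
      c * (a ^ holderExponent n * b ^ (1 - holderExponent n)) := by
  have hα := holderExponent_pos n
  have hα1 := holderExponent_le_one n
  have hc0 : 0 ≤ c := by linarith
  calc a' ^ holderExponent n * b' ^ (1 - holderExponent n)
      ≤ (c * a) ^ holderExponent n * (c * b) ^ (1 - holderExponent n) := by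
        gcongr
    _ = (c ^ holderExponent n * c ^ (1 - holderExponent n)) *
        (a ^ holderExponent n * b ^ (1 - holderExponent n)) := by
        rw [Real.mul_rpow hc0 ha, Real.mul_rpow hc0 hb]; ring
    _ = _ := by
        rw [← Real.rpow_add_of_nonneg hc0 hα.le (by linarith), add_sub_cancel, Real.rpow_one]

/-- Hölder continuity of the twisted energy for the Dirichlet quasi-metric, when `θ` is
`ω`-bounded. -/
theorem abs_twistedEnergy_sub_le (hS : S.SubmeanValueProperty) (hp : S.IsPolarization ω)
    (ho : S.OrthogonalityProperty ω) {K : ℝ} (hK : 0 < K) (h1 : θ ≤ K • ω) (h2 : -θ ≤ K • ω)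
    (μ ν : S.FiniteEnergy ω) :
    |twistedEnergy hS hp ho θ μ - twistedEnergy hS hp ho θ ν| ≤ dimConst n ^ 35 * K *
      (dirichletMetric hp ho μ ν ^ holderExponent n *
        (max μ.Jplus ν.Jplus) ^ (1 - holderExponent n)) := by
  have hα := holderExponent_pos n
  have hα1 := holderExponent_le_one n
  have hκ := dimConst_pos n
  have hκ1 := one_le_dimConst n
  refine (denseRange_maMap hp ho).induction_on₂ (p := fun μ ν =>
    |twistedEnergy hS hp ho θ μ - twistedEnergy hS hp ho θ ν| ≤ dimConst n ^ 35 * K *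
      (dirichletMetric hp ho μ ν ^ holderExponent n *
        (max μ.Jplus ν.Jplus) ^ (1 - holderExponent n))) ?_ (fun φ ψ => ?_) μ ν
  · have c1 := continuous_twistedEnergy hS hp ho θ
    have c2 := FiniteEnergy.continuous_Jplus (S := S) (ω := ω)
    refine isClosed_le (((c1.comp continuous_fst).sub (c1.comp continuous_snd)).abs)
      (continuous_const.mul (Continuous.mul ?_ ?_))
    · exact (continuous_dirichletMetric hp ho).rpow_const fun _ => Or.inr hα.le
    · exact ((c2.comp continuous_fst).max (c2.comp continuous_snd)).rpow_const
        fun _ => Or.inr (by linarith)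
  · have hT := hp.submeanConst_ne_top hS
    have hTn : 0 ≤ (S.submeanConst ω).toReal := ENNReal.toReal_nonneg
    set m := max (maMap hp φ).J (maMap hp ψ).J with hm
    have hm0 : 0 ≤ m := ((maMap hp φ).J_nonneg hp.1).trans (le_max_left _ _)
    have b1 := (quasiDist_le_J_maMap hp φ).trans
      (mul_le_mul_of_nonneg_left (le_max_left _ (maMap hp ψ).J) hκ.le)
    have b2 := (quasiDist_le_J_maMap hp ψ).trans
      (mul_le_mul_of_nonneg_left (le_max_right (maMap hp φ).J _) hκ.le)
    have key := abs_twist_sub_le hp.1 hp.vol_pos ho hT hK h1 h2 φ.2 ψ.2 b1 b2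
    have e : max (maMap hp φ).Jplus (maMap hp ψ).Jplus = m + (S.submeanConst ω).toReal := by
      rw [FiniteEnergy.Jplus, FiniteEnergy.Jplus, max_add_add_right]
    rw [twistedEnergy_maMap, twistedEnergy_maMap, dirichletMetric_maMap, e]
    refine key.trans ?_
    have := rpow_mul_rpow_mono n hκ1 (S.dirichlet_nonneg hp.vol_pos φ.2 ψ.2)
      (S.quasiDist_nonneg hp.vol_pos φ.2 ψ.2) (add_nonneg hm0 hTn) (by positivity)
      (S.quasiDist_le hp.vol_pos φ.2 ψ.2)
      (b' := dimConst n * m + (S.submeanConst ω).toReal) (by nlinarith)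
    calc _ ≤ dimConst n ^ 34 * K * _ := mul_le_mul_of_nonneg_left this (by positivity)
      _ = _ := by ring

theorem abs_twistedEnergy_le (hS : S.SubmeanValueProperty) (hp : S.IsPolarization ω)
    (ho : S.OrthogonalityProperty ω) {K : ℝ} (hK : 0 < K) (h1 : θ ≤ K • ω) (h2 : -θ ≤ K • ω)
    (μ : S.FiniteEnergy ω) :
    |twistedEnergy hS hp ho θ μ| ≤ dimConst n ^ 35 * K * μ.Jplus := by
  have hκ := dimConst_pos n
  have hκ1 := one_le_dimConst n
  refine (denseRange_maMap hp ho).induction_on (p := fun μ =>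
    |twistedEnergy hS hp ho θ μ| ≤ dimConst n ^ 35 * K * μ.Jplus) μ ?_ (fun φ => ?_)
  · exact isClosed_le (continuous_twistedEnergy hS hp ho θ).abs
      (continuous_const.mul FiniteEnergy.continuous_Jplus)
  · have hT := hp.submeanConst_ne_top hS
    have hTn : 0 ≤ (S.submeanConst ω).toReal := ENNReal.toReal_nonneg
    have hz := S.zero_mem_psh hp.1
    have hq := S.quasiDist_nonneg hp.vol_pos φ.2 hz
    have key := abs_twist_sub_le hp.1 hp.vol_pos ho hT hK h1 h2 φ.2 hz le_rfl
      (by rwa [quasiDist_self])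
    rw [S.twist_zero, sub_zero] at key
    rw [twistedEnergy_maMap, FiniteEnergy.Jplus]
    refine key.trans ?_
    have e1 := rpow_mul_rpow_le n hq (le_add_of_nonneg_right hTn)
    have e2 := quasiDist_le_J_maMap hp φ
    calc _ ≤ dimConst n ^ 34 * K * (dimConst n * ((maMap hp φ).J +
          (S.submeanConst ω).toReal)) := mul_le_mul_of_nonneg_left (by nlinarith) (by positivity)
      _ = _ := by ring

theorem exists_abs_twistedEnergy_le (hS : S.SubmeanValueProperty) (hp : S.IsPolarization ω)
    (ho : S.OrthogonalityProperty ω) (θ : Z) :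
    ∃ B : ℝ, 0 < B ∧ (∀ μ ν : S.FiniteEnergy ω,
      |twistedEnergy hS hp ho θ μ - twistedEnergy hS hp ho θ ν| ≤
        B * dirichletMetric hp ho μ ν ^ holderExponent n *
          (max μ.J ν.J + 1) ^ (1 - holderExponent n)) ∧
      ∀ μ : S.FiniteEnergy ω, |twistedEnergy hS hp ho θ μ| ≤ B * (μ.J + 1) := by
  obtain ⟨B, hB, hb⟩ := exists_abs_twist_sub_le hS hp ho θ
  have hα := holderExponent_pos n
  have hα1 := holderExponent_le_one n
  have hκ := dimConst_pos n
  have hκ1 := one_le_dimConst n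
  have hz := S.zero_mem_psh hp.1
  refine ⟨B * dimConst n, by positivity, fun μ ν => ?_, fun μ => ?_⟩
  · refine (denseRange_maMap hp ho).induction_on₂ (p := fun μ ν =>
      |twistedEnergy hS hp ho θ μ - twistedEnergy hS hp ho θ ν| ≤
        B * dimConst n * dirichletMetric hp ho μ ν ^ holderExponent n *
          (max μ.J ν.J + 1) ^ (1 - holderExponent n)) ?_ (fun φ ψ => ?_) μ ν
    · have c1 := continuous_twistedEnergy hS hp ho θ
      have c2 := FiniteEnergy.continuous_J (S := S) (ω := ω)
      refine isClosed_le (((c1.comp continuous_fst).sub (c1.comp continuous_snd)).abs)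
        (Continuous.mul (continuous_const.mul ?_) ?_)
      · exact (continuous_dirichletMetric hp ho).rpow_const fun _ => Or.inr hα.le
      · exact (((c2.comp continuous_fst).max (c2.comp continuous_snd)).add
          continuous_const).rpow_const fun _ => Or.inr (by linarith)
    · set m := max (maMap hp φ).J (maMap hp ψ).J with hm
      have hm0 : 0 ≤ m := ((maMap hp φ).J_nonneg hp.1).trans (le_max_left _ _)
      have b1 := (quasiDist_le_J_maMap hp φ).trans
        (mul_le_mul_of_nonneg_left (le_max_left _ (maMap hp ψ).J) hκ.le)
      have b2 := (quasiDist_le_J_maMap hp ψ).trans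
        (mul_le_mul_of_nonneg_left (le_max_right (maMap hp φ).J _) hκ.le)
      rw [twistedEnergy_maMap, twistedEnergy_maMap, dirichletMetric_maMap]
      refine (hb _ φ.2 _ ψ.2 _ b1 b2).trans ?_
      have := rpow_mul_rpow_mono n hκ1 (S.dirichlet_nonneg hp.vol_pos φ.2 ψ.2)
        (S.quasiDist_nonneg hp.vol_pos φ.2 ψ.2) (add_nonneg hm0 zero_le_one) (by positivity)
        (S.quasiDist_le hp.vol_pos φ.2 ψ.2) (b' := dimConst n * m + 1) (by nlinarith)
      calc _ ≤ B * _ := mul_le_mul_of_nonneg_left this hB.le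
        _ = _ := by ring
  · refine (denseRange_maMap hp ho).induction_on (p := fun μ =>
      |twistedEnergy hS hp ho θ μ| ≤ B * dimConst n * (μ.J + 1)) μ ?_ (fun φ => ?_)
    · exact isClosed_le (continuous_twistedEnergy hS hp ho θ).abs
        (continuous_const.mul (FiniteEnergy.continuous_J.add continuous_const))
    · have hq := S.quasiDist_nonneg hp.vol_pos φ.2 hz
      have key := hb _ φ.2 _ hz _ le_rfl (by rwa [quasiDist_self])
      rw [S.twist_zero, sub_zero] at key
      rw [twistedEnergy_maMap]
      refine key.trans ?_
      have e1 := rpow_mul_rpow_le n hq (le_add_of_nonneg_right zero_le_one)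
      have e2 := quasiDist_le_J_maMap hp φ
      calc _ ≤ B * (dimConst n * ((maMap hp φ).J + 1)) :=
            mul_le_mul_of_nonneg_left (by nlinarith) hB.le
        _ = _ := by ring

/-- The twisted energy of a measure is approximated by that of almost maximizers. -/
theorem abs_twist_sub_twistedEnergy_le (hS : S.SubmeanValueProperty) (hp : S.IsPolarization ω)
    (ho : S.OrthogonalityProperty ω) {K : ℝ} (hK : 0 < K) (h1 : θ ≤ K • ω) (h2 : -θ ≤ K • ω)
    (μ : S.FiniteEnergy ω) {φ : S.D} (hφ : φ ∈ S.psh ω) :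
    |S.twist ω θ φ - twistedEnergy hS hp ho θ μ| ≤ dimConst n ^ 38 * K *
      (μ.gap φ ^ holderExponent n * (μ.gap φ + μ.Jplus) ^ (1 - holderExponent n)) := by
  have hκ := dimConst_pos n
  have hκ1 := one_le_dimConst n
  have hTn : 0 ≤ (S.submeanConst ω).toReal := ENNReal.toReal_nonneg
  have hg := μ.gap_nonneg hp.1 hφ
  have hJ := μ.J_nonneg hp.1
  have key := abs_twistedEnergy_sub_le hS hp ho hK h1 h2 μ (maMap hp ⟨φ, hφ⟩)
  rw [twistedEnergy_maMap, dirichletMetric_right, abs_sub_comm] at key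
  refine key.trans ?_
  have h3 : (maMap hp ⟨φ, hφ⟩).J ≤ dimConst n ^ 3 * (μ.gap φ + μ.J) := by
    refine (FiniteEnergy.J_maPoint_le hp.1 hp.vol_pos hφ).trans ?_
    calc _ ≤ dimConst n * (dimConst n ^ 2 * (μ.gap φ + μ.J)) :=
          mul_le_mul_of_nonneg_left (μ.quasiDist_zero_le hp.1 hp.vol_pos hφ) hκ.le
      _ = _ := by ring
  have hκ3 : 1 ≤ dimConst n ^ 3 := one_le_pow₀ hκ1
  have h4 : max μ.Jplus (maMap hp ⟨φ, hφ⟩).Jplus ≤ dimConst n ^ 3 * (μ.gap φ + μ.Jplus) := by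
    simp only [FiniteEnergy.Jplus]
    refine max_le ?_ ?_ <;> nlinarith
  have h0 : 0 ≤ max μ.Jplus (maMap hp ⟨φ, hφ⟩).Jplus :=
    (μ.Jplus_nonneg hp.1).trans (le_max_left _ _)
  have := rpow_mul_rpow_mono n hκ3 hg hg (add_nonneg hg (μ.Jplus_nonneg hp.1)) h0
    (le_mul_of_one_le_left hg hκ3) h4
  calc _ ≤ dimConst n ^ 35 * K * _ := mul_le_mul_of_nonneg_left this (by positivity)
    _ = _ := by ring

end PluripotentialSetup

namespace PluripotentialSetup

variable {n : ℕ} {X : Type u} [TopologicalSpace X] {Z : Type v}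
  [AddCommGroup Z] [Module ℝ Z] [PartialOrder Z] {S : PluripotentialSetup n X Z} {ω ω' θ : Z}

/-! ### The norm defined by `ω` -/

theorem le_mul_of_forall_lt {x a N : ℝ} (h : ∀ K, N < K → x ≤ a * K) : x ≤ a * N := by
  have : Tendsto (fun K : ℝ => a * K) (𝓝[>] N) (𝓝 (a * N)) :=
    (tendsto_id.const_mul a).mono_left nhdsWithin_le_nhds
  exact ge_of_tendsto this (eventually_nhdsWithin_of_forall h)

variable [IsOrderedAddMonoid Z] [PosSMulMono ℝ Z]

theorem le_smul_of_formNorm_lt (hω : 0 ≤ ω) (h : S.formNorm ω θ < ⊤) {K : ℝ}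
    (hK : (S.formNorm ω θ).toReal < K) : θ ≤ K • ω ∧ -θ ≤ K • ω := by
  have hK0 : 0 < K := ENNReal.toReal_nonneg.trans_lt hK
  have h1 : S.formNorm ω θ < ENNReal.ofReal K := (ENNReal.lt_ofReal_iff_toReal_lt h.ne).mpr hK
  simp only [formNorm, iInf_lt_iff] at h1
  obtain ⟨C, hC, hlt⟩ := h1
  have h2 : (C : ℝ) ≤ K := by
    rw [← ENNReal.ofReal_coe_nnreal, ENNReal.ofReal_lt_ofReal_iff hK0] at hlt
    exact hlt.le
  exact ⟨le_smul_of_le_smul hω hC.1 h2, le_smul_of_le_smul hω hC.2 h2⟩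

theorem exists_thompson (hω : 0 ≤ ω) (hω' : 0 ≤ ω') (h : S.thompsonDist ω ω' < ⊤) {δ : ℝ}
    (hδ : (S.thompsonDist ω ω').toReal < δ) :
    ω' ≤ Real.exp δ • ω ∧ ω ≤ Real.exp δ • ω' := by
  have hδ0 : 0 < δ := ENNReal.toReal_nonneg.trans_lt hδ
  have h1 : S.thompsonDist ω ω' < ENNReal.ofReal δ :=
    (ENNReal.lt_ofReal_iff_toReal_lt h.ne).mpr hδ
  simp only [thompsonDist, iInf_lt_iff] at h1
  obtain ⟨C, hC, hlt⟩ := h1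
  have h2 : (C : ℝ) ≤ δ := by
    rw [← ENNReal.ofReal_coe_nnreal, ENNReal.ofReal_lt_ofReal_iff hδ0] at hlt
    exact hlt.le
  have h3 : ω ≤ Real.exp C • ω' := by
    have := smul_le_smul_of_nonneg_left hC.1 (Real.exp_pos C).le
    rwa [smul_smul, ← Real.exp_add, add_neg_cancel, Real.exp_zero, one_smul] at this
  exact ⟨le_smul_of_le_smul hω hC.2 (Real.exp_le_exp.mpr h2),
    le_smul_of_le_smul hω' h3 (Real.exp_le_exp.mpr h2)⟩

variable [CompactSpace X]

theorem abs_twistedEnergy_sub_le_formNorm (hS : S.SubmeanValueProperty) (hp : S.IsPolarization ω)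
    (ho : S.OrthogonalityProperty ω) (hθ : S.formNorm ω θ < ⊤) (μ ν : S.FiniteEnergy ω) :
    |twistedEnergy hS hp ho θ μ - twistedEnergy hS hp ho θ ν| ≤ dimConst n ^ 35 *
      dirichletMetric hp ho μ ν ^ holderExponent n *
        (max μ.Jplus ν.Jplus) ^ (1 - holderExponent n) * (S.formNorm ω θ).toReal := by
  refine le_mul_of_forall_lt fun K hK => ?_
  obtain ⟨h1, h2⟩ := le_smul_of_formNorm_lt hp.1 hθ hK
  refine (abs_twistedEnergy_sub_le hS hp ho (ENNReal.toReal_nonneg.trans_lt hK) h1 h2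
    μ ν).trans_eq ?_
  ring

theorem abs_twistedEnergy_le_formNorm (hS : S.SubmeanValueProperty) (hp : S.IsPolarization ω)
    (ho : S.OrthogonalityProperty ω) (hθ : S.formNorm ω θ < ⊤) (μ : S.FiniteEnergy ω) :
    |twistedEnergy hS hp ho θ μ| ≤ dimConst n ^ 35 * μ.Jplus * (S.formNorm ω θ).toReal := by
  refine le_mul_of_forall_lt fun K hK => ?_
  obtain ⟨h1, h2⟩ := le_smul_of_formNorm_lt hp.1 hθ hK
  refine (abs_twistedEnergy_le hS hp ho (ENNReal.toReal_nonneg.trans_lt hK) h1 h2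
    μ).trans_eq ?_
  ring

end PluripotentialSetup

namespace PluripotentialSetup

variable {n : ℕ} {X : Type u} [TopologicalSpace X] {Z : Type v}
  [AddCommGroup Z] [Module ℝ Z] [PartialOrder Z] {S : PluripotentialSetup n X Z}
  {ω ω₁ θ : Z} {φ : S.D} {s ε : ℝ}

/-! ### Perturbation of the reference form -/

/-- The pair `(ω₁, s φ)` is `ε`-close to the pair `(ω, φ)`, where `φ` is `ω`-plurisubharmonic. No
positivity of `ω₁` is required. The bound on `ε` only serves to keep the constants explicit. -/
structure IsClose (S : PluripotentialSetup n X Z) (ω : Z) (φ : S.D) (ω₁ : Z) (s ε : ℝ) : Prop where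
  nonneg : 0 ≤ ω
  mem_psh : φ ∈ S.psh ω
  pos : 0 < ε
  le : ε ≤ 16
  abs_sub_one_le : |s - 1| ≤ ε
  sub_le : ω₁ - ω ≤ ε • ω
  neg_sub_le : -(ω₁ - ω) ≤ ε • ω

/-- The constant in the perturbation estimates. -/
def closeConst (n : ℕ) : ℝ := 600 ^ (n + 1)

theorem one_le_closeConst (n : ℕ) : 1 ≤ closeConst n := one_le_pow₀ (by norm_num)

theorem closeConst_pos (n : ℕ) : 0 < closeConst n := one_pos.trans_le (one_le_closeConst n)

theorem IsClose.self [PosSMulMono ℝ Z] (h : IsClose S ω φ ω₁ s ε) : IsClose S ω φ ω 1 ε where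
  nonneg := h.nonneg
  mem_psh := h.mem_psh
  pos := h.pos
  le := h.le
  abs_sub_one_le := by simpa using h.pos.le
  sub_le := by simpa using smul_nonneg h.pos.le h.nonneg
  neg_sub_le := by simpa using smul_nonneg h.pos.le h.nonneg

variable [IsOrderedAddMonoid Z] [PosSMulMono ℝ Z]

namespace IsClose

/-- Both tuples of forms are dominated by multiples of `2ω + ddᶜφ`, and so are the differences of
their entries, with an extra factor `ε`. -/
theorem abs_sub_le (h : IsClose S ω φ ω₁ s ε) {F : Multiset Z → ℝ} (hF : IsPosMultilinear F)
    (i j : ℕ) (r : Multiset Z) (hr : ∀ x ∈ r, x ≤ ω ∧ -x ≤ ω) :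
    |F (Multiset.replicate i ω + Multiset.replicate j (ω + S.ddc φ) + r) -
      F (Multiset.replicate i ω₁ + Multiset.replicate j (ω₁ + S.ddc (s • φ)) + r)| ≤
      (i + j) * (2 * ε) * 100 ^ (i + j + r.card) *
        F (Multiset.replicate (i + j + r.card) (ω + (ω + S.ddc φ))) ∧
    |F (Multiset.replicate i ω₁ + Multiset.replicate j (ω₁ + S.ddc (s • φ)) + r)| ≤
      100 ^ (i + j + r.card) *
        F (Multiset.replicate (i + j + r.card) (ω + (ω + S.ddc φ))) := by
  obtain ⟨hω, hφ, hε, hε16, hs, h1, h2⟩ := h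
  rw [psh, Set.mem_ofPred_eq] at hφ
  set η := ω + (ω + S.ddc φ) with hη
  have hη0 : 0 ≤ η := add_nonneg hω hφ
  have hωη : ω ≤ η := le_add_of_nonneg_right hφ
  have hφη : ω + S.ddc φ ≤ η := le_add_of_nonneg_left hω
  have mono : ∀ {x : Z} {a b : ℝ}, x ≤ a • η → a ≤ b → x ≤ b • η := fun hx hab =>
    le_smul_of_le_smul hη0 hx hab
  have neg_le : ∀ {x : Z} {a : ℝ}, 0 ≤ x → 0 ≤ a → -x ≤ a • η := fun hx ha =>
    (neg_nonpos.mpr hx).trans (smul_nonneg ha hη0)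
  have one : ∀ {x : Z}, x ≤ η → x ≤ (1 : ℝ) • η := fun hx => by rwa [one_smul]
  have hsm : ∀ {a : ℝ}, 0 ≤ a → a • ω ≤ a • η := fun ha => smul_le_smul_of_nonneg_left hωη ha
  -- bounds for the differences of the forms
  have d1 : ω - ω₁ ≤ (2 * ε) • η := by
    rw [neg_sub] at h2
    exact mono (h2.trans (hsm hε.le)) (by linarith)
  have d2 : -(ω - ω₁) ≤ (2 * ε) • η := by
    rw [neg_sub]
    exact mono (h1.trans (hsm hε.le)) (by linarith)
  have hdd : ∀ c : ℝ, |c| ≤ ε → c • S.ddc φ ≤ ε • η := by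
    intro c hc
    have e : ε • η - c • S.ddc φ = (ε - c) • (ω + S.ddc φ) + (ε + c) • ω := by
      rw [hη]; module
    rw [← sub_nonneg, e]
    exact add_nonneg (smul_nonneg (by linarith [(abs_le.mp hc).2]) hφ)
      (smul_nonneg (by linarith [(abs_le.mp hc).1]) hω)
  have d3 : (ω + S.ddc φ) - (ω₁ + S.ddc (s • φ)) ≤ (2 * ε) • η := by
    have e : (ω + S.ddc φ) - (ω₁ + S.ddc (s • φ)) = -(ω₁ - ω) + (1 - s) • S.ddc φ := by
      rw [map_smul]; module
    rw [e, two_mul, add_smul]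
    exact add_le_add (h2.trans (hsm hε.le)) (hdd _ (by rwa [abs_sub_comm]))
  have d4 : -((ω + S.ddc φ) - (ω₁ + S.ddc (s • φ))) ≤ (2 * ε) • η := by
    have e : -((ω + S.ddc φ) - (ω₁ + S.ddc (s • φ))) = (ω₁ - ω) + (s - 1) • S.ddc φ := by
      rw [map_smul]; module
    rw [e, two_mul, add_smul]
    exact add_le_add (h1.trans (hsm hε.le)) (hdd _ hs)
  have b1 : ω ≤ (33 : ℝ) • η ∧ -ω ≤ (33 : ℝ) • η :=
    ⟨mono (one hωη) (by norm_num), neg_le hω (by norm_num)⟩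
  have b2 : ω + S.ddc φ ≤ (33 : ℝ) • η ∧ -(ω + S.ddc φ) ≤ (33 : ℝ) • η :=
    ⟨mono (one hφη) (by norm_num), neg_le hφ (by norm_num)⟩
  have b3 : ω₁ ≤ (33 : ℝ) • η ∧ -ω₁ ≤ (33 : ℝ) • η := by
    constructor
    · have : ω₁ = ω + -(ω - ω₁) := by abel
      rw [this]
      refine mono (a := 1 + 2 * ε) ?_ (by linarith)
      rw [add_smul]
      exact add_le_add (one hωη) d2
    · have : -ω₁ = (ω - ω₁) + -ω := by abel
      rw [this]
      refine mono (a := 2 * ε + 0) ?_ (by linarith)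
      rw [add_smul]
      exact add_le_add d1 (neg_le hω le_rfl)
  have b4 : ω₁ + S.ddc (s • φ) ≤ (33 : ℝ) • η ∧ -(ω₁ + S.ddc (s • φ)) ≤ (33 : ℝ) • η := by
    constructor
    · have : ω₁ + S.ddc (s • φ) =
          (ω + S.ddc φ) + -((ω + S.ddc φ) - (ω₁ + S.ddc (s • φ))) := by abel
      rw [this]
      refine mono (a := 1 + 2 * ε) ?_ (by linarith)
      rw [add_smul]
      exact add_le_add (one hφη) d4
    · have : -(ω₁ + S.ddc (s • φ)) =
          ((ω + S.ddc φ) - (ω₁ + S.ddc (s • φ))) + -(ω + S.ddc φ) := by abel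
      rw [this]
      refine mono (a := 2 * ε + 0) ?_ (by linarith)
      rw [add_smul]
      exact add_le_add d3 (neg_le hφ le_rfl)
  have hr' : ∀ x ∈ r, x ≤ (33 : ℝ) • η ∧ -x ≤ (33 : ℝ) • η := fun x hx =>
    ⟨mono (one ((hr x hx).1.trans hωη)) (by norm_num),
      mono (one ((hr x hx).2.trans hωη)) (by norm_num)⟩
  have hFη : 0 ≤ F (Multiset.replicate (i + j + r.card) η) :=
    hF.nonneg _ (IsPosMultilinear.nonneg_replicate _ hη0)
  have hpow : (3 * 33 : ℝ) ^ (i + j + r.card) ≤ 100 ^ (i + j + r.card) :=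
    pow_le_pow_left₀ (by norm_num) (by norm_num) _
  constructor
  · have key := hF.abs_sub_le hη0 (A := 33) (by norm_num) (ε := 2 * ε) (by linarith)
      (Multiset.replicate i (ω, ω₁) + Multiset.replicate j (ω + S.ddc φ, ω₁ + S.ddc (s • φ)))
      (fun p hp => by
        rcases Multiset.mem_add.mp hp with hp | hp <;> rw [Multiset.eq_of_mem_replicate hp]
        exacts [⟨b1, b3, d1, d2⟩, ⟨b2, b4, d3, d4⟩]) r hr'
    simp only [Multiset.map_add, Multiset.map_replicate, Multiset.card_add,
      Multiset.card_replicate] at key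
    push_cast at key
    refine key.trans ?_
    gcongr
  · have key := hF.abs_le hη0 (A := 33) (by norm_num) (Multiset.replicate i ω₁ +
      Multiset.replicate j (ω₁ + S.ddc (s • φ)) + r) (fun x hx => by
        rcases Multiset.mem_add.mp hx with hx | hx
        · rcases Multiset.mem_add.mp hx with hx | hx <;> rw [Multiset.eq_of_mem_replicate hx]
          exacts [b3, b4]
        · exact hr' x hx)
    simp only [Multiset.card_add, Multiset.card_replicate] at key
    refine key.trans ?_
    gcongr

end IsClose

/-- The mass `V⁻¹ ∫ (-φ) (2ω + ddᶜφ)ⁿ` controlling the perturbation estimates. -/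
def negMass (S : PluripotentialSetup n X Z) (ω : Z) (φ : S.D) : ℝ :=
  (S.vol ω)⁻¹ * S.prod (Multiset.replicate n (ω + (ω + S.ddc φ))) (-(φ : C(X, ℝ)))

namespace IsClose

/-- The function changes from `φ` to `s φ` as well, whence the additional terms. -/
theorem abs_preEnergy_sub_le (h : IsClose S ω φ ω₁ s ε) (hV : 0 < S.vol ω)
    (hφ0 : ∀ x, (φ : C(X, ℝ)) x ≤ 0) {m : ℕ} {r : Multiset Z}
    (hr : ∀ x ∈ r, x ≤ ω ∧ -x ≤ ω) (hm : m + r.card = n) :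
    |S.preEnergy m r ω φ - S.preEnergy m r ω₁ (s • φ)| ≤
      ε * closeConst n * (S.vol ω * S.negMass ω φ) ∧
    |S.preEnergy m r ω₁ (s • φ)| ≤ closeConst n * (S.vol ω * S.negMass ω φ) := by
  have hF := isPosMultilinear_prod (S := S) (f := -(φ : C(X, ℝ))) (fun x => by simpa using hφ0 x)
  have hR : S.vol ω * S.negMass ω φ =
      S.prod (Multiset.replicate n (ω + (ω + S.ddc φ))) (-(φ : C(X, ℝ))) := by
    rw [negMass]; field_simp
  have hR0 : 0 ≤ S.vol ω * S.negMass ω φ := by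
    rw [hR]
    exact hF.nonneg _ (IsPosMultilinear.nonneg_replicate _ (add_nonneg h.nonneg h.mem_psh))
  set R := S.vol ω * S.negMass ω φ with hRdef
  have hε := h.pos
  have hε16 := h.le
  have hs := abs_le.mp h.abs_sub_one_le
  set a : ℕ → ℝ := fun i => S.prod (Multiset.replicate i ω +
    Multiset.replicate (m - i) (ω + S.ddc φ) + r) (-(φ : C(X, ℝ))) with ha
  set b : ℕ → ℝ := fun i => S.prod (Multiset.replicate i ω₁ +
    Multiset.replicate (m - i) (ω₁ + S.ddc (s • φ)) + r) (-(φ : C(X, ℝ))) with hb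
  have hab : ∀ i ∈ Finset.range (m + 1), |a i - b i| ≤ m * (2 * ε) * 100 ^ n * R ∧
      |b i| ≤ 100 ^ n * R := by
    intro i hi
    have hi' : i + (m - i) = m := by have := Finset.mem_range.mp hi; omega
    have key := h.abs_sub_le hF i (m - i) r hr
    rw [← Nat.cast_add, hi', hm, ← hR] at key
    exact key
  have e0 : S.preEnergy m r ω φ = -∑ i ∈ Finset.range (m + 1), a i := by
    rw [preEnergy, ← Finset.sum_neg_distrib]
    exact Finset.sum_congr rfl fun i _ => by rw [ha]; simp
  have e1 : S.preEnergy m r ω₁ (s • φ) = -(s * ∑ i ∈ Finset.range (m + 1), b i) := by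
    rw [preEnergy, Finset.mul_sum, ← Finset.sum_neg_distrib]
    exact Finset.sum_congr rfl fun i _ => by rw [hb]; simp
  have s0 : |∑ i ∈ Finset.range (m + 1), a i - ∑ i ∈ Finset.range (m + 1), b i| ≤
      (m + 1) * (m * (2 * ε) * 100 ^ n * R) := by
    rw [← Finset.sum_sub_distrib]
    refine (Finset.abs_sum_le_sum_abs _ _).trans ((Finset.sum_le_sum fun i hi =>
      (hab i hi).1).trans_eq ?_)
    simp
  have s1 : |∑ i ∈ Finset.range (m + 1), b i| ≤ (m + 1) * (100 ^ n * R) := by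
    refine (Finset.abs_sum_le_sum_abs _ _).trans ((Finset.sum_le_sum fun i hi =>
      (hab i hi).2).trans_eq ?_)
    simp
  have hmn : (m : ℝ) ≤ n := by exact_mod_cast (by omega : m ≤ n)
  have n1 : (m : ℝ) + 1 ≤ 2 ^ n := by
    have : n + 1 ≤ 2 ^ n := Nat.lt_two_pow_self
    have : (n : ℝ) + 1 ≤ 2 ^ n := by exact_mod_cast this
    linarith
  have n2 : 2 * (m : ℝ) + 1 ≤ 3 ^ n := by
    have := one_add_mul_le_pow (show (-2 : ℝ) ≤ 2 by norm_num) n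
    norm_num at this
    linarith
  have hP : (2 : ℝ) ^ n * 3 ^ n * 100 ^ n ≤ closeConst n := by
    rw [← mul_pow, ← mul_pow, closeConst]
    norm_num
    exact pow_le_pow_right₀ (by norm_num) (Nat.le_succ n)
  have hP' : (17 : ℝ) * (2 ^ n * 100 ^ n) ≤ closeConst n := by
    rw [← mul_pow, closeConst, pow_succ]
    have : (2 * 100 : ℝ) ^ n ≤ 600 ^ n := pow_le_pow_left₀ (by norm_num) (by norm_num) n
    nlinarith [pow_pos (show (0 : ℝ) < 600 by norm_num) n]
  rw [e0, e1]
  generalize ∑ i ∈ Finset.range (m + 1), a i = x at *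
  generalize ∑ i ∈ Finset.range (m + 1), b i = y at *
  constructor
  · have e : -x - -(s * y) = -(x - y) + (s - 1) * y := by ring
    rw [e]
    refine (abs_add_le _ _).trans ?_
    rw [abs_neg, abs_mul]
    calc |x - y| + |s - 1| * |y| ≤ (m + 1) * (m * (2 * ε) * 100 ^ n * R) +
          ε * ((m + 1) * (100 ^ n * R)) := by
          gcongr
          exact h.abs_sub_one_le
      _ = ε * ((m + 1) * (2 * m + 1) * 100 ^ n) * R := by ring
      _ ≤ ε * (2 ^ n * 3 ^ n * 100 ^ n) * R := by gcongr
      _ ≤ ε * closeConst n * R := by gcongr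
  · rw [abs_neg, abs_mul]
    have hs17 : |s| ≤ 17 := abs_le.mpr ⟨by linarith, by linarith⟩
    calc |s| * |y| ≤ 17 * ((m + 1) * (100 ^ n * R)) := by gcongr
      _ ≤ 17 * (2 ^ n * (100 ^ n * R)) := by gcongr
      _ = (17 * (2 ^ n * 100 ^ n)) * R := by ring
      _ ≤ closeConst n * R := by gcongr

theorem abs_prod_one_sub_le (h : IsClose S ω φ ω₁ s ε) {m : ℕ} {r : Multiset Z}
    (hr : ∀ x ∈ r, x ≤ ω ∧ -x ≤ ω) (hm : m + r.card = n) :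
    |S.prod (Multiset.replicate m ω + r) 1 - S.prod (Multiset.replicate m ω₁ + r) 1| ≤
      ε * closeConst n * S.vol ω ∧
    |S.prod (Multiset.replicate m ω₁ + r) 1| ≤ closeConst n * S.vol ω := by
  have h0 : IsClose S ω 0 ω₁ s ε :=
    { h with mem_psh := S.zero_mem_psh h.nonneg }
  have hF := isPosMultilinear_mass (S := S)
  have key := h0.abs_sub_le hF m 0 r hr
  have e : S.prod (Multiset.replicate n (ω + (ω + S.ddc 0))) 1 = 2 ^ n * S.vol ω := by
    have h2 : S.prod (Multiset.replicate n ((2 : ℝ) • ω)) 1 = 2 ^ n * S.vol ω := by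
      rw [← vol_eq, vol, vol]
      have := S.wedge.map_smul_univ (fun _ => (2 : ℝ)) (fun _ => ω)
      rw [this]; simp
    rw [map_zero, add_zero, ← two_smul ℝ ω, h2]
  simp only [Multiset.replicate_zero, add_zero, Nat.cast_zero] at key
  have hv : 0 ≤ S.vol ω := by
    rw [vol_eq]; exact hF.nonneg _ (IsPosMultilinear.nonneg_replicate _ h.nonneg)
  rw [hm, e] at key
  have hε := h.pos
  have hmn : (m : ℝ) ≤ n := by exact_mod_cast (by omega : m ≤ n)
  have n2 : 2 * (m : ℝ) ≤ 3 ^ n := by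
    have := one_add_mul_le_pow (show (-2 : ℝ) ≤ 2 by norm_num) n
    norm_num at this
    linarith
  have hP : (3 : ℝ) ^ n * 100 ^ n * 2 ^ n ≤ closeConst n := by
    rw [← mul_pow, ← mul_pow, closeConst]
    norm_num
    exact pow_le_pow_right₀ (by norm_num) (Nat.le_succ n)
  have hP' : (100 : ℝ) ^ n * 2 ^ n ≤ closeConst n := by
    rw [← mul_pow, closeConst]
    refine (pow_le_pow_left₀ (by norm_num) (by norm_num : (100 * 2 : ℝ) ≤ 600) n).trans ?_
    exact pow_le_pow_right₀ (by norm_num) (Nat.le_succ n)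
  refine ⟨key.1.trans ?_, key.2.trans ?_⟩
  · calc m * (2 * ε) * 100 ^ n * (2 ^ n * S.vol ω)
        = ε * ((2 * m) * 100 ^ n * 2 ^ n) * S.vol ω := by ring
      _ ≤ ε * (3 ^ n * 100 ^ n * 2 ^ n) * S.vol ω := by gcongr
      _ ≤ _ := by gcongr
  · calc (100 : ℝ) ^ n * (2 ^ n * S.vol ω) = (100 ^ n * 2 ^ n) * S.vol ω := by ring
      _ ≤ _ := by gcongr

end IsClose

end PluripotentialSetup

namespace PluripotentialSetup

theorem abs_div_sub_div_le {a₀ a₁ V₀ V₁ P ε m : ℝ} (hV₀ : 0 < V₀) (hV₁ : 0 < V₁) (hP : 1 ≤ P)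
    (hε : 0 ≤ ε) (hm : 0 ≤ m) (h1 : |a₀ - a₁| ≤ ε * P * (V₀ * m)) (h2 : |a₁| ≤ P * (V₀ * m))
    (h3 : |V₀ - V₁| ≤ ε * P * V₀) (h4 : V₀ ≤ P * V₁) :
    |a₀ / V₀ - a₁ / V₁| ≤ ε * (2 * P ^ 3) * m ∧ |a₁ / V₁| ≤ P ^ 2 * m := by
  have e : a₀ / V₀ - a₁ / V₁ = (a₀ - a₁) / V₀ - a₁ / V₁ * ((V₀ - V₁) / V₀) := by field_simp; ring
  have b1 : |(a₀ - a₁) / V₀| ≤ ε * P * m := by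
    rw [abs_div, abs_of_pos hV₀, div_le_iff₀ hV₀]; linarith
  have b2 : |(V₀ - V₁) / V₀| ≤ ε * P := by
    rw [abs_div, abs_of_pos hV₀, div_le_iff₀ hV₀]; linarith
  have b3 : |a₁ / V₁| ≤ P ^ 2 * m := by
    rw [abs_div, abs_of_pos hV₁, div_le_iff₀ hV₁]
    calc |a₁| ≤ P * (V₀ * m) := h2
      _ ≤ P * ((P * V₁) * m) := by gcongr
      _ = _ := by ring
  refine ⟨?_, b3⟩
  rw [e]
  refine (abs_sub _ _).trans ?_
  rw [abs_mul]
  have hPP : P ≤ P ^ 3 := le_self_pow₀ hP (by norm_num)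
  calc |(a₀ - a₁) / V₀| + |a₁ / V₁| * |(V₀ - V₁) / V₀| ≤ ε * P * m + P ^ 2 * m * (ε * P) := by
        gcongr
    _ = ε * (P + P ^ 3) * m := by ring
    _ ≤ ε * (2 * P ^ 3) * m := by gcongr; linarith

variable {n : ℕ} {X : Type u} [TopologicalSpace X] {Z : Type v}
  [AddCommGroup Z] [Module ℝ Z] [PartialOrder Z] {S : PluripotentialSetup n X Z}
  {ω ω₁ θ : Z} {φ : S.D} {s ε : ℝ}

theorem negMass_nonneg [IsOrderedAddMonoid Z] (hV : 0 < S.vol ω) (hω : 0 ≤ ω) (hφ : φ ∈ S.psh ω)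
    (hφ0 : ∀ x, (φ : C(X, ℝ)) x ≤ 0) : 0 ≤ S.negMass ω φ :=
  mul_nonneg (inv_nonneg.mpr hV.le)
    ((isPosMultilinear_prod (S := S) (f := -(φ : C(X, ℝ))) (fun x => by simpa using hφ0 x)).nonneg
      _ (IsPosMultilinear.nonneg_replicate _ (add_nonneg hω hφ)))

variable [IsOrderedAddMonoid Z] [PosSMulMono ℝ Z]

namespace IsClose

theorem abs_vol_sub_le (h : IsClose S ω φ ω₁ s ε) :
    |S.vol ω - S.vol ω₁| ≤ ε * closeConst n * S.vol ω := by
  have := (h.abs_prod_one_sub_le (m := n) (r := 0) (by simp) (by simp)).1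
  simpa only [add_zero, ← vol_eq] using this

theorem abs_MAEnergy_sub_le (h : IsClose S ω φ ω₁ s ε) (hV : 0 < S.vol ω) (hV₁ : 0 < S.vol ω₁)
    (hVV : S.vol ω ≤ closeConst n * S.vol ω₁) (hφ0 : ∀ x, (φ : C(X, ℝ)) x ≤ 0) :
    |S.MAEnergy ω φ - S.MAEnergy ω₁ (s • φ)| ≤ ε * (2 * closeConst n ^ 3) * S.negMass ω φ ∧
    |S.MAEnergy ω₁ (s • φ)| ≤ closeConst n ^ 2 * S.negMass ω φ := by
  have hm := negMass_nonneg hV h.nonneg h.mem_psh hφ0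
  have key := h.abs_preEnergy_sub_le hV hφ0 (m := n) (r := 0) (by simp) (by simp)
  obtain ⟨k1, k2⟩ := abs_div_sub_div_le hV hV₁ (one_le_closeConst n) h.pos.le hm key.1 key.2
    h.abs_vol_sub_le hVV
  have hn : (1 : ℝ) ≤ (n : ℝ) + 1 := by linarith [(Nat.cast_nonneg n : (0 : ℝ) ≤ n)]
  have e : ∀ η χ, S.MAEnergy η χ = S.preEnergy n 0 η χ / S.vol η / (n + 1) := fun η χ => by
    rw [MAEnergy_eq, div_div, mul_comm]
  constructor
  · rw [e, e, ← sub_div, abs_div, abs_of_pos (by linarith : (0 : ℝ) < n + 1)]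
    exact (div_le_self (abs_nonneg _) hn).trans k1
  · rw [e, abs_div, abs_of_pos (by linarith : (0 : ℝ) < n + 1)]
    exact (div_le_self (abs_nonneg _) hn).trans k2

theorem abs_MA_sub_le (h : IsClose S ω φ ω₁ s ε) (hV : 0 < S.vol ω) (hV₁ : 0 < S.vol ω₁)
    (hVV : S.vol ω ≤ closeConst n * S.vol ω₁) (hφ0 : ∀ x, (φ : C(X, ℝ)) x ≤ 0) :
    |S.MA ω φ (φ : C(X, ℝ)) - S.MA ω₁ (s • φ) (φ : C(X, ℝ))| ≤
      ε * (2 * closeConst n ^ 3) * S.negMass ω φ := by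
  have hm := negMass_nonneg hV h.nonneg h.mem_psh hφ0
  have hF := isPosMultilinear_prod (S := S) (f := -(φ : C(X, ℝ))) (fun x => by simpa using hφ0 x)
  have hR : S.vol ω * S.negMass ω φ =
      S.prod (Multiset.replicate n (ω + (ω + S.ddc φ))) (-(φ : C(X, ℝ))) := by
    rw [negMass]; field_simp
  have key := h.abs_sub_le hF 0 n 0 (by simp)
  have hR0 : 0 ≤ S.vol ω * S.negMass ω φ := by positivity
  simp only [Multiset.replicate_zero, zero_add, add_zero, Multiset.card_zero, Nat.cast_zero,
    ← hR, map_neg] at key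
  have hε := h.pos
  have n2 : 2 * (n : ℝ) ≤ 3 ^ n := by
    have := one_add_mul_le_pow (show (-2 : ℝ) ≤ 2 by norm_num) n
    norm_num at this
    linarith
  have hP : (3 : ℝ) ^ n * 100 ^ n ≤ closeConst n := by
    rw [← mul_pow, closeConst]
    refine (pow_le_pow_left₀ (by norm_num) (by norm_num : (3 * 100 : ℝ) ≤ 600) n).trans ?_
    exact pow_le_pow_right₀ (by norm_num) (Nat.le_succ n)
  have hP' : (100 : ℝ) ^ n ≤ closeConst n := by
    rw [closeConst]
    refine (pow_le_pow_left₀ (by norm_num) (by norm_num : (100 : ℝ) ≤ 600) n).trans ?_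
    exact pow_le_pow_right₀ (by norm_num) (Nat.le_succ n)
  have a1 : |S.prod (Multiset.replicate n (ω + S.ddc φ)) (φ : C(X, ℝ)) -
      S.prod (Multiset.replicate n (ω₁ + S.ddc (s • φ))) (φ : C(X, ℝ))| ≤
      ε * closeConst n * (S.vol ω * S.negMass ω φ) := by
    rw [abs_sub_comm]
    have e : ∀ x y : ℝ, -y - -x = x - y := fun x y => by ring
    rw [← e]
    refine key.1.trans ?_
    calc n * (2 * ε) * 100 ^ n * (S.vol ω * S.negMass ω φ)
        = ε * ((2 * n) * 100 ^ n) * (S.vol ω * S.negMass ω φ) := by ring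
      _ ≤ ε * (3 ^ n * 100 ^ n) * (S.vol ω * S.negMass ω φ) := by gcongr
      _ ≤ _ := by gcongr
  have a2 : |S.prod (Multiset.replicate n (ω₁ + S.ddc (s • φ))) (φ : C(X, ℝ))| ≤
      closeConst n * (S.vol ω * S.negMass ω φ) := by
    rw [← abs_neg]
    exact key.2.trans (by gcongr)
  have := (abs_div_sub_div_le hV hV₁ (one_le_closeConst n) h.pos.le hm a1 a2
    h.abs_vol_sub_le hVV).1
  rwa [MA_apply, MA_apply, ← div_eq_inv_mul, ← div_eq_inv_mul]

/-- The twisted energy varies in a Lipschitz way with the reference form. -/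
theorem abs_twist_sub_le (h : IsClose S ω φ ω₁ s ε) (hV : 0 < S.vol ω) (hV₁ : 0 < S.vol ω₁)
    (hVV : S.vol ω ≤ closeConst n * S.vol ω₁) (hφ0 : ∀ x, (φ : C(X, ℝ)) x ≤ 0)
    {K : ℝ} (hK : 0 < K) (h1 : θ ≤ K • ω) (h2 : -θ ≤ K • ω) :
    |S.twist ω θ φ - S.twist ω₁ θ (s • φ)| ≤
      ε * (6 * closeConst n ^ 5) * K * S.negMass ω φ := by
  have hm := negMass_nonneg hV h.nonneg h.mem_psh hφ0
  have hP := one_le_closeConst n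
  have hε := h.pos
  set θ' := K⁻¹ • θ with hθ'
  have e : θ = K • θ' := by rw [hθ', smul_smul, mul_inv_cancel₀ hK.ne', one_smul]
  have hr : ∀ x ∈ ({θ'} : Multiset Z), x ≤ ω ∧ -x ≤ ω := by
    intro x hx
    rw [Multiset.mem_singleton.mp hx]
    constructor
    · have := smul_le_smul_of_nonneg_left h1 (inv_nonneg.mpr hK.le)
      rwa [smul_smul, inv_mul_cancel₀ hK.ne', one_smul] at this
    · have := smul_le_smul_of_nonneg_left h2 (inv_nonneg.mpr hK.le)
      rwa [smul_smul, inv_mul_cancel₀ hK.ne', one_smul, smul_neg] at this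
  have hcard : n - 1 + ({θ'} : Multiset Z).card = n := by
    rw [Multiset.card_singleton]; exact Nat.sub_add_cancel S.one_le_dim
  have p1 := h.abs_preEnergy_sub_le hV hφ0 hr hcard
  have p2 := h.abs_preEnergy_sub_le hV hφ0 (m := n) (r := 0) (by simp) (by simp)
  have p3 := h.abs_prod_one_sub_le hr hcard
  have p3' := h.self.abs_prod_one_sub_le hr hcard
  simp only [add_comm _ ({_} : Multiset Z), Multiset.singleton_add] at p3 p3'
  have q1 := abs_div_sub_div_le hV hV₁ hP hε.le hm p1.1 p1.2 h.abs_vol_sub_le hVV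
  have q2 := abs_div_sub_div_le hV hV₁ hP hε.le hm p2.1 p2.2 h.abs_vol_sub_le hVV
  have q3 := abs_div_sub_div_le hV hV₁ hP hε.le zero_le_one (by rw [mul_one]; exact p3.1)
    (by rw [mul_one]; exact p3.2) h.abs_vol_sub_le hVV
  have q4 : |S.prod (θ' ::ₘ Multiset.replicate (n - 1) ω) 1 / S.vol ω| ≤ closeConst n := by
    rw [abs_div, abs_of_pos hV, div_le_iff₀ hV]
    exact p3'.2
  have et : ∀ η χ, S.twist η θ' χ = S.preEnergy (n - 1) {θ'} η χ / S.vol η -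
      (n / (n + 1)) * ((S.prod (θ' ::ₘ Multiset.replicate (n - 1) η) 1 / S.vol η) *
        (S.preEnergy n 0 η χ / S.vol η)) := by
    intro η χ
    rw [twist, MAEnergy_eq]
    have : (n : ℝ) + 1 ≠ 0 := by positivity
    congr 1
    field_simp
  have hn : (n : ℝ) / (n + 1) ≤ 1 := by
    rw [div_le_one (by positivity)]; linarith
  have hn0 : 0 ≤ (n : ℝ) / (n + 1) := by positivity
  have hmain : |S.twist ω θ' φ - S.twist ω₁ θ' (s • φ)| ≤
      ε * (6 * closeConst n ^ 5) * S.negMass ω φ := by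
    rw [et, et]
    generalize S.preEnergy (n - 1) {θ'} ω φ / S.vol ω = x₀ at *
    generalize S.preEnergy (n - 1) {θ'} ω₁ (s • φ) / S.vol ω₁ = x₁ at *
    generalize S.preEnergy n 0 ω φ / S.vol ω = y₀ at *
    generalize S.preEnergy n 0 ω₁ (s • φ) / S.vol ω₁ = y₁ at *
    generalize S.prod (θ' ::ₘ Multiset.replicate (n - 1) ω) 1 / S.vol ω = c₀ at *
    generalize S.prod (θ' ::ₘ Multiset.replicate (n - 1) ω₁) 1 / S.vol ω₁ = c₁ at *
    generalize S.negMass ω φ = m at *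
    set P := closeConst n
    have hcy : |c₀ * y₀ - c₁ * y₁| ≤ ε * (4 * P ^ 5) * m := by
      have e : c₀ * y₀ - c₁ * y₁ = c₀ * (y₀ - y₁) + (c₀ - c₁) * y₁ := by ring
      rw [e]
      refine (abs_add_le _ _).trans ?_
      rw [abs_mul, abs_mul]
      have hPP : P ^ 4 ≤ P ^ 5 := pow_le_pow_right₀ hP (by norm_num)
      calc |c₀| * |y₀ - y₁| + |c₀ - c₁| * |y₁| ≤
            P * (ε * (2 * P ^ 3) * m) + (ε * (2 * P ^ 3) * 1) * (P ^ 2 * m) := by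
            gcongr
            exacts [q2.1, q3.1, q2.2]
        _ = ε * (2 * P ^ 4 + 2 * P ^ 5) * m := by ring
        _ ≤ ε * (4 * P ^ 5) * m := by gcongr; linarith
    have hPP : P ^ 3 ≤ P ^ 5 := pow_le_pow_right₀ hP (by norm_num)
    have e : x₀ - (n : ℝ) / (n + 1) * (c₀ * y₀) - (x₁ - (n : ℝ) / (n + 1) * (c₁ * y₁)) =
        (x₀ - x₁) - (n : ℝ) / (n + 1) * (c₀ * y₀ - c₁ * y₁) := by ring
    rw [e]
    refine (abs_sub _ _).trans ?_
    rw [abs_mul, abs_of_nonneg hn0]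
    calc |x₀ - x₁| + (n : ℝ) / (n + 1) * |c₀ * y₀ - c₁ * y₁| ≤
          ε * (2 * P ^ 3) * m + 1 * (ε * (4 * P ^ 5) * m) := by
          gcongr
          exact q1.1
      _ = ε * (2 * P ^ 3 + 4 * P ^ 5) * m := by ring
      _ ≤ ε * (6 * P ^ 5) * m := by gcongr; linarith
  have et' : ∀ η χ, S.twist η θ χ = K * S.twist η θ' χ := fun η χ => by
    conv_lhs => rw [e]
    exact twist_smul K θ' χ
  rw [et', et', ← mul_sub, abs_mul, abs_of_pos hK]
  calc _ ≤ K * (ε * (6 * closeConst n ^ 5) * S.negMass ω φ) :=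
        mul_le_mul_of_nonneg_left hmain hK.le
    _ = _ := by ring

end IsClose

variable [CompactSpace X]

/-- The mass of a normalized function is controlled by its quasi-distance to `0`. -/
theorem negMass_le (hω : 0 ≤ ω) (hV : 0 < S.vol ω) (ho : S.OrthogonalityProperty ω)
    (hT : S.submeanConst ω ≠ ⊤) (hφ : φ ∈ S.psh ω) (hx : ∃ x, (φ : C(X, ℝ)) x = 0) :
    S.negMass ω φ ≤ dimConst n ^ 18 * (S.quasiDist ω φ 0 + (S.submeanConst ω).toReal) := by
  have hκ := dimConst_pos n
  have hκ1 := one_le_dimConst n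
  have hz := S.zero_mem_psh hω
  have hTn : 0 ≤ (S.submeanConst ω).toReal := ENNReal.toReal_nonneg
  have hq := S.quasiDist_nonneg hV hφ hz
  set ξ : S.D := (1 / 2 : ℝ) • (φ + 0) with hξ
  have hξm : ξ ∈ S.psh ω := mid_mem_psh hφ hz
  have e : ω + (ω + S.ddc φ) = (2 : ℝ) • (ω + S.ddc ξ) := by
    rw [hξ, add_zero, map_smul]; module
  have e2 : S.negMass ω φ = 2 ^ n * -S.MA ω ξ (φ : C(X, ℝ)) := by
    have h1 : S.prod (Multiset.replicate n (ω + (ω + S.ddc φ))) =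
        (2 : ℝ) ^ n • S.prod (Multiset.replicate n (ω + S.ddc ξ)) := by
      rw [e, prod_replicate, prod_replicate]
      have := S.wedge.map_smul_univ (fun _ => (2 : ℝ)) (fun _ => ω + S.ddc ξ)
      rw [this]; simp
    rw [negMass, h1, MA_apply, map_neg, RadonMeasure.smul_apply]
    ring
  have h1 := (maPoint hV hξm).neg_le_of_normalized hω hV ho hT hφ hx one_pos
  have h2 : (maPoint hV hξm).J ≤ dimConst n ^ 3 * S.quasiDist ω φ 0 := by
    refine (FiniteEnergy.J_maPoint_le hω hV hξm).trans ?_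
    have := S.quasiDist_mid_le hω hV hφ hz le_rfl (by rwa [quasiDist_self])
    calc dimConst n * S.quasiDist ω ξ 0 ≤ dimConst n * (dimConst n ^ 2 * S.quasiDist ω φ 0) :=
          mul_le_mul_of_nonneg_left this hκ.le
      _ = _ := by ring
  rw [toMeasure_maPoint, div_one, one_mul] at h1
  have h2n : (2 : ℝ) ^ n * 4 ≤ dimConst n := by
    rw [dimConst, pow_succ]
    have : (2 : ℝ) ^ n ≤ 4 ^ n := pow_le_pow_left₀ (by norm_num) (by norm_num) n
    linarith
  have h3 : -S.MA ω ξ (φ : C(X, ℝ)) ≤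
      4 * dimConst n ^ 16 * (S.quasiDist ω φ 0 + (S.submeanConst ω).toReal) := by
    have k1 : dimConst n ^ 13 * (maPoint hV hξm).J ≤ dimConst n ^ 16 * S.quasiDist ω φ 0 := by
      calc _ ≤ dimConst n ^ 13 * (dimConst n ^ 3 * S.quasiDist ω φ 0) := by gcongr
        _ = _ := by ring
    have k2 : (maPoint hV hξm).J ≤ dimConst n ^ 16 * S.quasiDist ω φ 0 :=
      h2.trans (mul_le_mul_of_nonneg_right (pow_le_pow_right₀ hκ1 (by norm_num)) hq)
    have k3 : S.quasiDist ω φ 0 ≤ dimConst n ^ 16 * S.quasiDist ω φ 0 :=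
      le_mul_of_one_le_left hq (one_le_pow₀ hκ1)
    have k4 : (S.submeanConst ω).toReal ≤ dimConst n ^ 16 * (S.submeanConst ω).toReal :=
      le_mul_of_one_le_left hTn (one_le_pow₀ hκ1)
    linarith
  rw [e2]
  have hs : 0 ≤ S.quasiDist ω φ 0 + (S.submeanConst ω).toReal := add_nonneg hq hTn
  calc 2 ^ n * -S.MA ω ξ (φ : C(X, ℝ)) ≤ 2 ^ n * (4 * dimConst n ^ 16 *
        (S.quasiDist ω φ 0 + (S.submeanConst ω).toReal)) := by gcongr
    _ = (2 ^ n * 4) * dimConst n ^ 16 *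
        (S.quasiDist ω φ 0 + (S.submeanConst ω).toReal) := by ring
    _ ≤ dimConst n * dimConst n ^ 16 *
        (S.quasiDist ω φ 0 + (S.submeanConst ω).toReal) := by gcongr
    _ = dimConst n ^ 17 * (S.quasiDist ω φ 0 + (S.submeanConst ω).toReal) := by ring
    _ ≤ _ := mul_le_mul_of_nonneg_right (pow_le_pow_right₀ hκ1 (by norm_num)) hs

/-- The mass of a normalized function is controlled by its gap. -/
theorem FiniteEnergy.negMass_le_gap (hω : 0 ≤ ω) (hV : 0 < S.vol ω)
    (ho : S.OrthogonalityProperty ω) (hT : S.submeanConst ω ≠ ⊤) (μ : S.FiniteEnergy ω)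
    (hφ : φ ∈ S.psh ω) (hx : ∃ x, (φ : C(X, ℝ)) x = 0) :
    S.negMass ω φ ≤ dimConst n ^ 20 * (μ.gap φ + μ.Jplus) := by
  have hκ := dimConst_pos n
  have hκ1 := one_le_dimConst n
  have hTn : 0 ≤ (S.submeanConst ω).toReal := ENNReal.toReal_nonneg
  have h1 := μ.quasiDist_zero_le hω hV hφ
  refine (negMass_le hω hV ho hT hφ hx).trans ?_
  have k : 1 ≤ dimConst n ^ 2 := one_le_pow₀ hκ1
  calc dimConst n ^ 18 * (S.quasiDist ω φ 0 + (S.submeanConst ω).toReal) ≤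
        dimConst n ^ 18 * (dimConst n ^ 2 * (μ.gap φ + μ.Jplus)) := by
        gcongr
        rw [FiniteEnergy.Jplus]
        nlinarith
    _ = _ := by ring

end PluripotentialSetup

namespace PluripotentialSetup

/-! ### Differentiability of the energy -/

theorem eventually_abs_mul_le (A : ℝ) {b : ℝ} (hb : 0 < b) : ∀ᶠ t : ℝ in 𝓝 0, |t| * A ≤ b := by
  have hc : ContinuousAt (fun t : ℝ => |t| * A) 0 := by fun_prop
  exact (hc.eventually_lt_const (by simpa using hb)).mono fun t ht => ht.le

/-- The error terms in the first order expansion of the energy are negligible. -/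
theorem eventually_forall_error_le (n : ℕ) {c c' m ε : ℝ} (hc : 0 ≤ c) (hm : 0 ≤ m)
    (hε : 0 < ε) : ∀ᶠ t : ℝ in 𝓝 0, ∀ g : ℝ, 0 ≤ g →
      |t| * (c * (g ^ holderExponent n * (g + m) ^ (1 - holderExponent n))) +
        c' * t ^ 2 * (g + m) ≤ g + ε * |t| := by
  have hα := holderExponent_pos n
  have hα1 := holderExponent_le_one n
  have hcont : ContinuousAt (fun g : ℝ => c * (g ^ holderExponent n *
      (g + m) ^ (1 - holderExponent n))) 0 := by
    refine continuousAt_const.mul (ContinuousAt.mul ?_ ?_)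
    · exact Real.continuousAt_rpow_const _ _ (Or.inr hα.le)
    · exact ContinuousAt.rpow_const (by fun_prop) (Or.inr (by linarith))
  have h0 := hcont.eventually_lt_const (u := ε / 2) (by
    simpa [Real.zero_rpow hα.ne'] using half_pos hε)
  obtain ⟨δ, hδ, h⟩ := Metric.eventually_nhds_iff.mp h0
  filter_upwards [eventually_abs_mul_le (c * (1 + m / (δ / 2))) one_half_pos,
    eventually_abs_mul_le c' one_half_pos, eventually_abs_mul_le 1 one_pos,
    eventually_abs_mul_le (c' * m) (half_pos hε)] with t t1 t2 t3 t4 g hg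
  have ht := abs_nonneg t
  rw [mul_one] at t3
  have hsq : t ^ 2 = |t| * |t| := by rw [← sq, sq_abs]
  have a1 : |t| * (c * (g ^ holderExponent n * (g + m) ^ (1 - holderExponent n))) ≤
      g / 2 + ε / 2 * |t| := by
    by_cases hgδ : g < δ
    · have := h (y := g) (by rwa [Real.dist_0_eq_abs, abs_of_nonneg hg])
      have := mul_le_mul_of_nonneg_left this.le ht
      linarith
    · push Not at hgδ
      have b1 := rpow_mul_rpow_le n hg (le_add_of_nonneg_right hm)
      have b2 : m ≤ m / (δ / 2) * g := by
        rw [div_mul_eq_mul_div, le_div_iff₀ (half_pos hδ)]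
        exact mul_le_mul_of_nonneg_left (by linarith) hm
      calc |t| * (c * (g ^ holderExponent n * (g + m) ^ (1 - holderExponent n))) ≤
            |t| * (c * (g + m)) := by gcongr
        _ ≤ |t| * (c * ((1 + m / (δ / 2)) * g)) := by gcongr; linarith
        _ = (|t| * (c * (1 + m / (δ / 2)))) * g := by ring
        _ ≤ 1 / 2 * g := by gcongr
        _ ≤ _ := by
          have : 0 ≤ ε / 2 * |t| := by positivity
          linarith
  have a2 : c' * t ^ 2 * (g + m) ≤ g / 2 + ε / 2 * |t| := by
    have b1 : c' * t ^ 2 * g ≤ 1 / 2 * g := by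
      refine mul_le_mul_of_nonneg_right ?_ hg
      calc c' * t ^ 2 = (|t| * c') * |t| := by rw [hsq]; ring
        _ ≤ 1 / 2 * 1 := by gcongr
        _ = _ := mul_one _
    have b2 : c' * t ^ 2 * m ≤ ε / 2 * |t| := by
      calc c' * t ^ 2 * m = (|t| * (c' * m)) * |t| := by rw [hsq]; ring
        _ ≤ _ := by gcongr
    linarith
  linarith

theorem sqrt_mul_le_rpow (hn : 1 ≤ n) {a b : ℝ} (ha : 0 ≤ a) (hab : a ≤ b) :
    √(a * b) ≤ a ^ holderExponent n * b ^ (1 - holderExponent n) := by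
  have hb : 0 ≤ b := ha.trans hab
  have hα := holderExponent_pos n
  have hα1 := holderExponent_le_one n
  have hα2 : 0 ≤ 1 - 2 * holderExponent n := by
    have : (2 : ℝ) ≤ 2 ^ n := le_self_pow₀ (by norm_num) (by omega)
    have : holderExponent n ≤ 2⁻¹ := inv_anti₀ (by norm_num) this
    linarith
  refine Real.sqrt_le_iff.mpr ⟨by positivity, ?_⟩
  calc a * b = (a ^ (2 * holderExponent n) * a ^ (1 - 2 * holderExponent n)) * b := by
        rw [← Real.rpow_add_of_nonneg ha (by linarith) hα2, add_sub_cancel, Real.rpow_one]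
    _ ≤ (a ^ (2 * holderExponent n) * b ^ (1 - 2 * holderExponent n)) * b := by gcongr
    _ = a ^ (2 * holderExponent n) * (b ^ (1 - 2 * holderExponent n) * b ^ (1 : ℝ)) := by
        rw [Real.rpow_one]; ring
    _ = (a ^ holderExponent n * b ^ (1 - holderExponent n)) ^ 2 := by
        rw [← Real.rpow_add_of_nonneg hb hα2 zero_le_one, mul_pow, ← Real.rpow_natCast,
          ← Real.rpow_natCast, ← Real.rpow_mul ha, ← Real.rpow_mul hb]
        congr 2 <;> push_cast <;> ring

variable {n : ℕ} {X : Type u} [TopologicalSpace X] {Z : Type v}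
  [AddCommGroup Z] [Module ℝ Z] [PartialOrder Z] {S : PluripotentialSetup n X Z}
  {ω ω₁ θ : Z} {φ : S.D} {s ε : ℝ}
  [IsOrderedAddMonoid Z] [PosSMulMono ℝ Z]

theorem smul_le_of_abs_le (hω : 0 ≤ ω) {K : ℝ} (h1 : θ ≤ K • ω) (h2 : -θ ≤ K • ω) {t ε : ℝ}
    (h : K * |t| ≤ ε) : t • θ ≤ ε • ω ∧ -(t • θ) ≤ ε • ω := by
  have key : |t| • θ ≤ ε • ω ∧ -(|t| • θ) ≤ ε • ω := by
    have k1 := smul_le_smul_of_nonneg_left h1 (abs_nonneg t)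
    have k2 := smul_le_smul_of_nonneg_left h2 (abs_nonneg t)
    rw [smul_smul, mul_comm] at k1 k2
    rw [smul_neg] at k2
    exact ⟨le_smul_of_le_smul hω k1 h, le_smul_of_le_smul hω k2 h⟩
  rcases abs_choice t with e | e <;> rw [e] at key
  · exact key
  · rw [neg_smul, neg_neg] at key
    exact key.symm

/-- Small perturbations of `ω` by an `ω`-bounded form. -/
theorem isClose_add_smul (hω : 0 ≤ ω) (hφ : φ ∈ S.psh ω) {K : ℝ} (h1 : θ ≤ K • ω)
    (h2 : -θ ≤ K • ω) {t ε s : ℝ} (hε : 0 < ε) (hε' : ε ≤ 1 / 2) (h : K * |t| ≤ ε)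
    (hs : |s - 1| ≤ ε) : IsClose S ω φ (ω + t • θ) s ε := by
  obtain ⟨k1, k2⟩ := smul_le_of_abs_le hω h1 h2 h
  exact ⟨hω, hφ, hε, by linarith, hs, by rwa [add_sub_cancel_left], by rwa [add_sub_cancel_left]⟩

theorem vol_add_smul_bounds (hω : 0 ≤ ω) (hV : 0 < S.vol ω) {K : ℝ} (h1 : θ ≤ K • ω)
    (h2 : -θ ≤ K • ω) {t : ℝ} (h : K * |t| ≤ 1 / 2) :
    0 < S.vol (ω + t • θ) ∧ S.vol ω ≤ closeConst n * S.vol (ω + t • θ) := by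
  obtain ⟨-, k2⟩ := smul_le_of_abs_le hω h1 h2 h
  have e : (2 : ℝ) • (ω + t • θ) - ω = (2 : ℝ) • ((1 / 2 : ℝ) • ω - -(t • θ)) := by module
  have hle : ω ≤ (2 : ℝ) • (ω + t • θ) := by
    rw [← sub_nonneg, e]
    exact smul_nonneg (by norm_num) (sub_nonneg.mpr k2)
  have hnn : 0 ≤ ω + t • θ := by
    have e' : ω + t • θ = ((1 / 2 : ℝ) • ω - -(t • θ)) + (1 / 2 : ℝ) • ω := by module
    rw [e']
    exact add_nonneg (sub_nonneg.mpr k2) (smul_nonneg (by norm_num) hω)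
  have hv := vol_le_of_le (S := S) hnn hω (by norm_num) hle
  have hv0 : 0 < S.vol (ω + t • θ) := by
    by_contra hneg
    push Not at hneg
    have : (2 : ℝ) ^ n * S.vol (ω + t • θ) ≤ 0 :=
      mul_nonpos_of_nonneg_of_nonpos (by positivity) hneg
    linarith
  refine ⟨hv0, hv.trans (mul_le_mul_of_nonneg_right ?_ hv0.le)⟩
  refine (pow_le_pow_left₀ (by norm_num) (by norm_num : (2 : ℝ) ≤ 600) n).trans ?_
  exact pow_le_pow_right₀ (by norm_num) (Nat.le_succ n)

/-- Second order estimate for the energy, when the reference form and the function move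
simultaneously. -/
theorem abs_MAEnergy_sub_linear_le (hω : 0 ≤ ω) (hV : 0 < S.vol ω) (hφ : φ ∈ S.psh ω)
    (hφ0 : ∀ x, (φ : C(X, ℝ)) x ≤ 0) {K : ℝ} (hK : 0 < K) (h1 : θ ≤ K • ω) (h2 : -θ ≤ K • ω)
    {k t : ℝ} (hk : |k| ≤ K) (ht : K * |t| ≤ 1 / 2) :
    |S.MAEnergy (ω + t • θ) ((1 + k * t) • φ) - S.MAEnergy ω φ -
      t * (S.twist ω θ φ + k * S.MA ω φ (φ : C(X, ℝ)))| ≤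
      8 * closeConst n ^ 5 * K ^ 2 * t ^ 2 * S.negMass ω φ := by
  rcases eq_or_ne t 0 with rfl | ht0
  · simp
  have hm := negMass_nonneg hV hω hφ hφ0
  have hP := one_le_closeConst n
  have ht' : 0 < |t| := abs_pos.mpr ht0
  set m := S.negMass ω φ
  set P := closeConst n with hPdef
  set ε := K * |t| with hε
  have hε0 : 0 < ε := by positivity
  set a := S.twist ω θ φ + k * S.MA ω φ (φ : C(X, ℝ)) with ha
  have hline : ∀ τ : ℝ, φ + τ • k • φ = (1 + k * τ) • φ := fun τ => by module
  have hd : ∀ τ ∈ Set.Icc (-|t|) |t|, HasDerivWithinAt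
      (fun τ : ℝ => S.MAEnergy (ω + τ • θ) (φ + τ • k • φ) - τ * a)
      (S.twist (ω + τ • θ) θ ((1 + k * τ) • φ) + S.MA (ω + τ • θ) ((1 + k * τ) • φ)
        ((k • φ : S.D) : C(X, ℝ)) - a) (Set.Icc (-|t|) |t|) τ := by
    intro τ hτ
    have hτ' : K * |τ| ≤ 1 / 2 :=
      (mul_le_mul_of_nonneg_left (abs_le.mpr hτ) hK.le).trans ht
    have hd := S.hasDerivAt_MAEnergy ω θ φ (k • φ) τ
      (vol_add_smul_bounds hω hV h1 h2 hτ').1.ne'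
    rw [hline] at hd
    have := hd.sub ((hasDerivAt_id τ).mul_const a)
    rw [one_mul] at this
    exact this.hasDerivWithinAt
  have hb : ∀ τ ∈ Set.Icc (-|t|) |t|, ‖S.twist (ω + τ • θ) θ ((1 + k * τ) • φ) +
      S.MA (ω + τ • θ) ((1 + k * τ) • φ) ((k • φ : S.D) : C(X, ℝ)) - a‖ ≤
      8 * P ^ 5 * K * ε * m := by
    intro τ hτ
    have hτε : K * |τ| ≤ ε := mul_le_mul_of_nonneg_left (abs_le.mpr hτ) hK.le
    obtain ⟨v1, v2⟩ := vol_add_smul_bounds hω hV h1 h2 (hτε.trans ht)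
    have hs : |(1 + k * τ) - 1| ≤ ε := by
      rw [add_sub_cancel_left, abs_mul]
      exact (mul_le_mul_of_nonneg_right hk (abs_nonneg τ)).trans hτε
    have hcl := isClose_add_smul hω hφ h1 h2 hε0 ht hτε hs
    have b1 := hcl.abs_twist_sub_le hV v1 v2 hφ0 hK h1 h2
    have b2 := hcl.abs_MA_sub_le hV v1 v2 hφ0
    rw [Real.norm_eq_abs, Submodule.coe_smul, map_smul, smul_eq_mul, ha]
    have e : ∀ x x' y y' : ℝ, x' + k * y' - (x + k * y) = -((x - x') + k * (y - y')) :=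
      fun _ _ _ _ => by ring
    rw [e, abs_neg]
    refine (abs_add_le _ _).trans ?_
    rw [abs_mul]
    have hPP : P ^ 3 ≤ P ^ 5 := pow_le_pow_right₀ hP (by norm_num)
    calc _ ≤ ε * (6 * P ^ 5) * K * m + K * (ε * (2 * P ^ 3) * m) := by gcongr
      _ = (6 * P ^ 5 + 2 * P ^ 3) * K * ε * m := by ring
      _ ≤ _ := by gcongr; linarith
  have key := (convex_Icc (-|t|) |t|).norm_image_sub_le_of_norm_hasDerivWithin_le hd hb
    (⟨by linarith, by linarith⟩ : (0 : ℝ) ∈ Set.Icc (-|t|) |t|)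
    (⟨neg_abs_le t, le_abs_self t⟩ : t ∈ Set.Icc (-|t|) |t|)
  simp only [zero_smul, add_zero, zero_mul, sub_zero, hline, Real.norm_eq_abs] at key
  have e : S.MAEnergy (ω + t • θ) ((1 + k * t) • φ) - t * a - S.MAEnergy ω φ =
    S.MAEnergy (ω + t • θ) ((1 + k * t) • φ) - S.MAEnergy ω φ - t * a := by ring
  rw [e] at key
  refine key.trans_eq ?_
  rw [hε, ← sq_abs t]; ring

end PluripotentialSetup

namespace PluripotentialSetup

variable {n : ℕ} {X : Type u} [TopologicalSpace X] {Z : Type v}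
  [AddCommGroup Z] [Module ℝ Z] [PartialOrder Z] {S : PluripotentialSetup n X Z}
  {ω ω₁ θ : Z} {φ : S.D} {s ε : ℝ}

theorem FiniteEnergy.gap_sub_constD (hV : 0 < S.vol ω) (μ : S.FiniteEnergy ω) (φ : S.D) (c : ℝ) :
    μ.gap (φ - S.constD c) = μ.gap φ := by
  rw [FiniteEnergy.gap, FiniteEnergy.gap, MAEnergy_sub_constD hV, Submodule.coe_sub, map_sub,
    coe_constD, map_smul, μ.isProbability.2, smul_eq_mul]
  ring

/-- The functional maximized in the definition of the energy is invariant under translation by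
constants. -/
theorem MAEnergy_sub_apply_smul_sub_constD (hV : 0 < S.vol ω) {μ : RadonMeasure X}
    (hμ : μ.IsProbability) (φ : S.D) (c s : ℝ) :
    S.MAEnergy ω (s • (φ - S.constD c)) - s * μ ((φ - S.constD c : S.D) : C(X, ℝ)) =
      S.MAEnergy ω (s • φ) - s * μ (φ : C(X, ℝ)) := by
  have e : s • (φ - S.constD c) = s • φ - S.constD (s * c) := by
    refine Subtype.ext ?_
    simp only [Submodule.coe_smul, Submodule.coe_sub, coe_constD]
    module
  rw [e, MAEnergy_sub_constD hV, Submodule.coe_sub, map_sub, coe_constD, map_smul, hμ.2,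
    smul_eq_mul]
  ring

variable [IsOrderedAddMonoid Z] [PosSMulMono ℝ Z] [CompactSpace X]

/-- Almost maximizers almost satisfy the Euler--Lagrange equation. -/
theorem FiniteEnergy.abs_MA_sub_self_le (hω : 0 ≤ ω) (hV : 0 < S.vol ω)
    (ho : S.OrthogonalityProperty ω) (μ : S.FiniteEnergy ω) (hφ : φ ∈ S.psh ω) :
    |S.MA ω φ (φ : C(X, ℝ)) - μ.toMeasure (φ : C(X, ℝ))| ≤ dimConst n ^ 8 *
      (μ.gap φ ^ holderExponent n * (μ.gap φ + μ.Jplus) ^ (1 - holderExponent n)) := by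
  have hκ := dimConst_pos n
  have hκ1 := one_le_dimConst n
  have hz := S.zero_mem_psh hω
  have hg := μ.gap_nonneg hω hφ
  have hJ := μ.J_nonneg hω
  have hTn : 0 ≤ (S.submeanConst ω).toReal := ENNReal.toReal_nonneg
  have hκ2 : 1 ≤ dimConst n ^ 2 := one_le_pow₀ hκ1
  have hq := μ.quasiDist_zero_le hω hV hφ
  have h0 : 0 ≤ dimConst n ^ 2 * (μ.gap φ + μ.J) := by positivity
  have key := μ.sub_MA_sq_le hω hV ho hφ hz hφ hq (by rwa [quasiDist_self]) hq
    (by nlinarith)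
  rw [sub_zero] at key
  have hJp : μ.gap φ ≤ μ.gap φ + μ.Jplus := le_add_of_nonneg_right (μ.Jplus_nonneg hω)
  refine le_trans ?_ (mul_le_mul_of_nonneg_left (sqrt_mul_le_rpow S.one_le_dim hg hJp)
    (by positivity))
  rw [abs_sub_comm, ← Real.sqrt_sq (show 0 ≤ dimConst n ^ 8 by positivity), ← Real.sqrt_mul
    (by positivity)]
  refine Real.abs_le_sqrt (key.trans ?_)
  have hκ15 : dimConst n ^ 15 ≤ (dimConst n ^ 8) ^ 2 := by
    rw [← pow_mul]; exact pow_le_pow_right₀ hκ1 (by norm_num)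
  calc dimConst n ^ 13 * (dimConst n ^ 2 * (μ.gap φ + μ.J)) * μ.gap φ =
        dimConst n ^ 15 * (μ.gap φ * (μ.gap φ + μ.J)) := by ring
    _ ≤ (dimConst n ^ 8) ^ 2 * (μ.gap φ * (μ.gap φ + μ.Jplus)) := by
        gcongr
        rw [FiniteEnergy.Jplus]; linarith

/-- First order expansion of the functional maximized in the definition of the energy. -/
theorem abs_functional_sub_le (hS : S.SubmeanValueProperty) (hp : S.IsPolarization ω)
    (ho : S.OrthogonalityProperty ω) {K : ℝ} (hK : 0 < K) (h1 : θ ≤ K • ω) (h2 : -θ ≤ K • ω)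
    (μ : S.FiniteEnergy ω) (hφ : φ ∈ S.psh ω) {k t : ℝ} (hk : |k| ≤ K) (ht : K * |t| ≤ 1 / 2) :
    |S.MAEnergy (ω + t • θ) ((1 + k * t) • φ) - (1 + k * t) * μ.toMeasure (φ : C(X, ℝ)) -
      (μ.J - μ.gap φ + t * twistedEnergy hS hp ho θ μ)| ≤
      |t| * ((dimConst n ^ 38 + dimConst n ^ 8) * K *
        (μ.gap φ ^ holderExponent n * (μ.gap φ + μ.Jplus) ^ (1 - holderExponent n))) +
      8 * closeConst n ^ 5 * K ^ 2 * dimConst n ^ 20 * t ^ 2 * (μ.gap φ + μ.Jplus) := by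
  have hV := hp.vol_pos
  have hT := hp.submeanConst_ne_top hS
  have hP := closeConst_pos n
  have := nonempty_of_vol_pos hV
  obtain ⟨c, hφ', h0, hx⟩ := exists_normalized hφ
  have hVt := (vol_add_smul_bounds hp.1 hV h1 h2 ht).1
  rw [← MAEnergy_sub_apply_smul_sub_constD hVt μ.isProbability φ c (1 + k * t),
    ← μ.gap_sub_constD hV φ c]
  generalize φ - S.constD c = ψ at *
  have a1 := abs_MAEnergy_sub_linear_le hp.1 hV hφ' h0 hK h1 h2 hk ht
  have a2 := abs_twist_sub_twistedEnergy_le hS hp ho hK h1 h2 μ hφ'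
  have a3 := μ.abs_MA_sub_self_le hp.1 hV ho hφ'
  have a4 := μ.negMass_le_gap hp.1 hV ho hT hφ' hx
  have e : S.MAEnergy (ω + t • θ) ((1 + k * t) • ψ) - (1 + k * t) * μ.toMeasure (ψ : C(X, ℝ)) -
      (μ.J - μ.gap ψ + t * twistedEnergy hS hp ho θ μ) =
      (S.MAEnergy (ω + t • θ) ((1 + k * t) • ψ) - S.MAEnergy ω ψ -
        t * (S.twist ω θ ψ + k * S.MA ω ψ (ψ : C(X, ℝ)))) +
      t * ((S.twist ω θ ψ - twistedEnergy hS hp ho θ μ) +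
        k * (S.MA ω ψ (ψ : C(X, ℝ)) - μ.toMeasure (ψ : C(X, ℝ)))) := by
    rw [FiniteEnergy.gap]; ring
  rw [e]
  refine (abs_add_le _ _).trans ?_
  rw [abs_mul t]
  generalize μ.gap ψ ^ holderExponent n * (μ.gap ψ + μ.Jplus) ^ (1 - holderExponent n) = Φ at *
  have b1 : |(S.twist ω θ ψ - twistedEnergy hS hp ho θ μ) +
        k * (S.MA ω ψ (ψ : C(X, ℝ)) - μ.toMeasure (ψ : C(X, ℝ)))| ≤
      (dimConst n ^ 38 + dimConst n ^ 8) * K * Φ := by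
    refine (abs_add_le _ _).trans ?_
    rw [abs_mul]
    calc _ ≤ dimConst n ^ 38 * K * Φ + K * (dimConst n ^ 8 * Φ) := by gcongr
      _ = _ := by ring
  have b2 : 8 * closeConst n ^ 5 * K ^ 2 * t ^ 2 * S.negMass ω ψ ≤
      8 * closeConst n ^ 5 * K ^ 2 * dimConst n ^ 20 * t ^ 2 * (μ.gap ψ + μ.Jplus) := by
    calc _ ≤ 8 * closeConst n ^ 5 * K ^ 2 * t ^ 2 *
          (dimConst n ^ 20 * (μ.gap ψ + μ.Jplus)) := by gcongr
      _ = _ := by ring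
  have b3 := mul_le_mul_of_nonneg_left b1 (abs_nonneg t)
  linarith

/-- Differentiability of the energy in the direction of an `ω`-bounded form, in quantitative
form. -/
theorem eventually_abs_energy_sub_le (hS : S.SubmeanValueProperty) (hp : S.IsPolarization ω)
    (ho : S.OrthogonalityProperty ω) {K : ℝ} (hK : 0 < K) (h1 : θ ≤ K • ω) (h2 : -θ ≤ K • ω)
    (μ : S.FiniteEnergy ω) {ε : ℝ} (hε : 0 < ε) :
    ∀ᶠ t : ℝ in 𝓝 0, ∃ e : ℝ, S.energy (ω + t • θ) μ.toMeasure = e ∧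
      |e - (μ.J + t * twistedEnergy hS hp ho θ μ)| ≤ ε * |t| := by
  have hκ := dimConst_pos n
  have hP := closeConst_pos n
  set c := (dimConst n ^ 38 + dimConst n ^ 8) * K with hc
  have hc0 : 0 ≤ c := by positivity
  set c' := 8 * closeConst n ^ 5 * K ^ 2 * dimConst n ^ 20 with hc'
  have hJp := μ.Jplus_nonneg hp.1
  set j := twistedEnergy hS hp ho θ μ with hj
  filter_upwards [eventually_forall_error_le n (c' := c') hc0 hJp hε,
    eventually_abs_mul_le K one_half_pos, eventually_abs_mul_le (c' * μ.Jplus) (half_pos hε)]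
    with t herr htK ht2
  rw [mul_comm] at htK
  rcases eq_or_ne t 0 with rfl | ht0
  · exact ⟨μ.J, by rw [zero_smul, add_zero, μ.coe_J hp.1], by simp⟩
  have ht' : 0 < |t| := abs_pos.mpr ht0
  obtain ⟨k, hk, hkt⟩ : ∃ k : ℝ, |k| = K ∧ k * t = K * |t| := by
    rcases abs_choice t with e | e <;> rw [e]
    · exact ⟨K, abs_of_pos hK, rfl⟩
    · exact ⟨-K, by rw [abs_neg, abs_of_pos hK], by ring⟩
  obtain ⟨m1, m2⟩ := smul_le_of_abs_le hp.1 h1 h2 (le_refl (K * |t|))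
  have hKt : 0 < K * |t| := by positivity
  -- a competitor for `ω + tθ` is `1 + K|t|` times an `ω`-psh function, whose gap absorbs the error
  have hup : S.energy (ω + t • θ) μ.toMeasure ≤ ((μ.J + t * j + ε * |t| : ℝ) : EReal) := by
    refine iSup₂_le fun φ' hφ' => EReal.coe_le_coe_iff.mpr ?_
    have hs : 0 < 1 + K * |t| := by linarith
    have hle : ω + t • θ ≤ (1 + K * |t|) • ω := by
      rw [add_smul, one_smul]
      exact add_le_add le_rfl m1
    have hφ := smul_inv_mem_psh hs hle hφ'
    have key := abs_le.mp (abs_functional_sub_le hS hp ho hK h1 h2 μ hφ hk.le htK)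
    rw [hkt, smul_smul, mul_inv_cancel₀ hs.ne', one_smul, Submodule.coe_smul, map_smul,
      smul_eq_mul, mul_inv_cancel_left₀ hs.ne'] at key
    have := herr _ (μ.gap_nonneg hp.1 hφ)
    linarith [key.2]
  -- conversely, `1 - K|t|` times an `ω`-psh function is a competitor for `ω + tθ`
  have hlow : ∀ φ ∈ S.psh ω, ((μ.J - μ.gap φ + t * j - (|t| * (c * (μ.gap φ ^ holderExponent n *
      (μ.gap φ + μ.Jplus) ^ (1 - holderExponent n))) + c' * t ^ 2 * (μ.gap φ + μ.Jplus)) : ℝ) :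
        EReal) ≤ S.energy (ω + t • θ) μ.toMeasure := by
    intro φ hφ
    have hφ' : (1 + -k * t) • φ ∈ S.psh (ω + t • θ) := by
      have e : ω + t • θ + S.ddc ((1 + -k * t) • φ) =
          ((K * |t|) • ω - -(t • θ)) + (1 - K * |t|) • (ω + S.ddc φ) := by
        rw [neg_mul, hkt, map_smul]; module
      rw [psh, Set.mem_ofPred_eq, e]
      exact add_nonneg (sub_nonneg.mpr m2) (smul_nonneg (by linarith) hφ)
    refine le_trans (EReal.coe_le_coe_iff.mpr ?_) (le_iSup₂ (f := fun (φ : S.D)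
      (_ : φ ∈ S.psh (ω + t • θ)) => ((S.MAEnergy (ω + t • θ) φ - μ.toMeasure (φ : C(X, ℝ)) : ℝ) :
        EReal)) _ hφ')
    have key := abs_le.mp (abs_functional_sub_le hS hp ho hK h1 h2 μ hφ (k := -k)
      (by rw [abs_neg, hk]) htK)
    rw [Submodule.coe_smul, map_smul, smul_eq_mul]
    linarith [key.1]
  obtain ⟨e, he⟩ : ∃ e : ℝ, S.energy (ω + t • θ) μ.toMeasure = e := by
    refine ⟨_, (EReal.coe_toReal (hup.trans_lt (EReal.coe_lt_top _)).ne ?_).symm⟩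
    exact ((EReal.bot_lt_coe _).trans_le (hlow 0 (S.zero_mem_psh hp.1))).ne'
  refine ⟨e, he, ?_⟩
  rw [he, EReal.coe_le_coe_iff] at hup
  have hα := holderExponent_pos n
  have hα1 := holderExponent_le_one n
  -- the errors tend to `c' t² J⁺` along maximizing sequences
  have hcont : ContinuousAt (fun g : ℝ => g + (|t| * (c * (g ^ holderExponent n *
      (g + μ.Jplus) ^ (1 - holderExponent n))) + c' * t ^ 2 * (g + μ.Jplus))) 0 := by
    refine continuousAt_id.add (ContinuousAt.add (continuousAt_const.mul (continuousAt_const.mul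
      (ContinuousAt.mul ?_ ?_))) (by fun_prop))
    · exact Real.continuousAt_rpow_const _ _ (Or.inr hα.le)
    · exact ContinuousAt.rpow_const (by fun_prop) (Or.inr (by linarith))
  have hsm : c' * t ^ 2 * μ.Jplus < ε * |t| := by
    have : c' * t ^ 2 * μ.Jplus = (|t| * (c' * μ.Jplus)) * |t| := by
      rw [← sq_abs t]; ring
    rw [this]
    have := mul_le_mul_of_nonneg_right ht2 ht'.le
    nlinarith
  have h0 := hcont.eventually_lt_const (u := ε * |t|) (by
    simpa [Real.zero_rpow hα.ne'] using hsm)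
  obtain ⟨δ, hδ, h⟩ := Metric.eventually_nhds_iff.mp h0
  obtain ⟨φ, hφ, hgap⟩ := μ.exists_gap_lt hp.1 hδ
  have hl := hlow φ hφ
  rw [he, EReal.coe_le_coe_iff] at hl
  have := h (y := μ.gap φ) (by rwa [Real.dist_0_eq_abs, abs_of_nonneg (μ.gap_nonneg hp.1 hφ)])
  rw [abs_le]
  constructor <;> linarith

end PluripotentialSetup

namespace PluripotentialSetup

variable {n : ℕ} {X : Type u} [TopologicalSpace X] {Z : Type v}
  [AddCommGroup Z] [Module ℝ Z] [PartialOrder Z] {S : PluripotentialSetup n X Z}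
  {ω ω' θ : Z} {φ : S.D} {s ε : ℝ}

theorem energy_le_of_shift {μ : RadonMeasure X} (g : S.D) {c : ℝ}
    (h : S.energy (ω + S.ddc g) μ ≤ c) :
    S.energy ω μ ≤ ((c + (S.MAEnergy ω g - μ (g : C(X, ℝ))) : ℝ) : EReal) := by
  refine iSup₂_le fun φ hφ => EReal.coe_le_coe_iff.mpr ?_
  have h1 := (le_iSup₂ (f := fun (φ : S.D) (_ : φ ∈ S.psh (ω + S.ddc g)) =>
    ((S.MAEnergy (ω + S.ddc g) φ - μ (φ : C(X, ℝ)) : ℝ) : EReal)) _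
    (sub_mem_psh_shift.mpr hφ)).trans h
  rw [EReal.coe_le_coe_iff, MAEnergy_shift, Submodule.coe_sub, map_sub] at h1
  linarith

/-- The energy under a change of reference form in its class. -/
theorem energy_eq_of_shift {μ : RadonMeasure X} (g : S.D) {c : ℝ}
    (h : S.energy (ω + S.ddc g) μ = c) :
    S.energy ω μ = ((c + (S.MAEnergy ω g - μ (g : C(X, ℝ))) : ℝ) : EReal) := by
  refine le_antisymm (energy_le_of_shift g h.le) ?_
  by_contra! hlt
  obtain ⟨r, hr1, hr2⟩ := EReal.lt_iff_exists_real_btwn.mp hlt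
  have e : ω + S.ddc g + S.ddc (-g) = ω := by rw [map_neg, add_neg_cancel_right]
  have h1 := energy_le_of_shift (S := S) (ω := ω + S.ddc g) (μ := μ) (-g) (c := r)
    (by rw [e]; exact hr1.le)
  have h2 := MAEnergy_shift ω g (0 : S.D)
  rw [zero_sub, S.MAEnergy_zero] at h2
  rw [h, EReal.coe_le_coe_iff, h2, Submodule.coe_neg, map_neg] at h1
  rw [EReal.coe_lt_coe_iff] at hr2
  linarith

variable [IsOrderedAddMonoid Z] [PosSMulMono ℝ Z] [CompactSpace X]

/-- Differentiability of the energy in the direction of an `ω`-bounded form. -/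
theorem hasDerivAt_energy_of_le (hS : S.SubmeanValueProperty) (hp : S.IsPolarization ω)
    (ho : S.OrthogonalityProperty ω) {K : ℝ} (hK : 0 < K) (h1 : θ ≤ K • ω) (h2 : -θ ≤ K • ω)
    (μ : S.FiniteEnergy ω) :
    HasDerivAt (fun t : ℝ => (S.energy (ω + t • θ) μ.toMeasure).toReal)
      (twistedEnergy hS hp ho θ μ) 0 := by
  rw [hasDerivAt_iff_isLittleO, Asymptotics.isLittleO_iff]
  intro ε hε
  filter_upwards [eventually_abs_energy_sub_le hS hp ho hK h1 h2 μ hε] with t ht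
  obtain ⟨e, he, hle⟩ := ht
  have h0 : (S.energy (ω + (0 : ℝ) • θ) μ.toMeasure).toReal = μ.J := by
    rw [zero_smul, add_zero]; rfl
  rw [h0, he, EReal.toReal_coe, sub_zero, smul_eq_mul, Real.norm_eq_abs, Real.norm_eq_abs]
  rwa [sub_sub]

/-- The twisted energy under a change of reference form in its class. -/
theorem twistedEnergy_shift (hS : S.SubmeanValueProperty) (hp : S.IsPolarization ω)
    (ho : S.OrthogonalityProperty ω) (θ : Z) {g : S.D} (hg : g ∈ S.psh ω)
    (μ : S.FiniteEnergy ω) (ν : S.FiniteEnergy (ω + S.ddc g))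
    (hν : ∀ φ, ν.gap (φ - g) = μ.gap φ) :
    twistedEnergy hS (hp.add_ddc hg) (ho.shift g) θ ν =
      twistedEnergy hS hp ho θ μ - S.twist ω θ g := by
  choose φ hφ h using fun k : ℕ => μ.exists_gap_lt hp.1 (ε := 1 / ((k : ℝ) + 1)) (by positivity)
  have hgap : Tendsto (fun k => μ.gap (φ k)) atTop (𝓝 0) :=
    squeeze_zero (fun k => μ.gap_nonneg hp.1 (hφ k)) (fun k => (h k).le)
      tendsto_one_div_add_atTop_nhds_zero_nat
  have t1 := ((continuous_twistedEnergy hS hp ho θ).tendsto μ).comp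
    (FiniteEnergy.tendsto_maPoint hp ho hφ hgap)
  have t2 := ((continuous_twistedEnergy hS (hp.add_ddc hg) (ho.shift g) θ).tendsto ν).comp
    (FiniteEnergy.tendsto_maPoint (hp.add_ddc hg) (ho.shift g)
      (χ := fun k => φ k - g) (fun k => sub_mem_psh_shift.mpr (hφ k))
        (by simpa only [hν] using hgap))
  refine tendsto_nhds_unique (t2.congr fun k => ?_) (t1.sub_const (S.twist ω θ g))
  have e1 := twistedEnergy_maMap hS hp ho θ ⟨φ k, hφ k⟩
  have e2 := twistedEnergy_maMap hS (hp.add_ddc hg) (ho.shift g) θ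
    ⟨φ k - g, sub_mem_psh_shift.mpr (hφ k)⟩
  rw [maMap] at e1 e2
  rw [Function.comp_apply, Function.comp_apply, e1, e2, twist_shift hp.vol_pos.ne']

/-- The energy is differentiable with respect to the reference form. -/
theorem hasDerivAt_energy (hS : S.SubmeanValueProperty) (hp : S.IsPolarization ω)
    (ho : S.OrthogonalityProperty ω) (θ : Z) (μ : S.FiniteEnergy ω) :
    (∀ᶠ t : ℝ in 𝓝 0, S.energy (ω + t • θ) μ.toMeasure ≠ ⊥ ∧
      S.energy (ω + t • θ) μ.toMeasure ≠ ⊤) ∧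
    HasDerivAt (fun t : ℝ => (S.energy (ω + t • θ) μ.toMeasure).toReal)
      (twistedEnergy hS hp ho θ μ) 0 := by
  obtain ⟨K, hK, g, hg, h1, h2⟩ := hp.exists_bound θ
  have hpg := hp.add_ddc hg
  obtain ⟨ν, hν, -, hgap⟩ := μ.exists_shift hp.1 hg
  have hshift : ∀ᶠ t : ℝ in 𝓝 0, ∃ e : ℝ,
      S.energy (ω + S.ddc g + t • θ) μ.toMeasure = e ∧
      S.energy (ω + t • θ) μ.toMeasure =
        ((e + (S.MAEnergy (ω + t • θ) g - μ.toMeasure (g : C(X, ℝ))) : ℝ) : EReal) := by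
    filter_upwards [eventually_abs_energy_sub_le hS hpg (ho.shift g) hK h1 h2 ν one_pos] with t ht
    obtain ⟨e, he, -⟩ := ht
    rw [hν] at he
    exact ⟨e, he, energy_eq_of_shift g (by rw [add_right_comm, he])⟩
  refine ⟨?_, ?_⟩
  · filter_upwards [hshift] with t ht
    obtain ⟨e, -, he⟩ := ht
    rw [he]
    exact ⟨EReal.coe_ne_bot _, EReal.coe_ne_top _⟩
  · have d1 := hasDerivAt_energy_of_le hS hpg (ho.shift g) hK h1 h2 ν
    have d2 := (hasDerivAt_MAEnergy_zero hp.vol_pos.ne' θ g).sub_const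
      (μ.toMeasure (g : C(X, ℝ)))
    have d3 := d1.add d2
    rw [twistedEnergy_shift hS hp ho θ hg μ ν hgap, sub_add_cancel] at d3
    refine d3.congr_of_eventuallyEq ?_
    filter_upwards [hshift] with t ht
    obtain ⟨e, he1, he2⟩ := ht
    rw [he2, Pi.add_apply, hν, he1, EReal.toReal_coe, EReal.toReal_coe]

end PluripotentialSetup

namespace PluripotentialSetup

variable {n : ℕ} {X : Type u} [TopologicalSpace X] {Z : Type v}
  [AddCommGroup Z] [Module ℝ Z] [PartialOrder Z] {S : PluripotentialSetup n X Z} {ω ω' θ θ' : Z}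

/-! ### Dependence of the twisted energy on the reference form -/

theorem exp_le_one_add_mul {δ : ℝ} (h0 : 0 ≤ δ) (h2 : δ ≤ 2) :
    Real.exp δ ≤ 8 ∧ Real.exp δ - 1 ≤ 8 * δ := by
  have e2 : Real.exp 2 ≤ 8 := by
    have h1 := Real.exp_one_lt_d9
    have e : Real.exp 2 = Real.exp 1 * Real.exp 1 := by rw [← Real.exp_add]; norm_num
    rw [e]
    nlinarith [Real.exp_pos 1]
  have e8 : Real.exp δ ≤ 8 := (Real.exp_le_exp.mpr h2).trans e2
  refine ⟨e8, ?_⟩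
  have h1 := Real.add_one_le_exp (-δ)
  have h3 : Real.exp δ * Real.exp (-δ) = 1 := by rw [← Real.exp_add, add_neg_cancel, Real.exp_zero]
  have h4 := Real.exp_pos δ
  nlinarith

/-- The factor by which `J⁺` changes under a change of reference form of Thompson distance at
most `2`. -/
def jplusConst (n : ℕ) : ℝ := compareConst n 8 + 8 ^ (2 * n + 1)

theorem one_le_jplusConst (n : ℕ) : 1 ≤ jplusConst n :=
  (one_le_compareConst n (by norm_num)).trans (le_add_of_nonneg_right (by positivity))

/-- The constant in the comparison of the functionals maximized in the definition of the
energy. -/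
def functionalConst (n : ℕ) : ℝ := 18 * closeConst n ^ 3 * dimConst n ^ 20

theorem functionalConst_pos (n : ℕ) : 0 < functionalConst n := by
  have := dimConst_pos n
  have := closeConst_pos n
  unfold functionalConst
  positivity

theorem FiniteEnergy.exists_normalized_gap_lt [CompactSpace X] (hω : 0 ≤ ω)
    (hV : 0 < S.vol ω) (μ : S.FiniteEnergy ω) {ε : ℝ} (hε : 0 < ε) :
    ∃ φ ∈ S.psh ω, (∀ x, (φ : C(X, ℝ)) x ≤ 0) ∧ (∃ x, (φ : C(X, ℝ)) x = 0) ∧ μ.gap φ < ε := by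
  have := nonempty_of_vol_pos hV
  obtain ⟨φ, hφ, hg⟩ := μ.exists_gap_lt hω hε
  obtain ⟨c, hφ', h0, hx⟩ := exists_normalized hφ
  exact ⟨_, hφ', h0, hx, by rwa [μ.gap_sub_constD hV]⟩

variable [IsOrderedAddMonoid Z]

theorem vol_le_closeConst_mul (hω : 0 ≤ ω) (hω' : 0 ≤ ω') (hV : 0 < S.vol ω) {A : ℝ}
    (hA : 0 ≤ A) (hA8 : A ≤ 8) (h : ω' ≤ A • ω) : S.vol ω' ≤ closeConst n * S.vol ω := by
  refine (vol_le_of_le hω hω' hA h).trans ?_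
  gcongr
  calc A ^ n ≤ 600 ^ n := pow_le_pow_left₀ hA (hA8.trans (by norm_num)) n
    _ ≤ 600 ^ (n + 1) := pow_le_pow_right₀ (by norm_num) n.le_succ

variable [PosSMulMono ℝ Z]

/-- Forms at Thompson distance less than `δ` are close. -/
theorem isClose_exp (hω : 0 ≤ ω) {φ : S.D} (hφ : φ ∈ S.psh ω) {δ : ℝ} (hδ : 0 < δ)
    (hδ2 : δ ≤ 2) (h1 : ω' ≤ Real.exp δ • ω) (h2 : ω ≤ Real.exp δ • ω') :
    IsClose S ω φ ω' (Real.exp δ)⁻¹ (8 * δ) := by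
  have hA1 : 1 ≤ Real.exp δ := Real.one_le_exp hδ.le
  obtain ⟨-, he⟩ := exp_le_one_add_mul hδ.le hδ2
  have hs : 1 - δ ≤ (Real.exp δ)⁻¹ := by
    rw [← Real.exp_neg]; linarith [Real.add_one_le_exp (-δ)]
  refine ⟨hω, hφ, by positivity, by linarith, ?_, ?_, ?_⟩
  · rw [abs_sub_comm, abs_of_nonneg (sub_nonneg.mpr (inv_le_one_of_one_le₀ hA1))]
    linarith
  · refine le_smul_of_le_smul hω (A := Real.exp δ - 1) ?_ he
    rw [sub_smul, one_smul]
    exact sub_le_sub_right h1 ω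
  · have h3 : (Real.exp δ)⁻¹ • ω ≤ ω' := by
      have := smul_le_smul_of_nonneg_left h2 (inv_nonneg.mpr (Real.exp_pos δ).le)
      rwa [smul_smul, inv_mul_cancel₀ (Real.exp_pos δ).ne', one_smul] at this
    refine le_smul_of_le_smul hω (A := 1 - (Real.exp δ)⁻¹) ?_ (by linarith)
    rw [sub_smul, one_smul, neg_sub]
    exact sub_le_sub_left h3 ω

theorem formNorm_sub_lt_top (hω : 0 ≤ ω) (hθ : S.formNorm ω θ < ⊤) (hθ' : S.formNorm ω θ' < ⊤) :
    S.formNorm ω (θ - θ') < ⊤ := by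
  obtain ⟨a1, a2⟩ := le_smul_of_formNorm_lt hω hθ (lt_add_one _)
  obtain ⟨b1, b2⟩ := le_smul_of_formNorm_lt hω hθ' (lt_add_one _)
  set a := (S.formNorm ω θ).toReal + 1
  set b := (S.formNorm ω θ').toReal + 1
  have hab : 0 ≤ a + b := by positivity
  refine (iInf₂_le (Real.toNNReal (a + b)) ⟨?_, ?_⟩).trans_lt ENNReal.coe_lt_top
  · rw [Real.coe_toNNReal _ hab, add_smul, sub_eq_add_neg]
    exact add_le_add a1 b2
  · rw [Real.coe_toNNReal _ hab, add_smul, neg_sub, sub_eq_neg_add]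
    exact add_le_add a2 b1

variable [CompactSpace X]

/-- The functionals `E_ω - μ` and `E_ω' - μ` are close at `φ` and `e^{-δ} φ`. -/
theorem FiniteEnergy.abs_functional_sub_functional_le (hω : 0 ≤ ω) (hω' : 0 ≤ ω')
    (hV : 0 < S.vol ω) (hV' : 0 < S.vol ω') (ho : S.OrthogonalityProperty ω)
    (hT : S.submeanConst ω ≠ ⊤) {δ : ℝ} (hδ : 0 < δ) (hδ2 : δ ≤ 2)
    (h1 : ω' ≤ Real.exp δ • ω) (h2 : ω ≤ Real.exp δ • ω') (μ : S.FiniteEnergy ω) {φ : S.D}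
    (hφ : φ ∈ S.psh ω) (h0 : ∀ x, (φ : C(X, ℝ)) x ≤ 0) (hx : ∃ x, (φ : C(X, ℝ)) x = 0) :
    |(S.MAEnergy ω φ - μ.toMeasure (φ : C(X, ℝ))) -
      (S.MAEnergy ω' ((Real.exp δ)⁻¹ • φ) -
        μ.toMeasure (((Real.exp δ)⁻¹ • φ : S.D) : C(X, ℝ)))| ≤
      functionalConst n * δ * (μ.gap φ + μ.Jplus) := by
  have hκ1 := one_le_dimConst n
  have hκ := dimConst_pos n
  have hP1 := one_le_closeConst n
  have hP := closeConst_pos n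
  have hc := isClose_exp hω hφ hδ hδ2 h1 h2
  have hVV := vol_le_closeConst_mul hω' hω hV' (Real.exp_pos δ).le
    (exp_le_one_add_mul hδ.le hδ2).1 h2
  have a1 := (hc.abs_MAEnergy_sub_le hV hV' hVV h0).1
  have a2 := (hc.self.abs_MAEnergy_sub_le hV hV (le_mul_of_one_le_left hV.le hP1) h0).2
  rw [one_smul] at a2
  have hN := μ.negMass_le_gap hω hV ho hT hφ hx
  have hg := μ.gap_nonneg hω hφ
  have hJ := μ.J_nonneg hω
  have hJp : μ.J ≤ μ.Jplus := le_add_of_nonneg_right ENNReal.toReal_nonneg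
  set G := μ.gap φ + μ.Jplus with hG
  have hG0 : 0 ≤ G := by linarith
  have hm : -μ.toMeasure (φ : C(X, ℝ)) = μ.J - μ.gap φ - S.MAEnergy ω φ := by
    rw [FiniteEnergy.gap]; ring
  have hm0 : 0 ≤ -μ.toMeasure (φ : C(X, ℝ)) := by
    rw [← map_neg]
    exact μ.isProbability.1 _ (fun x => by simpa using h0 x)
  have hm1 : -μ.toMeasure (φ : C(X, ℝ)) ≤ G + closeConst n ^ 2 * S.negMass ω φ := by
    rw [hm]; linarith [neg_abs_le (S.MAEnergy ω φ)]
  have hs : 1 - δ ≤ (Real.exp δ)⁻¹ := by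
    rw [← Real.exp_neg]; linarith [Real.add_one_le_exp (-δ)]
  have hs1 : (Real.exp δ)⁻¹ ≤ 1 := inv_le_one_of_one_le₀ (Real.one_le_exp hδ.le)
  have e : (S.MAEnergy ω φ - μ.toMeasure (φ : C(X, ℝ))) -
      (S.MAEnergy ω' ((Real.exp δ)⁻¹ • φ) -
        μ.toMeasure (((Real.exp δ)⁻¹ • φ : S.D) : C(X, ℝ))) =
      (S.MAEnergy ω φ - S.MAEnergy ω' ((Real.exp δ)⁻¹ • φ)) +
        (1 - (Real.exp δ)⁻¹) * -μ.toMeasure (φ : C(X, ℝ)) := by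
    rw [Submodule.coe_smul, map_smul, smul_eq_mul]; ring
  rw [e]
  refine (abs_add_le _ _).trans ?_
  rw [abs_of_nonneg (mul_nonneg (sub_nonneg.mpr hs1) hm0)]
  have b2 : (1 - (Real.exp δ)⁻¹) * -μ.toMeasure (φ : C(X, ℝ)) ≤
      δ * (G + closeConst n ^ 2 * (dimConst n ^ 20 * G)) := by
    refine mul_le_mul (by linarith) (hm1.trans ?_) hm0 hδ.le
    gcongr
  have b1 : 8 * δ * (2 * closeConst n ^ 3) * S.negMass ω φ ≤
      8 * δ * (2 * closeConst n ^ 3) * (dimConst n ^ 20 * G) := by gcongr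
  have p1 : closeConst n ^ 2 ≤ closeConst n ^ 3 := pow_le_pow_right₀ hP1 (by norm_num)
  have p2 : 1 ≤ closeConst n ^ 3 * dimConst n ^ 20 :=
    one_le_mul_of_one_le_of_one_le (one_le_pow₀ hP1) (one_le_pow₀ hκ1)
  calc _ ≤ 8 * δ * (2 * closeConst n ^ 3) * (dimConst n ^ 20 * G) +
        δ * (1 * G + closeConst n ^ 2 * (dimConst n ^ 20 * G)) := by
        rw [one_mul]; exact add_le_add (a1.trans b1) b2
    _ ≤ 8 * δ * (2 * closeConst n ^ 3) * (dimConst n ^ 20 * G) +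
        δ * ((closeConst n ^ 3 * dimConst n ^ 20) * G +
          closeConst n ^ 3 * (dimConst n ^ 20 * G)) := by gcongr
    _ = functionalConst n * δ * G := by rw [functionalConst]; ring

/-- Almost maximizers for `ω` are almost maximizers for `ω'`, up to dilation. -/
theorem FiniteEnergy.gap_smul_le (hω : 0 ≤ ω) (hω' : 0 ≤ ω')
    (hV : 0 < S.vol ω) (hV' : 0 < S.vol ω') (ho : S.OrthogonalityProperty ω)
    (hT : S.submeanConst ω ≠ ⊤) {δ : ℝ} (hδ : 0 < δ) (hδ2 : δ ≤ 2)
    (h1 : ω' ≤ Real.exp δ • ω) (h2 : ω ≤ Real.exp δ • ω') (μ : S.FiniteEnergy ω)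
    (μ' : S.FiniteEnergy ω') (hμ : μ.toMeasure = μ'.toMeasure) {φ : S.D}
    (hφ : φ ∈ S.psh ω) (h0 : ∀ x, (φ : C(X, ℝ)) x ≤ 0) (hx : ∃ x, (φ : C(X, ℝ)) x = 0) :
    μ'.gap ((Real.exp δ)⁻¹ • φ) ≤
      μ'.J - μ.J + μ.gap φ + functionalConst n * δ * (μ.gap φ + μ.Jplus) := by
  have := (abs_le.mp (μ.abs_functional_sub_functional_le hω hω' hV hV' ho hT hδ hδ2 h1 h2 hφ
    h0 hx)).2
  rw [FiniteEnergy.gap, ← hμ]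
  have e : μ.gap φ = μ.J - (S.MAEnergy ω φ - μ.toMeasure (φ : C(X, ℝ))) := by
    rw [FiniteEnergy.gap]; ring
  linarith

/-- The energy is Lipschitz in the reference form, for the Thompson distance. -/
theorem FiniteEnergy.J_sub_le (hω : 0 ≤ ω) (hω' : 0 ≤ ω')
    (hV : 0 < S.vol ω) (hV' : 0 < S.vol ω') (ho : S.OrthogonalityProperty ω)
    (hT : S.submeanConst ω ≠ ⊤) {δ : ℝ} (hδ : 0 < δ) (hδ2 : δ ≤ 2)
    (h1 : ω' ≤ Real.exp δ • ω) (h2 : ω ≤ Real.exp δ • ω') (μ : S.FiniteEnergy ω)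
    (μ' : S.FiniteEnergy ω') (hμ : μ.toMeasure = μ'.toMeasure) :
    μ.J - μ'.J ≤ functionalConst n * δ * μ.Jplus := by
  have hF := functionalConst_pos n
  refine le_of_forall_pos_le_add fun ε hε => ?_
  have hc : 0 < 1 + functionalConst n * δ := by positivity
  obtain ⟨φ, hφ, h0, hx, hg⟩ := μ.exists_normalized_gap_lt hω hV (div_pos hε hc)
  have hg' := μ.gap_nonneg hω hφ
  have hψ := smul_inv_mem_psh (Real.exp_pos δ) h2 hφ
  have k1 := μ'.gap_nonneg hω' hψ
  have k2 := μ.gap_smul_le hω hω' hV hV' ho hT hδ hδ2 h1 h2 μ' hμ hφ h0 hx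
  have k3 : (1 + functionalConst n * δ) * μ.gap φ ≤ ε := by
    rw [lt_div_iff₀ hc] at hg; linarith
  linarith

theorem FiniteEnergy.Jplus_le_mul (hω : 0 ≤ ω) (hω' : 0 ≤ ω')
    (hV : 0 < S.vol ω) (hV' : 0 < S.vol ω') (ho : S.OrthogonalityProperty ω)
    (hT : S.submeanConst ω ≠ ⊤) (h1 : ω' ≤ (8 : ℝ) • ω) (h2 : ω ≤ (8 : ℝ) • ω')
    (μ : S.FiniteEnergy ω) (μ' : S.FiniteEnergy ω') (hμ : μ.toMeasure = μ'.toMeasure) :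
    μ'.Jplus ≤ jplusConst n * μ.Jplus := by
  obtain ⟨ν, hν, hJ⟩ := μ.exists_of_comparable hω hω' hV hV' ho hT (A := 8) (by norm_num) h1 h2
  obtain rfl : ν = μ' := FiniteEnergy.toMeasure_injective (hν.trans hμ)
  have h3 := submeanConst_toReal_le hω hω' hV hV' hT (A := 8) (by norm_num) h1 h2
  have h4 : (S.submeanConst ω).toReal ≤ μ.Jplus := le_add_of_nonneg_left (μ.J_nonneg hω)
  rw [FiniteEnergy.Jplus, jplusConst, add_mul]
  refine add_le_add hJ (h3.trans ?_)
  gcongr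

/-- The ratio of the gaps, relative to `δ J⁺`, of an almost maximizer and of its dilation. -/
def ratioConst (n : ℕ) : ℝ := 3 + 2 * functionalConst n * (3 + jplusConst n) + jplusConst n

/-- The constant in the Hölder estimate for the dependence of the twisted energy on the reference
form. -/
def referenceConst (n : ℕ) : ℝ :=
  9 * dimConst n ^ 38 * ratioConst n + 768 * closeConst n ^ 5 * dimConst n ^ 20 * ratioConst n

theorem le_two_mul_rpow (n : ℕ) {δ : ℝ} (h0 : 0 < δ) (h2 : δ ≤ 2) :
    δ ≤ 2 * δ ^ holderExponent n := by
  have hα := holderExponent_le_one n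
  have hα0 := holderExponent_pos n
  calc δ = δ ^ (1 - holderExponent n) * δ ^ holderExponent n := by
        rw [← Real.rpow_add h0, sub_add_cancel, Real.rpow_one]
    _ ≤ 2 ^ (1 - holderExponent n) * δ ^ holderExponent n := by
        gcongr
    _ ≤ 2 ^ (1 : ℝ) * δ ^ holderExponent n := by
        gcongr
        · norm_num
        · linarith
    _ = _ := by rw [Real.rpow_one]

/-- Hölder dependence of the twisted energy on the reference form, when `θ` is fixed. An almost
maximizer `φ` for `ω'` is dilated to an almost maximizer for `ω`, and the value of the twisted
energy at `φ` changes little. Taking `M` larger than `J⁺_ω(μ)` leaves room for gaps when the latter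
vanishes. -/
theorem abs_twistedEnergy_sub_twistedEnergy_le (hS : S.SubmeanValueProperty)
    (hp : S.IsPolarization ω) (ho : S.OrthogonalityProperty ω) (hp' : S.IsPolarization ω')
    (ho' : S.OrthogonalityProperty ω') {δ : ℝ} (hδ : 0 < δ) (hδ2 : δ ≤ 2)
    (h1 : ω' ≤ Real.exp δ • ω) (h2 : ω ≤ Real.exp δ • ω') {K : ℝ} (hK : 0 < K)
    (hθ1 : θ ≤ K • ω) (hθ2 : -θ ≤ K • ω) (μ : S.FiniteEnergy ω) (μ' : S.FiniteEnergy ω')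
    (hμ : μ.toMeasure = μ'.toMeasure) {M : ℝ} (hM : μ.Jplus < M) :
    |twistedEnergy hS hp ho θ μ - twistedEnergy hS hp' ho' θ μ'| ≤
      referenceConst n * δ ^ holderExponent n * K * M := by
  have hκ := dimConst_pos n
  have hP := closeConst_pos n
  have hF := functionalConst_pos n
  have hj1 := one_le_jplusConst n
  have hV := hp.vol_pos
  have hV' := hp'.vol_pos
  have hT := hp.submeanConst_ne_top hS
  have hT' := hp'.submeanConst_ne_top hS
  have hJp := μ.Jplus_nonneg hp.1
  have hJp' := μ'.Jplus_nonneg hp'.1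
  have hM0 : 0 < M := hJp.trans_lt hM
  have he8 := (exp_le_one_add_mul hδ.le hδ2).1
  have h1' := le_smul_of_le_smul hp.1 h1 he8
  have h2' := le_smul_of_le_smul hp'.1 h2 he8
  have hJM : μ'.Jplus ≤ jplusConst n * M :=
    (μ.Jplus_le_mul hp.1 hp'.1 hV hV' ho hT h1' h2' μ' hμ).trans (by gcongr)
  -- an almost maximizer for `ω'` and its dilation
  obtain ⟨φ, hφ, h0, hx, hg⟩ := μ'.exists_normalized_gap_lt hp'.1 hV' (mul_pos hδ hM0)
  have hg0 := μ'.gap_nonneg hp'.1 hφ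
  have hψ := smul_inv_mem_psh (Real.exp_pos δ) h1 hφ
  have hψ0 := μ.gap_nonneg hp.1 hψ
  have g1 := μ'.gap_smul_le hp'.1 hp.1 hV' hV ho' hT' hδ hδ2 h2 h1 μ hμ.symm hφ h0 hx
  have g2 := μ.J_sub_le hp.1 hp'.1 hV hV' ho hT hδ hδ2 h1 h2 μ' hμ
  set ψ : S.D := (Real.exp δ)⁻¹ • φ with hψd
  have hδM : δ * M ≤ 2 * M := by gcongr
  have hr : ratioConst n = 3 + 2 * functionalConst n * (3 + jplusConst n) + jplusConst n := rfl
  have hfj : 0 < functionalConst n * (3 + jplusConst n) := by positivity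
  have hr1 : 1 ≤ ratioConst n := by linarith
  have hr0 : 0 < ratioConst n := one_pos.trans_le hr1
  have g3 : μ.gap ψ ≤ (1 + functionalConst n * (3 + jplusConst n)) * (δ * M) := by
    calc μ.gap ψ ≤ δ * M + functionalConst n * δ * (2 * M + jplusConst n * M) +
          functionalConst n * δ * M := by
          have k1 : functionalConst n * δ * (μ'.gap φ + μ'.Jplus) ≤
            functionalConst n * δ * (2 * M + jplusConst n * M) := by gcongr; linarith
          have k2 : functionalConst n * δ * μ.Jplus ≤ functionalConst n * δ * M := by gcongr
          linarith
      _ = _ := by ring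
  have g4 : μ.gap ψ ≤ ratioConst n * (δ * M) := by
    refine g3.trans ?_
    gcongr
    linarith
  have g5 : μ.gap ψ + μ.Jplus ≤ ratioConst n * M := by
    have : (1 + functionalConst n * (3 + jplusConst n)) * (δ * M) ≤
      (1 + functionalConst n * (3 + jplusConst n)) * (2 * M) := by gcongr
    calc _ ≤ (1 + functionalConst n * (3 + jplusConst n)) * (2 * M) + M := by linarith
      _ = (3 + 2 * functionalConst n * (3 + jplusConst n) + 0) * M := by ring
      _ ≤ ratioConst n * M := by rw [hr]; gcongr; linarith
  have g6 : μ'.gap φ ≤ ratioConst n * (δ * M) :=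
    hg.le.trans (le_mul_of_one_le_left (by positivity) hr1)
  have g7 : μ'.gap φ + μ'.Jplus ≤ ratioConst n * M := by
    calc _ ≤ (3 + 0 + jplusConst n) * M := by linarith
      _ ≤ ratioConst n * M := by rw [hr]; gcongr; linarith
  have hδα : (δ * M) ^ holderExponent n * M ^ (1 - holderExponent n) =
      δ ^ holderExponent n * M := by
    rw [Real.mul_rpow hδ.le hM0.le, mul_assoc, ← Real.rpow_add hM0, add_sub_cancel, Real.rpow_one]
  have r1 := rpow_mul_rpow_mono n hr1 (by positivity) hψ0 hM0.le (by positivity) g4 g5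
  have r2 := rpow_mul_rpow_mono n hr1 (by positivity) hg0 hM0.le (by positivity) g6 g7
  rw [hδα] at r1 r2
  -- the errors in passing from measures to functions, and from `ω'` to `ω`
  have hθ' : ∀ {ζ : Z}, ζ ≤ K • ω → ζ ≤ (8 * K) • ω' := fun h => by
    refine h.trans ?_
    rw [mul_comm, mul_smul]
    exact smul_le_smul_of_nonneg_left h2' hK.le
  have t1 := abs_twist_sub_twistedEnergy_le hS hp ho hK hθ1 hθ2 μ hψ
  have t2 := abs_twist_sub_twistedEnergy_le hS hp' ho' (by positivity) (hθ' hθ1) (hθ' hθ2) μ' hφ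
  have t3 := (isClose_exp hp'.1 hφ hδ hδ2 h2 h1).abs_twist_sub_le hV' hV
    (vol_le_closeConst_mul hp.1 hp'.1 hV (Real.exp_pos δ).le he8 h1) h0
    (by positivity) (hθ' hθ1) (hθ' hθ2)
  have t4 := (μ'.negMass_le_gap hp'.1 hV' ho' hT' hφ hx).trans
    (mul_le_mul_of_nonneg_left g7 (by positivity))
  have e : twistedEnergy hS hp ho θ μ - twistedEnergy hS hp' ho' θ μ' =
      -(S.twist ω θ ψ - twistedEnergy hS hp ho θ μ) +
      (S.twist ω' θ φ - twistedEnergy hS hp' ho' θ μ') - (S.twist ω' θ φ - S.twist ω θ ψ) := by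
    ring
  rw [e]
  refine (abs_sub _ _).trans ?_
  refine (add_le_add (abs_add_le _ _) le_rfl).trans ?_
  rw [abs_neg]
  have hδ' := le_two_mul_rpow n hδ hδ2
  have hδp : 0 < δ ^ holderExponent n := Real.rpow_pos_of_pos hδ _
  calc _ ≤ dimConst n ^ 38 * K * (ratioConst n * (δ ^ holderExponent n * M)) +
        dimConst n ^ 38 * (8 * K) * (ratioConst n * (δ ^ holderExponent n * M)) +
        8 * (2 * δ ^ holderExponent n) * (6 * closeConst n ^ 5) * (8 * K) *
          (dimConst n ^ 20 * (ratioConst n * M)) := by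
        refine add_le_add (add_le_add (t1.trans ?_) (t2.trans ?_)) (t3.trans ?_)
        · gcongr
        · gcongr
        · refine mul_le_mul ?_ t4 ?_ (by positivity)
          · gcongr
          · exact negMass_nonneg hV' hp'.1 hφ h0
    _ = referenceConst n * δ ^ holderExponent n * K * M := by rw [referenceConst]; ring

theorem abs_twistedEnergy_sub_twistedEnergy_le_formNorm (hS : S.SubmeanValueProperty)
    (hp : S.IsPolarization ω) (ho : S.OrthogonalityProperty ω) (hp' : S.IsPolarization ω')
    (ho' : S.OrthogonalityProperty ω') (hd : S.thompsonDist ω ω' ≤ 1)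
    (hθ : S.formNorm ω θ < ⊤) (μ : S.FiniteEnergy ω) (μ' : S.FiniteEnergy ω')
    (hμ : μ.toMeasure = μ'.toMeasure) :
    |twistedEnergy hS hp ho θ μ - twistedEnergy hS hp' ho' θ μ'| ≤
      referenceConst n * (S.thompsonDist ω ω').toReal ^ holderExponent n *
        (S.formNorm ω θ).toReal * μ.Jplus := by
  refine le_mul_of_forall_lt fun M hM => ?_
  have hd1 : (S.thompsonDist ω ω').toReal ≤ 1 := by
    simpa using ENNReal.toReal_mono ENNReal.one_ne_top hd
  have hcont : Continuous fun δ : ℝ => referenceConst n * δ ^ holderExponent n *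
      (S.formNorm ω θ).toReal * M := by
    have := Real.continuous_rpow_const (q := holderExponent n) (holderExponent_pos n).le
    fun_prop
  have hlim := (hcont.tendsto (S.thompsonDist ω ω').toReal).mono_left
    (nhdsWithin_le_nhds (s := Set.Ioi (S.thompsonDist ω ω').toReal))
  refine ge_of_tendsto hlim ?_
  filter_upwards [Ioo_mem_nhdsGT (hd1.trans_lt one_lt_two)] with δ hδ
  obtain ⟨h1, h2⟩ := exists_thompson hp.1 hp'.1 (hd.trans_lt ENNReal.one_lt_top) hδ.1
  rw [mul_right_comm]
  refine le_mul_of_forall_lt fun K hK => ?_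
  obtain ⟨k1, k2⟩ := le_smul_of_formNorm_lt hp.1 hθ hK
  rw [mul_right_comm]
  exact abs_twistedEnergy_sub_twistedEnergy_le hS hp ho hp' ho'
    (ENNReal.toReal_nonneg.trans_lt hδ.1) hδ.2.le h1 h2 (ENNReal.toReal_nonneg.trans_lt hK)
    k1 k2 μ μ' hμ hM

/-- The constant in the Hölder estimates for the twisted energy. -/
def twistedHolderConst (n : ℕ) : ℝ := dimConst n ^ 35 * (8 * jplusConst n) + referenceConst n

theorem dimConst_pow_le_twistedHolderConst (n : ℕ) : dimConst n ^ 35 ≤ twistedHolderConst n := by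
  have hκ := dimConst_pos n
  have hP := closeConst_pos n
  have hF := functionalConst_pos n
  have hj := one_le_jplusConst n
  have hr : 0 ≤ referenceConst n := by unfold referenceConst ratioConst; positivity
  have : dimConst n ^ 35 * 1 ≤ dimConst n ^ 35 * (8 * jplusConst n) := by gcongr; linarith
  unfold twistedHolderConst
  linarith

/-- Hölder dependence of the twisted energy on both the reference form and the twist. -/
theorem abs_twistedEnergy_sub_le_thompsonDist (hS : S.SubmeanValueProperty)
    (hp : S.IsPolarization ω) (ho : S.OrthogonalityProperty ω) (hp' : S.IsPolarization ω')
    (ho' : S.OrthogonalityProperty ω') (hd : S.thompsonDist ω ω' ≤ 1)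
    (hθ : S.formNorm ω θ < ⊤) (hθ' : S.formNorm ω θ' < ⊤) (μ : S.FiniteEnergy ω)
    (μ' : S.FiniteEnergy ω') (hμ : μ.toMeasure = μ'.toMeasure) :
    |twistedEnergy hS hp ho θ μ - twistedEnergy hS hp' ho' θ' μ'| ≤
      twistedHolderConst n *
        ((S.thompsonDist ω ω').toReal ^ holderExponent n * (S.formNorm ω θ).toReal +
          (S.formNorm ω (θ - θ')).toReal) * μ.Jplus := by
  have hκ := dimConst_pos n
  have hP := closeConst_pos n
  have hF := functionalConst_pos n
  have hj := one_le_jplusConst n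
  have hr : 0 ≤ referenceConst n := by unfold referenceConst ratioConst; positivity
  have hJp := μ.Jplus_nonneg hp.1
  have hJp' := μ'.Jplus_nonneg hp'.1
  have hd2 : (S.thompsonDist ω ω').toReal < 2 := by
    have : (S.thompsonDist ω ω').toReal ≤ 1 := by
      simpa using ENNReal.toReal_mono ENNReal.one_ne_top hd
    linarith
  have he8 := (exp_le_one_add_mul zero_le_two le_rfl).1
  obtain ⟨h1, h2⟩ := exists_thompson hp.1 hp'.1 (hd.trans_lt ENNReal.one_lt_top) hd2
  have h1' := le_smul_of_le_smul hp.1 h1 he8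
  have h2' := le_smul_of_le_smul hp'.1 h2 he8
  have hJJ := μ.Jplus_le_mul hp.1 hp'.1 hp.vol_pos hp'.vol_pos ho (hp.submeanConst_ne_top hS)
    h1' h2' μ' hμ
  have a1 := abs_twistedEnergy_sub_twistedEnergy_le_formNorm hS hp ho hp' ho' hd hθ μ μ' hμ
  have a2 : |twistedEnergy hS hp' ho' (θ - θ') μ'| ≤
      dimConst n ^ 35 * (8 * jplusConst n) * μ.Jplus * (S.formNorm ω (θ - θ')).toReal := by
    refine le_mul_of_forall_lt fun K hK => ?_
    have hK0 : 0 < K := ENNReal.toReal_nonneg.trans_lt hK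
    obtain ⟨k1, k2⟩ := le_smul_of_formNorm_lt hp.1 (formNorm_sub_lt_top hp.1 hθ hθ') hK
    have up : ∀ {ζ : Z}, ζ ≤ K • ω → ζ ≤ (8 * K) • ω' := fun h => by
      refine h.trans ?_
      rw [mul_comm, mul_smul]
      exact smul_le_smul_of_nonneg_left h2' hK0.le
    refine (abs_twistedEnergy_le hS hp' ho' (by positivity) (up k1) (up k2) μ').trans ?_
    calc _ ≤ dimConst n ^ 35 * (8 * K) * (jplusConst n * μ.Jplus) := by gcongr
      _ = _ := by ring
  have e : twistedEnergy hS hp ho θ μ - twistedEnergy hS hp' ho' θ' μ' =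
      (twistedEnergy hS hp ho θ μ - twistedEnergy hS hp' ho' θ μ') +
        twistedEnergy hS hp' ho' (θ - θ') μ' := by
    have := congrFun (map_sub (twistedEnergyLinear hS hp' ho') θ θ') μ'
    change twistedEnergy hS hp' ho' (θ - θ') μ' =
      twistedEnergy hS hp' ho' θ μ' - twistedEnergy hS hp' ho' θ' μ' at this
    rw [this]; ring
  rw [e]
  refine (abs_add_le _ _).trans ((add_le_add a1 a2).trans ?_)
  have c1 : referenceConst n ≤ twistedHolderConst n := le_add_of_nonneg_left (by positivity)
  have c2 : dimConst n ^ 35 * (8 * jplusConst n) ≤ twistedHolderConst n := le_add_of_nonneg_right hr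
  have hα : 0 ≤ (S.thompsonDist ω ω').toReal ^ holderExponent n :=
    Real.rpow_nonneg ENNReal.toReal_nonneg _
  calc _ ≤ twistedHolderConst n * (S.thompsonDist ω ω').toReal ^ holderExponent n *
        (S.formNorm ω θ).toReal * μ.Jplus +
        twistedHolderConst n * μ.Jplus * (S.formNorm ω (θ - θ')).toReal := by gcongr
    _ = _ := by ring

end PluripotentialSetup

end

/-! ### The twisted energy and its Hölder estimates -/

theorem theoremB (n : ℕ) :
    -- a constant depending only on `n`
    ∃ C : ℝ, 0 < C ∧
    ∀ (X : Type u) [TopologicalSpace X] [CompactSpace X] [T2Space X]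
      (Z : Type v) [AddCommGroup Z] [Module ℝ Z] [PartialOrder Z] [IsOrderedAddMonoid Z]
      [PosSMulMono ℝ Z] (S : PluripotentialSetup n X Z),
      S.SubmeanValueProperty →
      -- the metric on `M¹_ω` defines its strong topology
      (∀ ω : Z, S.IsPolarization ω → S.OrthogonalityProperty ω →
        ∃ m : MetricSpace (S.FiniteEnergy ω),
          m.toUniformSpace.toTopologicalSpace =
            PluripotentialSetup.FiniteEnergy.strongTopology S ω ∧
          ∀ μ ν : S.FiniteEnergy ω,
            ENNReal.ofReal (m.dist μ ν) = S.strongDist ω μ.toMeasure ν.toMeasure) ∧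
      -- the topological space `M¹_ω` and the Lipschitz class of its metric are independent of `ω`
      (∀ ω ω' : Z, S.IsPolarization ω → S.OrthogonalityProperty ω →
        S.IsPolarization ω' → S.OrthogonalityProperty ω' →
        (∃ e : S.FiniteEnergy ω ≃ₜ S.FiniteEnergy ω', ∀ μ, (e μ).toMeasure = μ.toMeasure) ∧
        ∃ A : ℝ≥0, ∀ μ ν : S.FiniteEnergy ω,
          S.strongDist ω' μ.toMeasure ν.toMeasure ≤
            A * S.strongDist ω μ.toMeasure ν.toMeasure ∧
          S.strongDist ω μ.toMeasure ν.toMeasure ≤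
            A * S.strongDist ω' μ.toMeasure ν.toMeasure) ∧
      -- the twisted energy
      (∀ ω : Z, S.IsPolarization ω → S.OrthogonalityProperty ω →
        ∃ d : S.FiniteEnergy ω → S.FiniteEnergy ω → ℝ,
          S.IsDirichletQuasiMetric ω d ∧
          (∀ d', S.IsDirichletQuasiMetric ω d' → d' = d) ∧
          ∃ J : Z →ₗ[ℝ] (S.FiniteEnergy ω → ℝ),
            (∀ θ : Z, S.IsTwistedEnergy ω θ (J θ) ∧
              ∀ F, S.IsTwistedEnergy ω θ F → F = J θ) ∧
            -- Hölder estimates, for `ω`-bounded `θ` and for arbitrary `θ`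
            (∀ θ : Z, S.formNorm ω θ < ⊤ →
              (∀ μ ν : S.FiniteEnergy ω,
                |J θ μ - J θ ν| ≤ C * (d μ ν) ^ holderExponent n *
                  (max μ.Jplus ν.Jplus) ^ (1 - holderExponent n) * (S.formNorm ω θ).toReal) ∧
              ∀ μ : S.FiniteEnergy ω, |J θ μ| ≤ C * μ.Jplus * (S.formNorm ω θ).toReal) ∧
            (∀ θ : Z, ∃ B : ℝ, 0 < B ∧
              (∀ μ ν : S.FiniteEnergy ω,
                |J θ μ - J θ ν| ≤ B * (d μ ν) ^ holderExponent n *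
                  (max μ.J ν.J + 1) ^ (1 - holderExponent n)) ∧
              ∀ μ : S.FiniteEnergy ω, |J θ μ| ≤ B * (μ.J + 1)) ∧
            -- differentiability of the energy
            (∀ (θ : Z) (μ : S.FiniteEnergy ω),
              (∀ᶠ t : ℝ in 𝓝 0, S.energy (ω + t • θ) μ.toMeasure ≠ ⊥ ∧
                S.energy (ω + t • θ) μ.toMeasure ≠ ⊤) ∧
              HasDerivAt (fun t : ℝ => (S.energy (ω + t • θ) μ.toMeasure).toReal) (J θ μ) 0)) ∧
      -- Hölder estimates for the twisted energy with respect to `ω`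
      (∀ ω ω' : Z, S.IsPolarization ω → S.OrthogonalityProperty ω →
        S.IsPolarization ω' → S.OrthogonalityProperty ω' → S.thompsonDist ω ω' ≤ 1 →
        ∀ θ θ' : Z, S.formNorm ω θ < ⊤ → S.formNorm ω θ' < ⊤ →
        ∀ (F : S.FiniteEnergy ω → ℝ) (F' : S.FiniteEnergy ω' → ℝ),
          S.IsTwistedEnergy ω θ F → S.IsTwistedEnergy ω' θ' F' →
          ∀ (μ : S.FiniteEnergy ω) (μ' : S.FiniteEnergy ω'), μ.toMeasure = μ'.toMeasure →
            |F μ - F' μ'| ≤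
              C * ((S.thompsonDist ω ω').toReal ^ holderExponent n * (S.formNorm ω θ).toReal +
                (S.formNorm ω (θ - θ')).toReal) * μ.Jplus) := by
  refine ⟨PluripotentialSetup.twistedHolderConst n,
    (pow_pos (PluripotentialSetup.dimConst_pos n) 35).trans_le
    (PluripotentialSetup.dimConst_pow_le_twistedHolderConst n), ?_⟩
  intro X _ _ _ Z _ _ _ _ _ S hS
  have hC := PluripotentialSetup.dimConst_pow_le_twistedHolderConst n
  refine ⟨fun ω hp ho => PluripotentialSetup.FiniteEnergy.exists_metricSpace hp ho,
    fun ω ω' hp ho hp' ho' => PluripotentialSetup.exists_homeomorph hS hp ho hp' ho',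
    fun ω hp ho => ⟨PluripotentialSetup.dirichletMetric hp ho,
      PluripotentialSetup.isDirichletQuasiMetric hp ho,
      fun d' h => PluripotentialSetup.IsDirichletQuasiMetric.eq hp ho h,
      PluripotentialSetup.twistedEnergyLinear hS hp ho,
      fun θ => ⟨PluripotentialSetup.isTwistedEnergy_twistedEnergy hS hp ho θ,
        fun F hF => PluripotentialSetup.IsTwistedEnergy.eq hS hp ho hF⟩,
      fun θ hθ => ⟨fun μ ν => ?_, fun μ => ?_⟩,
      fun θ => PluripotentialSetup.exists_abs_twistedEnergy_le hS hp ho θ,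
      fun θ μ => PluripotentialSetup.hasDerivAt_energy hS hp ho θ μ⟩, ?_⟩
  · refine (PluripotentialSetup.abs_twistedEnergy_sub_le_formNorm hS hp ho hθ μ ν).trans ?_
    have h1 := PluripotentialSetup.dirichletMetric_nonneg hp ho μ ν
    have h2 : 0 ≤ max μ.Jplus ν.Jplus := le_max_of_le_left (μ.Jplus_nonneg hp.1)
    gcongr
  · refine (PluripotentialSetup.abs_twistedEnergy_le_formNorm hS hp ho hθ μ).trans ?_
    have h1 := μ.Jplus_nonneg hp.1
    gcongr
  · intro ω ω' hp ho hp' ho' hd θ θ' hθ hθ' F F' hF hF' μ μ' hμ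
    rw [PluripotentialSetup.IsTwistedEnergy.eq hS hp ho hF,
      PluripotentialSetup.IsTwistedEnergy.eq hS hp' ho' hF']
    exact PluripotentialSetup.abs_twistedEnergy_sub_le_thompsonDist hS hp ho hp' ho' hd hθ hθ' μ
      μ' hμ
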